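/- Let $\Bbbk$ be a commutative unital ring and let $\underline N=(N_1,\dots,N_r)$ be a finite (possibly empty) sequence of non-negative integers, with $|\underline N|=N_1+\dots+N_r$. For $b\ge 0$ let $T_b=T_b^{\lambda,\underline N}$ be the dg-enhanced KLRW algebra. It is the unital $\Bbbk$-algebra generated by braid-like diagrams with a blue strand labelled $\lambda$ at the very left, $r$ red strands labelled $N_1,\dots,N_r$ from left to right, which do not cross each other, and $b$ black strands. Black strands may carry dots and may cross black and red strands, and the leftmost strand, when it is black, may be nailed on the blue strand. Multiplication is vertical stacking (zero if the ends do not match), and diagrams are taken up to braid-like planar isotopy. The unit is the sum of the idempotents given by all the diagrams consisting of vertical strands only. The local relations are as follows, where $\tau$ is a black/black crossing, $x_L$ and $x_R$ are dots on the left and on the right of the black strands considered (so $x_L,x_R$ refer to positions), $\theta$ is a nail, and $ab$ is $a$ stacked on top of $b$. * NilHecke relations: $\tau^2=0$, the braid relation for three black strands, $\tau x_L=x_R\tau+1$ and $x_L\tau=\tau x_R+1$. * Black/red relations: dots slide through black/red crossings; the two black/red bigons with a red strand labelled $N_i$ equal $N_i$ dots on the black strand; a black/black crossing slides freely through a red strand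 that passes both of its strands on the way; finally, for two black strands that cross, with a red strand labelled $N_i$ between them at both ends, the diagram in which the red strand passes at the left of the crossing equals the one in which it passes at the right plus $\sum_{a+c=N_i-1}$ of the diagram with three vertical strands, $a$ dots on the left black strand and $c$ dots on the right one. * Nail relations: $\theta x=x\theta$, $\theta^2=0$ and $\tau\theta\tau\theta=-\theta\tau\theta\tau$. The algebra $T_b$ is graded by (homological degree, $q$-degree, $\lambda$-degree), with dots in degree $(0,2,0)$, black/black crossings in degree $(0,-2,0)$, black/red crossings with the red strand labelled $N_i$ in degree $(0,N_i,0)$ and nails in degree $(1,0,2)$. It is regarded as a $\mathbb Z^2$-graded dg-algebra $(T_b,0)$ with zero differential. Let $\mathcal D_{dg}(T_b,0)$ be its dg-derived category: its objects are the cofibrant $\mathbb Z^2$-graded left dg-modules (those with the lifting property against all surjective quasi-isomorphisms; differentials lower the homological degree by one), and its morphism complexes are the complexes $\mathrm{HOM}_{T_b}(M,N)_0$ of maps that preserve the $\mathbb Z^2$-grading. Write $q^a\lambda^c(-)$ for the shift up by $(a,c)$ in the $\mathbb Z^2$-grading and $[1]$ for the shift up by $1$ in the homological degree. Adding a vertical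 black strand at the right gives a non-unital algebra map $T_b\to T_{b+1}$; let $1_{b,1}$ be the image of $1$. Let $$\mathsf F_b=T_{b+1}1_{b,1}\otimes_{T_b}(-),\qquad \mathsf E_b=\lambda^{-1}q^{1+2b-|\underline N|}\,\mathrm{Res}_b^{b+1},\qquad \mathrm{Res}_b^{b+1}(M)=1_{b,1}M .$$ Then $\mathrm{Res}_b^{b+1}$ preserves cofibrant dg-modules for every $b\ge0$ (as $\mathsf F_b$ does in general), so that these are dg-functors $\mathsf F_b:\mathcal D_{dg}(T_b,0)\to\mathcal D_{dg}(T_{b+1},0)$ and $\mathsf E_b:\mathcal D_{dg}(T_{b+1},0)\to\mathcal D_{dg}(T_b,0)$, and for every $b\ge 0$ there is a quasi-isomorphism of dg-functors $$\mathrm{cone}\bigl(\mathsf F_{b-1}\mathsf E_{b-1}\to\mathsf E_b\mathsf F_b\bigr)\xrightarrow{\ \simeq\ }\bigoplus_{[\beta+|\underline N|-2b]_q}\mathrm{id}_b:=\bigoplus_{p\ge0}\Bigl(\lambda q^{1+2p+|\underline N|-2b}\,\mathrm{id}_b[1]\ \oplus\ \lambda^{-1}q^{1+2p-|\underline N|+2b}\,\mathrm{id}_b\Bigr),$$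 that is, a closed natural transformation of degree $0$, all of whose components are quasi-isomorphisms. Here $\mathrm{id}_b$ is the identity dg-functor, $\mathsf F_{-1}\mathsf E_{-1}:=0$, and for $b\ge1$ the map $\mathsf F_{b-1}\mathsf E_{b-1}\to\mathsf E_b\mathsf F_b$ is $x\otimes m\mapsto x\tau_b\otimes m$, where $x\in T_b$ is viewed in $T_{b+1}$ by adding a black strand at the right, and $\tau_b\in T_{b+1}$ is the crossing of the last two black strands when they are the two rightmost strands (the sum over all positions of the other strands). -/

import Mathlib

open scoped DirectSum TensorProduct

universe u

namespace DGKLRW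

/-! ## Graded algebras and dg-modules -/

/-- Degrees: (homological degree, `q`-degree, `λ`-degree). -/
abbrev Deg := ℤ × ℤ × ℤ

/-- The sign `(-1)^n`. -/
def sgn (n : ℤ) : ℤ := (n.negOnePow : ℤ)

lemma sgn_add (m n : ℤ) : sgn (m + n) = sgn m * sgn n := by
  simp [sgn, Int.negOnePow_add]

lemma sgn_zero : sgn 0 = 1 := by simp [sgn]

lemma sgn_one : sgn 1 = -1 := by simp [sgn]

lemma sgn_mul_self (n : ℤ) : sgn n * sgn n = 1 := by
  rw [← sgn_add]; simp [sgn, ← two_mul]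

lemma sgn_neg (n : ℤ) : sgn (-n) = sgn n := by simp [sgn]

/-- A `ℤ × ℤ²`-graded unital `k`-algebra, also regarded as a `ℤ²`-graded dg-algebra with
zero differential. -/
structure GrAlg (k : Type u) [CommRing k] where
  carrier : Type u
  [ring : Ring carrier]
  [algebra : Algebra k carrier]
  gr : Deg → Submodule k carrier
  [graded : GradedAlgebra gr]

attribute [instance] GrAlg.ring GrAlg.algebra GrAlg.graded

instance (k : Type u) [CommRing k] : CoeSort (GrAlg k) (Type u) := ⟨GrAlg.carrier⟩

variable {k : Type u} [CommRing k]

lemma hom_induction {M : Type u} [AddCommGroup M] [Module k M] {gr : Deg → Submodule k M}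
    (h : DirectSum.IsInternal gr) {p : M → Prop} (h0 : p 0)
    (hadd : ∀ x y, p x → p y → p (x + y)) (hmem : ∀ i, ∀ x ∈ gr i, p x) (m : M) : p m := by
  have hm : m ∈ iSup gr := by rw [h.submodule_iSup_eq_top]; trivial
  exact Submodule.iSup_induction gr (motive := p) hm hmem h0 hadd

namespace GrAlg

variable (A : GrAlg k)

lemma internal : DirectSum.IsInternal A.gr := DirectSum.Decomposition.isInternal A.gr

/-- The linear map `a ↦ (-1)^{n |a|} a`, where `|a|` is the homological degree. -/
def twLin (n : ℤ) : A →ₗ[k] A :=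
  (DirectSum.toModule k Deg A fun i => sgn (n * i.1) • (A.gr i).subtype) ∘ₗ
    (DirectSum.decomposeLinearEquiv A.gr).toLinearMap

lemma twLin_of_mem (n : ℤ) {i : Deg} {a : A} (ha : a ∈ A.gr i) :
    A.twLin n a = sgn (n * i.1) • a := by
  have h : DirectSum.decompose A.gr a = DirectSum.lof k Deg (fun i => A.gr i) i ⟨a, ha⟩ :=
    DirectSum.decompose_of_mem A.gr ha
  simp only [twLin, LinearMap.comp_apply, LinearEquiv.coe_coe,
    DirectSum.decomposeLinearEquiv_apply, h, DirectSum.toModule_lof]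
  rfl

lemma twLin_mul (n : ℤ) (a b : A) : A.twLin n (a * b) = A.twLin n a * A.twLin n b := by
  refine hom_induction A.internal (p := fun a => A.twLin n (a * b) = A.twLin n a * A.twLin n b)
    (by simp) (fun x y hx hy => by simp only [add_mul, map_add, hx, hy]) (fun i a ha => ?_) a
  refine hom_induction A.internal (p := fun b => A.twLin n (a * b) = A.twLin n a * A.twLin n b)
    (by simp) (fun x y hx hy => by simp only [mul_add, map_add, hx, hy]) (fun j b hb => ?_) b
  rw [A.twLin_of_mem n ha, A.twLin_of_mem n hb,
    A.twLin_of_mem n (SetLike.mul_mem_graded ha hb)]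
  have h : n * (i + j).1 = n * i.1 + n * j.1 := mul_add _ _ _
  rw [h, sgn_add, smul_mul_smul_comm]

/-- The algebra automorphism `a ↦ (-1)^{n |a|} a`, where `|a|` is the homological degree. -/
def tw (n : ℤ) : A →ₐ[k] A :=
  AlgHom.ofLinearMap (A.twLin n)
    (by
      have := A.twLin_of_mem n (i := 0) (a := 1) SetLike.GradedOne.one_mem
      simpa [sgn_zero] using this)
    (A.twLin_mul n)

lemma tw_of_mem (n : ℤ) {i : Deg} {a : A} (ha : a ∈ A.gr i) :
    A.tw n a = sgn (n * i.1) • a := A.twLin_of_mem n ha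

lemma tw_mem (n : ℤ) {i : Deg} {a : A} (ha : a ∈ A.gr i) : A.tw n a ∈ A.gr i := by
  rw [A.tw_of_mem n ha]; exact zsmul_mem ha _

lemma tw_tw (m n : ℤ) (a : A) : A.tw m (A.tw n a) = A.tw (m + n) a := by
  refine hom_induction A.internal (p := fun a => A.tw m (A.tw n a) = A.tw (m + n) a)
    (by simp) (fun x y hx hy => by simp only [map_add, hx, hy]) (fun i a ha => ?_) a
  rw [A.tw_of_mem n ha, map_zsmul, A.tw_of_mem m ha, A.tw_of_mem (m + n) ha, smul_smul,
    add_mul, sgn_add, mul_comm]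

lemma tw_zero (a : A) : A.tw 0 a = a := by
  refine hom_induction A.internal (p := fun a => A.tw 0 a = a)
    (by simp) (fun x y hx hy => by simp only [map_add, hx, hy]) (fun i a ha => ?_) a
  rw [A.tw_of_mem 0 ha]; simp [sgn_zero]

lemma tw_neg (n : ℤ) (a : A) : A.tw (-n) a = A.tw n a := by
  refine hom_induction A.internal (p := fun a => A.tw (-n) a = A.tw n a)
    (by simp) (fun x y hx hy => by simp only [map_add, hx, hy]) (fun i a ha => ?_) a
  rw [A.tw_of_mem _ ha, A.tw_of_mem _ ha, neg_mul, sgn_neg]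

lemma tw_tw_self (n : ℤ) (a : A) : A.tw n (A.tw n a) = a := by
  nth_rewrite 1 [← A.tw_neg]
  rw [tw_tw, neg_add_cancel, tw_zero]

end GrAlg

/-- A `ℤ²`-graded left dg-module over `(A, 0)`. The differential lowers the homological degree by
one and satisfies `d (a m) = (-1)^{|a|} a (d m)`. -/
structure DGMod (A : GrAlg k) where
  carrier : Type u
  [acg : AddCommGroup carrier]
  [module : Module k carrier]
  act : A →ₐ[k] Module.End k carrier
  gr : Deg → Submodule k carrier
  internal : DirectSum.IsInternal gr
  act_mem : ∀ {i j : Deg} {a : A} {m : carrier}, a ∈ A.gr i → m ∈ gr j → act a m ∈ gr (i + j)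
  d : carrier →ₗ[k] carrier
  d_mem : ∀ {i : Deg} {m : carrier}, m ∈ gr i → d m ∈ gr (i - (1, 0, 0))
  d_d : ∀ m : carrier, d (d m) = 0
  d_act : ∀ (a : A) (m : carrier), d (act a m) = act (A.tw 1 a) (d m)

attribute [instance] DGMod.acg DGMod.module

instance (A : GrAlg k) : CoeSort (DGMod A) (Type u) := ⟨DGMod.carrier⟩

namespace DGMod

variable {A B : GrAlg k}

/-- The homology `ker d / im d`. -/
abbrev Homology (M : DGMod A) : Type u :=
  LinearMap.ker M.d ⧸ (LinearMap.range M.d).comap (LinearMap.ker M.d).subtype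

/-- Morphisms of dg-modules: maps preserving all the structure. -/
structure Mor (M N : DGMod A) where
  toLin : M →ₗ[k] N
  mem : ∀ {i : Deg} {m : M}, m ∈ M.gr i → toLin m ∈ N.gr i
  act : ∀ (a : A) (m : M), toLin (M.act a m) = N.act a (toLin m)
  comm : ∀ m : M, toLin (M.d m) = N.d (toLin m)

/-- The map induced on homology by a morphism of dg-modules. -/
def Mor.homologyMap {M N : DGMod A} (f : Mor M N) : M.Homology →ₗ[k] N.Homology :=
  Submodule.mapQ _ _
    (f.toLin.restrict (p := LinearMap.ker M.d) (q := LinearMap.ker N.d) (fun m hm => by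
      rw [LinearMap.mem_ker] at hm ⊢
      rw [← f.comm, hm, map_zero]))
    (by
      rintro ⟨m, hm⟩ ⟨x, hx⟩
      exact ⟨f.toLin x, by rw [← f.comm, hx]; rfl⟩)

/-- Quasi-isomorphisms: morphisms inducing an isomorphism on homology. -/
def Mor.IsQuasiIso {M N : DGMod A} (f : Mor M N) : Prop := Function.Bijective f.homologyMap

lemma Mor.isQuasiIso_iff {M N : DGMod A} (f : Mor M N) : f.IsQuasiIso ↔
    (∀ m, M.d m = 0 → (∃ y, N.d y = f.toLin m) → ∃ x, M.d x = m) ∧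
    (∀ n, N.d n = 0 → ∃ m y, M.d m = 0 ∧ n = f.toLin m + N.d y) := by
  refine and_congr ?_ ?_
  · rw [← LinearMap.ker_eq_bot, LinearMap.ker_eq_bot']
    constructor
    · rintro h m hm ⟨y, hy⟩
      have := h (Submodule.Quotient.mk ⟨m, hm⟩) (by
        refine (Submodule.Quotient.mk_eq_zero _).2 ⟨y, hy⟩)
      obtain ⟨x, hx⟩ := (Submodule.Quotient.mk_eq_zero _).1 this
      exact ⟨x, hx⟩
    · intro h c
      induction c using Submodule.Quotient.induction_on with
      | _ m =>
        intro hc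
        obtain ⟨y, hy⟩ := (Submodule.Quotient.mk_eq_zero _).1 hc
        obtain ⟨x, hx⟩ := h m.1 m.2 ⟨y, hy⟩
        exact (Submodule.Quotient.mk_eq_zero _).2 ⟨x, hx⟩
  · constructor
    · intro h n hn
      obtain ⟨c, hc⟩ := h (Submodule.Quotient.mk ⟨n, hn⟩)
      induction c using Submodule.Quotient.induction_on with
      | _ m =>
        obtain ⟨y, hy⟩ := (Submodule.Quotient.eq _).1 hc
        refine ⟨m.1, -y, m.2, ?_⟩
        have hy' : N.d y = f.toLin m.1 - n := hy
        rw [map_neg, hy']; abel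
    · intro h c
      induction c using Submodule.Quotient.induction_on with
      | _ n =>
        obtain ⟨m, y, hm, hy⟩ := h n.1 n.2
        refine ⟨Submodule.Quotient.mk ⟨m, hm⟩, (Submodule.Quotient.eq _).2 ⟨-y, ?_⟩⟩
        change N.d (-y) = f.toLin m - n.1
        rw [hy, map_neg]; abel

/-- Cofibrant dg-modules: those with the lifting property against all surjective
quasi-isomorphisms. -/
def Cofibrant (P : DGMod A) : Prop :=
  ∀ (X Y : DGMod A) (p : Mor X Y), Function.Surjective p.toLin → p.IsQuasiIso →
    ∀ g : Mor P Y, ∃ h : Mor P X, p.toLin ∘ₗ h.toLin = g.toLin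

/-- `HOM_A(M, N)` in homological degree `n` and `ℤ²`-degree `0`: maps `f` of degree `n` with
`f (a m) = (-1)^{n |a|} a (f m)`. -/
def Hom (n : ℤ) (M N : DGMod A) : Submodule k (M →ₗ[k] N) where
  carrier := {f | (∀ (i : Deg) (m : M), m ∈ M.gr i → f m ∈ N.gr (i + (n, 0, 0))) ∧
    ∀ (a : A) (m : M), f (M.act a m) = N.act (A.tw n a) (f m)}
  add_mem' hf hg := ⟨fun i m hm => add_mem (hf.1 i m hm) (hg.1 i m hm),
    fun a m => by simp [hf.2, hg.2]⟩
  zero_mem' := ⟨fun _ _ _ => zero_mem _, fun a m => by simp⟩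
  smul_mem' c f hf := ⟨fun i m hm => Submodule.smul_mem _ c (hf.1 i m hm),
    fun a m => by simp [hf.2]⟩

lemma zsmul_mem_hom {n : ℤ} {M N : DGMod A} {f : M →ₗ[k] N} (hf : f ∈ Hom n M N) (c : ℤ) :
    c • f ∈ Hom n M N := zsmul_mem hf c

/-- The identity, of degree `0`. -/
def Hom.id (M : DGMod A) : Hom 0 M M :=
  ⟨LinearMap.id, fun i m hm => by
    have h : i + ((0, 0, 0) : Deg) = i := add_zero i
    rw [h]; exact hm, fun a m => by simp [A.tw_zero]⟩

/-- Composition, of degree the sum of the degrees. -/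
def Hom.comp {M N P : DGMod A} {n m : ℤ} (g : Hom n N P) (f : Hom m M N) : Hom (n + m) M P :=
  ⟨g.1 ∘ₗ f.1, fun i x hx => by
    have h : i + ((n + m, 0, 0) : Deg) = i + (m, 0, 0) + (n, 0, 0) := by
      ext
      · simp; ring
      · simp
      · simp
    rw [h]; exact g.2.1 _ _ (f.2.1 _ _ hx),
   fun a x => by simp [f.2.2, g.2.2, A.tw_tw]⟩

/-- The differential `f ↦ d ∘ f - (-1)^n f ∘ d` on `HOM`. -/
def Hom.diff {M N : DGMod A} (n : ℤ) : Hom n M N →ₗ[k] Hom (n - 1) M N where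
  toFun f := ⟨N.d ∘ₗ f.1 - sgn n • (f.1 ∘ₗ M.d), by
    constructor
    · intro i m hm
      refine sub_mem ?_ (zsmul_mem ?_ _)
      · have h : i + ((n - 1, 0, 0) : Deg) = i + (n, 0, 0) - (1, 0, 0) := by
          ext <;> simp [add_sub_assoc]
        rw [h]; exact N.d_mem (f.2.1 _ _ hm)
      · have h : i + ((n - 1, 0, 0) : Deg) = i - (1, 0, 0) + (n, 0, 0) := by
          ext <;> simp; ring
        rw [h]; exact f.2.1 _ _ (M.d_mem hm)
    · intro a m
      have h1 : A.tw 1 (A.tw n a) = A.tw (n - 1) a := by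
        rw [← A.tw_neg 1, A.tw_tw, neg_add_eq_sub]
      have h2 : A.tw n (A.tw 1 a) = A.tw (n - 1) a := by
        rw [← A.tw_neg 1 a, A.tw_tw, sub_eq_add_neg]
      simp only [LinearMap.sub_apply, LinearMap.comp_apply, LinearMap.smul_apply, f.2.2, N.d_act,
        M.d_act, h1, h2, map_sub, map_zsmul]⟩
  map_add' f g := by
    ext m
    simp only [Submodule.coe_add, LinearMap.sub_apply, LinearMap.comp_apply, LinearMap.add_apply,
      LinearMap.smul_apply, map_add, smul_add]
    abel
  map_smul' c f := by
    ext m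
    simp only [Submodule.coe_smul, LinearMap.sub_apply, LinearMap.comp_apply,
      LinearMap.smul_apply, map_smul, RingHom.id_apply, smul_sub, smul_comm c (sgn n)]

end DGMod

/-- Objects of the dg-derived category `𝒟_dg(A, 0)`: cofibrant dg-modules. Its morphism complexes
are the `DGMod.Hom n`, `n ∈ ℤ`, with differential `DGMod.Hom.diff`, and its composition is
`DGMod.Hom.comp`. -/
structure Ddg (A : GrAlg k) where
  obj : DGMod A
  cofibrant : obj.Cofibrant

/-- Dg-functors between dg-derived categories: they are `k`-linear on morphism complexes, and
compatible with degrees, differentials, identities and composition. -/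
structure DGFunctor (A B : GrAlg k) where
  obj : Ddg A → Ddg B
  map : ∀ {M N : Ddg A} (n : ℤ), DGMod.Hom n M.obj N.obj →ₗ[k] DGMod.Hom n (obj M).obj (obj N).obj
  map_id : ∀ M : Ddg A, map 0 (DGMod.Hom.id M.obj) = DGMod.Hom.id (obj M).obj
  map_comp : ∀ {M N P : Ddg A} (n m : ℤ) (g : DGMod.Hom n N.obj P.obj)
    (f : DGMod.Hom m M.obj N.obj), map (n + m) (DGMod.Hom.comp g f) = DGMod.Hom.comp (map n g) (map m f)
  map_diff : ∀ {M N : Ddg A} (n : ℤ) (f : DGMod.Hom n M.obj N.obj),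
    map (n - 1) (DGMod.Hom.diff n f) = DGMod.Hom.diff n (map n f)

namespace DGFunctor

variable {A B C : GrAlg k}

/-- The identity dg-functor. -/
def id (A : GrAlg k) : DGFunctor A A where
  obj M := M
  map _ := LinearMap.id
  map_id _ := rfl
  map_comp _ _ _ _ := rfl
  map_diff _ _ := rfl

/-- The composite dg-functor `G ∘ F`. -/
def comp (G : DGFunctor B C) (F : DGFunctor A B) : DGFunctor A C where
  obj M := G.obj (F.obj M)
  map n := G.map n ∘ₗ F.map n
  map_id M := by simp [F.map_id, G.map_id]
  map_comp n m g f := by simp [F.map_comp, G.map_comp]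
  map_diff n f := by simp [F.map_diff, G.map_diff]

end DGFunctor

/-- Morphisms of dg-functors: closed natural transformations of degree `0`. -/
structure DGNat {A B : GrAlg k} (F G : DGFunctor A B) where
  app : ∀ M : Ddg A, DGMod.Mor (F.obj M).obj (G.obj M).obj
  naturality : ∀ {M N : Ddg A} (n : ℤ) (f : DGMod.Hom n M.obj N.obj) (x : (F.obj M).obj),
    (app N).toLin ((F.map n f).1 x) = (G.map n f).1 ((app M).toLin x)

/-- Quasi-isomorphisms of dg-functors: all components are quasi-isomorphisms. -/
def DGNat.IsQuasiIso {A B : GrAlg k} {F G : DGFunctor A B} (η : DGNat F G) : Prop :=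
  ∀ M : Ddg A, (η.app M).IsQuasiIso

/-! ## Shifts, coproducts and cones -/

lemma internal_of_coaction {M : Type u} [AddCommGroup M] [Module k M] {gr : Deg → Submodule k M}
    (c : M →ₗ[k] (Deg →₀ M)) (h1 : ∀ i, ∀ m ∈ gr i, c m = Finsupp.single i m)
    (htop : ∀ m, m ∈ iSup gr) : DirectSum.IsInternal gr := by
  have key : ∀ (x : ⨁ i, gr i) (i : Deg), c (DirectSum.coeLinearMap gr x) i = (x i : M) := by
    intro x i
    induction x using DirectSum.induction_on with
    | zero => simp
    | of j y =>
      have : DirectSum.coeLinearMap gr (DirectSum.of (fun i => gr i) j y) = y :=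
        DirectSum.coeLinearMap_lof gr j y
      rw [this, h1 j y y.2, DirectSum.coe_of_apply, Finsupp.single_apply]
      split <;> simp_all
    | add x y hx hy => simp [map_add, hx, hy]
  constructor
  · intro x y hxy
    refine DFinsupp.ext fun i => Subtype.ext ?_
    have h : DirectSum.coeLinearMap gr x = DirectSum.coeLinearMap gr y := hxy
    rw [← key x i, ← key y i, h]
  · intro m
    have h : m ∈ LinearMap.range (DirectSum.coeLinearMap gr) := by
      rw [DirectSum.range_coeLinearMap]; exact htop m
    exact h

namespace DGMod

variable {A B : GrAlg k}

/-- The linear map sending `m` of degree `i` to `Finsupp.single i m`. -/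
noncomputable def coaction (M : DGMod A) : M →ₗ[k] (Deg →₀ M) :=
  (DirectSum.toModule k Deg (Deg →₀ M) fun i => Finsupp.lsingle i ∘ₗ (M.gr i).subtype) ∘ₗ
    (LinearEquiv.ofBijective (DirectSum.coeLinearMap M.gr) M.internal).symm.toLinearMap

lemma coaction_of_mem (M : DGMod A) {i : Deg} {m : M} (hm : m ∈ M.gr i) :
    M.coaction m = Finsupp.single i m := by
  have h : (LinearEquiv.ofBijective (DirectSum.coeLinearMap M.gr) M.internal).symm m =
      DirectSum.lof k Deg (fun i => M.gr i) i ⟨m, hm⟩ :=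
    (LinearEquiv.symm_apply_eq _).2 (DirectSum.coeLinearMap_lof M.gr i ⟨m, hm⟩).symm
  simp only [coaction, LinearMap.comp_apply, LinearEquiv.coe_coe, h, DirectSum.toModule_lof]
  rfl

/-- The shift of `M` up by the degree `s = (h, a, b)`, that is `q^a λ^b M[h]`. The differential is
multiplied by `(-1)^h` and the left action is twisted by `(-1)^{h |a|}`. -/
abbrev shift (s : Deg) (M : DGMod A) : DGMod A where
  carrier := M
  act := M.act.comp (A.tw s.1)
  gr i := M.gr (i - s)
  internal := by
    rw [DirectSum.isInternal_submodule_iff_iSupIndep_and_iSup_eq_top]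
    refine ⟨M.internal.submodule_iSupIndep.comp (f := fun i => i - s) (sub_left_injective), ?_⟩
    exact ((Equiv.subRight s).iSup_comp (g := M.gr)).trans M.internal.submodule_iSup_eq_top
  act_mem {i j a m} ha hm := by
    have := M.act_mem (A.tw_mem s.1 ha) hm
    rwa [← add_sub_assoc] at this
  d := sgn s.1 • M.d
  d_mem {i m} hm := by
    have := M.d_mem hm
    rw [sub_right_comm] at this
    exact zsmul_mem this _
  d_d m := by simp [M.d_d]
  d_act a m := by
    simp only [LinearMap.smul_apply, AlgHom.comp_apply, M.d_act, A.tw_tw, map_zsmul, add_comm]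

lemma Cofibrant.shift {M : DGMod A} (hM : M.Cofibrant) (s : Deg) : (M.shift s).Cofibrant := by
  intro X Y p hp hq g
  have hs : ∀ {V : Type u} [AddCommGroup V] (v : V), sgn s.1 • sgn s.1 • v = v := fun v => by
    rw [smul_smul, sgn_mul_self, one_smul]
  let p' : Mor (X.shift (-s)) (Y.shift (-s)) :=
    { toLin := p.toLin
      mem := fun hm => p.mem hm
      act := fun a m => p.act _ m
      comm := fun m => by
        simp only [LinearMap.smul_apply, map_zsmul, p.comm] }
  have hq' : p'.IsQuasiIso := by
    rw [Mor.isQuasiIso_iff] at hq ⊢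
    have hd : ∀ (Z : DGMod A) (z : Z), (Z.shift (-s)).d z = sgn s.1 • Z.d z := fun Z z => by
      simp [sgn_neg]
    have hz : ∀ (Z : DGMod A) (z : Z), sgn s.1 • Z.d z = 0 → Z.d z = 0 := fun Z z h => by
      rw [← hs (Z.d z), h, smul_zero]
    constructor
    · rintro m hm ⟨y, hy⟩
      rw [hd] at hm hy
      obtain ⟨x, hx⟩ := hq.1 m (hz _ _ hm) ⟨sgn s.1 • y, by rw [map_zsmul, hy]⟩
      exact ⟨sgn s.1 • x, by rw [hd, map_zsmul, hs, hx]⟩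
    · intro n hn
      rw [hd] at hn
      obtain ⟨m, y, hm, hy⟩ := hq.2 n (hz _ _ hn)
      refine ⟨m, sgn s.1 • y, by rw [hd, hm, smul_zero], ?_⟩
      rw [hd, map_zsmul, hs]; exact hy
  let g' : Mor M (Y.shift (-s)) :=
    { toLin := g.toLin
      mem := fun {i m} hm => by
        have : m ∈ (M.shift s).gr (i + s) := by
          change m ∈ M.gr (i + s - s)
          rwa [add_sub_cancel_right]
        have := g.mem this
        rwa [← sub_neg_eq_add] at this
      act := fun a m => by
        have := g.act (A.tw s.1 a) m
        rw [AlgHom.comp_apply, A.tw_tw_self] at this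
        rw [this]
        simp [A.tw_neg]
      comm := fun m => by
        have := g.comm m
        simp only [LinearMap.smul_apply, map_zsmul] at this
        simp only [LinearMap.smul_apply, Prod.fst_neg, sgn_neg]
        rw [← this, hs] }
  obtain ⟨h, hh⟩ := hM _ _ p' hp hq' g'
  refine ⟨⟨h.toLin, fun {i m} hm => ?_, fun a m => ?_, fun m => ?_⟩, hh⟩
  · have := h.mem hm
    change h.toLin m ∈ X.gr (i - s - -s) at this
    rwa [sub_neg_eq_add, sub_add_cancel] at this
  · have := h.act (A.tw s.1 a) m
    rw [AlgHom.comp_apply, this, AlgHom.comp_apply, Prod.fst_neg, A.tw_neg, A.tw_tw_self]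
  · have := h.comm m
    simp only [LinearMap.smul_apply, Prod.fst_neg, sgn_neg] at this
    simp only [LinearMap.smul_apply, map_zsmul, this, hs]


lemma dsum_induction {ι : Type} [DecidableEq ι] {M : ι → Type u} [∀ i, AddCommGroup (M i)]
    [∀ i, Module k (M i)] (S : ∀ i, Submodule k (M i)) {p : (⨁ i, M i) → Prop} (h0 : p 0)
    (hadd : ∀ x y, p x → p y → p (x + y)) (hof : ∀ i, ∀ m ∈ S i, p (DirectSum.lof k ι M i m))
    (x : ⨁ i, M i) (hx : ∀ i, x i ∈ S i) : p x := by
  classical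
  rw [← DirectSum.sum_support_of x]
  exact Finset.sum_induction _ p hadd h0 fun i _ => hof i _ (hx i)

lemma lof_mem {ι : Type} [DecidableEq ι] {M : ι → Type u} [∀ i, AddCommGroup (M i)]
    [∀ i, Module k (M i)] (S : ∀ i, Submodule k (M i)) {i : ι} {m : M i} (hm : m ∈ S i) (l : ι) :
    (DirectSum.lof k ι M i m) l ∈ S l := by
  rcases eq_or_ne i l with rfl | h
  · rwa [DirectSum.lof_apply]
  · rw [DirectSum.lof_eq_of, DirectSum.of_eq_of_ne _ _ _ h.symm]
    exact zero_mem _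

/-- The direct sum of a family of dg-modules. -/
noncomputable abbrev coprod {ι : Type} [DecidableEq ι] (M : ι → DGMod A) : DGMod A where
  carrier := ⨁ i, M i
  act := AlgHom.ofLinearMap
    { toFun := fun a => DirectSum.lmap fun i => (M i).act a
      map_add' := fun a b => by ext i m : 2; simp
      map_smul' := fun c a => by ext i m : 2; simp }
    (by ext i m : 2; simp)
    (fun a b => by ext i m : 2; simp)
  gr j :=
    { carrier := {x | ∀ i, x i ∈ (M i).gr j}
      add_mem' := fun hx hy i => add_mem (hx i) (hy i)
      zero_mem' := fun _ => zero_mem _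
      smul_mem' := fun c _ hx i => Submodule.smul_mem _ c (hx i) }
  internal := by
    refine internal_of_coaction (DirectSum.toModule k ι _ fun i =>
      Finsupp.mapRange.linearMap (DirectSum.lof k ι (fun i => (M i : Type u)) i) ∘ₗ
        (M i).coaction) ?_ ?_
    · intro j x hx
      refine dsum_induction (fun i => (M i).gr j) (p := fun x => DirectSum.toModule k ι
        (Deg →₀ ⨁ i, M i) (fun i => Finsupp.mapRange.linearMap
          (DirectSum.lof k ι (fun i => (M i : Type u)) i) ∘ₗ (M i).coaction) x =
        Finsupp.single j x) ?_ ?_ ?_ x hx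
      · simp
      · intro x y hx hy
        rw [map_add, hx, hy, Finsupp.single_add]
      · intro i m hm
        rw [DirectSum.toModule_lof, LinearMap.comp_apply, (M i).coaction_of_mem hm]
        simp
    · intro x
      refine dsum_induction (fun i => (⊤ : Submodule k (M i))) (zero_mem _)
        (fun x y hx hy => add_mem hx hy) (fun i m _ => ?_) x (fun _ => trivial)
      refine hom_induction (M i).internal
        (p := fun m => DirectSum.lof k ι (fun i => (M i : Type u)) i m ∈ _) ?_ ?_ ?_ m
      · rw [map_zero]; exact zero_mem _
      · intro x y hx hy; rw [map_add]; exact add_mem hx hy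
      · intro j m hm
        exact Submodule.mem_iSup_of_mem j (lof_mem (fun i => (M i).gr j) hm)
  act_mem ha hx l := (M l).act_mem ha (hx l)
  d := DirectSum.lmap fun i => (M i).d
  d_mem hx l := (M l).d_mem (hx l)
  d_d x := DFinsupp.ext fun l => (M l).d_d (x l)
  d_act a x := DFinsupp.ext fun l => (M l).d_act a (x l)

/-- The inclusion of a summand. -/
noncomputable def incl {ι : Type} [DecidableEq ι] (M : ι → DGMod A) (i : ι) :
    Mor (M i) (coprod M) where
  toLin := DirectSum.lof k ι (fun i => (M i : Type u)) i
  mem {j _} hm := lof_mem (fun i => (M i).gr j) hm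
  act a m := (DirectSum.lmap_lof (fun i => (M i).act a) i m).symm
  comm m := (DirectSum.lmap_lof (fun i => (M i).d) i m).symm

lemma coprod_induction {ι : Type} [DecidableEq ι] {M : ι → DGMod A} {p : coprod M → Prop}
    (h0 : p 0) (hadd : ∀ x y, p x → p y → p (x + y)) (hof : ∀ i m, p ((incl M i).toLin m))
    (x : coprod M) : p x :=
  dsum_induction (fun i => (⊤ : Submodule k (M i))) h0 hadd (fun i m _ => hof i m) x
    (fun _ => trivial)

/-- The map out of a direct sum induced by linear maps out of the summands. -/
noncomputable def desc {ι : Type} [DecidableEq ι] {M : ι → DGMod A} {V : Type u} [AddCommGroup V]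
    [Module k V] (f : ∀ i, M i →ₗ[k] V) : coprod M →ₗ[k] V := DirectSum.toModule k ι V f

lemma desc_incl {ι : Type} [DecidableEq ι] {M : ι → DGMod A} {V : Type u} [AddCommGroup V]
    [Module k V] (f : ∀ i, M i →ₗ[k] V) (i : ι) (m : M i) :
    desc f ((incl M i).toLin m) = f i m :=
  DirectSum.toModule_lof (M := fun i => (M i : Type u)) k i m

lemma Cofibrant.coprod {ι : Type} [DecidableEq ι] {M : ι → DGMod A} (hM : ∀ i, (M i).Cofibrant) :
    (DGMod.coprod M).Cofibrant := by
  intro X Y p hp hq g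
  let g' : ∀ i, Mor (M i) Y := fun i =>
    { toLin := g.toLin ∘ₗ (incl M i).toLin
      mem := fun hm => g.mem ((incl M i).mem hm)
      act := fun a m => by rw [LinearMap.comp_apply, (incl M i).act, g.act]; rfl
      comm := fun m => by rw [LinearMap.comp_apply, (incl M i).comm, g.comm]; rfl }
  choose h hh using fun i => hM i X Y p hp hq (g' i)
  refine ⟨⟨desc fun i => (h i).toLin, fun {j x} hx => ?_, fun a x => ?_, fun x => ?_⟩, ?_⟩
  · refine dsum_induction (fun i => (M i).gr j)
      (p := fun x => desc (fun i => (h i).toLin) x ∈ X.gr j) ?_ ?_ ?_ x hx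
    · rw [map_zero]; exact zero_mem _
    · intro x y hx hy; rw [map_add]; exact add_mem hx hy
    · intro i m hm
      have := (h i).mem hm
      rwa [← desc_incl (fun i => (h i).toLin) i m] at this
  · refine coprod_induction (p := fun x => desc (fun i => (h i).toLin) ((DGMod.coprod M).act a x) =
      X.act a (desc (fun i => (h i).toLin) x)) (by simp) (fun x y hx hy => by simp only [map_add, hx, hy])
      (fun i m => ?_) x
    rw [← (incl M i).act, desc_incl, desc_incl, (h i).act]
  · refine coprod_induction (p := fun x => desc (fun i => (h i).toLin) ((DGMod.coprod M).d x) =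
      X.d (desc (fun i => (h i).toLin) x)) (by simp) (fun x y hx hy => by simp only [map_add, hx, hy])
      (fun i m => ?_) x
    rw [← (incl M i).comm, desc_incl, desc_incl, (h i).comm]
  · refine LinearMap.ext fun x => ?_
    refine coprod_induction (p := fun x => (p.toLin ∘ₗ desc fun i => (h i).toLin) x = g.toLin x)
      (by simp) (fun x y hx hy => by simp only [map_add, hx, hy])
      (fun i m => ?_) x
    rw [LinearMap.comp_apply, desc_incl]
    exact LinearMap.congr_fun (hh i) m

/-- The mapping cone `M[1] ⊕ N` of `f : M → N`, with differential
`(m, n) ↦ (- d m, f m + d n)`. -/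
noncomputable abbrev cone {M N : DGMod A} (f : Mor M N) : DGMod A where
  carrier := M × N
  act := AlgHom.ofLinearMap
    { toFun := fun a => LinearMap.prodMap (M.act (A.tw 1 a)) (N.act a)
      map_add' := fun a b => by ext <;> simp
      map_smul' := fun c a => by ext <;> simp }
    (by ext <;> simp)
    (fun a b => by ext <;> simp)
  gr i := ((M.shift (1, 0, 0)).gr i).prod (N.gr i)
  internal := by
    refine internal_of_coaction (LinearMap.coprod
      (Finsupp.mapRange.linearMap (LinearMap.inl k M N) ∘ₗ (M.shift (1, 0, 0)).coaction)
      (Finsupp.mapRange.linearMap (LinearMap.inr k M N) ∘ₗ N.coaction)) ?_ ?_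
    · rintro i ⟨m, n⟩ ⟨hm, hn⟩
      rw [LinearMap.coprod_apply, LinearMap.comp_apply, LinearMap.comp_apply,
        coaction_of_mem _ hm, coaction_of_mem _ hn]
      simp [← Finsupp.single_add]
    · rintro ⟨m, n⟩
      have h1 : ((m, 0) : M × N) ∈ ⨆ i, ((M.shift (1, 0, 0)).gr i).prod (N.gr i) := by
        refine hom_induction (M.shift (1, 0, 0)).internal
          (p := fun m => ((m, 0) : M × N) ∈ ⨆ i, ((M.shift (1, 0, 0)).gr i).prod (N.gr i))
          (zero_mem _) (fun x y hx hy => ?_) (fun i x hx => ?_) m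
        · have := add_mem hx hy
          rwa [Prod.mk_add_mk, add_zero] at this
        · exact Submodule.mem_iSup_of_mem i ⟨hx, zero_mem _⟩
      have h2 : ((0, n) : M × N) ∈ ⨆ i, ((M.shift (1, 0, 0)).gr i).prod (N.gr i) := by
        refine hom_induction N.internal
          (p := fun n => ((0, n) : M × N) ∈ ⨆ i, ((M.shift (1, 0, 0)).gr i).prod (N.gr i))
          (zero_mem _) (fun x y hx hy => ?_) (fun i x hx => ?_) n
        · have := add_mem hx hy
          rwa [Prod.mk_add_mk, add_zero] at this
        · exact Submodule.mem_iSup_of_mem i ⟨zero_mem _, hx⟩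
      have := add_mem h1 h2
      rwa [Prod.mk_add_mk, add_zero, zero_add] at this
  act_mem ha hx := ⟨(M.shift (1, 0, 0)).act_mem ha hx.1, N.act_mem ha hx.2⟩
  d := LinearMap.prod (-(M.d ∘ₗ LinearMap.fst k M N))
    (f.toLin ∘ₗ LinearMap.fst k M N + N.d ∘ₗ LinearMap.snd k M N)
  d_mem {i x} hx := by
    refine ⟨neg_mem ?_, add_mem (f.mem hx.1) (N.d_mem hx.2)⟩
    have := M.d_mem hx.1
    rwa [sub_right_comm] at this
  d_d x := by
    ext
    · simp [M.d_d]
    · simp [N.d_d, f.comm]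
  d_act a x := by
    ext
    · simp [M.d_act]
    · simp [N.d_act, f.act]

lemma cone_id_acyclic (X : DGMod A) (f : Mor X X) (hf : f.toLin = LinearMap.id) (z : cone f)
    (hz : (cone f).d z = 0) : ∃ w, (cone f).d w = z := by
  obtain ⟨x, y⟩ := z
  have h2 : f.toLin x + X.d y = 0 := congrArg Prod.snd hz
  rw [hf] at h2
  refine ⟨(y, 0), ?_⟩
  change (-(X.d y), f.toLin y + X.d 0) = (x, y)
  rw [hf, map_zero, add_zero]
  rw [LinearMap.id_apply, ← eq_neg_iff_add_eq_zero] at h2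
  rw [← h2]; rfl

lemma cone_acyclic {X Y : DGMod A} (f : Mor X Y) (hf : f.IsQuasiIso) (z : cone f)
    (hz : (cone f).d z = 0) : ∃ w, (cone f).d w = z := by
  rw [Mor.isQuasiIso_iff] at hf
  obtain ⟨x, y⟩ := z
  have h1 : -(X.d x) = 0 := congrArg Prod.fst hz
  have h2 : f.toLin x + Y.d y = 0 := congrArg Prod.snd hz
  obtain ⟨a, ha⟩ := hf.1 x (neg_eq_zero.1 h1) ⟨-y, by
    rw [map_neg]; exact (eq_neg_of_add_eq_zero_left h2).symm⟩
  obtain ⟨b, c, hb, hc⟩ := hf.2 (y + f.toLin a) (by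
    rw [map_add, ← f.comm, ha, add_comm, h2])
  refine ⟨(b - a, c), ?_⟩
  change (-(X.d (b - a)), f.toLin (b - a) + Y.d c) = (x, y)
  rw [map_sub, map_sub, hb, ha, zero_sub, neg_neg, sub_add_eq_add_sub, ← hc,
    add_sub_cancel_right]

lemma Cofibrant.cone {M N : DGMod A} (hM : M.Cofibrant) (hN : N.Cofibrant) (f : Mor M N) :
    (DGMod.cone f).Cofibrant := by
  intro X Y p hp hq g
  have gcomm : ∀ m n, g.toLin (-(M.d m), f.toLin m + N.d n) = Y.d (g.toLin (m, n)) :=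
    fun m n => g.comm (m, n)
  have gact : ∀ a m n, g.toLin (M.act (A.tw 1 a) m, N.act a n) = Y.act a (g.toLin (m, n)) :=
    fun a m n => g.act a (m, n)
  let v : Mor N Y :=
    { toLin := g.toLin ∘ₗ LinearMap.inr k M N
      mem := fun hn => g.mem ⟨zero_mem _, hn⟩
      act := fun a n => by simpa using gact a 0 n
      comm := fun n => by simpa using gcomm 0 n }
  obtain ⟨v', hv'⟩ := hN X Y p hp hq v
  have hv'' : ∀ n, p.toLin (v'.toLin n) = g.toLin (0, n) := fun n => LinearMap.congr_fun hv' n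
  let idX : Mor X X := ⟨LinearMap.id, fun h => h, fun _ _ => rfl, fun _ => rfl⟩
  let P : Mor (DGMod.cone idX) (DGMod.cone p) :=
    { toLin := LinearMap.prodMap LinearMap.id p.toLin
      mem := fun h => ⟨h.1, p.mem h.2⟩
      act := fun a x => Prod.ext rfl (p.act a x.2)
      comm := fun x => by
        refine Prod.ext rfl ?_
        change p.toLin (x.1 + X.d x.2) = p.toLin x.1 + Y.d (p.toLin x.2)
        rw [map_add, p.comm] }
  have hP : Function.Surjective P.toLin := by
    rintro ⟨x, y⟩
    obtain ⟨z, hz⟩ := hp y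
    exact ⟨(x, z), Prod.ext rfl hz⟩
  have hPq : P.IsQuasiIso := by
    rw [Mor.isQuasiIso_iff]
    refine ⟨fun z hz _ => cone_id_acyclic X idX rfl z hz, fun z hz => ?_⟩
    obtain ⟨w, hw⟩ := cone_acyclic p hq z hz
    exact ⟨0, w, map_zero _, by rw [hw, map_zero, zero_add]⟩
  let G : Mor (M.shift (1, 0, 0)) (DGMod.cone p) :=
    { toLin := LinearMap.prod (-(v'.toLin ∘ₗ f.toLin)) (g.toLin ∘ₗ LinearMap.inl k M N)
      mem := fun {i m} hm => ⟨neg_mem (v'.mem (f.mem hm)), g.mem ⟨hm, zero_mem _⟩⟩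
      act := fun a m => by
        refine Prod.ext ?_ ?_
        · change -(v'.toLin (f.toLin (M.act (A.tw 1 a) m))) =
            X.act (A.tw 1 a) (-(v'.toLin (f.toLin m)))
          rw [f.act, v'.act, map_neg]
        · have := gact a m 0
          rw [map_zero] at this
          exact this
      comm := fun m => by
        refine Prod.ext ?_ ?_
        · change -(v'.toLin (f.toLin (sgn 1 • M.d m))) = -(X.d (-(v'.toLin (f.toLin m))))
          rw [sgn_one, neg_one_smul, map_neg, map_neg, f.comm, v'.comm, map_neg]
        · change g.toLin (sgn 1 • M.d m, 0) =
            p.toLin (-(v'.toLin (f.toLin m))) + Y.d (g.toLin (m, 0))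
          rw [← gcomm, map_neg p.toLin, hv'', map_zero, add_zero, sgn_one, neg_one_smul,
            ← map_neg g.toLin, ← map_add g.toLin]
          congr 1
          ext <;> simp }
  obtain ⟨H, hH⟩ := hM.shift (1, 0, 0) _ _ P hP hPq G
  have hH1 : ∀ m, (H.toLin m).1 = -(v'.toLin (f.toLin m)) := fun m =>
    congrArg Prod.fst (LinearMap.congr_fun hH m)
  have hH2 : ∀ m, p.toLin (H.toLin m).2 = g.toLin (m, 0) := fun m =>
    congrArg Prod.snd (LinearMap.congr_fun hH m)
  refine ⟨⟨LinearMap.coprod (LinearMap.snd k X X ∘ₗ H.toLin) v'.toLin, fun {i x} hx => ?_,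
    fun a x => ?_, fun x => ?_⟩, ?_⟩
  · exact add_mem (H.mem hx.1).2 (v'.mem hx.2)
  · have h1 : (H.toLin (M.act (A.tw 1 a) x.1)).2 = X.act a (H.toLin x.1).2 :=
      congrArg Prod.snd (H.act a x.1)
    change (H.toLin (M.act (A.tw 1 a) x.1)).2 + v'.toLin (N.act a x.2) =
      X.act a ((H.toLin x.1).2 + v'.toLin x.2)
    rw [h1, v'.act, map_add]
  · have h1 : (H.toLin (sgn 1 • M.d x.1)).2 = (H.toLin x.1).1 + X.d (H.toLin x.1).2 :=
      congrArg Prod.snd (H.comm x.1)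
    rw [sgn_one, neg_one_smul, hH1] at h1
    change (H.toLin (-(M.d x.1))).2 + v'.toLin (f.toLin x.1 + N.d x.2) =
      X.d ((H.toLin x.1).2 + v'.toLin x.2)
    rw [h1, map_add, map_add, v'.comm]; abel
  · ext x
    · change p.toLin ((H.toLin x).2 + v'.toLin 0) = g.toLin (x, 0)
      rw [map_zero, add_zero, hH2]
    · change p.toLin ((H.toLin 0).2 + v'.toLin x) = g.toLin (0, x)
      rw [map_zero, Prod.snd_zero, zero_add, hv'']

end DGMod

/-- The action of `HOM` under the shift by `s = (h, a, b)`: `f ↦ (-1)^{h n} f`. -/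
def DGMod.shiftHom {A : GrAlg k} {M N : DGMod A} (s : Deg) (n : ℤ) :
    DGMod.Hom n M N →ₗ[k] DGMod.Hom n (M.shift s) (N.shift s) where
  toFun f := ⟨sgn (s.1 * n) • f.1, by
    refine DGMod.zsmul_mem_hom ⟨fun i m hm => ?_, fun a m => ?_⟩ _
    · have := f.2.1 _ _ hm
      rwa [sub_add_eq_add_sub] at this
    · have := f.2.2 (A.tw s.1 a) m
      rw [A.tw_tw, add_comm, ← A.tw_tw] at this
      exact this⟩
  map_add' f g := Subtype.ext (smul_add _ f.1 g.1)
  map_smul' c f := Subtype.ext (smul_comm _ c f.1)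

namespace DGFunctor

variable {A B : GrAlg k}

/-- The shift dg-functor `q^a λ^b (-)[h]` for `s = (h, a, b)`. -/
def shift (A : GrAlg k) (s : Deg) : DGFunctor A A where
  obj M := ⟨M.obj.shift s, M.cofibrant.shift s⟩
  map n := DGMod.shiftHom s n
  map_id M := by
    refine Subtype.ext ?_
    change sgn (s.1 * 0) • (LinearMap.id : M.obj →ₗ[k] M.obj) = LinearMap.id
    rw [mul_zero, sgn_zero, one_smul]
  map_comp {M N P} n m g f := by
    refine Subtype.ext (LinearMap.ext fun x => ?_)
    change sgn (s.1 * (n + m)) • g.1 (f.1 x) = sgn (s.1 * n) • g.1 (sgn (s.1 * m) • f.1 x)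
    rw [map_zsmul, smul_smul, mul_add, sgn_add]
  map_diff {M N} n f := by
    refine Subtype.ext (LinearMap.ext fun x => ?_)
    change sgn (s.1 * (n - 1)) • (N.obj.d (f.1 x) - sgn n • f.1 (M.obj.d x)) =
      sgn s.1 • N.obj.d (sgn (s.1 * n) • f.1 x) -
        sgn n • sgn (s.1 * n) • f.1 (sgn s.1 • M.obj.d x)
    have h : sgn (s.1 * (n - 1)) = sgn (s.1 * n) * sgn s.1 := by
      rw [mul_sub, mul_one, sub_eq_add_neg, sgn_add, sgn_neg]
    simp only [map_zsmul, smul_sub, smul_smul, h]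
    congr 2 <;> ring

/-- The direct sum of a family of dg-functors. -/
noncomputable def coprod {ι : Type} [DecidableEq ι] (F : ι → DGFunctor A B) : DGFunctor A B where
  obj M := ⟨DGMod.coprod fun i => ((F i).obj M).obj,
    DGMod.Cofibrant.coprod fun i => ((F i).obj M).cofibrant⟩
  map {M N} n :=
    { toFun := fun f => ⟨DirectSum.lmap fun i => ((F i).map n f).1,
        fun _ _ hm l => ((F l).map n f).2.1 _ _ (hm l),
        fun a m => DFinsupp.ext fun l => ((F l).map n f).2.2 a (m l)⟩
      map_add' := fun f g => Subtype.ext (LinearMap.ext fun x => DFinsupp.ext fun l =>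
        LinearMap.congr_fun (congrArg Subtype.val (((F l).map n).map_add f g)) (x l))
      map_smul' := fun c f => Subtype.ext (LinearMap.ext fun x => DFinsupp.ext fun l =>
        LinearMap.congr_fun (congrArg Subtype.val (((F l).map n).map_smul c f)) (x l)) }
  map_id M := Subtype.ext (LinearMap.ext fun x => DFinsupp.ext fun l =>
    LinearMap.congr_fun (congrArg Subtype.val ((F l).map_id M)) (x l))
  map_comp n m g f := Subtype.ext (LinearMap.ext fun x => DFinsupp.ext fun l =>
    LinearMap.congr_fun (congrArg Subtype.val ((F l).map_comp n m g f)) (x l))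
  map_diff n f := Subtype.ext (LinearMap.ext fun x => DFinsupp.ext fun l => by
    have h := LinearMap.congr_fun (congrArg Subtype.val ((F l).map_diff n f)) (x l)
    refine h.trans ?_
    change _ = (DirectSum.lmap _ _ - sgn n • _ : ⨁ i, ((F i).obj _).obj.carrier) l
    rw [DirectSum.sub_apply]
    congr 1
    )

/-- The cone of a morphism of dg-functors. -/
noncomputable def cone {F G : DGFunctor A B} (η : DGNat F G) : DGFunctor A B where
  obj M := ⟨DGMod.cone (η.app M),
    DGMod.Cofibrant.cone (F.obj M).cofibrant (G.obj M).cofibrant (η.app M)⟩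
  map {M N} n :=
    { toFun := fun f => ⟨LinearMap.prodMap (sgn n • (F.map n f).1) (G.map n f).1,
        fun i x hx => ⟨zsmul_mem (by
          have := (F.map n f).2.1 _ _ hx.1
          rwa [sub_add_eq_add_sub] at this) _, (G.map n f).2.1 _ _ hx.2⟩,
        fun a x => by
          refine Prod.ext ?_ ((G.map n f).2.2 a x.2)
          change sgn n • (F.map n f).1 ((F.obj M).obj.act (B.tw 1 a) x.1) =
            (F.obj N).obj.act (B.tw 1 (B.tw n a)) (sgn n • (F.map n f).1 x.1)
          rw [(F.map n f).2.2, B.tw_tw, B.tw_tw, map_zsmul, add_comm]⟩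
      map_add' := fun f g => Subtype.ext (LinearMap.ext fun x => by
        rw [map_add, map_add]
        exact Prod.ext (smul_add (sgn n) ((F.map n f).1 x.1) ((F.map n g).1 x.1)) rfl)
      map_smul' := fun c f => Subtype.ext (LinearMap.ext fun x => by
        rw [map_smul, map_smul]
        exact Prod.ext (smul_comm (sgn n) c ((F.map n f).1 x.1)) rfl) }
  map_id M := by
    refine Subtype.ext (LinearMap.ext fun x => ?_)
    refine Prod.ext ?_ ?_
    · change sgn 0 • (F.map 0 (DGMod.Hom.id M.obj)).1 x.1 = x.1
      rw [F.map_id, sgn_zero, one_smul]; rfl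
    · change (G.map 0 (DGMod.Hom.id M.obj)).1 x.2 = x.2
      rw [G.map_id]; rfl
  map_comp n m g f := by
    refine Subtype.ext (LinearMap.ext fun x => ?_)
    refine Prod.ext ?_ ?_
    · change sgn (n + m) • (F.map (n + m) (DGMod.Hom.comp g f)).1 x.1 =
        sgn n • (F.map n g).1 (sgn m • (F.map m f).1 x.1)
      rw [map_zsmul, smul_smul, sgn_add, F.map_comp]; rfl
    · change (G.map (n + m) (DGMod.Hom.comp g f)).1 x.2 = (G.map n g).1 ((G.map m f).1 x.2)
      rw [G.map_comp]; rfl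
  map_diff {M N} n f := by
    refine Subtype.ext (LinearMap.ext fun x => ?_)
    have hF : (F.map (n - 1) (DGMod.Hom.diff n f)).1 x.1 = (F.obj N).obj.d ((F.map n f).1 x.1) -
        sgn n • (F.map n f).1 ((F.obj M).obj.d x.1) := by rw [F.map_diff]; rfl
    have hG : (G.map (n - 1) (DGMod.Hom.diff n f)).1 x.2 = (G.obj N).obj.d ((G.map n f).1 x.2) -
        sgn n • (G.map n f).1 ((G.obj M).obj.d x.2) := by rw [G.map_diff]; rfl
    have h : sgn (n - 1) = -sgn n := by
      rw [sub_eq_add_neg, sgn_add, sgn_neg, sgn_one, mul_neg_one]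
    refine Prod.ext ?_ ?_
    · change sgn (n - 1) • (F.map (n - 1) (DGMod.Hom.diff n f)).1 x.1 =
        -((F.obj N).obj.d (sgn n • (F.map n f).1 x.1)) -
          sgn n • sgn n • (F.map n f).1 (-((F.obj M).obj.d x.1))
      simp only [hF, h, map_zsmul, map_neg, smul_sub, smul_neg, neg_smul]
    · change (G.map (n - 1) (DGMod.Hom.diff n f)).1 x.2 =
        ((η.app N).toLin (sgn n • (F.map n f).1 x.1) + (G.obj N).obj.d ((G.map n f).1 x.2)) -
          sgn n • (G.map n f).1 ((η.app M).toLin x.1 + (G.obj M).obj.d x.2)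
      rw [hG, map_zsmul, η.naturality, map_add, smul_add]
      abel

/-- The zero dg-functor. -/
noncomputable def zero (A B : GrAlg k) : DGFunctor A B :=
  coprod (ι := Empty) fun i => i.elim

end DGFunctor

/-! ## Induction and restriction -/

/-- Possibly non-unital homomorphisms of graded algebras. -/
structure GrHom (A B : GrAlg k) where
  toHom : A →ₙₐ[k] B
  mem : ∀ {i : Deg} {a : A}, a ∈ A.gr i → toHom a ∈ B.gr i

instance {A B : GrAlg k} : CoeFun (GrHom A B) (fun _ => A → B) := ⟨fun φ => φ.toHom⟩

namespace GrHom

variable {A B : GrAlg k} (φ : GrHom A B)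

lemma tw_apply (n : ℤ) (a : A) : B.tw n (φ a) = φ (A.tw n a) := by
  refine hom_induction A.internal (p := fun a => B.tw n (φ a) = φ (A.tw n a))
    (by simp) (fun x y hx hy => by simp only [map_add, hx, hy]) (fun i a ha => ?_) a
  rw [A.tw_of_mem n ha, B.tw_of_mem n (φ.mem ha), map_zsmul]

lemma one_mem : φ 1 ∈ B.gr 0 := φ.mem SetLike.GradedOne.one_mem

lemma tw_one (n : ℤ) : B.tw n (φ 1) = φ 1 := by rw [tw_apply, map_one]

lemma one_mul_apply (a : A) : φ 1 * φ a = φ a := by rw [← map_mul, one_mul]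

lemma apply_mul_one (a : A) : φ a * φ 1 = φ a := by rw [← map_mul, mul_one]

end GrHom

namespace DGMod

variable {A B : GrAlg k} (φ : GrHom A B)

/-- The restriction of a `B`-module `M` along `φ : A → B`: the subspace `φ(1) M = {m | φ(1) m = m}`,
with `A` acting through `φ`. It is `φ(1) B ⊗_B M ≅ HOM_B(B φ(1), M)`. -/
abbrev res (M : DGMod B) : DGMod A where
  carrier := LinearMap.eqLocus (M.act (φ 1)) LinearMap.id
  act := AlgHom.ofLinearMap
    { toFun := fun a => (M.act (φ a)).restrict (fun m _ => by
        change M.act (φ 1) (M.act (φ a) m) = M.act (φ a) m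
        rw [← Module.End.mul_apply, ← map_mul, φ.one_mul_apply])
      map_add' := fun a b => by ext m; simp
      map_smul' := fun c a => by ext m; simp }
    (by ext m; exact m.2)
    (fun a b => by ext m; simp)
  gr i := (M.gr i).comap (Submodule.subtype _)
  internal := by
    let π : M →ₗ[k] LinearMap.eqLocus (M.act (φ 1)) LinearMap.id :=
      (M.act (φ 1)).codRestrict _ (fun m => by
        change M.act (φ 1) (M.act (φ 1) m) = M.act (φ 1) m
        rw [← Module.End.mul_apply, ← map_mul, φ.one_mul_apply])
    have hπ : ∀ m : LinearMap.eqLocus (M.act (φ 1)) LinearMap.id, π m = m :=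
      fun m => Subtype.ext m.2
    refine internal_of_coaction
      (Finsupp.mapRange.linearMap π ∘ₗ M.coaction ∘ₗ Submodule.subtype _) ?_ ?_
    · intro i m hm
      have hm' : (m : M) ∈ M.gr i := hm
      simp [M.coaction_of_mem hm', hπ]
    · intro m
      rw [← hπ m]
      refine hom_induction M.internal (p := fun m => π m ∈ _) ?_ ?_ ?_ (m : M)
      · rw [map_zero]; exact zero_mem _
      · intro x y hx hy; rw [map_add]; exact add_mem hx hy
      · intro i m hm
        refine Submodule.mem_iSup_of_mem i ?_
        have := M.act_mem φ.one_mem hm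
        rwa [zero_add] at this
  act_mem ha hm := M.act_mem (φ.mem ha) hm
  d := M.d.restrict (fun m hm => by
    have hm' : M.act (φ 1) m = m := hm
    change M.act (φ 1) (M.d m) = M.d m
    conv_rhs => rw [← hm', M.d_act, φ.tw_one])
  d_mem hm := M.d_mem hm
  d_d m := Subtype.ext (M.d_d m)
  d_act a m := Subtype.ext (by
    change M.d (M.act (φ a) m) = M.act (φ (A.tw 1 a)) (M.d m)
    rw [M.d_act, φ.tw_apply])

/-- The action of `HOM` under restriction. -/
def resHom {M N : DGMod B} (n : ℤ) : Hom n M N →ₗ[k] Hom n (M.res φ) (N.res φ) where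
  toFun f := ⟨f.1.restrict (fun m hm => by
      have hm' : M.act (φ 1) m = m := hm
      change N.act (φ 1) (f.1 m) = f.1 m
      conv_rhs => rw [← hm', f.2.2, φ.tw_one]),
    fun i m hm => f.2.1 i m hm,
    fun a m => Subtype.ext (by
      change f.1 (M.act (φ a) m) = N.act (φ (A.tw n a)) (f.1 m)
      rw [f.2.2, φ.tw_apply])⟩
  map_add' f g := rfl
  map_smul' c f := rfl

/-- The relations `x φ(a) ⊗ m = x ⊗ a m` in `B ⊗_k M`. -/
def indRel (M : DGMod A) : Submodule k (B ⊗[k] M) :=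
  Submodule.span k {z | ∃ (x : B) (a : A) (m : M), z = (x * φ a) ⊗ₜ[k] m - x ⊗ₜ[k] M.act a m}

/-- The class of `x ⊗ m` in `B ⊗_A M`. -/
def tmul (M : DGMod A) : B →ₗ[k] M →ₗ[k] (B ⊗[k] M) ⧸ indRel φ M :=
  (TensorProduct.mk k B M).compr₂ (indRel φ M).mkQ

lemma tmul_act (M : DGMod A) (x : B) (a : A) (m : M) :
    tmul φ M x (M.act a m) = tmul φ M (x * φ a) m :=
  ((Submodule.Quotient.eq (indRel φ M)).2 (Submodule.subset_span ⟨x, a, m, rfl⟩)).symm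

lemma tmul_one (M : DGMod A) (x : B) (m : M) : tmul φ M (x * φ 1) m = tmul φ M x m := by
  rw [← tmul_act, map_one, Module.End.one_apply]

lemma ind_induction {M : DGMod A} {p : (B ⊗[k] M) ⧸ indRel φ M → Prop} (h0 : p 0)
    (hadd : ∀ x y, p x → p y → p (x + y)) (ht : ∀ x m, p (tmul φ M x m)) (z) : p z := by
  induction z using Submodule.Quotient.induction_on with
  | _ z =>
    induction z using TensorProduct.induction_on with
    | zero => exact h0
    | tmul x m => exact ht x m
    | add x y hx hy => exact hadd _ _ hx hy

/-- The map out of `B ⊗_A M` induced by an `A`-balanced bilinear map. -/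
def tlift {M : DGMod A} {V : Type u} [AddCommGroup V] [Module k V] (f : B →ₗ[k] M →ₗ[k] V)
    (hf : ∀ x a m, f (x * φ a) m = f x (M.act a m)) : (B ⊗[k] M) ⧸ indRel φ M →ₗ[k] V :=
  (indRel φ M).liftQ (TensorProduct.lift f) (Submodule.span_le.2 (by
    rintro _ ⟨x, a, m, rfl⟩
    simp [hf]))

lemma tlift_tmul {M : DGMod A} {V : Type u} [AddCommGroup V] [Module k V]
    (f : B →ₗ[k] M →ₗ[k] V) (hf : ∀ x a m, f (x * φ a) m = f x (M.act a m)) (x : B) (m : M) :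
    tlift φ f hf (tmul φ M x m) = f x m := by
  change TensorProduct.lift f (x ⊗ₜ[k] m) = f x m
  simp

lemma ind_hom_ext {M : DGMod A} {V : Type u} [AddCommGroup V] [Module k V]
    {f g : (B ⊗[k] M) ⧸ indRel φ M →ₗ[k] V}
    (h : ∀ x m, f (tmul φ M x m) = g (tmul φ M x m)) : f = g :=
  LinearMap.ext fun z => ind_induction φ (p := fun z => f z = g z) (by simp)
    (fun x y hx hy => by simp only [map_add, hx, hy]) h z

end DGMod

namespace DGMod

variable {A B : GrAlg k} (φ : GrHom A B)

/-- The map `x ⊗ m ↦ (-1)^{n |x|} x ⊗ f m` on `B ⊗_A M`. -/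
def twMap {M N : DGMod A} (n : ℤ) (f : M →ₗ[k] N)
    (hf : ∀ (a : A) (m : M), f (M.act a m) = N.act (A.tw n a) (f m)) :
    (B ⊗[k] M) ⧸ indRel φ M →ₗ[k] (B ⊗[k] N) ⧸ indRel φ N :=
  tlift φ ((tmul φ N).compl₁₂ (B.tw n).toLinearMap f) (fun x a m => by
    rw [LinearMap.compl₁₂_apply, LinearMap.compl₁₂_apply, hf, tmul_act, AlgHom.toLinearMap_apply,
      AlgHom.toLinearMap_apply, map_mul, φ.tw_apply])

lemma twMap_tmul {M N : DGMod A} (n : ℤ) (f : M →ₗ[k] N)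
    (hf : ∀ (a : A) (m : M), f (M.act a m) = N.act (A.tw n a) (f m)) (x : B) (m : M) :
    twMap φ n f hf (tmul φ M x m) = tmul φ N (B.tw n x) (f m) := tlift_tmul φ _ _ x m

/-- The map `x ⊗ m ↦ y x ⊗ m` on `B ⊗_A M`. -/
def mulMap (M : DGMod A) (y : B) : (B ⊗[k] M) ⧸ indRel φ M →ₗ[k] (B ⊗[k] M) ⧸ indRel φ M :=
  tlift φ (tmul φ M ∘ₗ LinearMap.mulLeft k y) (fun x a m => by
    rw [LinearMap.comp_apply, LinearMap.comp_apply, tmul_act, LinearMap.mulLeft_apply,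
      LinearMap.mulLeft_apply, mul_assoc])

lemma mulMap_tmul (M : DGMod A) (y x : B) (m : M) :
    mulMap φ M y (tmul φ M x m) = tmul φ M (y * x) m := tlift_tmul φ _ _ x m

/-- The map `x ⊗ m ↦ (single (|x| + |m|) (x ⊗ m))` for homogeneous `x` and `m`. -/
noncomputable def indCoaction (M : DGMod A) :
    B →ₗ[k] M →ₗ[k] (Deg →₀ ((B ⊗[k] M) ⧸ indRel φ M)) :=
  LinearMap.compl₂
    ((DirectSum.toModule k Deg _ fun i =>
      (((Finsupp.lsum k).toLinearMap ∘ₗ LinearMap.pi fun j : Deg =>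
        (tmul φ M).compr₂ (Finsupp.lsingle (i + j))) ∘ₗ (B.gr i).subtype)) ∘ₗ
      (DirectSum.decomposeLinearEquiv B.gr).toLinearMap)
    M.coaction

lemma indCoaction_of_mem (M : DGMod A) {i j : Deg} {x : B} {m : M} (hx : x ∈ B.gr i)
    (hm : m ∈ M.gr j) : indCoaction φ M x m = Finsupp.single (i + j) (tmul φ M x m) := by
  have h : DirectSum.decompose B.gr x = DirectSum.lof k Deg (fun i => B.gr i) i ⟨x, hx⟩ :=
    DirectSum.decompose_of_mem B.gr hx
  simp only [indCoaction, LinearMap.compl₂_apply, LinearMap.comp_apply, LinearEquiv.coe_coe,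
    DirectSum.decomposeLinearEquiv_apply, h, DirectSum.toModule_lof, M.coaction_of_mem hm]
  simp

lemma indCoaction_balanced (M : DGMod A) (x : B) (a : A) (m : M) :
    indCoaction φ M (x * φ a) m = indCoaction φ M x (M.act a m) := by
  refine hom_induction B.internal
    (p := fun x => indCoaction φ M (x * φ a) m = indCoaction φ M x (M.act a m))
    (by simp) (fun x y hx hy => by simp only [add_mul, map_add, LinearMap.add_apply, hx, hy])
    (fun i x hx => ?_) x
  refine hom_induction A.internal
    (p := fun a => indCoaction φ M (x * φ a) m = indCoaction φ M x (M.act a m))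
    (by simp) (fun x y hx hy => by simp only [mul_add, map_add, LinearMap.add_apply, hx, hy])
    (fun j a ha => ?_) a
  refine hom_induction M.internal
    (p := fun m => indCoaction φ M (x * φ a) m = indCoaction φ M x (M.act a m))
    (by simp) (fun x y hx hy => by simp only [map_add, hx, hy])
    (fun l m hm => ?_) m
  rw [indCoaction_of_mem φ M (SetLike.mul_mem_graded hx (φ.mem ha)) hm,
    indCoaction_of_mem φ M hx (M.act_mem ha hm), tmul_act, add_assoc]

/-- Induction along `φ : A → B`: the dg-module `B ⊗_A M = B φ(1) ⊗_A M`. It is spanned by the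
`x ⊗ m`, whose degree is `|x| + |m|`, and `d (x ⊗ m) = (-1)^{|x|} x ⊗ d m`. -/
noncomputable abbrev ind (M : DGMod A) : DGMod B where
  carrier := (B ⊗[k] M) ⧸ indRel φ M
  act := AlgHom.ofLinearMap
    { toFun := fun y => mulMap φ M y
      map_add' := fun y z => ind_hom_ext φ fun x m => by
        simp [mulMap_tmul, add_mul]
      map_smul' := fun c y => ind_hom_ext φ fun x m => by
        simp [mulMap_tmul] }
    (ind_hom_ext φ fun x m => by simp [mulMap_tmul])
    (fun y z => ind_hom_ext φ fun x m => by simp [mulMap_tmul, mul_assoc])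
  gr i := Submodule.span k {z | ∃ (j l : Deg) (x : B) (m : M), x ∈ B.gr j ∧ m ∈ M.gr l ∧
    j + l = i ∧ z = tmul φ M x m}
  internal := by
    refine internal_of_coaction (tlift φ (indCoaction φ M) (indCoaction_balanced φ M)) ?_ ?_
    · intro i z hz
      induction hz using Submodule.span_induction with
      | mem z hz =>
        obtain ⟨j, l, x, m, hx, hm, rfl, rfl⟩ := hz
        rw [tlift_tmul, indCoaction_of_mem φ M hx hm]
      | zero => simp
      | add x y _ _ hx hy => rw [map_add, hx, hy, Finsupp.single_add]
      | smul c x _ hx => rw [map_smul, hx, Finsupp.smul_single]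
    · intro z
      refine ind_induction φ (p := fun z => z ∈ _) (zero_mem _) (fun x y hx hy => add_mem hx hy)
        (fun x m => ?_) z
      refine hom_induction B.internal (p := fun x => tmul φ M x m ∈ _) ?_ ?_ ?_ x
      · rw [map_zero]; exact zero_mem _
      · intro x y hx hy; rw [map_add]; exact add_mem hx hy
      · intro i x hx
        refine hom_induction M.internal (p := fun m => tmul φ M x m ∈ _) ?_ ?_ ?_ m
        · rw [map_zero]; exact zero_mem _
        · intro x y hx hy; rw [map_add]; exact add_mem hx hy
        · intro j m hm
          exact Submodule.mem_iSup_of_mem (i + j)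
            (Submodule.subset_span ⟨i, j, x, m, hx, hm, rfl, rfl⟩)
  act_mem {i j y z} hy hz := by
    induction hz using Submodule.span_induction with
    | mem z hz =>
      obtain ⟨j, l, x, m, hx, hm, rfl, rfl⟩ := hz
      refine Submodule.subset_span ⟨i + j, l, y * x, m, SetLike.mul_mem_graded hy hx, hm,
        add_assoc _ _ _, mulMap_tmul φ M y x m⟩
    | zero => rw [map_zero]; exact zero_mem _
    | add x y _ _ hx hy => rw [map_add]; exact add_mem hx hy
    | smul c x _ hx => rw [map_smul]; exact Submodule.smul_mem _ c hx
  d := twMap φ 1 M.d M.d_act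
  d_mem {i z} hz := by
    induction hz using Submodule.span_induction with
    | mem z hz =>
      obtain ⟨j, l, x, m, hx, hm, rfl, rfl⟩ := hz
      rw [twMap_tmul]
      exact Submodule.subset_span ⟨j, l - (1, 0, 0), _, _, B.tw_mem 1 hx, M.d_mem hm,
        (add_sub_assoc _ _ _).symm, rfl⟩
    | zero => rw [map_zero]; exact zero_mem _
    | add x y _ _ hx hy => rw [map_add]; exact add_mem hx hy
    | smul c x _ hx => rw [map_smul]; exact Submodule.smul_mem _ c hx
  d_d z := by
    refine ind_induction φ (p := fun z => twMap φ 1 M.d M.d_act (twMap φ 1 M.d M.d_act z) = 0)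
      (by simp) (fun x y hx hy => by simp only [map_add, hx, hy, add_zero]) (fun x m => ?_) z
    rw [twMap_tmul, twMap_tmul, M.d_d, map_zero]
  d_act y z := by
    refine ind_induction φ (p := fun z => twMap φ 1 M.d M.d_act (mulMap φ M y z) =
      mulMap φ M (B.tw 1 y) (twMap φ 1 M.d M.d_act z)) (by simp)
      (fun x y hx hy => by simp only [map_add, hx, hy]) (fun x m => ?_) z
    rw [mulMap_tmul, twMap_tmul, twMap_tmul, mulMap_tmul, map_mul]

lemma ind_act (M : DGMod A) (y x : B) (m : M) :
    (M.ind φ).act y (tmul φ M x m) = tmul φ M (y * x) m := mulMap_tmul φ M y x m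

lemma ind_d (M : DGMod A) (x : B) (m : M) :
    (M.ind φ).d (tmul φ M x m) = tmul φ M (B.tw 1 x) (M.d m) := twMap_tmul φ 1 M.d M.d_act x m

lemma tmul_mem (M : DGMod A) {i j : Deg} {x : B} {m : M} (hx : x ∈ B.gr i) (hm : m ∈ M.gr j) :
    tmul φ M x m ∈ (M.ind φ).gr (i + j) :=
  Submodule.subset_span ⟨i, j, x, m, hx, hm, rfl, rfl⟩

/-- Maps of a given degree out of `B ⊗_A M` are detected on homogeneous tensors. -/
lemma ind_mem {M : DGMod A} {V : Type u} [AddCommGroup V] [Module k V]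
    (gr : Deg → Submodule k V) (s : Deg) (f : (M.ind φ) →ₗ[k] V)
    (h : ∀ {i j : Deg} {x : B} {m : M}, x ∈ B.gr i → m ∈ M.gr j →
      f (tmul φ M x m) ∈ gr (i + j + s)) {i : Deg} {z : M.ind φ} (hz : z ∈ (M.ind φ).gr i) :
    f z ∈ gr (i + s) := by
  induction hz using Submodule.span_induction with
  | mem z hz =>
    obtain ⟨j, l, x, m, hx, hm, rfl, rfl⟩ := hz
    exact h hx hm
  | zero => rw [map_zero]; exact zero_mem _
  | add x y _ _ hx hy => rw [map_add]; exact add_mem hx hy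
  | smul c x _ hx => rw [map_smul]; exact Submodule.smul_mem _ c hx

/-- The action of `HOM` under induction: `x ⊗ m ↦ (-1)^{n |x|} x ⊗ f m`. -/
noncomputable def indHom {M N : DGMod A} (n : ℤ) : Hom n M N →ₗ[k] Hom n (M.ind φ) (N.ind φ) where
  toFun f := ⟨twMap φ n f.1 (fun a m => f.2.2 a m), by
    constructor
    · intro i z hz
      refine ind_mem φ (N.ind φ).gr (n, 0, 0) _ (fun {i j x m} hx hm => ?_) hz
      rw [twMap_tmul, add_assoc]
      exact tmul_mem φ N (B.tw_mem n hx) (f.2.1 _ _ hm)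
    · intro y z
      refine ind_induction φ (p := fun z => twMap φ n f.1 (fun a m => f.2.2 a m)
        ((M.ind φ).act y z) = (N.ind φ).act (B.tw n y)
        (twMap φ n f.1 (fun a m => f.2.2 a m) z)) (by simp)
        (fun x y hx hy => by simp only [map_add, hx, hy]) (fun x m => ?_) z
      rw [ind_act, twMap_tmul, twMap_tmul, ind_act, map_mul]⟩
  map_add' f g := Subtype.ext (ind_hom_ext φ fun x m => by
    simp [twMap_tmul])
  map_smul' c f := Subtype.ext (ind_hom_ext φ fun x m => by
    simp [twMap_tmul])

lemma indHom_tmul {M N : DGMod A} {n : ℤ} (f : Hom n M N) (x : B) (m : M) :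
    (indHom φ n f).1 (tmul φ M x m) = tmul φ N (B.tw n x) (f.1 m) :=
  twMap_tmul φ n f.1 (fun a m => f.2.2 a m) x m

lemma Cofibrant.ind {M : DGMod A} (hM : M.Cofibrant) : (M.ind φ).Cofibrant := by
  intro X Y p hp hq g
  have he : ∀ (Z : DGMod B) (z : Z), Z.act (φ 1) (Z.act (φ 1) z) = Z.act (φ 1) z := fun Z z => by
    rw [← Module.End.mul_apply, ← map_mul, φ.one_mul_apply]
  have hd : ∀ (Z : DGMod B) (z : Z), Z.d (Z.act (φ 1) z) = Z.act (φ 1) (Z.d z) := fun Z z => by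
    rw [Z.d_act, φ.tw_one]
  let p' : Mor (X.res φ) (Y.res φ) :=
    { toLin := p.toLin.restrict (fun m hm => by
        have hm' : X.act (φ 1) m = m := hm
        change Y.act (φ 1) (p.toLin m) = p.toLin m
        rw [← p.act, hm'])
      mem := fun hm => p.mem hm
      act := fun a m => Subtype.ext (p.act (φ a) m)
      comm := fun m => Subtype.ext (p.comm m) }
  have hp' : Function.Surjective p'.toLin := by
    rintro ⟨y, hy⟩
    have hy' : Y.act (φ 1) y = y := hy
    obtain ⟨x, hx⟩ := hp y
    refine ⟨⟨X.act (φ 1) x, he X x⟩, Subtype.ext ?_⟩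
    change p.toLin (X.act (φ 1) x) = y
    rw [p.act, hx, hy']
  have hq' : p'.IsQuasiIso := by
    rw [Mor.isQuasiIso_iff] at hq ⊢
    constructor
    · rintro ⟨m, hm⟩ h1 ⟨y, hy⟩
      have hm' : X.act (φ 1) m = m := hm
      obtain ⟨x, hx⟩ := hq.1 m (congrArg Subtype.val h1) ⟨y.1, congrArg Subtype.val hy⟩
      refine ⟨⟨X.act (φ 1) x, he X x⟩, Subtype.ext ?_⟩
      change X.d (X.act (φ 1) x) = m
      rw [hd, hx, hm']
    · rintro ⟨n, hn⟩ h1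
      have hn' : Y.act (φ 1) n = n := hn
      obtain ⟨m, y, hm, hy⟩ := hq.2 n (congrArg Subtype.val h1)
      refine ⟨⟨X.act (φ 1) m, he X m⟩, ⟨Y.act (φ 1) y, he Y y⟩, Subtype.ext ?_, Subtype.ext ?_⟩
      · change X.d (X.act (φ 1) m) = 0
        rw [hd, hm, map_zero]
      · change n = p.toLin (X.act (φ 1) m) + Y.d (Y.act (φ 1) y)
        rw [p.act, hd, ← map_add, ← hy, hn']
  let g' : Mor M (Y.res φ) :=
    { toLin := (g.toLin ∘ₗ tmul φ M (φ 1)).codRestrict _ (fun m => by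
        change Y.act (φ 1) (g.toLin (tmul φ M (φ 1) m)) = g.toLin (tmul φ M (φ 1) m)
        rw [← g.act, ind_act, φ.one_mul_apply])
      mem := fun {i m} hm => by
        have := g.mem (tmul_mem φ M φ.one_mem hm)
        rwa [zero_add] at this
      act := fun a m => Subtype.ext (by
        change g.toLin (tmul φ M (φ 1) (M.act a m)) = Y.act (φ a) (g.toLin (tmul φ M (φ 1) m))
        rw [← g.act, ind_act, tmul_act, φ.one_mul_apply, φ.apply_mul_one])
      comm := fun m => Subtype.ext (by
        change g.toLin (tmul φ M (φ 1) (M.d m)) = Y.d (g.toLin (tmul φ M (φ 1) m))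
        rw [← g.comm, ind_d, φ.tw_one]) }
  obtain ⟨h, hh⟩ := hM _ _ p' hp' hq' g'
  have hh' : ∀ m, p.toLin (h.toLin m).1 = g.toLin (tmul φ M (φ 1) m) := fun m =>
    congrArg Subtype.val (LinearMap.congr_fun hh m)
  have hb : ∀ (x : B) (a : A) (m : M),
      X.act (x * φ a) (h.toLin m).1 = X.act x (h.toLin (M.act a m)).1 := fun x a m => by
    have : (h.toLin (M.act a m)).1 = X.act (φ a) (h.toLin m).1 := congrArg Subtype.val (h.act a m)
    rw [this, map_mul, Module.End.mul_apply]
  let H : (M.ind φ) →ₗ[k] X :=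
    tlift φ (X.act.toLinearMap.compl₂ (Submodule.subtype _ ∘ₗ h.toLin)) hb
  have hH : ∀ x m, H (tmul φ M x m) = X.act x (h.toLin m).1 := fun x m => tlift_tmul φ _ hb x m
  refine ⟨⟨H, fun {i z} hz => ?_, fun a z => ?_, fun z => ?_⟩, ?_⟩
  · have := ind_mem φ X.gr 0 H (fun {i j x m} hx hm => by
      rw [hH, add_zero]; exact X.act_mem hx (h.mem hm)) hz
    rwa [add_zero] at this
  · refine ind_induction φ (p := fun z => H ((M.ind φ).act a z) = X.act a (H z)) (by simp)
      (fun x y hx hy => by simp only [map_add, hx, hy]) (fun x m => ?_) z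
    rw [ind_act, hH, hH, map_mul, Module.End.mul_apply]
  · refine ind_induction φ (p := fun z => H ((M.ind φ).d z) = X.d (H z)) (by simp)
      (fun x y hx hy => by simp only [map_add, hx, hy]) (fun x m => ?_) z
    have : (h.toLin (M.d m)).1 = X.d (h.toLin m).1 := congrArg Subtype.val (h.comm m)
    rw [ind_d, hH, hH, this, X.d_act]
  · refine ind_hom_ext φ fun x m => ?_
    rw [LinearMap.comp_apply, hH, p.act, hh', ← g.act, ind_act, tmul_one]

end DGMod

namespace DGFunctor

variable {A B : GrAlg k} (φ : GrHom A B)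

/-- The induction dg-functor along `φ`. -/
noncomputable def ind : DGFunctor A B where
  obj M := ⟨M.obj.ind φ, M.cofibrant.ind φ⟩
  map n := DGMod.indHom φ n
  map_id M := Subtype.ext (DGMod.ind_hom_ext φ fun x m => by
    rw [DGMod.indHom_tmul, B.tw_zero]; rfl)
  map_comp {M N P} n m g f := Subtype.ext (DGMod.ind_hom_ext φ fun x z => by
    rw [DGMod.indHom_tmul]
    change DGMod.tmul φ P.obj (B.tw (n + m) x) (g.1 (f.1 z)) =
      (DGMod.indHom φ n g).1 ((DGMod.indHom φ m f).1 (DGMod.tmul φ M.obj x z))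
    rw [DGMod.indHom_tmul, DGMod.indHom_tmul, B.tw_tw])
  map_diff {M N} n f := Subtype.ext (DGMod.ind_hom_ext φ fun x m => by
    rw [DGMod.indHom_tmul]
    change DGMod.tmul φ N.obj (B.tw (n - 1) x) (N.obj.d (f.1 m) - sgn n • f.1 (M.obj.d m)) =
      (N.obj.ind φ).d ((DGMod.indHom φ n f).1 (DGMod.tmul φ M.obj x m)) -
        sgn n • (DGMod.indHom φ n f).1 ((M.obj.ind φ).d (DGMod.tmul φ M.obj x m))
    have h1 : B.tw 1 (B.tw n x) = B.tw (n - 1) x := by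
      rw [← B.tw_neg 1, B.tw_tw, neg_add_eq_sub]
    have h2 : B.tw n (B.tw 1 x) = B.tw (n - 1) x := by
      rw [← B.tw_neg 1 x, B.tw_tw, sub_eq_add_neg]
    rw [DGMod.indHom_tmul, DGMod.ind_d, DGMod.ind_d, DGMod.indHom_tmul, h1, h2, map_sub,
      map_zsmul])

/-- The restriction dg-functor along `φ`, given that restriction preserves cofibrant modules. -/
noncomputable def res (h : ∀ M : DGMod B, M.Cofibrant → (M.res φ).Cofibrant) : DGFunctor B A where
  obj M := ⟨M.obj.res φ, h M.obj M.cofibrant⟩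
  map n := DGMod.resHom φ n
  map_id _ := rfl
  map_comp _ _ _ _ := rfl
  map_diff _ _ := rfl

end DGFunctor

/-! ## The dg-enhanced KLRW algebras -/

namespace KLRW

/-- A strand: black, or red with a label. The blue strand, always at the very left, is left
implicit. -/
inductive Strand
  | black
  | red (n : ℕ)
  deriving DecidableEq

/-- The sequence of strands met by a horizontal line, from left to right. -/
abbrev Word := List Strand

/-- The words made of `b` black strands and of red strands labelled from left to right by `N`. -/
def words : List ℕ → ℕ → Finset Word
  | [], 0 => {[]}
  | [], b + 1 => (words [] b).image (List.cons .black)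
  | n :: N, 0 => (words N 0).image (List.cons (.red n))
  | n :: N, b + 1 =>
      (words (n :: N) b).image (List.cons .black) ∪ (words N (b + 1)).image (List.cons (.red n))

/-- The local pieces: a dot on a black strand, a crossing of two black strands, and the crossings
of a black and a red strand, where the black strand starts (at the bottom) on the left for `br`,
and on the right for `rb`. -/
inductive Loc
  | dot
  | bb
  | br (n : ℕ)
  | rb (n : ℕ)

/-- The strands at the bottom of a local piece. -/
def Loc.src : Loc → Word
  | .dot => [.black]
  | .bb => [.black, .black]
  | .br n => [.black, .red n]
  | .rb n => [.red n, .black]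

/-- The strands at the top of a local piece. -/
def Loc.tgt : Loc → Word
  | .dot => [.black]
  | .bb => [.black, .black]
  | .br n => [.red n, .black]
  | .rb n => [.black, .red n]

/-- The degree of a local piece. -/
def Loc.deg : Loc → Deg
  | .dot => (0, 2, 0)
  | .bb => (0, -2, 0)
  | .br n => (0, n, 0)
  | .rb n => (0, n, 0)

/-- The generating diagrams: vertical strands `w`; a local piece with vertical strands `u` at its
left and `v` at its right; the leftmost strand, black, nailed on the blue strand, with vertical
strands `v` at its right. -/
inductive Gen
  | idem (w : Word)
  | box (u : Word) (l : Loc) (v : Word)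
  | nail (v : Word)

/-- The strands at the bottom of a generating diagram. -/
def Gen.bot : Gen → Word
  | .idem w => w
  | .box u l v => u ++ l.src ++ v
  | .nail v => .black :: v

/-- The strands at the top of a generating diagram. -/
def Gen.top : Gen → Word
  | .idem w => w
  | .box u l v => u ++ l.tgt ++ v
  | .nail v => .black :: v

/-- The degree of a generating diagram. -/
def Gen.deg : Gen → Deg
  | .idem _ => 0
  | .box _ l _ => l.deg
  | .nail _ => (1, 0, 2)

/-- The diagram with a vertical black strand added at the right. -/
def Gen.app : Gen → Gen
  | .idem w => .idem (w ++ [.black])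
  | .box u l v => .box u l (v ++ [.black])
  | .nail v => .nail (v ++ [.black])

section Relations

variable {k : Type u} [CommRing k]

/-- A generating diagram, as an element of the free algebra. -/
abbrev gen (g : Gen) : FreeAlgebra k Gen := FreeAlgebra.ι k g

/-- Vertical strands. -/
abbrev idem (w : Word) : FreeAlgebra k Gen := gen (.idem w)

/-- A local piece with vertical strands `u` at its left and `v` at its right. -/
abbrev box (l : Loc) (u v : Word) : FreeAlgebra k Gen := gen (.box u l v)

/-- A dot, with `u` at its left and `v` at its right. -/
abbrev dot (u v : Word) : FreeAlgebra k Gen := box .dot u v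

/-- A black/black crossing, with `u` at its left and `v` at its right. -/
abbrev bb (u v : Word) : FreeAlgebra k Gen := box .bb u v

/-- A crossing with the black strand starting on the left, with `u` at its left and `v` at its
right. -/
abbrev br (n : ℕ) (u v : Word) : FreeAlgebra k Gen := box (.br n) u v

/-- A crossing with the black strand starting on the right, with `u` at its left and `v` at its
right. -/
abbrev rb (n : ℕ) (u v : Word) : FreeAlgebra k Gen := box (.rb n) u v

/-- A nail, with `v` at its right. -/
abbrev nail (v : Word) : FreeAlgebra k Gen := gen (.nail v)

/-- The relations of the dg-enhanced KLRW algebra on `b` black strands and red strands labelled by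
`N`. In a product `x * y` the diagram `x` is stacked on top of `y`. -/
inductive Rel (N : List ℕ) (b : ℕ) : FreeAlgebra k Gen → FreeAlgebra k Gen → Prop
  -- Diagrams with the prescribed strands; products of non-matching diagrams vanish.
  | idem_zero (w : Word) (h : w ∉ words N b) : Rel N b (idem w) 0
  | idem_mul (w w' : Word) (h : w ≠ w') : Rel N b (idem w * idem w') 0
  | sum_idem : Rel N b (∑ w ∈ words N b, idem w) 1
  | top_mul (g : Gen) : Rel N b (idem g.top * gen g) (gen g)
  | mul_bot (g : Gen) : Rel N b (gen g * idem g.bot) (gen g)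
  -- Planar isotopy.
  | box_box (l l' : Loc) (u m v : Word) :
      Rel N b (box l u (m ++ l'.tgt ++ v) * box l' (u ++ l.src ++ m) v)
        (box l' (u ++ l.tgt ++ m) v * box l u (m ++ l'.src ++ v))
  | nail_box (l : Loc) (m v : Word) :
      Rel N b (nail (m ++ l.tgt ++ v) * box l (.black :: m) v)
        (box l (.black :: m) v * nail (m ++ l.src ++ v))
  -- NilHecke relations.
  | bb_bb (u v : Word) : Rel N b (bb u v * bb u v) 0
  | bb_braid (u v : Word) :
      Rel N b (bb u (.black :: v) * bb (u ++ [.black]) v * bb u (.black :: v))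
        (bb (u ++ [.black]) v * bb u (.black :: v) * bb (u ++ [.black]) v)
  | bb_dot (u v : Word) :
      Rel N b (bb u v * dot u (.black :: v))
        (dot (u ++ [.black]) v * bb u v + idem (u ++ [.black, .black] ++ v))
  | dot_bb (u v : Word) :
      Rel N b (dot u (.black :: v) * bb u v)
        (bb u v * dot (u ++ [.black]) v + idem (u ++ [.black, .black] ++ v))
  -- Black/red relations.
  | dot_rb (n : ℕ) (u v : Word) :
      Rel N b (dot u (.red n :: v) * rb n u v) (rb n u v * dot (u ++ [.red n]) v)
  | br_dot (n : ℕ) (u v : Word) :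
      Rel N b (br n u v * dot u (.red n :: v)) (dot (u ++ [.red n]) v * br n u v)
  | br_rb (n : ℕ) (u v : Word) :
      Rel N b (br n u v * rb n u v)
        (dot (u ++ [.red n]) v ^ n * idem (u ++ [.red n, .black] ++ v))
  | rb_br (n : ℕ) (u v : Word) :
      Rel N b (rb n u v * br n u v)
        (dot u (.red n :: v) ^ n * idem (u ++ [.black, .red n] ++ v))
  | bb_rb_rb (n : ℕ) (u v : Word) :
      Rel N b (bb u (.red n :: v) * rb n (u ++ [.black]) v * rb n u (.black :: v))
        (rb n (u ++ [.black]) v * rb n u (.black :: v) * bb (u ++ [.red n]) v)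
  | br_br_bb (n : ℕ) (u v : Word) :
      Rel N b (br n u (.black :: v) * br n (u ++ [.black]) v * bb u (.red n :: v))
        (bb (u ++ [.red n]) v * br n u (.black :: v) * br n (u ++ [.black]) v)
  | rb_bb_br (n : ℕ) (u v : Word) :
      Rel N b (rb n u (.black :: v) * bb (u ++ [.red n]) v * br n u (.black :: v))
        (br n (u ++ [.black]) v * bb u (.red n :: v) * rb n (u ++ [.black]) v +
          ∑ i ∈ Finset.range n, dot u (.red n :: .black :: v) ^ i *
            dot (u ++ [.black, .red n]) v ^ (n - 1 - i) *
            idem (u ++ [.black, .red n, .black] ++ v))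
  -- Nail relations.
  | nail_dot (v : Word) : Rel N b (nail v * dot [] v) (dot [] v * nail v)
  | nail_bb (v : Word) :
      Rel N b (bb [] v * nail (.black :: v) * bb [] v * nail (.black :: v))
        (-(nail (.black :: v) * bb [] v * nail (.black :: v) * bb [] v))
  | nail_nail (v : Word) : Rel N b (nail v * nail v) 0

end Relations

/-- The underlying algebra of the dg-enhanced KLRW algebra. -/
abbrev Alg (k : Type u) [CommRing k] (N : List ℕ) (b : ℕ) : Type u :=
  RingQuot (Rel (k := k) N b)

section Grading

variable (k : Type u) [CommRing k] (N : List ℕ) (b : ℕ)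

/-- The quotient map from the free algebra. -/
def proj : FreeAlgebra k Gen →ₐ[k] Alg k N b := RingQuot.mkAlgHom k (Rel N b)

variable {k}

lemma proj_rel {x y : FreeAlgebra k Gen} (h : Rel N b x y) : proj k N b x = proj k N b y :=
  RingQuot.mkAlgHom_rel k h

lemma proj_surjective : Function.Surjective (proj k N b) := RingQuot.mkAlgHom_surjective k _

/-- The map sending a diagram `g` to `single (deg g) g`. -/
noncomputable def coactFree : FreeAlgebra k Gen →ₐ[k] AddMonoidAlgebra (Alg k N b) Deg :=
  FreeAlgebra.lift k fun g => AddMonoidAlgebra.single g.deg (proj k N b (gen g))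

/-- The elements that are homogeneous of degree `i`. -/
def IsH (i : Deg) (x : FreeAlgebra k Gen) : Prop :=
  coactFree N b x = AddMonoidAlgebra.single i (proj k N b x)

variable {N b}

lemma IsH.cast {i j : Deg} {x : FreeAlgebra k Gen} (h : IsH N b i x) (hij : i = j) :
    IsH N b j x := hij ▸ h

lemma IsH.gen (g : Gen) : IsH (k := k) N b g.deg (gen g) := by
  simp [IsH, coactFree]

lemma IsH.mul {i j : Deg} {x y : FreeAlgebra k Gen} (hx : IsH N b i x) (hy : IsH N b j y) :
    IsH N b (i + j) (x * y) := by
  unfold IsH at *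
  rw [map_mul, hx, hy, AddMonoidAlgebra.single_mul_single, map_mul]

lemma IsH.add {i : Deg} {x y : FreeAlgebra k Gen} (hx : IsH N b i x) (hy : IsH N b i y) :
    IsH N b i (x + y) := by
  unfold IsH at *
  rw [map_add, hx, hy, ← AddMonoidAlgebra.single_add, map_add]

lemma IsH.zero {i : Deg} : IsH (k := k) N b i 0 := by simp [IsH]

lemma IsH.one : IsH (k := k) N b 0 1 := by simp [IsH, AddMonoidAlgebra.one_def]

lemma IsH.neg {i : Deg} {x : FreeAlgebra k Gen} (hx : IsH N b i x) : IsH N b i (-x) := by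
  unfold IsH at *
  rw [map_neg, hx, map_neg, AddMonoidAlgebra.single_neg]

lemma IsH.pow {i : Deg} {x : FreeAlgebra k Gen} (hx : IsH N b i x) (n : ℕ) :
    IsH N b (n • i) (x ^ n) := by
  induction n with
  | zero => simpa using IsH.one
  | succ n ih => rw [pow_succ, succ_nsmul]; exact ih.mul hx

lemma IsH.sum {ι : Type} {s : Finset ι} {i : Deg} {x : ι → FreeAlgebra k Gen}
    (h : ∀ a ∈ s, IsH N b i (x a)) : IsH N b i (∑ a ∈ s, x a) := by
  classical
  induction s using Finset.induction_on with
  | empty => exact IsH.zero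
  | insert a s ha ih =>
    rw [Finset.sum_insert ha]
    exact (h a (by simp)).add (ih fun c hc => h c (by simp [hc]))

lemma Rel.isH {x y : FreeAlgebra k Gen} (h : Rel N b x y) : ∃ i, IsH N b i x ∧ IsH N b i y := by
  cases h with
  | idem_zero w h => exact ⟨_, .gen _, .zero⟩
  | idem_mul w w' h => exact ⟨_, .mul (.gen _) (.gen _), .zero⟩
  | sum_idem => exact ⟨0, .sum fun w _ => .gen _, .one⟩
  | top_mul g => exact ⟨_, (IsH.mul (.gen _) (.gen _)).cast (zero_add _), .gen _⟩
  | mul_bot g => exact ⟨_, (IsH.mul (.gen _) (.gen _)).cast (add_zero _), .gen _⟩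
  | box_box l l' u m v =>
    exact ⟨_, .mul (.gen _) (.gen _), (IsH.mul (.gen _) (.gen _)).cast (add_comm _ _)⟩
  | nail_box l m v =>
    exact ⟨_, .mul (.gen _) (.gen _), (IsH.mul (.gen _) (.gen _)).cast (add_comm _ _)⟩
  | bb_bb u v => exact ⟨_, .mul (.gen _) (.gen _), .zero⟩
  | bb_braid u v =>
    exact ⟨_, .mul (.mul (.gen _) (.gen _)) (.gen _), .mul (.mul (.gen _) (.gen _)) (.gen _)⟩
  | bb_dot u v =>
    exact ⟨_, .mul (.gen _) (.gen _), .add ((IsH.mul (.gen _) (.gen _)).cast (add_comm _ _))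
      ((IsH.gen _).cast rfl)⟩
  | dot_bb u v =>
    exact ⟨_, .mul (.gen _) (.gen _), .add ((IsH.mul (.gen _) (.gen _)).cast (add_comm _ _))
      ((IsH.gen _).cast rfl)⟩
  | dot_rb n u v =>
    exact ⟨_, .mul (.gen _) (.gen _), (IsH.mul (.gen _) (.gen _)).cast (add_comm _ _)⟩
  | br_dot n u v =>
    exact ⟨_, .mul (.gen _) (.gen _), (IsH.mul (.gen _) (.gen _)).cast (add_comm _ _)⟩
  | br_rb n u v =>
    refine ⟨_, .mul (.gen _) (.gen _), (IsH.mul (.pow (.gen _) _) (.gen _)).cast ?_⟩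
    ext <;> simp [Gen.deg, Loc.deg]; ring
  | rb_br n u v =>
    refine ⟨_, .mul (.gen _) (.gen _), (IsH.mul (.pow (.gen _) _) (.gen _)).cast ?_⟩
    ext <;> simp [Gen.deg, Loc.deg]; ring
  | bb_rb_rb n u v =>
    refine ⟨_, .mul (.mul (.gen _) (.gen _)) (.gen _),
      (IsH.mul (.mul (.gen _) (.gen _)) (.gen _)).cast ?_⟩
    ext <;> simp [Gen.deg, Loc.deg]; ring
  | br_br_bb n u v =>
    refine ⟨_, .mul (.mul (.gen _) (.gen _)) (.gen _),
      (IsH.mul (.mul (.gen _) (.gen _)) (.gen _)).cast ?_⟩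
    ext <;> simp [Gen.deg, Loc.deg]; ring
  | rb_bb_br n u v =>
    refine ⟨_, .mul (.mul (.gen _) (.gen _)) (.gen _),
      .add (.mul (.mul (.gen _) (.gen _)) (.gen _)) (.sum fun i hi =>
        (IsH.mul (.mul (.pow (.gen _) _) (.pow (.gen _) _)) (.gen _)).cast ?_)⟩
    rw [Finset.mem_range] at hi
    ext <;> simp [Gen.deg, Loc.deg]; omega
  | nail_dot v =>
    exact ⟨_, .mul (.gen _) (.gen _), (IsH.mul (.gen _) (.gen _)).cast (add_comm _ _)⟩
  | nail_bb v =>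
    exact ⟨_, .mul (.mul (.mul (.gen _) (.gen _)) (.gen _)) (.gen _),
      .neg ((IsH.mul (.mul (.mul (.gen _) (.gen _)) (.gen _)) (.gen _)).cast (by rfl))⟩
  | nail_nail v => exact ⟨_, .mul (.gen _) (.gen _), .zero⟩

variable (k N b)

/-- The map sending `x` of degree `i` to `single i x`. -/
noncomputable def coact : Alg k N b →ₐ[k] AddMonoidAlgebra (Alg k N b) Deg :=
  RingQuot.liftAlgHom k ⟨coactFree N b, fun x y h => by
    obtain ⟨i, hx, hy⟩ := h.isH
    exact hx.trans ((congrArg _ (proj_rel N b h)).trans hy.symm)⟩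

lemma coact_proj (x : FreeAlgebra k Gen) : coact k N b (proj k N b x) = coactFree N b x :=
  RingQuot.liftAlgHom_mkAlgHom_apply k _ _ x

/-- The elements of degree `i`: linear combinations of products of generating diagrams of total
degree `i`. -/
def gr (i : Deg) : Submodule k (Alg k N b) :=
  Submodule.span k {x | ∃ L : List Gen, (L.map Gen.deg).sum = i ∧
    x = (L.map fun g => proj k N b (gen g)).prod}

lemma isH_prod (L : List Gen) :
    IsH (k := k) N b (L.map Gen.deg).sum (L.map fun g => gen g).prod := by
  induction L with
  | nil => exact IsH.one
  | cons g L ih => rw [List.map_cons, List.map_cons, List.sum_cons, List.prod_cons]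
                   exact (IsH.gen g).mul ih

lemma proj_prod (L : List Gen) : proj k N b (L.map fun g => gen g).prod =
    (L.map fun g => proj k N b (gen g)).prod := by
  rw [map_list_prod, List.map_map]; rfl

lemma coact_of_mem {i : Deg} {x : Alg k N b} (hx : x ∈ gr k N b i) :
    coact k N b x = AddMonoidAlgebra.single i x := by
  induction hx using Submodule.span_induction with
  | mem x hx =>
    obtain ⟨L, rfl, rfl⟩ := hx
    rw [← proj_prod, coact_proj]
    exact isH_prod k N b L
  | zero => simp
  | add x y _ _ hx hy => rw [map_add, hx, hy, AddMonoidAlgebra.single_add]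
  | smul c x _ hx => rw [map_smul, hx, AddMonoidAlgebra.smul_single]

lemma gen_mem (g : Gen) : proj k N b (gen g) ∈ gr k N b g.deg :=
  Submodule.subset_span ⟨[g], by simp, by simp⟩

instance : SetLike.GradedMonoid (gr k N b) where
  one_mem := Submodule.subset_span ⟨[], by simp, by simp⟩
  mul_mem i j x y hx hy := by
    induction hx using Submodule.span_induction with
    | mem x hx =>
      induction hy using Submodule.span_induction with
      | mem y hy =>
        obtain ⟨L, rfl, rfl⟩ := hx
        obtain ⟨L', rfl, rfl⟩ := hy
        exact Submodule.subset_span ⟨L ++ L', by simp, by simp⟩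
      | zero => rw [mul_zero]; exact zero_mem _
      | add y z _ _ hy hz => rw [mul_add]; exact add_mem hy hz
      | smul c y _ hy => rw [mul_smul_comm]; exact Submodule.smul_mem _ c hy
    | zero => rw [zero_mul]; exact zero_mem _
    | add y z _ _ hy hz => rw [add_mul]; exact add_mem hy hz
    | smul c y _ hy => rw [smul_mul_assoc]; exact Submodule.smul_mem _ c hy

lemma gr_internal : DirectSum.IsInternal (gr k N b) := by
  refine internal_of_coaction
    { toFun := fun x => (coact k N b x).coeff
      map_add' := fun x y => by rw [map_add, AddMonoidAlgebra.coeff_add]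
      map_smul' := fun c x => by rw [map_smul, AddMonoidAlgebra.coeff_smul]; rfl } ?_ ?_
  · intro i x hx
    change (coact k N b x).coeff = _
    rw [coact_of_mem k N b hx]; rfl
  · intro x
    obtain ⟨x, rfl⟩ := proj_surjective N b x
    have h : ∀ {x y : Alg k N b}, x ∈ iSup (gr k N b) → y ∈ iSup (gr k N b) →
        x * y ∈ iSup (gr k N b) := by
      intro x y hx hy
      refine Submodule.iSup_induction _ (motive := fun x => x * y ∈ iSup (gr k N b)) hx
        (fun i x hx => ?_) (by simp) (fun x z hx hz => by rw [add_mul]; exact add_mem hx hz)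
      refine Submodule.iSup_induction _ (motive := fun y => x * y ∈ iSup (gr k N b)) hy
        (fun j y hy => ?_) (by simp) (fun y z hy hz => by rw [mul_add]; exact add_mem hy hz)
      exact Submodule.mem_iSup_of_mem (i + j) (SetLike.mul_mem_graded hx hy)
    induction x using FreeAlgebra.induction with
    | grade0 r =>
      rw [AlgHom.commutes, Algebra.algebraMap_eq_smul_one]
      exact Submodule.smul_mem _ _ (Submodule.mem_iSup_of_mem 0 SetLike.GradedOne.one_mem)
    | grade1 g => exact Submodule.mem_iSup_of_mem g.deg (gen_mem k N b g)
    | mul x y hx hy => rw [map_mul]; exact h hx hy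
    | add x y hx hy => rw [map_add]; exact add_mem hx hy

noncomputable instance : GradedAlgebra (gr k N b) where
  __ := (inferInstance : SetLike.GradedMonoid (gr k N b))
  __ := (gr_internal k N b).chooseDecomposition

end Grading

end KLRW

/-- The dg-enhanced KLRW algebra `T_b^{λ,N}` on `b` black strands and red strands labelled from
left to right by `N`, with its homological, `q`- and `λ`-gradings. -/
noncomputable def T (k : Type u) [CommRing k] (N : List ℕ) (b : ℕ) : GrAlg k where
  carrier := KLRW.Alg k N b
  gr := KLRW.gr k N b

namespace KLRW

/-- The labels of the red strands. -/
def labels (w : Word) : List ℕ := w.filterMap fun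
  | .black => none
  | .red n => some n

lemma mem_words {N : List ℕ} {b : ℕ} {w : Word} :
    w ∈ words N b ↔ w.count .black = b ∧ labels w = N := by
  induction N, b using words.induct generalizing w with
  | case1 => cases w with
    | nil => simp [words, labels]
    | cons s w => cases s <;> simp [words, labels]
  | case2 b ih => cases w with
    | nil => simp [words, labels]
    | cons s w => cases s <;> simp [words, labels, ih]
  | case3 n N ih => cases w with
    | nil => simp [words, labels]
    | cons s w => cases s <;> simp [words, labels, ih, and_left_comm, eq_comm]
  | case4 n N b ih1 ih2 => cases w with
    | nil => simp [words, labels]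
    | cons s w => cases s <;> simp [words, labels, ih1, ih2, and_left_comm, eq_comm]

lemma append_mem_words {N : List ℕ} {b : ℕ} {w : Word} :
    w ++ [.black] ∈ words N (b + 1) ↔ w ∈ words N b := by
  simp [mem_words, labels]

section Corner

variable {k : Type u} [CommRing k] {R : Type u} [Ring R] [Algebra k R] {e : R}
  (he : IsIdempotentElem e)

/-- The inclusion of a corner. -/
def cornerVal : he.Corner →ₙ+* R where
  toFun x := x.1
  map_mul' _ _ := rfl
  map_zero' := rfl
  map_add' _ _ := rfl

lemma cornerVal_injective : Function.Injective (cornerVal he) := Subtype.val_injective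

instance : SMul k he.Corner where
  smul c x := ⟨c • x.1, (Subsemigroup.mem_corner_iff he).2
    ⟨by rw [mul_smul_comm, ((Subsemigroup.mem_corner_iff he).1 x.2).1],
      by rw [smul_mul_assoc, ((Subsemigroup.mem_corner_iff he).1 x.2).2]⟩⟩

instance : Module k he.Corner :=
  Function.Injective.module k (cornerVal he).toAddMonoidHom (cornerVal_injective he)
    fun _ _ => rfl

instance : Algebra k he.Corner := Algebra.ofModule
  (fun c x y => cornerVal_injective he (smul_mul_assoc c x.1 y.1))
  (fun c x y => cornerVal_injective he (mul_smul_comm c x.1 y.1))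

end Corner

section AddStrand

variable {k : Type u} [CommRing k] {N : List ℕ} {b : ℕ}

lemma idem_mul_ne {w w' : Word} (h : w ≠ w') :
    proj k N b (idem w) * proj k N b (idem w') = 0 := by
  rw [← map_mul, proj_rel N b (.idem_mul w w' h), map_zero]

lemma top_mul (g : Gen) : proj k N b (idem g.top) * proj k N b (gen g) = proj k N b (gen g) := by
  rw [← map_mul]; exact proj_rel N b (.top_mul g)

lemma mul_bot (g : Gen) : proj k N b (gen g) * proj k N b (idem g.bot) = proj k N b (gen g) := by
  rw [← map_mul]; exact proj_rel N b (.mul_bot g)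

lemma idem_eq_zero {w : Word} (h : w ∉ words N b) : proj k N b (idem w) = 0 := by
  rw [proj_rel N b (.idem_zero w h), map_zero]

lemma gen_eq_zero_of_top {g : Gen} (h : g.top ∉ words N b) : proj k N b (gen g) = 0 := by
  rw [← top_mul, idem_eq_zero h, zero_mul]

lemma gen_eq_zero_of_bot {g : Gen} (h : g.bot ∉ words N b) : proj k N b (gen g) = 0 := by
  rw [← mul_bot, idem_eq_zero h, mul_zero]

lemma top_app (g : Gen) : g.app.top = g.top ++ [.black] := by
  cases g <;> simp [Gen.app, Gen.top]

lemma bot_app (g : Gen) : g.app.bot = g.bot ++ [.black] := by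
  cases g <;> simp [Gen.app, Gen.bot]

lemma deg_app (g : Gen) : g.app.deg = g.deg := by cases g <;> rfl

variable (k N b)

/-- The idempotent `1_{b,1}`: the sum of all vertical diagrams on `b + 1` black strands whose
rightmost strand is black. -/
noncomputable def lastIdem : Alg k N (b + 1) :=
  ∑ w ∈ words N b, proj k N (b + 1) (idem (w ++ [.black]))

variable {k N b}

lemma lastIdem_mul (g : Gen) {w : Word} (h : g.top = w ++ [.black]) :
    lastIdem k N b * proj k N (b + 1) (gen g) = proj k N (b + 1) (gen g) := by
  by_cases hw : w ∈ words N b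
  · rw [lastIdem, Finset.sum_mul, Finset.sum_eq_single_of_mem w hw]
    · rw [← h, top_mul]
    · intro w' _ hne
      rw [← top_mul g, h, ← mul_assoc, idem_mul_ne (by simpa using hne), zero_mul]
  · rw [gen_eq_zero_of_top (by rwa [h, append_mem_words]), mul_zero]

lemma mul_lastIdem (g : Gen) {w : Word} (h : g.bot = w ++ [.black]) :
    proj k N (b + 1) (gen g) * lastIdem k N b = proj k N (b + 1) (gen g) := by
  by_cases hw : w ∈ words N b
  · rw [lastIdem, Finset.mul_sum, Finset.sum_eq_single_of_mem w hw]
    · rw [← h, mul_bot]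
    · intro w' _ hne
      rw [← mul_bot g, h, mul_assoc, idem_mul_ne (by simpa using hne.symm), mul_zero]
  · rw [gen_eq_zero_of_bot (by rwa [h, append_mem_words]), zero_mul]

variable (k N b)

lemma lastIdem_idem : IsIdempotentElem (lastIdem k N b) := by
  change lastIdem k N b * lastIdem k N b = lastIdem k N b
  conv_lhs => rw [lastIdem, Finset.sum_mul]
  exact Finset.sum_congr rfl fun w _ => mul_lastIdem (.idem (w ++ [.black])) rfl

/-- A diagram with a vertical black strand added at the right, in the corner of the idempotent
`1_{b,1}`. -/
noncomputable def appCorner (g : Gen) : (lastIdem_idem k N b).Corner :=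
  ⟨proj k N (b + 1) (gen g.app), (Subsemigroup.mem_corner_iff (lastIdem_idem k N b)).2
    ⟨lastIdem_mul g.app (top_app g), mul_lastIdem g.app (bot_app g)⟩⟩

/-- The map from the free algebra adding a vertical black strand at the right. -/
noncomputable def addFree : FreeAlgebra k Gen →ₐ[k] (lastIdem_idem k N b).Corner :=
  FreeAlgebra.lift k (appCorner k N b)

variable {k N b}

lemma addFree_gen (g : Gen) : addFree k N b (gen g) = appCorner k N b g := by
  simp [addFree]

lemma val_app (g : Gen) :
    cornerVal (lastIdem_idem k N b) (appCorner k N b g) = proj k N (b + 1) (gen g.app) := rfl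

lemma val_mul (x y : (lastIdem_idem k N b).Corner) : cornerVal (lastIdem_idem k N b) (x * y) =
    cornerVal (lastIdem_idem k N b) x * cornerVal (lastIdem_idem k N b) y := rfl

lemma val_one : cornerVal (lastIdem_idem k N b) 1 = lastIdem k N b := rfl

lemma val_pow_mul (x y : (lastIdem_idem k N b).Corner) (n : ℕ) :
    cornerVal (lastIdem_idem k N b) (x ^ n * y) =
      cornerVal (lastIdem_idem k N b) x ^ n * cornerVal (lastIdem_idem k N b) y := by
  induction n with
  | zero => simp
  | succ n ih => rw [pow_succ', mul_assoc, val_mul, ih, pow_succ', mul_assoc]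

lemma addFree_rel {x y : FreeAlgebra k Gen} (h : Rel N b x y) :
    addFree k N b x = addFree k N b y := by
  have R : ∀ {x y : FreeAlgebra k Gen}, Rel N (b + 1) x y →
    proj k N (b + 1) x = proj k N (b + 1) y := fun h => proj_rel N (b + 1) h
  refine cornerVal_injective _ ?_
  cases h with
  | idem_zero w h =>
    rw [addFree_gen, map_zero, map_zero]
    exact idem_eq_zero (by rwa [append_mem_words])
  | idem_mul w w' h =>
    rw [map_mul, addFree_gen, addFree_gen, map_zero, map_zero, val_mul]
    exact idem_mul_ne (by simpa using h)
  | sum_idem =>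
    rw [map_sum, map_one, map_sum, val_one]
    exact Finset.sum_congr rfl fun w _ => by rw [addFree_gen]; rfl
  | top_mul g =>
    rw [map_mul, addFree_gen, addFree_gen, val_mul, val_app]
    have := top_mul (k := k) (N := N) (b := b + 1) g.app
    rwa [top_app] at this
  | mul_bot g =>
    rw [map_mul, addFree_gen, addFree_gen, val_mul, val_app]
    have := mul_bot (k := k) (N := N) (b := b + 1) g.app
    rwa [bot_app] at this
  | box_box l l' u m v =>
    have := R (.box_box l l' u m (v ++ [.black]))
    simpa [addFree_gen, val_app, Gen.app] using this
  | nail_box l m v =>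
    have := R (.nail_box l m (v ++ [.black]))
    simpa [addFree_gen, val_app, Gen.app] using this
  | bb_bb u v =>
    have := R (.bb_bb u (v ++ [.black]))
    simpa [addFree_gen, val_app, Gen.app] using this
  | bb_braid u v =>
    have := R (.bb_braid u (v ++ [.black]))
    simpa [addFree_gen, val_app, Gen.app] using this
  | bb_dot u v =>
    have := R (.bb_dot u (v ++ [.black]))
    simpa [addFree_gen, val_app, Gen.app] using this
  | dot_bb u v =>
    have := R (.dot_bb u (v ++ [.black]))
    simpa [addFree_gen, val_app, Gen.app] using this
  | dot_rb n u v =>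
    have := R (.dot_rb n u (v ++ [.black]))
    simpa [addFree_gen, val_app, Gen.app] using this
  | br_dot n u v =>
    have := R (.br_dot n u (v ++ [.black]))
    simpa [addFree_gen, val_app, Gen.app] using this
  | br_rb n u v =>
    have := R (.br_rb n u (v ++ [.black]))
    rw [map_mul (addFree k N b) (_ ^ n), map_pow, val_pow_mul]
    simpa [addFree_gen, val_app, Gen.app] using this
  | rb_br n u v =>
    have := R (.rb_br n u (v ++ [.black]))
    rw [map_mul (addFree k N b) (_ ^ n), map_pow, val_pow_mul]
    simpa [addFree_gen, val_app, Gen.app] using this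
  | bb_rb_rb n u v =>
    have := R (.bb_rb_rb n u (v ++ [.black]))
    simpa [addFree_gen, val_app, Gen.app] using this
  | br_br_bb n u v =>
    have := R (.br_br_bb n u (v ++ [.black]))
    simpa [addFree_gen, val_app, Gen.app] using this
  | rb_bb_br n u v =>
    have := R (.rb_bb_br n u (v ++ [.black]))
    simp only [mul_assoc] at this ⊢
    simp only [map_add, map_sum, map_mul (addFree k N b), map_pow, val_pow_mul]
    simpa [addFree_gen, val_app, Gen.app] using this
  | nail_dot v =>
    have := R (.nail_dot (v ++ [.black]))
    simpa [addFree_gen, val_app, Gen.app] using this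
  | nail_bb v =>
    have := R (.nail_bb (v ++ [.black]))
    simpa [addFree_gen, val_app, Gen.app] using this
  | nail_nail v =>
    have := R (.nail_nail (v ++ [.black]))
    simpa [addFree_gen, val_app, Gen.app] using this

variable (k N b)

/-- Adding a vertical black strand at the right, as a unital map to a corner. -/
noncomputable def addCorner : Alg k N b →ₐ[k] (lastIdem_idem k N b).Corner :=
  RingQuot.liftAlgHom k ⟨addFree k N b, fun _ _ h => addFree_rel h⟩

/-- Adding a vertical black strand at the right of a diagram. -/
noncomputable def addStrand : Alg k N b →ₙₐ[k] Alg k N (b + 1) where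
  toFun x := (addCorner k N b x).1
  map_smul' c x := by rw [map_smul]; rfl
  map_zero' := by rw [map_zero]; rfl
  map_add' x y := by rw [map_add]; rfl
  map_mul' x y := by rw [map_mul]; rfl

lemma addStrand_gen (g : Gen) :
    addStrand k N b (proj k N b (gen g)) = proj k N (b + 1) (gen g.app) := by
  have : addCorner k N b (proj k N b (gen g)) = addFree k N b (gen g) :=
    RingQuot.liftAlgHom_mkAlgHom_apply k _ _ _
  change (addCorner k N b (proj k N b (gen g))).1 = _
  rw [this, addFree_gen]; rfl

lemma addStrand_one : addStrand k N b 1 = lastIdem k N b := by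
  change (addCorner k N b 1).1 = _
  rw [map_one]; exact val_one

lemma addStrand_mem {i : Deg} {x : Alg k N b} (hx : x ∈ gr k N b i) :
    addStrand k N b x ∈ gr k N (b + 1) i := by
  induction hx using Submodule.span_induction with
  | mem x hx =>
    obtain ⟨L, rfl, rfl⟩ := hx
    induction L with
    | nil =>
      rw [List.map_nil, List.map_nil, List.prod_nil, List.sum_nil, addStrand_one]
      exact sum_mem fun w _ => gen_mem k N (b + 1) (.idem (w ++ [Strand.black]))
    | cons g L ih =>
      rw [List.map_cons, List.map_cons, List.prod_cons, List.sum_cons, map_mul, addStrand_gen]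
      have := gen_mem k N (b + 1) g.app
      rw [deg_app] at this
      exact SetLike.mul_mem_graded this ih
  | zero => rw [map_zero]; exact zero_mem _
  | add x y _ _ hx hy => rw [map_add]; exact add_mem hx hy
  | smul c x _ hx => rw [map_smul]; exact Submodule.smul_mem _ c hx

/-- The crossing of the last two black strands: the sum of all diagrams on `b + 2` black strands
having only a black/black crossing, at the very right. -/
noncomputable def lastCrossing : Alg k N (b + 2) :=
  ∑ w ∈ words N b, proj k N (b + 2) (bb w [])

lemma lastCrossing_mem : lastCrossing k N b ∈ gr k N (b + 2) (0, -2, 0) :=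
  sum_mem fun w _ => gen_mem k N (b + 2) (.box w .bb [])

variable {k N b}

lemma lastCrossing_mul {g : Gen} {w : Word} (h : g.top = w ++ [.black] ++ [.black]) :
    lastCrossing k N b * proj k N (b + 2) (gen g) =
      proj k N (b + 2) (bb w []) * proj k N (b + 2) (gen g) := by
  have hb : ∀ w, (Gen.box w .bb []).bot = w ++ [.black] ++ [.black] := fun w => by
    simp [Gen.bot, Loc.src]
  by_cases hw : w ∈ words N b
  · rw [lastCrossing, Finset.sum_mul, Finset.sum_eq_single_of_mem w hw]
    intro w' _ hne
    rw [← top_mul g, h, ← mul_bot (.box w' .bb []), hb, mul_assoc,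
      ← mul_assoc (proj k N (b + 2) (idem _)), idem_mul_ne (by simpa using hne),
      zero_mul, mul_zero]
  · have : g.top ∉ words N (b + 2) := by
      rwa [h, append_mem_words, append_mem_words]
    rw [gen_eq_zero_of_top this, mul_zero, mul_zero]

lemma mul_lastCrossing {g : Gen} {w : Word} (h : g.bot = w ++ [.black] ++ [.black]) :
    proj k N (b + 2) (gen g) * lastCrossing k N b =
      proj k N (b + 2) (gen g) * proj k N (b + 2) (bb w []) := by
  have hb : ∀ w, (Gen.box w .bb []).top = w ++ [.black] ++ [.black] := fun w => by
    simp [Gen.top, Loc.tgt]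
  by_cases hw : w ∈ words N b
  · rw [lastCrossing, Finset.mul_sum, Finset.sum_eq_single_of_mem w hw]
    intro w' _ hne
    rw [← mul_bot g, h, ← top_mul (.box w' .bb []), hb, mul_assoc,
      ← mul_assoc (proj k N (b + 2) (idem _)), idem_mul_ne (by simpa using hne.symm),
      zero_mul, mul_zero]
  · have : g.bot ∉ words N (b + 2) := by
      rwa [h, append_mem_words, append_mem_words]
    rw [gen_eq_zero_of_bot this, zero_mul, zero_mul]

lemma lastCrossing_comm (x : Alg k N b) :
    addStrand k N (b + 1) (addStrand k N b x) * lastCrossing k N b =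
      lastCrossing k N b * addStrand k N (b + 1) (addStrand k N b x) := by
  have h1 : ∀ g : Gen, g.app.app.top = g.top ++ [.black] ++ [.black] := fun g => by
    rw [top_app, top_app]
  have h2 : ∀ g : Gen, g.app.app.bot = g.bot ++ [.black] ++ [.black] := fun g => by
    rw [bot_app, bot_app]
  have hg : ∀ g : Gen, addStrand k N (b + 1) (addStrand k N b (proj k N b (gen g))) *
      lastCrossing k N b =
      lastCrossing k N b * addStrand k N (b + 1) (addStrand k N b (proj k N b (gen g))) := by
    intro g
    rw [addStrand_gen, addStrand_gen, mul_lastCrossing (h2 g), lastCrossing_mul (h1 g)]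
    cases g with
    | idem w =>
      have e1 := top_mul (k := k) (N := N) (b := b + 2) (.box w .bb [])
      have e2 := mul_bot (k := k) (N := N) (b := b + 2) (.box w .bb [])
      simp only [Gen.top, Gen.bot, Gen.app, Loc.src, Loc.tgt, List.append_nil,
        List.append_assoc, List.cons_append, List.nil_append] at e1 e2 ⊢
      rw [e1, e2]
    | box u l v =>
      have := proj_rel (k := k) N (b + 2) (.box_box l .bb u v [])
      simpa [Gen.app, Gen.top, Gen.bot, Loc.src, Loc.tgt] using this
    | nail v =>
      have := proj_rel (k := k) N (b + 2) (.nail_box .bb v [])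
      simpa [Gen.app, Gen.top, Gen.bot, Loc.src, Loc.tgt] using this
  have h1' : addStrand k N (b + 1) (addStrand k N b 1) * lastCrossing k N b =
      lastCrossing k N b * addStrand k N (b + 1) (addStrand k N b 1) := by
    rw [addStrand_one, lastIdem, map_sum, Finset.sum_mul, Finset.mul_sum]
    refine Finset.sum_congr rfl fun w _ => ?_
    have := hg (.idem w)
    rwa [addStrand_gen] at this
  obtain ⟨x, rfl⟩ := proj_surjective N b x
  induction x using FreeAlgebra.induction with
  | grade0 r =>
    rw [AlgHom.commutes, Algebra.algebraMap_eq_smul_one, map_smul, map_smul, smul_mul_assoc, h1',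
      mul_smul_comm]
  | grade1 g => exact hg g
  | mul x y hx hy =>
    rw [map_mul, map_mul, map_mul, mul_assoc, hy, ← mul_assoc, hx, mul_assoc]
  | add x y hx hy => rw [map_add, map_add, map_add, add_mul, hx, hy, mul_add]

end AddStrand

end KLRW

/-- The non-unital map `T_b^{λ,N} → T_{b+1}^{λ,N}` adding a vertical black strand at the right. -/
noncomputable def addBlack (k : Type u) [CommRing k] (N : List ℕ) (b : ℕ) :
    GrHom (T k N b) (T k N (b + 1)) where
  toHom := KLRW.addStrand k N b
  mem hx := KLRW.addStrand_mem k N b hx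

/-! ## The commutator map -/

namespace DGMod

variable {B C D : GrAlg k} (φ : GrHom C B) (ψ : GrHom B D) (s : ℤ × ℤ) (τ : D)

/-- The bilinear map `(x, m) ↦ ψ(x) τ ⊗ m`. -/
def exchangeBilin (M : DGMod B) :
    B →ₗ[k] ((M.res φ).shift (0, s)) →ₗ[k] (M.ind ψ) where
  toFun x := tmul ψ M (ψ x * τ) ∘ₗ Submodule.subtype _
  map_add' x y := by ext m; simp [add_mul]
  map_smul' c x := by ext m; simp

lemma exchangeBilin_balanced (hc : ∀ c : C, ψ (φ c) * τ = τ * ψ (φ c)) (M : DGMod B) (x : B) (c : C) (m : (M.res φ).shift (0, s)) :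
    exchangeBilin φ ψ s τ M (x * φ c) m =
      exchangeBilin φ ψ s τ M x (((M.res φ).shift (0, s)).act c m) := by
  change tmul ψ M (ψ (x * φ c) * τ) m.1 = tmul ψ M (ψ x * τ) (M.act (φ (C.tw 0 c)) m.1)
  rw [C.tw_zero, tmul_act, map_mul ψ.toHom, mul_assoc, hc, mul_assoc]

/-- The map `B ⊗_C φ(1) M → ψ(1) (D ⊗_B M)`, `x ⊗ m ↦ ψ(x) τ ⊗ m`. -/
noncomputable def exchangeLin (hc : ∀ c : C, ψ (φ c) * τ = τ * ψ (φ c)) (M : DGMod B) :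
    (((M.res φ).shift (0, s)).ind φ) →ₗ[k] ((M.ind ψ).res ψ) :=
  (tlift φ (exchangeBilin φ ψ s τ M) (exchangeBilin_balanced φ ψ s τ hc M)).codRestrict _
    (fun z => by
      change (M.ind ψ).act (ψ 1) _ = _
      refine ind_induction φ (p := fun z => (M.ind ψ).act (ψ 1)
        (tlift φ (exchangeBilin φ ψ s τ M) (exchangeBilin_balanced φ ψ s τ hc M) z) =
        tlift φ (exchangeBilin φ ψ s τ M) (exchangeBilin_balanced φ ψ s τ hc M) z) (by simp)
        (fun x y hx hy => by simp only [map_add, hx, hy]) (fun x m => ?_) z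
      rw [tlift_tmul]
      change (M.ind ψ).act (ψ 1) (tmul ψ M (ψ x * τ) m.1) = tmul ψ M (ψ x * τ) m.1
      rw [ind_act, ← mul_assoc, ψ.one_mul_apply])

lemma exchangeLin_tmul (hc : ∀ c : C, ψ (φ c) * τ = τ * ψ (φ c)) (M : DGMod B) (x : B)
    (m : (M.res φ).shift (0, s)) :
    (exchangeLin φ ψ s τ hc M (tmul φ _ x m)).1 = tmul ψ M (ψ x * τ) m.1 :=
  tlift_tmul φ _ _ x m

/-- The map `B ⊗_C φ(1) M → ψ(1) (D ⊗_B M)`, `x ⊗ m ↦ ψ(x) τ ⊗ m`, with the shifts making it of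
degree `0`. -/
noncomputable def exchange (hc : ∀ c : C, ψ (φ c) * τ = τ * ψ (φ c)) (s' t : ℤ × ℤ)
    (hs : s' + t = s) (hτ : τ ∈ D.gr (0, t)) (M : DGMod B) :
    Mor (((M.res φ).shift (0, s)).ind φ) (((M.ind ψ).res ψ).shift (0, s')) where
  toLin := exchangeLin φ ψ s τ hc M
  mem {i z} hz := by
    have := ind_mem φ (fun i => ((M.ind ψ).res ψ).gr (i - (0, s'))) 0
      (exchangeLin φ ψ s τ hc M) (fun {i j x m} hx hm => by
        change (exchangeLin φ ψ s τ hc M (tmul φ _ x m)).1 ∈ (M.ind ψ).gr _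
        rw [exchangeLin_tmul]
        have hm' : m.1 ∈ M.gr (j - (0, s)) := hm
        have := tmul_mem ψ M (SetLike.mul_mem_graded (ψ.mem hx) hτ) hm'
        have e : i + j + 0 - (0, s') = i + (0, t) + (j - (0, s)) := by
          rw [← hs]; ext <;> simp <;> ring
        rwa [e]) hz
    rwa [add_zero] at this
  act b z := by
    refine ind_induction φ (p := fun z => exchangeLin φ ψ s τ hc M
      ((((M.res φ).shift (0, s)).ind φ).act b z) =
      (((M.ind ψ).res ψ).shift (0, s')).act b (exchangeLin φ ψ s τ hc M z)) (by simp)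
      (fun x y hx hy => by simp only [map_add, hx, hy]) (fun x m => Subtype.ext ?_) z
    change _ = (M.ind ψ).act (ψ (B.tw 0 b)) (exchangeLin φ ψ s τ hc M (tmul φ _ x m)).1
    rw [ind_act, exchangeLin_tmul, exchangeLin_tmul, ind_act, B.tw_zero, map_mul ψ.toHom, mul_assoc]
  comm z := by
    refine ind_induction φ (p := fun z => exchangeLin φ ψ s τ hc M
      ((((M.res φ).shift (0, s)).ind φ).d z) =
      (((M.ind ψ).res ψ).shift (0, s')).d (exchangeLin φ ψ s τ hc M z)) (by simp)
      (fun x y hx hy => by simp only [map_add, hx, hy]) (fun x m => Subtype.ext ?_) z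
    have hτ' : D.tw 1 τ = τ := by rw [D.tw_of_mem 1 hτ]; simp [sgn_zero]
    change _ = sgn 0 • (M.ind ψ).d (exchangeLin φ ψ s τ hc M (tmul φ _ x m)).1
    rw [ind_d, exchangeLin_tmul, exchangeLin_tmul, ind_d, map_mul (D.tw 1), hτ', ψ.tw_apply, sgn_zero,
      one_smul]
    change tmul ψ M _ (sgn 0 • M.d m.1) = _
    rw [sgn_zero, one_smul]

lemma exchange_naturality (hc : ∀ c : C, ψ (φ c) * τ = τ * ψ (φ c)) (s' t : ℤ × ℤ)
    (hs : s' + t = s) (hτ : τ ∈ D.gr (0, t)) {M N : DGMod B} (n : ℤ) (f : Hom n M N)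
    (z : ((M.res φ).shift (0, s)).ind φ) :
    (exchange φ ψ s τ hc s' t hs hτ N).toLin
        ((indHom φ n (shiftHom (0, s) n (resHom φ n f))).1 z) =
      (shiftHom (0, s') n (resHom ψ n (indHom ψ n f))).1
        ((exchange φ ψ s τ hc s' t hs hτ M).toLin z) := by
  suffices h : exchangeLin φ ψ s τ hc N ∘ₗ (indHom φ n (shiftHom (0, s) n (resHom φ n f))).1 =
      (shiftHom (0, s') n (resHom ψ n (indHom ψ n f))).1 ∘ₗ exchangeLin φ ψ s τ hc M by
    have := LinearMap.congr_fun h z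
    rwa [LinearMap.comp_apply, LinearMap.comp_apply] at this
  refine ind_hom_ext φ fun x m => Subtype.ext ?_
  have hτ' : D.tw n τ = τ := by rw [D.tw_of_mem n hτ]; simp [sgn_zero]
  have hs : ∀ {V : Type u} [AddCommGroup V] (v : V), sgn (0 * n) • v = v := fun v => by
    rw [zero_mul, sgn_zero, one_smul]
  rw [LinearMap.comp_apply, LinearMap.comp_apply, indHom_tmul, exchangeLin_tmul]
  change _ = sgn (0 * n) • (indHom ψ n f).1 (exchangeLin φ ψ s τ hc M (tmul φ _ x m)).1
  rw [hs, exchangeLin_tmul, indHom_tmul, map_mul (D.tw n), hτ', ψ.tw_apply]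
  change tmul ψ N _ (sgn (0 * n) • f.1 m.1) = _
  rw [hs]

end DGMod

/-- Let `φ : C → B`, `ψ : B → D` and let `τ ∈ D`, of homological degree `0`, commute with
`ψ (φ c)` for all `c`. This is the natural map `B ⊗_C φ(1) M → ψ(1) (D ⊗_B M)`,
`x ⊗ m ↦ ψ(x) τ ⊗ m`, with the shifts making it of degree `0`. -/
noncomputable def DGNat.exchange {B C D : GrAlg k} (φ : GrHom C B) (ψ : GrHom B D)
    (hφ : ∀ M : DGMod B, M.Cofibrant → (M.res φ).Cofibrant)
    (hψ : ∀ M : DGMod D, M.Cofibrant → (M.res ψ).Cofibrant) (s s' t : ℤ × ℤ)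
    (hs : s' + t = s) (τ : D) (hτ : τ ∈ D.gr (0, t)) (hc : ∀ c : C, ψ (φ c) * τ = τ * ψ (φ c)) :
    DGNat ((DGFunctor.ind φ).comp ((DGFunctor.shift C (0, s)).comp (DGFunctor.res φ hφ)))
      (((DGFunctor.shift B (0, s')).comp (DGFunctor.res ψ hψ)).comp (DGFunctor.ind ψ)) where
  app M := DGMod.exchange φ ψ s τ hc s' t hs hτ M.obj
  naturality n f z :=
    DGMod.exchange_naturality φ ψ s τ hc s' t hs hτ n f z

section Action

variable (k : Type u) [CommRing k] (N : List ℕ)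

/-- Restriction along `T_b → T_{b+1}` preserves cofibrant dg-modules, for all `b`. -/
def ResCofibrant : Prop :=
  ∀ b : ℕ, ∀ M : DGMod (T k N (b + 1)), M.Cofibrant → (M.res (addBlack k N b)).Cofibrant

variable {k N}

/-- The dg-functor `F_b = Ind_b^{b+1}`. -/
noncomputable def F (k : Type u) [CommRing k] (N : List ℕ) (b : ℕ) :
    DGFunctor (T k N b) (T k N (b + 1)) :=
  DGFunctor.ind (addBlack k N b)

/-- The dg-functor `E_b = λ^{-1} q^{1+2b-|N|} Res_b^{b+1}`. -/
noncomputable def E (h : ResCofibrant k N) (b : ℕ) : DGFunctor (T k N (b + 1)) (T k N b) :=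
  (DGFunctor.shift (T k N b) (0, 1 + 2 * (b : ℤ) - (N.sum : ℤ), -1)).comp
    (DGFunctor.res (addBlack k N b) (h b))

/-- The dg-functor `F_{b-1} E_{b-1}`, which is zero for `b = 0`. -/
noncomputable def FE (h : ResCofibrant k N) : ∀ b : ℕ, DGFunctor (T k N b) (T k N b)
  | 0 => DGFunctor.zero _ _
  | b + 1 => (F k N b).comp (E h b)

/-- The dg-functor `E_b F_b`. -/
noncomputable def EF (h : ResCofibrant k N) (b : ℕ) : DGFunctor (T k N b) (T k N b) :=
  (E h b).comp (F k N b)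

/-- The only morphism out of the zero dg-functor. -/
noncomputable def DGNat.ofZero {A B : GrAlg k} (G : DGFunctor A B) :
    DGNat (DGFunctor.zero A B) G where
  app _ :=
    { toLin := 0
      mem := fun _ => zero_mem _
      act := fun _ _ => (map_zero _).symm
      comm := fun _ => (map_zero _).symm }
  naturality _ _ _ := (map_zero _).symm

/-- The morphism `F_{b-1} E_{b-1} → E_b F_b` given by `x ⊗ m ↦ x τ_b ⊗ m`, where `τ_b` is the
crossing of the last two black strands. -/
noncomputable def commutatorMap (h : ResCofibrant k N) : ∀ b : ℕ, DGNat (FE h b) (EF h b)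
  | 0 => DGNat.ofZero _
  | b + 1 => DGNat.exchange (addBlack k N b) (addBlack k N (b + 1)) (h b) (h (b + 1))
      (1 + 2 * (b : ℤ) - (N.sum : ℤ), -1) (1 + 2 * ((b + 1 : ℕ) : ℤ) - (N.sum : ℤ), -1) (-2, 0)
      (by ext <;> simp; ring) (KLRW.lastCrossing k N b) (KLRW.lastCrossing_mem k N b)
      KLRW.lastCrossing_comm

/-- The dg-functor `⊕_{[β+n]_q} id`, that is, the direct sum over `p ≥ 0` of
`λ q^{1+2p+n} id [1]` and `λ^{-1} q^{1+2p-n} id`. -/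
noncomputable def quantumSum (A : GrAlg k) (n : ℤ) : DGFunctor A A :=
  DGFunctor.coprod (ι := ℕ ⊕ ℕ) fun
    | .inl p => DGFunctor.shift A (1, 1 + 2 * (p : ℤ) + n, 1)
    | .inr p => DGFunctor.shift A (0, 1 + 2 * (p : ℤ) - n, -1)

end Action

end DGKLRW

/-!
Write `ψ : T_b → T_{b+1}` for the map adding a vertical black strand at the right. Everything
follows from two descriptions: one of `ψ(1) T_{b+1}` as a left `T_b`-module, and one of the corner
`ψ(1) T_{b+1} ψ(1)` as a bimodule over `T_b`.

**The representation.** Mark one black strand of a word with `b + 1` black strands, and forget it to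
get a word with `b` of them. The diagrams which do not involve the marked strand act through `T_b`.
A dot on the marked strand acts by a variable `x`, its crossing with another black strand carrying a
dot `d` acts by a divided difference with the denominator `x - d`, and the nail acts on it by a
square-zero element `ω`. The coefficients are matrices of size two over the series in `x⁻¹` over
`T_b`, so that `x - d` is invertible; the second entry of the diagonal is twisted by a sign, so that
`ω` anticommutes with the other nails. The relations of `T_{b+1}` hold (`MarkData.rep_rel`), which
gives the representation `MarkData.rep`.

**The basis.** In a *direct* diagram the marked strand carries dots and moves to the right end; in a
*loop* it moves to the left end, through the nail, and then to the right end. Sliding the other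
pieces of a diagram off the marked strand shows that these diagrams span `ψ(1) T_{b+1}` over `T_b`
(`mul_gen_mem`). In the representation, the loops are triangular with respect to the lower left
matrix entry, which vanishes on the direct diagrams; these are triangular with respect to the upper
left entry. Hence both kinds together are linearly independent (`combine_injective`), and `ψ(1)
T_{b+1}` is a direct sum of modules `T_b e` with `e` idempotent (`idemBasis`). The coinduction right
adjoint to the restriction therefore preserves surjective quasi-isomorphisms, and the restriction
preserves cofibrant modules (`DGMod.Cofibrant.res`).

**The corner.** Let `τ_b` be the crossing of the last two black strands. The basis elements in which
the last strand at the bottom is black and not the marked one are the products `τ_b ψ(z)`, where `z`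
is a basis element for one black strand less (`basisElt_snoc`). They span `J = ψ(T_b) τ_b ψ(T_b)`
over `T_b`, and their independence implies that `x ⊗ m ↦ ψ(x) τ_b ⊗ m` is injective
(`exchangeLin_injective`). Besides `J`, the corner is spanned by the dotted last strands and by the
loops of the last strand (`corner_mem`). To describe the quotient by `J` as a bimodule, contract the
marked strand between the right end at the bottom and the right end at the top. The contraction of
`τ_b` is `-(x - d)⁻¹`, without any polynomial part in `x`, so that the polynomial part of the upper
left entry, and all of the lower left one, vanish on `J`. The strand with `l` dots contracts to `xˡ`
in the upper left entry, and the loop with `l` dots contracts to `±x^(|N| - 2b + l)` plus lower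
terms in the lower left one. These coordinates are triangular (`Splitting.ofTriangular`,
`bubbleSplitting`) and identify the quotient with one shifted copy of `T_b` for each strand with `l`
dots and each loop with `l` dots.

Thus the exchange map is injective with the quantum sum as its cokernel, and the cone of an
injective map is quasi-isomorphic to the cokernel (`exists_isQuasiIso_cone_exchange`; for `b = 0`,
where `J = 0`, `exists_isQuasiIso_cone_zero`).
-/

namespace DGKLRW

namespace KLRW

set_option linter.unusedSimpArgs false

open Strand

/-! ### Words with a marked strand -/

section Marked

@[simp] lemma src_dot : Loc.dot.src = [black] := rfl
@[simp] lemma src_bb : Loc.bb.src = [black, black] := rfl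
@[simp] lemma src_br (n : ℕ) : (Loc.br n).src = [black, red n] := rfl
@[simp] lemma src_rb (n : ℕ) : (Loc.rb n).src = [red n, black] := rfl
@[simp] lemma tgt_dot : Loc.dot.tgt = [black] := rfl
@[simp] lemma tgt_bb : Loc.bb.tgt = [black, black] := rfl
@[simp] lemma tgt_br (n : ℕ) : (Loc.br n).tgt = [red n, black] := rfl
@[simp] lemma tgt_rb (n : ℕ) : (Loc.rb n).tgt = [black, red n] := rfl

/-- The coefficients through which `T_{b+1}` acts on words with one marked black strand: a ring `R`
to which `T_b` maps by `ρ`, the element `X` by which a dot on the marked strand acts, the element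
`ω` by which the nail acts on the marked strand, and the inverses `G u v` of `X - ρ d`, where `d` is
the dot on the black strand between `u` and `v`. The square-zero element `ω` anticommutes with the
nails, which reflects the last nail relation. -/
structure MarkData (k : Type u) [CommRing k] (N : List ℕ) (b : ℕ) (R : Type u) [Ring R]
    [Algebra k R] where
  ρ : Alg k N b →ₐ[k] R
  X : R
  ω : R
  G : Word → Word → R
  X_ρ : ∀ a, X * ρ a = ρ a * X
  X_ω : X * ω = ω * X
  ω_ω : ω * ω = 0
  ω_idem : ∀ w, ω * ρ (proj k N b (idem w)) = ρ (proj k N b (idem w)) * ω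
  ω_box : ∀ u l v, ω * ρ (proj k N b (box l u v)) = ρ (proj k N b (box l u v)) * ω
  ω_nail : ∀ v, ω * ρ (proj k N b (nail v)) = -(ρ (proj k N b (nail v)) * ω)
  G_mul : ∀ u v, G u v * (X - ρ (proj k N b (dot u v))) = 1
  mul_G : ∀ u v, (X - ρ (proj k N b (dot u v))) * G u v = 1

variable {k : Type u} [CommRing k] {N : List ℕ} {b : ℕ} {R : Type u} [Ring R] [Algebra k R]

/-- The right `R`-module with basis the pairs `(u, v)`, which stand for the words `u ++ black :: v`
whose black strand between `u` and `v` is marked. -/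
abbrev MarkMod (R : Type u) [Ring R] : Type u := (Word × Word) →₀ R

namespace MarkData

variable (D : MarkData k N b R)

/-- The image in `R` of a generating diagram of `T_b`. -/
def r (g : Gen) : R := D.ρ (proj k N b (gen g))

/-- The action of the local piece `l` between `U` and `V` when its strand number `n`, counted from
`0`, is the marked one. A black/black crossing acts by a divided difference, which has the
denominator `X - ρ d`. Moving the marked strand to the right through a red strand costs nothing, and
moving it back gives the dots required by the bigon relation. -/
noncomputable def mid (U : Word) (l : Loc) (V : Word) (n : ℕ) : MarkMod R :=
  match l, n with
  | .dot, _ => Finsupp.single (U, V) (D.X * D.r (.idem (U ++ V)))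
  | .bb, 0 => Finsupp.single (U, black :: V) (D.G U V * D.r (.idem (U ++ black :: V))) +
      Finsupp.single (U ++ [black], V) (D.r (.idem (U ++ black :: V)))
  | .bb, _ => Finsupp.single (U, black :: V)
      (-(D.G U V * D.G U V * D.r (.idem (U ++ black :: V)))) +
      Finsupp.single (U ++ [black], V) (-(D.G U V * D.r (.idem (U ++ black :: V))))
  | .br n, _ => Finsupp.single (U ++ [red n], V) (D.r (.idem (U ++ red n :: V)))
  | .rb n, _ => Finsupp.single (U, red n :: V) (D.X ^ n * D.r (.idem (U ++ red n :: V)))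

/-- The action of a generating diagram on the word `u ++ black :: v` whose black strand between `u`
and `v` is marked. -/
noncomputable def act (g : Gen) (u v : Word) : MarkMod R :=
  if g.bot = u ++ black :: v then
    match g with
    | .idem _ => Finsupp.single (u, v) (D.r (.idem (u ++ v)))
    | .box U l V =>
      if u.length < U.length then
        Finsupp.single (u, U.drop (u.length + 1) ++ l.tgt ++ V)
          (D.r (.box (u ++ U.drop (u.length + 1)) l V))
      else if U.length + l.src.length ≤ u.length then
        Finsupp.single (U ++ l.tgt ++ u.drop (U.length + l.src.length), v)
          (D.r (.box U l (u.drop (U.length + l.src.length) ++ v)))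
      else D.mid U l V (u.length - U.length)
    | .nail _ =>
      match u with
      | [] => Finsupp.single ([], v) (D.ω * D.r (.idem v))
      | _ :: u' => Finsupp.single (u, v) (D.r (.nail (u' ++ v)))
  else 0

/-- Right multiplication by a scalar. -/
noncomputable def rmul (r : R) : MarkMod R →ₗ[k] MarkMod R :=
  Finsupp.mapRange.linearMap (LinearMap.mulRight k r)

lemma rmul_single (r c : R) (i : Word × Word) :
    rmul (k := k) r (Finsupp.single i c) = Finsupp.single i (c * r) := by
  simp [rmul]

/-- The operator of a generating diagram. -/
noncomputable def op (g : Gen) : MarkMod R →ₗ[k] MarkMod R :=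
  Finsupp.lsum k fun i =>
    { toFun := fun r => rmul (k := k) r (D.act g i.1 i.2)
      map_add' := fun r s => by
        ext j; simp [rmul, mul_add]
      map_smul' := fun c r => by
        ext j; simp [rmul] }

lemma op_single (g : Gen) (u v : Word) (r : R) :
    D.op g (Finsupp.single (u, v) r) = rmul (k := k) r (D.act g u v) := by
  simp only [op, Finsupp.lsum_single]
  rfl

lemma op_zero {g : Gen} {u v : Word} (h : g.bot ≠ u ++ black :: v) (r : R) :
    D.op g (Finsupp.single (u, v) r) = 0 := by
  rw [op_single]; unfold act; rw [if_neg h, map_zero]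

lemma op_idem (u v u' v' : Word) (hu : u = u') (hv : v = v') (r : R) :
    D.op (.idem (u ++ black :: v)) (Finsupp.single (u', v') r) =
      Finsupp.single (u', v') (D.r (.idem (u ++ v)) * r) := by
  subst hu hv
  rw [op_single]; unfold act; rw [if_pos (show (Gen.idem (u ++ black :: v)).bot =
    u ++ black :: v from rfl), rmul_single]

/-- A diagram at the right of the marked strand acts through `ρ`. The words are related by equations
instead of being in a normal form, so that this lemma and the similar ones below can be used as
rewriting rules up to the associativity of the concatenation. -/
lemma op_left (u u2 : Word) (l : Loc) (V u' v : Word) (hu : u' = u) (hv : v = u2 ++ (l.src ++ V))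
    (r : R) :
    D.op (.box (u ++ black :: u2) l V) (Finsupp.single (u', v) r) =
      Finsupp.single (u', u2 ++ (l.tgt ++ V)) (D.r (.box (u ++ u2) l V) * r) := by
  subst hu hv
  rw [op_single]; unfold act; rw [if_pos (show Gen.bot _ = _ by simp [Gen.bot])]
  have : (u' ++ black :: u2).drop (u'.length + 1) = u2 := by simp
  simp only [this]
  rw [if_pos (by simp), rmul_single, List.append_assoc]

/-- A diagram at the left of the marked strand acts through `ρ`. -/
lemma op_right (U : Word) (l : Loc) (v1 v u' v' : Word) (hu : u' = U ++ (l.src ++ v1)) (hv : v' = v)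
    (r : R) :
    D.op (.box U l (v1 ++ black :: v)) (Finsupp.single (u', v') r) =
      Finsupp.single (U ++ (l.tgt ++ v1), v') (D.r (.box U l (v1 ++ v)) * r) := by
  subst hu hv
  rw [op_single]; unfold act; rw [if_pos (show Gen.bot _ = _ by simp [Gen.bot])]
  have : (U ++ (l.src ++ v1)).drop (U.length + l.src.length) = v1 := by
    rw [← List.append_assoc, List.drop_left' (by simp)]
  simp only [this]
  rw [if_neg (by simp), if_pos (by simp [← add_assoc]), rmul_single, List.append_assoc]

lemma op_dot (U V u v : Word) (hu : u = U) (hv : v = V) (r : R) :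
    D.op (.box U .dot V) (Finsupp.single (u, v) r) =
      Finsupp.single (u, v) (D.X * D.r (.idem (u ++ v)) * r) := by
  subst hu hv
  rw [op_single]; unfold act; rw [if_pos (show Gen.bot _ = _ by simp [Gen.bot, Loc.src])]
  simp [mid, Loc.src, rmul_single, -Finsupp.single_mul, -Finsupp.single_neg]

lemma op_bb_left (U V u v : Word) (hu : u = U) (hv : v = black :: V) (r : R) :
    D.op (.box U .bb V) (Finsupp.single (u, v) r) =
      Finsupp.single (U, black :: V) (D.G U V * D.r (.idem (U ++ black :: V)) * r) +
      Finsupp.single (U ++ [black], V) (D.r (.idem (U ++ black :: V)) * r) := by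
  subst hu hv
  rw [op_single]; unfold act; rw [if_pos (show Gen.bot _ = _ by simp [Gen.bot, Loc.src])]
  simp [mid, Loc.src, rmul_single, -Finsupp.single_mul, -Finsupp.single_neg]

lemma op_bb_right (U V u v : Word) (hu : u = U ++ [black]) (hv : v = V) (r : R) :
    D.op (.box U .bb V) (Finsupp.single (u, v) r) =
      Finsupp.single (U, black :: V) (-(D.G U V * D.G U V * D.r (.idem (U ++ black :: V))) * r) +
      Finsupp.single (U ++ [black], V) (-(D.G U V * D.r (.idem (U ++ black :: V))) * r) := by
  subst hu hv
  rw [op_single]; unfold act; rw [if_pos (show Gen.bot _ = _ by simp [Gen.bot, Loc.src])]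
  simp [mid, Loc.src, rmul_single, -Finsupp.single_mul, -Finsupp.single_neg]

lemma op_br (n : ℕ) (U V u v : Word) (hu : u = U) (hv : v = red n :: V) (r : R) :
    D.op (.box U (.br n) V) (Finsupp.single (u, v) r) =
      Finsupp.single (U ++ [red n], V) (D.r (.idem (U ++ red n :: V)) * r) := by
  subst hu hv
  rw [op_single]; unfold act; rw [if_pos (show Gen.bot _ = _ by simp [Gen.bot, Loc.src])]
  simp [mid, Loc.src, rmul_single, -Finsupp.single_mul, -Finsupp.single_neg]

lemma op_rb (n : ℕ) (U V u v : Word) (hu : u = U ++ [red n]) (hv : v = V) (r : R) :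
    D.op (.box U (.rb n) V) (Finsupp.single (u, v) r) =
      Finsupp.single (U, red n :: V) (D.X ^ n * D.r (.idem (U ++ red n :: V)) * r) := by
  subst hu hv
  rw [op_single]; unfold act; rw [if_pos (show Gen.bot _ = _ by simp [Gen.bot, Loc.src])]
  simp [mid, Loc.src, rmul_single, -Finsupp.single_mul, -Finsupp.single_neg]

lemma op_nail_nil (V v : Word) (hv : v = V) (r : R) :
    D.op (.nail V) (Finsupp.single ([], v) r) =
      Finsupp.single ([], v) (D.ω * D.r (.idem v) * r) := by
  subst hv
  rw [op_single]; unfold act; rw [if_pos (show Gen.bot _ = _ by simp [Gen.bot]), rmul_single]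

lemma op_nail_cons (u v u' v' : Word) (hu : u' = black :: u) (hv : v' = v) (r : R) :
    D.op (.nail (u ++ black :: v)) (Finsupp.single (u', v') r) =
      Finsupp.single (u', v') (D.r (.nail (u ++ v)) * r) := by
  subst hu hv
  rw [op_single]; unfold act; rw [if_pos (show Gen.bot _ = _ by simp [Gen.bot]), rmul_single]

lemma rel {x y : FreeAlgebra k Gen} (h : Rel N b x y) :
    D.ρ (proj k N b x) = D.ρ (proj k N b y) := congrArg D.ρ (proj_rel N b h)

/-- The strand `s` of `u ++ s :: v` lies in one of the two factors of `A ++ B`. -/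
lemma append_split {A B u v : Word} {s : Strand} (h : A ++ B = u ++ s :: v) :
    (∃ a, A = u ++ s :: a ∧ v = a ++ B) ∨ (∃ c, B = c ++ s :: v ∧ u = A ++ c) := by
  induction A generalizing u with
  | nil => exact .inr ⟨u, h, rfl⟩
  | cons t A ih =>
    cases u with
    | nil =>
      simp only [List.cons_append, List.nil_append, List.cons.injEq] at h
      exact .inl ⟨A, by rw [h.1]; rfl, h.2.symm⟩
    | cons t' u =>
      simp only [List.cons_append, List.cons.injEq] at h
      rcases ih h.2 with ⟨a, h1, h2⟩ | ⟨c, h1, h2⟩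
      · exact .inl ⟨a, by rw [h1, h.1]; rfl, h2⟩
      · exact .inr ⟨c, h1, by rw [h2, h.1]; rfl⟩

lemma append_split₃ {U V u v S : Word} {s : Strand} (h : U ++ (S ++ V) = u ++ s :: v) :
    (∃ a, U = u ++ s :: a ∧ v = a ++ (S ++ V)) ∨
    (∃ s1 s2, S = s1 ++ s :: s2 ∧ u = U ++ s1 ∧ v = s2 ++ V) ∨
    (∃ c, V = c ++ s :: v ∧ u = U ++ (S ++ c)) := by
  rcases append_split h with h | ⟨c, h1, h2⟩
  · exact .inl h
  · rcases append_split h1 with ⟨a, h3, h4⟩ | ⟨d, h3, h4⟩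
    · exact .inr (.inl ⟨c, a, h3, h2, h4⟩)
    · exact .inr (.inr ⟨d, h3, by rw [h2, h4]⟩)

end MarkData

end Marked

/-! ### The operators of the generating diagrams -/

section Marked

variable {k : Type u} [CommRing k] {N : List ℕ} {b : ℕ} {R : Type u} [Ring R] [Algebra k R]

namespace MarkData

variable (D : MarkData k N b R)

lemma ρ_ι (g : Gen) : D.ρ (proj k N b (FreeAlgebra.ι k g)) = D.r g := rfl

lemma r_top (g : Gen) : D.r (.idem g.top) * D.r g = D.r g := by
  simpa only [map_mul, ρ_ι] using D.rel (.top_mul g)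

lemma r_bot (g : Gen) : D.r g * D.r (.idem g.bot) = D.r g := by
  simpa only [map_mul, ρ_ι] using D.rel (.mul_bot g)

lemma r_idem_box (w : Word) (U : Word) (l : Loc) (V : Word) (h : w = U ++ (l.tgt ++ V)) :
    D.r (.idem w) * D.r (.box U l V) = D.r (.box U l V) := by
  subst h; simpa [Gen.top] using D.r_top (.box U l V)

lemma r_box_idem (w : Word) (U : Word) (l : Loc) (V : Word) (h : w = U ++ (l.src ++ V)) :
    D.r (.box U l V) * D.r (.idem w) = D.r (.box U l V) := by
  subst h; simpa [Gen.bot] using D.r_bot (.box U l V)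

lemma r_idem_nail (w : Word) (V : Word) (h : w = black :: V) :
    D.r (.idem w) * D.r (.nail V) = D.r (.nail V) := by
  subst h; exact D.r_top (.nail V)

lemma r_nail_idem (w : Word) (V : Word) (h : w = black :: V) :
    D.r (.nail V) * D.r (.idem w) = D.r (.nail V) := by
  subst h; exact D.r_bot (.nail V)

lemma r_idem_idem (w : Word) : D.r (.idem w) * D.r (.idem w) = D.r (.idem w) :=
  D.r_top (.idem w)

lemma r_idem_zero {w : Word} (h : w ∉ words N b) : D.r (.idem w) = 0 := by
  simpa only [map_zero, ρ_ι] using D.rel (.idem_zero w h)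

lemma X_r (g : Gen) : D.X * D.r g = D.r g * D.X := D.X_ρ _

/-- An element which intertwines two dots also intertwines their resolvents. -/
lemma G_conj {a : R} {u v u' v' : Word} (hX : D.X * a = a * D.X)
    (h : a * D.r (.box u .dot v) = D.r (.box u' .dot v') * a) :
    a * D.G u v = D.G u' v' * a := by
  have h2 : (D.X - D.r (.box u' .dot v')) * a = a * (D.X - D.r (.box u .dot v)) := by
    rw [mul_sub, h, ← hX, ← sub_mul]
  calc a * D.G u v = D.G u' v' * ((D.X - D.r (.box u' .dot v')) * a) * D.G u v := by
        rw [← mul_assoc, r, D.G_mul, one_mul]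
    _ = D.G u' v' * a := by rw [h2, mul_assoc, mul_assoc, r, D.mul_G, mul_one]

lemma X_G (u v : Word) : D.X * D.G u v = D.G u v * D.X :=
  D.G_conj rfl (D.X_r _)

lemma ω_G (u v : Word) : D.ω * D.G u v = D.G u v * D.ω :=
  D.G_conj D.X_ω (D.ω_box _ _ _)

lemma ι_G (w u v : Word) (h : w = u ++ black :: v) :
    D.r (.idem w) * D.G u v = D.G u v * D.r (.idem w) :=
  D.G_conj (D.X_r _) (by rw [r_idem_box _ _ _ _ _ h, r_box_idem _ _ _ _ _ h])

lemma ω_r_idem (w : Word) : D.ω * D.r (.idem w) = D.r (.idem w) * D.ω := D.ω_idem w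

lemma ω_r_box (u : Word) (l : Loc) (v : Word) :
    D.ω * D.r (.box u l v) = D.r (.box u l v) * D.ω := D.ω_box u l v

lemma ω_r_nail (v : Word) : D.ω * D.r (.nail v) = -(D.r (.nail v) * D.ω) := D.ω_nail v

lemma ext_bot {F F' : MarkMod R →ₗ[k] MarkMod R} (W : Word)
    (h0 : ∀ u v r, W ≠ u ++ black :: v →
      F (Finsupp.single (u, v) r) = 0 ∧ F' (Finsupp.single (u, v) r) = 0)
    (h : ∀ u v r, W = u ++ black :: v →
      F (Finsupp.single (u, v) r) = F' (Finsupp.single (u, v) r)) : F = F' := by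
  refine Finsupp.lhom_ext fun i r => ?_
  by_cases hW : W = i.1 ++ black :: i.2
  · exact h _ _ _ hW
  · have := h0 i.1 i.2 r hW
    rw [this.1, this.2]

/-- The black strand between `u` and `v` lies at the left of the bottom of the local piece `l`, is
one of its strands, or lies at its right. -/
lemma split_box {U V u v : Word} {l : Loc} (h : U ++ (l.src ++ V) = u ++ black :: v) :
    (∃ a, U = u ++ black :: a ∧ v = a ++ (l.src ++ V)) ∨
    (l = .dot ∧ u = U ∧ v = V) ∨ (l = .bb ∧ u = U ∧ v = black :: V) ∨
    (l = .bb ∧ u = U ++ [black] ∧ v = V) ∨ (∃ n, l = .br n ∧ u = U ∧ v = red n :: V) ∨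
    (∃ n, l = .rb n ∧ u = U ++ [red n] ∧ v = V) ∨
    (∃ c, V = c ++ black :: v ∧ u = U ++ (l.src ++ c)) := by
  rcases append_split₃ h with h | ⟨s1, s2, hs, rfl, rfl⟩ | h
  · exact .inl h
  · right
    cases l with
    | dot => cases s1 <;> simp_all [Loc.src]
    | bb =>
      cases s1 with
      | nil => simp only [Loc.src, List.nil_append, List.cons.injEq, true_and] at hs; simp [← hs]
      | cons s s1 => cases s1 <;> simp_all [Loc.src]
    | br n =>
      cases s1 with
      | nil => simp only [Loc.src, List.nil_append, List.cons.injEq, true_and] at hs; simp [← hs]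
      | cons s s1 => cases s1 <;> simp_all [Loc.src]
    | rb n =>
      cases s1 with
      | nil => simp_all [Loc.src]
      | cons s s1 => cases s1 <;> simp_all [Loc.src]
  · simp only [h, or_true]

lemma op_right₁ (U : Word) (l : Loc) (s : Strand) (v1 v u' v' : Word)
    (hu : u' = U ++ (l.src ++ s :: v1)) (hv : v' = v) (r : R) :
    D.op (.box U l (s :: (v1 ++ black :: v))) (Finsupp.single (u', v') r) =
      Finsupp.single (U ++ (l.tgt ++ s :: v1), v') (D.r (.box U l (s :: (v1 ++ v))) * r) :=
  D.op_right U l (s :: v1) v u' v' hu hv r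

lemma op_right' (U : Word) (l : Loc) (v u' v' : Word)
    (hu : u' = U ++ l.src) (hv : v' = v) (r : R) :
    D.op (.box U l (black :: v)) (Finsupp.single (u', v') r) =
      Finsupp.single (U ++ l.tgt, v') (D.r (.box U l v) * r) := by
  simpa using D.op_right U l [] v u' v' (by simpa using hu) hv r

lemma op_left₁ (u u2 : Word) (s : Strand) (l : Loc) (V u' v : Word) (hu : u' = u ++ [s])
    (hv : v = u2 ++ (l.src ++ V)) (r : R) :
    D.op (.box (u ++ s :: black :: u2) l V) (Finsupp.single (u', v) r) =
      Finsupp.single (u', u2 ++ (l.tgt ++ V)) (D.r (.box (u ++ s :: u2) l V) * r) := by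
  simpa [-Finsupp.single_mul] using D.op_left (u ++ [s]) u2 l V u' v hu hv r

lemma op_right₃ (U : Word) (l : Loc) (s : Strand) (v1 v u' v' : Word)
    (hu : u' = U ++ (l.src ++ (v1 ++ [s]))) (hv : v' = v) (r : R) :
    D.op (.box U l (v1 ++ s :: black :: v)) (Finsupp.single (u', v') r) =
      Finsupp.single (U ++ (l.tgt ++ (v1 ++ [s])), v') (D.r (.box U l (v1 ++ s :: v)) * r) := by
  simpa [-Finsupp.single_mul] using D.op_right U l (v1 ++ [s]) v u' v' hu hv r

lemma op_mul_bot (g : Gen) : D.op g * D.op (.idem g.bot) = D.op g := by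
  refine ext_bot g.bot (fun u v r h => ?_) (fun u v r h => ?_)
  · rw [Module.End.mul_apply, op_zero D h, op_zero _ (g := .idem g.bot) h]; simp
  · rw [Module.End.mul_apply, h, op_idem _ _ _ _ _ rfl rfl]
    cases g with
    | idem w =>
      change w = _ at h
      rw [h, op_idem _ _ _ _ _ rfl rfl, op_idem _ _ _ _ _ rfl rfl, ← mul_assoc, r_idem_idem]
    | box U l V =>
      simp only [Gen.bot, List.append_assoc] at h
      rcases split_box h with ⟨a, rfl, rfl⟩ | ⟨rfl, rfl, rfl⟩ | ⟨rfl, rfl, rfl⟩ | ⟨rfl, rfl, rfl⟩ |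
        ⟨n, rfl, rfl, rfl⟩ | ⟨n, rfl, rfl, rfl⟩ | ⟨c, rfl, rfl⟩
      · rw [op_left _ _ _ _ _ _ _ rfl rfl, op_left _ _ _ _ _ _ _ rfl rfl, ← mul_assoc,
          r_box_idem _ _ _ _ _ (by simp)]
      · simp only [op_dot, ← mul_assoc]
        simp only [mul_assoc _ (D.r _) (D.r _), r_idem_idem]
      · simp only [op_bb_left, ← mul_assoc]
        simp only [mul_assoc _ (D.r _) (D.r _), r_idem_idem]
      · simp only [op_bb_right, ← mul_assoc, List.append_assoc, List.cons_append, List.nil_append,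
          neg_mul]
        simp only [mul_assoc _ (D.r _) (D.r _), r_idem_idem]
      · simp only [op_br, ← mul_assoc]
        simp only [r_idem_idem]
      · simp only [op_rb, ← mul_assoc, List.append_assoc, List.cons_append, List.nil_append]
        simp only [mul_assoc _ (D.r _) (D.r _), r_idem_idem]
      · rw [op_right _ _ _ _ _ _ _ rfl rfl, op_right _ _ _ _ _ _ _ rfl rfl, ← mul_assoc,
          r_box_idem _ _ _ _ _ (by simp)]
    | nail V =>
      cases u with
      | nil =>
        obtain rfl : V = v := by simpa [Gen.bot] using h
        rw [op_nail_nil _ _ _ rfl, op_nail_nil _ _ _ rfl]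
        simp only [List.nil_append, ← mul_assoc]
        rw [mul_assoc D.ω, r_idem_idem]
      | cons s u =>
        obtain ⟨rfl, rfl⟩ : black = s ∧ V = u ++ black :: v := by simpa [Gen.bot] using h
        rw [op_nail_cons _ _ _ _ _ rfl rfl, op_nail_cons _ _ _ _ _ rfl rfl, ← mul_assoc,
          r_nail_idem _ _ _ (by simp)]

lemma assoc₂ {a b c d : R} (h : a * b = c * d) (x : R) : a * (b * x) = c * (d * x) := by
  rw [← mul_assoc, h, mul_assoc]

lemma assoc₁ {a b c : R} (h : a * b = c) (x : R) : a * (b * x) = c * x := by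
  rw [← mul_assoc, h]

lemma X_pow_r (n : ℕ) (g : Gen) : D.X ^ n * D.r g = D.r g * D.X ^ n :=
  (Commute.pow_left (D.X_r g) n)

lemma X_pow_G (n : ℕ) (u v : Word) : D.X ^ n * D.G u v = D.G u v * D.X ^ n :=
  (Commute.pow_left (D.X_G u v) n)

lemma op_idem_single (w u v : Word) (h : w = u ++ black :: v) (r : R) :
    D.op (.idem w) (Finsupp.single (u, v) r) =
      Finsupp.single (u, v) (D.r (.idem (u ++ v)) * r) := by
  subst h; exact D.op_idem _ _ _ _ rfl rfl r

lemma op_top_mul (g : Gen) : D.op (.idem g.top) * D.op g = D.op g := by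
  refine ext_bot g.bot (fun u v r h => ?_) (fun u v r h => ?_)
  · rw [Module.End.mul_apply, op_zero D h, map_zero]; simp
  · rw [Module.End.mul_apply]
    cases g with
    | idem w =>
      change w = _ at h
      subst h
      simp only [Gen.top, op_idem, ← mul_assoc, r_idem_idem]
    | box U l V =>
      have h1 := fun w : Word => D.r_idem_idem w
      simp only [Gen.bot, List.append_assoc] at h
      rcases split_box h with ⟨a, rfl, rfl⟩ | ⟨rfl, rfl, rfl⟩ | ⟨rfl, rfl, rfl⟩ | ⟨rfl, rfl, rfl⟩ |
        ⟨n, rfl, rfl, rfl⟩ | ⟨n, rfl, rfl, rfl⟩ | ⟨c, rfl, rfl⟩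
      · rw [op_left _ _ _ _ _ _ _ rfl rfl, op_idem_single _ _ _ _ (by simp [Gen.top]),
          assoc₁ (D.r_idem_box _ _ _ _ (by simp))]
      · rw [op_dot _ _ _ _ _ rfl rfl,
          op_idem_single _ _ _ _ (by simp [Gen.top, Loc.tgt]), mul_assoc,
          ← assoc₂ (D.X_r _), assoc₁ (h1 _)]
      · rw [op_bb_left _ _ _ _ _ rfl rfl, map_add,
          op_idem_single _ _ _ _ (by simp [Gen.top, Loc.tgt]),
          op_idem_single _ _ _ _ (by simp [Gen.top, Loc.tgt]), mul_assoc,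
          assoc₂ (D.ι_G _ _ _ rfl), assoc₁ (h1 _)]
        simp only [List.append_assoc, List.cons_append, List.nil_append]
        rw [assoc₁ (h1 _)]
      · rw [op_bb_right _ _ _ _ _ rfl rfl, map_add,
          op_idem_single _ _ _ _ (by simp [Gen.top, Loc.tgt]),
          op_idem_single _ _ _ _ (by simp [Gen.top, Loc.tgt])]
        simp only [List.append_assoc, List.cons_append, List.nil_append, mul_assoc, neg_mul,
          mul_neg]
        simp only [assoc₂ (D.ι_G _ _ _ rfl), assoc₁ (h1 _)]
      · rw [op_br _ _ _ _ _ _ rfl rfl, op_idem_single _ _ _ _ (by simp [Gen.top, Loc.tgt])]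
        simp only [List.append_assoc, List.cons_append, List.nil_append, assoc₁ (h1 _)]
      · rw [op_rb _ _ _ _ _ _ rfl rfl,
          op_idem_single _ _ _ _ (by simp [Gen.top, Loc.tgt]), mul_assoc,
          ← assoc₂ (D.X_pow_r _ _), assoc₁ (h1 _)]
      · rw [op_right _ _ _ _ _ _ _ rfl rfl, op_idem_single _ _ _ _ (by simp [Gen.top]),
          assoc₁ (D.r_idem_box _ _ _ _ (by simp))]
    | nail V =>
      cases u with
      | nil =>
        obtain rfl : V = v := by simpa [Gen.bot] using h
        rw [op_nail_nil _ _ _ rfl, op_idem_single _ _ _ _ (by simp [Gen.top]), mul_assoc,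
          ← assoc₂ (D.ω_r_idem _), List.nil_append]
        exact congrArg _ (congrArg _ (assoc₁ (D.r_idem_idem _) r))
      | cons s u =>
        obtain ⟨rfl, rfl⟩ : black = s ∧ V = u ++ black :: v := by simpa [Gen.bot] using h
        rw [op_nail_cons _ _ _ _ _ rfl rfl, op_idem_single _ _ _ _ (by simp [Gen.top]),
          assoc₁ (D.r_idem_nail _ _ (by simp))]

lemma op_bb_bb (u v : Word) : D.op (.box u .bb v) * D.op (.box u .bb v) = 0 := by
  refine ext_bot (u ++ ([black, black] ++ v)) (fun u' v' r h => ?_) (fun u' v' r h => ?_)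
  · rw [Module.End.mul_apply, op_zero D (by simpa [Gen.bot, Loc.src] using h), map_zero]; simp
  · rw [Module.End.mul_apply]
    rcases split_box (l := .bb) h with ⟨a, rfl, rfl⟩ | ⟨h, _⟩ | ⟨-, rfl, rfl⟩ | ⟨-, rfl, rfl⟩ |
      ⟨n, h, _⟩ | ⟨n, h, _⟩ | ⟨c, rfl, rfl⟩
    · have := D.rel (.bb_bb (u' ++ a) v)
      simp only [map_mul, ρ_ι, map_zero] at this
      -- without `refine id ?_`, `simp` does not discharge the equations between words
      simp (disch := refine id ?_; simp [Loc.src]) [op_left, ← mul_assoc, this, Loc.src, Loc.tgt,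
        -Finsupp.single_mul]
    · cases h
    · have h1 := D.ι_G (u' ++ black :: v) u' v rfl
      have h2 := D.r_idem_idem (u' ++ black :: v)
      simp [op_bb_left, op_bb_right, -Finsupp.single_mul, mul_assoc, assoc₂ h1, assoc₁ h2]
      abel
    · have h1 := D.ι_G (u ++ black :: v') u v' rfl
      have h2 := D.r_idem_idem (u ++ black :: v')
      simp [op_bb_left, op_bb_right, -Finsupp.single_mul, mul_assoc, assoc₂ h1, assoc₁ h2]
      abel
    · cases h
    · cases h
    · have := D.rel (.bb_bb u (c ++ v'))
      simp only [map_mul, ρ_ι, map_zero] at this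
      simp (disch := refine id ?_; simp [Loc.src]) [op_right, ← mul_assoc, this, Loc.src, Loc.tgt,
        -Finsupp.single_mul]

end MarkData

end Marked

/-! ### Distant diagrams -/

section Marked

variable {k : Type u} [CommRing k] {N : List ℕ} {b : ℕ} {R : Type u} [Ring R] [Algebra k R]

namespace MarkData

variable (D : MarkData k N b R)

lemma r_dot_box (l : Loc) (s u m v U V : Word) (hU : U = u ++ (l.tgt ++ m)) (hU' : s =
    u ++ (l.src ++ m)) (hV : V = m ++ .black :: v) :
    D.r (.box u l V) * D.r (.box s .dot v) = D.r (.box U .dot v) * D.r (.box u l V) := by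
  subst hU hU' hV
  have := D.rel (.box_box l .dot u m v)
  simpa only [map_mul, ρ_ι, Loc.src, Loc.tgt, List.append_assoc, List.cons_append,
    List.nil_append] using this

/-- Sliding a dot on the left through a local piece. -/
lemma r_box_dot (l : Loc) (s u m v U V : Word) (hU : U = m ++ (l.tgt ++ v))
    (hU' : s = m ++ (l.src ++ v)) (hV : V = u ++ .black :: m) :
    D.r (.box V l v) * D.r (.box u .dot s) = D.r (.box u .dot U) * D.r (.box V l v) := by
  subst hU hU' hV
  have := D.rel (.box_box .dot l u m v)
  simpa only [map_mul, ρ_ι, Loc.src, Loc.tgt, List.append_assoc, List.cons_append,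
    List.nil_append] using this.symm

lemma op_box_box (l l' : Loc) (u m v : Word) :
    D.op (.box u l (m ++ l'.tgt ++ v)) * D.op (.box (u ++ l.src ++ m) l' v) =
      D.op (.box (u ++ l.tgt ++ m) l' v) * D.op (.box u l (m ++ l'.src ++ v)) := by
  refine ext_bot (u ++ (l.src ++ (m ++ (l'.src ++ v)))) (fun u' v' r h => ?_) (fun u' v' r h => ?_)
  · rw [Module.End.mul_apply, Module.End.mul_apply, op_zero D (by simpa [Gen.bot] using h),
      op_zero D (by simpa [Gen.bot] using h), map_zero, map_zero]; simp
  · rw [Module.End.mul_apply, Module.End.mul_apply]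
    rcases split_box h with ⟨a, rfl, rfl⟩ | ⟨rfl, rfl, rfl⟩ | ⟨rfl, rfl, rfl⟩ | ⟨rfl, rfl, rfl⟩ |
      ⟨n, rfl, rfl, rfl⟩ | ⟨n, rfl, rfl, rfl⟩ | ⟨c, hc, rfl⟩
    · have := D.rel (.box_box l l' (u' ++ a) m v)
      simp only [map_mul, ρ_ι, List.append_assoc] at this
      simp (disch := refine id ?_; simp) [op_left, -Finsupp.single_mul, assoc₂ this]
    · have h1 := D.X_r (.box (u' ++ m) l' v)
      have h2 := D.r_idem_box (u' ++ (m ++ (l'.tgt ++ v))) (u' ++ m) l' v (by simp)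
      have h3 := D.r_box_idem (u' ++ (m ++ (l'.src ++ v))) (u' ++ m) l' v (by simp)
      simp (disch := refine id ?_; simp) [op_left, op_dot, -Finsupp.single_mul,
        mul_assoc]
      rw [assoc₁ h2, ← assoc₂ h1, assoc₁ h3]
    · have h0 := D.r_box_dot l' (m ++ (l'.src ++ v)) u' m v (m ++ (l'.tgt ++ v))
          (u' ++ black :: m) rfl rfl rfl
      have h1 := D.G_conj (D.X_r (.box (u' ++ black :: m) l' v)) h0
      have h2 := D.r_idem_box (u' ++ black :: (m ++ (l'.tgt ++ v)))
          (u' ++ black :: m) l' v (by simp)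
      have h3 := D.r_box_idem (u' ++ black :: (m ++ (l'.src ++ v)))
          (u' ++ black :: m) l' v (by simp)
      simp (disch := refine id ?_; simp) [op_left, op_left₁, op_bb_left, -Finsupp.single_mul,
        mul_assoc]
      rw [assoc₁ h2, assoc₁ h3, assoc₂ h1, assoc₁ h3]
    · have h0 := D.r_box_dot l' (m ++ (l'.src ++ v)) u m v (m ++ (l'.tgt ++ v))
          (u ++ black :: m) rfl rfl rfl
      have h1 := D.G_conj (D.X_r (.box (u ++ black :: m) l' v)) h0
      have h2 := D.r_idem_box (u ++ black :: (m ++ (l'.tgt ++ v))) (u ++ black :: m) l' v (by simp)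
      have h3 := D.r_box_idem (u ++ black :: (m ++ (l'.src ++ v))) (u ++ black :: m) l' v (by simp)
      simp (disch := refine id ?_; simp) [op_left, op_left₁, op_bb_right, -Finsupp.single_mul,
        mul_assoc]
      rw [assoc₁ h2, assoc₂ h1, assoc₂ h1, assoc₁ h3]
    · have h2 := D.r_idem_box (u' ++ red n :: (m ++ (l'.tgt ++ v)))
          (u' ++ red n :: m) l' v (by simp)
      have h3 := D.r_box_idem (u' ++ red n :: (m ++ (l'.src ++ v)))
          (u' ++ red n :: m) l' v (by simp)
      simp (disch := refine id ?_; simp) [op_left, op_left₁, op_br, -Finsupp.single_mul,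
        mul_assoc]
      rw [assoc₁ h2, assoc₁ h3]
    · have h1 := D.X_pow_r n (.box (u ++ red n :: m) l' v)
      have h2 := D.r_idem_box (u ++ red n :: (m ++ (l'.tgt ++ v))) (u ++ red n :: m) l' v (by simp)
      have h3 := D.r_box_idem (u ++ red n :: (m ++ (l'.src ++ v))) (u ++ red n :: m) l' v (by simp)
      simp (disch := refine id ?_; simp) [op_left, op_left₁, op_rb, -Finsupp.single_mul,
        mul_assoc]
      rw [assoc₁ h2, ← assoc₂ h1, assoc₁ h3]
    · rcases split_box (U := m) (l := l') hc with
        ⟨a, rfl, rfl⟩ | ⟨rfl, rfl, rfl⟩ | ⟨rfl, rfl, rfl⟩ | ⟨rfl, rfl, rfl⟩ |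
        ⟨n, rfl, rfl, rfl⟩ | ⟨n, rfl, rfl, rfl⟩ | ⟨d, rfl, rfl⟩
      · have := D.rel (.box_box l l' u (c ++ a) v)
        simp only [map_mul, ρ_ι, List.append_assoc] at this
        have e1 : ∀ r, D.op (.box (u ++ (l.src ++ (c ++ black :: a))) l' v)
            (Finsupp.single (u ++ (l.src ++ c), a ++ (l'.src ++ v)) r) = _ := fun r => by
          have := D.op_left (u ++ (l.src ++ c)) a l' v _ _ rfl rfl r
          simpa [-Finsupp.single_mul] using this
        have e2 : ∀ r, D.op (.box (u ++ (l.tgt ++ (c ++ black :: a))) l' v)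
            (Finsupp.single (u ++ (l.tgt ++ c), a ++ (l'.src ++ v)) r) = _ := fun r => by
          have := D.op_left (u ++ (l.tgt ++ c)) a l' v _ _ rfl rfl r
          simpa [-Finsupp.single_mul] using this
        simp (disch := refine id ?_; simp) [op_right, -Finsupp.single_mul, assoc₂ this, e1, e2]
      · have h1 := D.X_r (.box u l (c ++ v'))
        have h2 := D.r_idem_box (u ++ (l.tgt ++ (c ++ v'))) u l (c ++ v') (by simp)
        have h3 := D.r_box_idem (u ++ (l.src ++ (c ++ v'))) u l (c ++ v') (by simp)
        simp (disch := refine id ?_; simp) [op_right, op_dot, -Finsupp.single_mul,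
          mul_assoc]
        rw [assoc₁ h2, ← assoc₂ h1, assoc₁ h3]
      · have h0 := D.r_dot_box l (u ++ (l.src ++ c)) u c v (u ++ (l.tgt ++ c))
            (c ++ black :: v) rfl rfl rfl
        have h1 := D.G_conj (D.X_r (.box u l (c ++ black :: v))) h0
        have h2 := D.r_idem_box (u ++ (l.tgt ++ (c ++ black :: v))) u l (c ++ black :: v) (by simp)
        have h3 := D.r_box_idem (u ++ (l.src ++ (c ++ black :: v))) u l (c ++ black :: v) (by simp)
        simp (disch := refine id ?_; simp) [op_right, op_right₃, op_bb_left, -Finsupp.single_mul,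
          mul_assoc]
        rw [assoc₁ h2, assoc₁ h3, assoc₂ h1, assoc₁ h3]
      · have h0 := D.r_dot_box l (u ++ (l.src ++ m)) u m v' (u ++ (l.tgt ++ m))
            (m ++ black :: v') rfl rfl rfl
        have h1 := D.G_conj (D.X_r (.box u l (m ++ black :: v'))) h0
        have h2 := D.r_idem_box (u ++ (l.tgt ++ (m ++ black :: v'))) u l (m ++ black :: v')
            (by simp)
        have h3 := D.r_box_idem (u ++ (l.src ++ (m ++ black :: v'))) u l (m ++ black :: v')
            (by simp)
        simp (disch := refine id ?_; simp) [op_right, op_right₃, op_bb_right, -Finsupp.single_mul,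
          mul_assoc]
        rw [assoc₁ h2, assoc₂ h1, assoc₂ h1, assoc₁ h3]
      · have h2 := D.r_idem_box (u ++ (l.tgt ++ (c ++ red n :: v))) u l (c ++ red n :: v) (by simp)
        have h3 := D.r_box_idem (u ++ (l.src ++ (c ++ red n :: v))) u l (c ++ red n :: v) (by simp)
        simp (disch := refine id ?_; simp) [op_right, op_right₃, op_br, -Finsupp.single_mul,
          mul_assoc]
        rw [assoc₁ h2, assoc₁ h3]
      · have h1 := D.X_pow_r n (.box u l (m ++ red n :: v'))
        have h2 := D.r_idem_box (u ++ (l.tgt ++ (m ++ red n :: v'))) u l (m ++ red n :: v')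
            (by simp)
        have h3 := D.r_box_idem (u ++ (l.src ++ (m ++ red n :: v'))) u l (m ++ red n :: v')
            (by simp)
        simp (disch := refine id ?_; simp) [op_right, op_right₃, op_rb, -Finsupp.single_mul,
          mul_assoc]
        rw [assoc₁ h2, ← assoc₂ h1, assoc₁ h3]
      · have := D.rel (.box_box l l' u m (d ++ v'))
        simp only [map_mul, ρ_ι, List.append_assoc] at this
        have e1 : ∀ r, D.op (.box u l (m ++ (l'.tgt ++ (d ++ black :: v'))))
            (Finsupp.single (u ++ (l.src ++ (m ++ (l'.tgt ++ d))), v') r) = _ := fun r => by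
          have := D.op_right u l (m ++ (l'.tgt ++ d)) v' _ _ rfl rfl r
          simpa [-Finsupp.single_mul] using this
        have e2 : ∀ r, D.op (.box u l (m ++ (l'.src ++ (d ++ black :: v'))))
            (Finsupp.single (u ++ (l.src ++ (m ++ (l'.src ++ d))), v') r) = _ := fun r => by
          have := D.op_right u l (m ++ (l'.src ++ d)) v' _ _ rfl rfl r
          simpa [-Finsupp.single_mul] using this
        simp (disch := refine id ?_; simp) [op_right, -Finsupp.single_mul, assoc₂ this, e1, e2]

end MarkData

end Marked

/-! ### NilHecke relations -/

section Marked

variable {k : Type u} [CommRing k] {N : List ℕ} {b : ℕ} {R : Type u} [Ring R] [Algebra k R]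

namespace MarkData

variable (D : MarkData k N b R)

/-- The black strand lies at the left of two given neighbours, is one of them, or lies at their
right. -/
lemma split₂ {U V u v : Word} {s t : Strand} (h : U ++ s :: t :: V = u ++ black :: v) :
    (∃ a, U = u ++ black :: a ∧ v = a ++ s :: t :: V) ∨
    (s = black ∧ u = U ∧ v = t :: V) ∨ (t = black ∧ u = U ++ [s] ∧ v = V) ∨
    (∃ c, V = c ++ black :: v ∧ u = U ++ s :: t :: c) := by
  rcases append_split₃ (S := [s, t]) h with h | ⟨s1, s2, hs, rfl, rfl⟩ | h
  · exact .inl h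
  · right
    rcases s1 with _ | ⟨p, _ | ⟨q, s1⟩⟩ <;>
      simp only [List.nil_append, List.cons_append, List.cons.injEq, List.nil_eq,
        List.append_eq_nil_iff, reduceCtorEq, and_false] at hs
    · obtain ⟨rfl, rfl⟩ := hs; simp
    · obtain ⟨rfl, rfl, rfl⟩ := hs; simp
  · exact .inr (.inr (.inr h))

/-- The black strand lies at the left of three given neighbours, is one of them, or lies at their
right. -/
lemma split₃ {U V u v : Word} {s t p : Strand} (h : U ++ s :: t :: p :: V = u ++ black :: v) :
    (∃ a, U = u ++ black :: a ∧ v = a ++ s :: t :: p :: V) ∨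
    (s = black ∧ u = U ∧ v = t :: p :: V) ∨ (t = black ∧ u = U ++ [s] ∧ v = p :: V) ∨
    (p = black ∧ u = U ++ [s, t] ∧ v = V) ∨
    (∃ c, V = c ++ black :: v ∧ u = U ++ s :: t :: p :: c) := by
  rcases append_split₃ (S := [s, t, p]) h with h | ⟨s1, s2, hs, rfl, rfl⟩ | h
  · exact .inl h
  · right
    rcases s1 with _ | ⟨p, _ | ⟨q, _ | ⟨q', s1⟩⟩⟩ <;>
      simp only [List.nil_append, List.cons_append, List.cons.injEq, List.nil_eq,
        List.append_eq_nil_iff, reduceCtorEq, and_false] at hs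
    · obtain ⟨rfl, rfl⟩ := hs; simp
    · obtain ⟨rfl, rfl, rfl⟩ := hs; simp
    · obtain ⟨rfl, rfl, rfl, rfl⟩ := hs; simp
  · exact .inr (.inr (.inr (.inr h)))

lemma pow_apply_single {F : MarkMod R →ₗ[k] MarkMod R} {i : Word × Word} {c : R}
    (h : ∀ r, F (Finsupp.single i r) = Finsupp.single i (c * r)) (n : ℕ) (r : R) :
    (F ^ n) (Finsupp.single i r) = Finsupp.single i (c ^ n * r) := by
  induction n with
  | zero => simp
  | succ n ih => rw [pow_succ', Module.End.mul_apply, ih, h, ← mul_assoc, ← pow_succ']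

lemma X_mul_idem_pow (n : ℕ) (w : Word) (x : R) :
    (D.X * D.r (.idem w)) ^ n * (D.r (.idem w) * x) = D.X ^ n * (D.r (.idem w) * x) := by
  induction n with
  | zero => simp
  | succ n ih => rw [pow_succ', mul_assoc, ih, mul_assoc, ← assoc₂ (D.X_pow_r n _),
      assoc₁ (D.r_idem_idem w), ← mul_assoc, ← pow_succ']

lemma op_dot_pow (n : ℕ) (U V u v : Word) (hu : u = U) (hv : v = V) (r : R) :
    (D.op (.box U .dot V) ^ n) (Finsupp.single (u, v) r) =
      Finsupp.single (u, v) ((D.X * D.r (.idem (u ++ v))) ^ n * r) :=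
  pow_apply_single (D.op_dot U V u v hu hv) n r

lemma op_left_dot_pow (n : ℕ) (u u2 V u' v : Word) (hu : u' = u) (hv : v = u2 ++ black :: V)
    (r : R) :
    (D.op (.box (u ++ black :: u2) .dot V) ^ n) (Finsupp.single (u', v) r) =
      Finsupp.single (u', v) (D.r (.box (u ++ u2) .dot V) ^ n * r) := by
  subst hv
  exact pow_apply_single (D.op_left u u2 .dot V _ _ hu rfl) n r

lemma op_right_dot_pow (n : ℕ) (U v1 v u' v' : Word) (hu : u' = U ++ (black :: v1))
    (hv : v' = v) (r : R) :
    (D.op (.box U .dot (v1 ++ black :: v)) ^ n) (Finsupp.single (u', v') r) =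
      Finsupp.single (u', v') (D.r (.box U .dot (v1 ++ v)) ^ n * r) := by
  subst hu
  exact pow_apply_single (D.op_right U .dot v1 v _ _ rfl hv) n r

lemma d_G (u v : Word) (y : R) : D.r (.box u .dot v) * (D.G u v * y) =
    D.G u v * (D.r (.box u .dot v) * y) :=
  assoc₂ (D.G_conj (D.X_r (.box u .dot v)) rfl) y

lemma G_X (u v : Word) (y : R) :
    D.G u v * (D.X * y) = D.G u v * (D.r (.box u .dot v) * y) + y := by
  have := congrArg (· * y) (D.G_mul u v)
  simp only [mul_sub, sub_mul, one_mul, mul_assoc] at this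
  rw [eq_add_of_sub_eq this, add_comm]
  rfl

lemma X_G' (u v : Word) (y : R) :
    D.X * (D.G u v * y) = D.G u v * (D.r (.box u .dot v) * y) + y := by
  rw [← G_X, assoc₂ (D.X_G u v)]

lemma G_comm (u v : Word) (y : R) : D.G (u ++ [black]) v * (D.G u (black :: v) * y) =
    D.G u (black :: v) * (D.G (u ++ [black]) v * y) := by
  refine assoc₂ (D.G_conj (D.X_G _ _).symm.symm ?_) y
  refine (D.G_conj (D.X_r _) ?_).symm
  simpa [Loc.src, Loc.tgt] using D.r_dot_box .dot (u ++ black :: []) u [] v (u ++ black :: [])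
    (black :: v) rfl rfl rfl

lemma r_bb_dot (u v : Word) : D.r (.box u .bb v) * D.r (.box u .dot (black :: v)) =
    D.r (.box (u ++ [black]) .dot v) * D.r (.box u .bb v) +
      D.r (.idem (u ++ black :: black :: v)) := by
  have := D.rel (.bb_dot u v)
  simpa only [map_mul, map_add, ρ_ι, List.append_assoc, List.cons_append,
    List.nil_append] using this

lemma r_dot_bb (u v : Word) : D.r (.box u .dot (black :: v)) * D.r (.box u .bb v) =
    D.r (.box u .bb v) * D.r (.box (u ++ [black]) .dot v) +
      D.r (.idem (u ++ black :: black :: v)) := by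
  have := D.rel (.dot_bb u v)
  simpa only [map_mul, map_add, ρ_ι, List.append_assoc, List.cons_append,
    List.nil_append] using this

/-- The divided difference rule for moving a crossing past the resolvent of a dot. -/
lemma G_twist {t d d' g g' i : R} (ht : D.X * t = t * D.X) (h1 : (D.X - d) * g = 1)
    (h2 : g' * (D.X - d') = 1) (h : t * d = d' * t + i) (y : R) :
    t * (g * y) = g' * (t * y) + g' * (i * (g * y)) := by
  have e : (D.X - d') * t = t * (D.X - d) + i := by
    rw [sub_mul, mul_sub, h, ht]; abel
  calc t * (g * y) = g' * ((D.X - d') * t) * g * y := by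
        rw [← mul_assoc, ← mul_assoc g', h2, one_mul]
    _ = _ := by
        rw [e, mul_add, add_mul, add_mul]
        congr 1
        · rw [mul_assoc, mul_assoc, mul_assoc, ← mul_assoc _ g, h1, one_mul]
        · simp only [mul_assoc]

lemma bb_G_left (u v : Word) (y : R) :
    D.r (.box u .bb v) * (D.G u (black :: v) * y) =
      D.G (u ++ [black]) v * (D.r (.box u .bb v) * y) +
      D.G u (black :: v) * (D.G (u ++ [black]) v * (D.r (.idem (u ++ black :: black :: v)) * y)) :=
        by
  rw [D.G_twist (D.X_r _) (D.mul_G _ _) (D.G_mul (u ++ [black]) v) (D.r_bb_dot u v),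
    assoc₂ (D.ι_G _ _ _ rfl), G_comm]

lemma bb_G_right (u v : Word) (y : R) :
    D.r (.box u .bb v) * (D.G (u ++ [black]) v * y) =
      D.G u (black :: v) * (D.r (.box u .bb v) * y) -
      D.G u (black :: v) * (D.G (u ++ [black]) v * (D.r (.idem (u ++ black :: black :: v)) * y)) :=
        by
  rw [D.G_twist (D.X_r _) (D.mul_G _ _) (D.G_mul u (black :: v)) (i := -_) ((eq_sub_of_add_eq
    (D.r_dot_bb u v).symm).trans (sub_eq_add_neg _ _)), neg_mul, mul_neg,
      assoc₂ (D.ι_G _ (u ++ [black]) v (by simp)), sub_eq_add_neg]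

lemma op_bb_dot (u v : Word) : D.op (.box u .bb v) * D.op (.box u .dot (black :: v)) =
    D.op (.box (u ++ [black]) .dot v) * D.op (.box u .bb v) +
      D.op (.idem (u ++ [black, black] ++ v)) := by
  refine ext_bot (u ++ black :: black :: v) (fun u' v' r h => ?_) (fun u' v' r h => ?_)
  · simp only [Module.End.mul_apply, LinearMap.add_apply]
    rw [op_zero D (by simpa [Gen.bot] using h), op_zero D (by simpa [Gen.bot] using h),
      op_zero D (by simpa [Gen.bot] using h)]; simp
  · simp only [Module.End.mul_apply, LinearMap.add_apply]
    rcases split₂ h with ⟨a, rfl, rfl⟩ | ⟨-, rfl, rfl⟩ | ⟨-, rfl, rfl⟩ | ⟨c, rfl, rfl⟩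
    · have := D.rel (.bb_dot (u' ++ a) v)
      simp only [map_mul, map_add, ρ_ι, List.append_assoc, List.cons_append,
        List.nil_append] at this
      simp (disch := refine id ?_; simp) [op_left, op_idem_single, -Finsupp.single_mul,
        ← Finsupp.single_add]
      rw [← mul_assoc, this, add_mul, mul_assoc]
    · have h1 := D.ι_G (u' ++ black :: v) u' v rfl
      have h2 := D.r_idem_idem (u' ++ black :: v)
      have h3 := D.X_r (.idem (u' ++ black :: v))
      have h4 := D.X_G u' v
      have h5 := D.r_idem_box (u' ++ black :: v) u' .dot v rfl
      have h6 := D.r_box_idem (u' ++ black :: v) u' .dot v rfl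
      simp (disch := refine id ?_; simp) [op_left, op_dot, op_bb_left, op_idem_single,
        -Finsupp.single_mul, mul_assoc, assoc₂ h1, ← assoc₂ h3, assoc₁ h2, assoc₁ h5, assoc₁ h6,
          G_X, d_G]
      abel
    · have h1 := D.ι_G (u ++ black :: v') u v' rfl
      have h2 := D.r_idem_idem (u ++ black :: v')
      have h3 := D.X_r (.idem (u ++ black :: v'))
      have h4 := D.X_G u v'
      have h5 := D.r_idem_box (u ++ black :: v') u .dot v' rfl
      have h6 := D.r_box_idem (u ++ black :: v') u .dot v' rfl
      simp (disch := refine id ?_; simp) [op_right', op_dot, op_bb_right, op_left, op_idem_single,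
        -Finsupp.single_mul, mul_assoc, assoc₂ h1, ← assoc₂ h3, assoc₁ h2, assoc₁ h5, assoc₁ h6,
          X_G', d_G]
      abel
    · have := D.rel (.bb_dot u (c ++ v'))
      simp only [map_mul, map_add, ρ_ι, List.append_assoc, List.cons_append,
        List.nil_append] at this
      simp (disch := refine id ?_; simp) [op_right, op_right₁, op_idem_single, -Finsupp.single_mul,
        ← Finsupp.single_add]
      rw [← mul_assoc, this, add_mul, mul_assoc]

lemma op_bb_braid (u v : Word) :
    D.op (.box u .bb (black :: v)) * D.op (.box (u ++ [black]) .bb v) *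
      D.op (.box u .bb (black :: v)) =
    D.op (.box (u ++ [black]) .bb v) * D.op (.box u .bb (black :: v)) *
      D.op (.box (u ++ [black]) .bb v) := by
  refine ext_bot (u ++ black :: black :: black :: v) (fun u' v' r h => ?_) (fun u' v' r h => ?_)
  · simp only [Module.End.mul_apply]
    rw [op_zero D (by simpa [Gen.bot] using h), op_zero D (by simpa [Gen.bot] using h)]; simp
  · simp only [Module.End.mul_apply]
    rcases split₃ h with ⟨a, rfl, rfl⟩ | ⟨-, rfl, rfl⟩ | ⟨-, rfl, rfl⟩ | ⟨-, rfl, rfl⟩ | ⟨c, rfl,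
      rfl⟩
    · have := D.rel (.bb_braid (u' ++ a) v)
      simp only [map_mul, ρ_ι, List.append_assoc] at this
      simp (disch := refine id ?_; simp) [op_left, -Finsupp.single_mul]
      simp only [← mul_assoc, this]
    · have h1 := D.ι_G (u' ++ black :: black :: v) u' (black :: v) rfl
      have h1' := D.ι_G (u' ++ black :: black :: v) (u' ++ [black]) v (by simp)
      have h2 := D.r_idem_idem (u' ++ black :: black :: v)
      have h5 := D.r_idem_box (u' ++ black :: black :: v) u' .bb v rfl
      have h6 := D.r_box_idem (u' ++ black :: black :: v) u' .bb v rfl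
      have h7 : D.r (.box u' .bb v) * D.r (.box u' .bb v) = 0 := by
        simpa only [map_mul, ρ_ι, map_zero] using D.rel (.bb_bb u' v)
      simp (disch := refine id ?_; simp) [op_left, op_bb_left, op_bb_right, op_right',
        -Finsupp.single_mul,
        mul_assoc, mul_add, mul_sub, mul_neg, assoc₂ h1, assoc₂ h1', assoc₁ h2, assoc₁ h5,
          assoc₁ h6, assoc₁ h7, bb_G_left, bb_G_right, G_comm]
      abel
    · have h1 := D.ι_G (u ++ black :: black :: v) u (black :: v) rfl
      have h1' := D.ι_G (u ++ black :: black :: v) (u ++ [black]) v (by simp)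
      have h2 := D.r_idem_idem (u ++ black :: black :: v)
      have h5 := D.r_idem_box (u ++ black :: black :: v) u .bb v rfl
      have h6 := D.r_box_idem (u ++ black :: black :: v) u .bb v rfl
      have h7 : D.r (.box u .bb v) * D.r (.box u .bb v) = 0 := by
        simpa only [map_mul, ρ_ι, map_zero] using D.rel (.bb_bb u v)
      simp (disch := refine id ?_; simp) [op_left, op_bb_left, op_bb_right, op_right',
        -Finsupp.single_mul,
        mul_assoc, mul_add, mul_sub, mul_neg, assoc₂ h1, assoc₂ h1', assoc₁ h2, assoc₁ h5,
          assoc₁ h6, assoc₁ h7, bb_G_left, bb_G_right, G_comm]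
      abel
    · have h1 := D.ι_G (u ++ black :: black :: v') u (black :: v') rfl
      have h1' := D.ι_G (u ++ black :: black :: v') (u ++ [black]) v' (by simp)
      have h2 := D.r_idem_idem (u ++ black :: black :: v')
      have h5 := D.r_idem_box (u ++ black :: black :: v') u .bb v' rfl
      have h6 := D.r_box_idem (u ++ black :: black :: v') u .bb v' rfl
      have h7 : D.r (.box u .bb v') * D.r (.box u .bb v') = 0 := by
        simpa only [map_mul, ρ_ι, map_zero] using D.rel (.bb_bb u v')
      simp (disch := refine id ?_; simp) [op_left, op_bb_left, op_bb_right, op_right',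
        -Finsupp.single_mul,
        mul_assoc, mul_add, mul_sub, mul_neg, assoc₂ h1, assoc₂ h1', assoc₁ h2, assoc₁ h5,
          assoc₁ h6, assoc₁ h7, bb_G_left, bb_G_right, G_comm]
      abel
    · have := D.rel (.bb_braid u (c ++ v'))
      simp only [map_mul, ρ_ι, List.append_assoc] at this
      simp (disch := refine id ?_; simp) [op_right, op_right₁, -Finsupp.single_mul]
      simp only [← mul_assoc, this]

end MarkData

end Marked

/-! ### Black and red crossings -/

section Marked

variable {k : Type u} [CommRing k] {N : List ℕ} {b : ℕ} {R : Type u} [Ring R] [Algebra k R]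

namespace MarkData

variable (D : MarkData k N b R)

lemma op_dot_bb (u v : Word) : D.op (.box u .dot (black :: v)) * D.op (.box u .bb v) =
    D.op (.box u .bb v) * D.op (.box (u ++ [black]) .dot v) +
      D.op (.idem (u ++ [black, black] ++ v)) := by
  refine ext_bot (u ++ black :: black :: v) (fun u' v' r h => ?_) (fun u' v' r h => ?_)
  · simp only [Module.End.mul_apply, LinearMap.add_apply]
    rw [op_zero D (by simpa [Gen.bot] using h), op_zero D (by simpa [Gen.bot] using h),
      op_zero D (by simpa [Gen.bot] using h)]; simp
  · simp only [Module.End.mul_apply, LinearMap.add_apply]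
    rcases split₂ h with ⟨a, rfl, rfl⟩ | ⟨-, rfl, rfl⟩ | ⟨-, rfl, rfl⟩ | ⟨c, rfl, rfl⟩
    · have := D.r_dot_bb (u' ++ a) v
      simp only [List.append_assoc, List.cons_append, List.nil_append] at this
      simp (disch := refine id ?_; simp) [op_left, op_idem_single, -Finsupp.single_mul,
        ← Finsupp.single_add]
      rw [← mul_assoc, this, add_mul, mul_assoc]
    · have h1 := D.ι_G (u' ++ black :: v) u' v rfl
      have h2 := D.r_idem_idem (u' ++ black :: v)
      have h3 := D.X_r (.idem (u' ++ black :: v))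
      have h5 := D.r_idem_box (u' ++ black :: v) u' .dot v rfl
      have h6 := D.r_box_idem (u' ++ black :: v) u' .dot v rfl
      simp (disch := refine id ?_; simp) [op_left, op_right', op_dot, op_bb_left, op_idem_single,
        -Finsupp.single_mul, mul_assoc, assoc₂ h1, ← assoc₂ h3, assoc₁ h2, assoc₁ h5, assoc₁ h6,
          X_G', d_G]
      abel
    · have h1 := D.ι_G (u ++ black :: v') u v' rfl
      have h2 := D.r_idem_idem (u ++ black :: v')
      have h3 := D.X_r (.idem (u ++ black :: v'))
      have h5 := D.r_idem_box (u ++ black :: v') u .dot v' rfl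
      have h6 := D.r_box_idem (u ++ black :: v') u .dot v' rfl
      simp (disch := refine id ?_; simp) [op_right', op_dot, op_bb_right, op_left, op_idem_single,
        -Finsupp.single_mul, mul_assoc, assoc₂ h1, ← assoc₂ h3, assoc₁ h2, assoc₁ h5, assoc₁ h6,
          G_X, X_G', d_G, mul_add]
      abel
    · have := D.r_dot_bb u (c ++ v')
      simp (disch := refine id ?_; simp) [op_right, op_right₁, op_idem_single, -Finsupp.single_mul,
        ← Finsupp.single_add]
      rw [← mul_assoc, this, add_mul, mul_assoc]

lemma op_dot_rb (n : ℕ) (u v : Word) : D.op (.box u .dot (red n :: v)) * D.op (.box u (.rb n) v) =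
    D.op (.box u (.rb n) v) * D.op (.box (u ++ [red n]) .dot v) := by
  refine ext_bot (u ++ red n :: black :: v) (fun u' v' r h => ?_) (fun u' v' r h => ?_)
  · simp only [Module.End.mul_apply]
    rw [op_zero D (by simpa [Gen.bot] using h), op_zero D (by simpa [Gen.bot] using h)]; simp
  · simp only [Module.End.mul_apply]
    rcases split₂ h with ⟨a, rfl, rfl⟩ | ⟨h, _⟩ | ⟨-, rfl, rfl⟩ | ⟨c, rfl, rfl⟩
    · have := D.rel (.dot_rb n (u' ++ a) v)
      simp only [map_mul, map_add, ρ_ι, List.append_assoc, List.cons_append,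
        List.nil_append] at this
      simp (disch := refine id ?_; simp) [op_left, -Finsupp.single_mul, assoc₂ this]
    · cases h
    · have h2 := D.r_idem_idem (u ++ red n :: v')
      have h3 := D.X_r (.idem (u ++ red n :: v'))
      have h4 := D.X_pow_r n (.idem (u ++ red n :: v'))
      simp (disch := refine id ?_; simp) [op_dot, op_rb, -Finsupp.single_mul, mul_assoc,
        ← assoc₂ h3,
        ← assoc₂ h4, assoc₁ h2, assoc₂ ((Commute.refl D.X).pow_left n).eq]
    · have := D.rel (.dot_rb n u (c ++ v'))
      simp only [map_mul, map_add, ρ_ι, List.append_assoc, List.cons_append,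
        List.nil_append] at this
      simp (disch := refine id ?_; simp) [op_right, op_right₁, -Finsupp.single_mul, assoc₂ this]

lemma op_br_dot (n : ℕ) (u v : Word) : D.op (.box u (.br n) v) * D.op (.box u .dot (red n :: v)) =
    D.op (.box (u ++ [red n]) .dot v) * D.op (.box u (.br n) v) := by
  refine ext_bot (u ++ black :: red n :: v) (fun u' v' r h => ?_) (fun u' v' r h => ?_)
  · simp only [Module.End.mul_apply]
    rw [op_zero D (by simpa [Gen.bot] using h), op_zero D (by simpa [Gen.bot] using h)]; simp
  · simp only [Module.End.mul_apply]
    rcases split₂ h with ⟨a, rfl, rfl⟩ | ⟨-, rfl, rfl⟩ | ⟨h, _⟩ | ⟨c, rfl, rfl⟩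
    · have := D.rel (.br_dot n (u' ++ a) v)
      simp only [map_mul, map_add, ρ_ι, List.append_assoc, List.cons_append,
        List.nil_append] at this
      simp (disch := refine id ?_; simp) [op_left, -Finsupp.single_mul, assoc₂ this]
    · have h2 := D.r_idem_idem (u' ++ red n :: v)
      have h3 := D.X_r (.idem (u' ++ red n :: v))
      simp (disch := refine id ?_; simp) [op_dot, op_br, -Finsupp.single_mul, mul_assoc,
        ← assoc₂ h3,
        assoc₁ h2]
    · cases h
    · have := D.rel (.br_dot n u (c ++ v'))
      simp only [map_mul, map_add, ρ_ι, List.append_assoc, List.cons_append,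
        List.nil_append] at this
      simp (disch := refine id ?_; simp) [op_right, op_right₁, -Finsupp.single_mul, assoc₂ this]

lemma op_br_rb (n : ℕ) (u v : Word) : D.op (.box u (.br n) v) * D.op (.box u (.rb n) v) =
    D.op (.box (u ++ [red n]) .dot v) ^ n * D.op (.idem (u ++ [red n, black] ++ v)) := by
  refine ext_bot (u ++ red n :: black :: v) (fun u' v' r h => ?_) (fun u' v' r h => ?_)
  · simp only [Module.End.mul_apply]
    rw [op_zero D (by simpa [Gen.bot] using h), op_zero D (by simpa [Gen.bot] using h)]; simp
  · simp only [Module.End.mul_apply]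
    rcases split₂ h with ⟨a, rfl, rfl⟩ | ⟨h, _⟩ | ⟨-, rfl, rfl⟩ | ⟨c, rfl, rfl⟩
    · have := D.rel (.br_rb n (u' ++ a) v)
      simp only [map_mul, map_pow, ρ_ι, List.append_assoc, List.cons_append,
        List.nil_append] at this
      have e1 := D.op_left_dot_pow n u' (a ++ [red n]) v u' (a ++ red n :: black :: v) rfl (by simp)
      simp (disch := refine id ?_; simp) [op_left, -Finsupp.single_mul, op_idem_single, e1,
        assoc₂ this]
    · cases h
    · have h2 := D.r_idem_idem (u ++ red n :: v')
      have h4 := D.X_pow_r n (.idem (u ++ red n :: v'))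
      have h5 := D.X_mul_idem_pow n (u ++ red n :: v')
      simp (disch := refine id ?_; simp) [op_br, op_rb, op_idem_single, op_dot_pow,
        -Finsupp.single_mul, mul_assoc,
        ← assoc₂ h4, assoc₁ h2, h5]
    · have := D.rel (.br_rb n u (c ++ v'))
      simp only [map_mul, map_pow, ρ_ι, List.append_assoc, List.cons_append,
        List.nil_append] at this
      simp (disch := refine id ?_; simp) [op_right, op_right₁, op_right_dot_pow, op_idem_single,
        -Finsupp.single_mul, assoc₂ this]

lemma op_rb_br (n : ℕ) (u v : Word) : D.op (.box u (.rb n) v) * D.op (.box u (.br n) v) =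
    D.op (.box u .dot (red n :: v)) ^ n * D.op (.idem (u ++ [black, red n] ++ v)) := by
  refine ext_bot (u ++ black :: red n :: v) (fun u' v' r h => ?_) (fun u' v' r h => ?_)
  · simp only [Module.End.mul_apply]
    rw [op_zero D (by simpa [Gen.bot] using h), op_zero D (by simpa [Gen.bot] using h)]; simp
  · simp only [Module.End.mul_apply]
    rcases split₂ h with ⟨a, rfl, rfl⟩ | ⟨-, rfl, rfl⟩ | ⟨h, _⟩ | ⟨c, rfl, rfl⟩
    · have := D.rel (.rb_br n (u' ++ a) v)
      simp only [map_mul, map_pow, ρ_ι, List.append_assoc, List.cons_append,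
        List.nil_append] at this
      simp (disch := refine id ?_; simp) [op_left, op_left_dot_pow, -Finsupp.single_mul,
        op_idem_single, assoc₂ this]
    · have h2 := D.r_idem_idem (u' ++ red n :: v)
      have h4 := D.X_pow_r n (.idem (u' ++ red n :: v))
      have h5 := D.X_mul_idem_pow n (u' ++ red n :: v)
      simp (disch := refine id ?_; simp) [op_br, op_rb, op_idem_single, op_dot_pow,
        -Finsupp.single_mul, mul_assoc,
        ← assoc₂ h4, assoc₁ h2, h5]
    · cases h
    · have := D.rel (.rb_br n u (c ++ v'))
      simp only [map_mul, map_pow, ρ_ι, List.append_assoc, List.cons_append,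
        List.nil_append] at this
      have e1 := D.op_right_dot_pow n u (red n :: c) v' (u ++ black :: red n :: c) v' rfl rfl
      simp only [List.append_assoc, List.cons_append, List.nil_append] at e1
      simp (disch := refine id ?_; simp) [op_right, op_right₁, e1, op_idem_single,
        -Finsupp.single_mul, assoc₂ this]

lemma op_bb_rb_rb (n : ℕ) (u v : Word) :
    D.op (.box u .bb (red n :: v)) * D.op (.box (u ++ [black]) (.rb n) v) *
      D.op (.box u (.rb n) (black :: v)) =
    D.op (.box (u ++ [black]) (.rb n) v) * D.op (.box u (.rb n) (black :: v)) *
      D.op (.box (u ++ [red n]) .bb v) := by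
  refine ext_bot (u ++ red n :: black :: black :: v) (fun u' v' r h => ?_) (fun u' v' r h => ?_)
  · simp only [Module.End.mul_apply]
    rw [op_zero D (by simpa [Gen.bot] using h), op_zero D (by simpa [Gen.bot] using h)]; simp
  · simp only [Module.End.mul_apply]
    rcases split₃ h with ⟨a, rfl, rfl⟩ | ⟨h, _⟩ | ⟨-, rfl, rfl⟩ | ⟨-, rfl, rfl⟩ | ⟨c, rfl, rfl⟩
    · have := D.rel (.bb_rb_rb n (u' ++ a) v)
      simp only [map_mul, ρ_ι, List.append_assoc, List.cons_append, List.nil_append] at this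
      simp (disch := refine id ?_; simp) [op_left, op_left₁, -Finsupp.single_mul]
      simp only [← mul_assoc, this]
    · cases h
    · have h0 := D.rel (.dot_rb n u v)
      simp only [map_mul, ρ_ι] at h0
      have h1 := D.G_conj (D.X_r (.box u (.rb n) v)) h0.symm
      have h2 := D.r_idem_box (u ++ black :: red n :: v) u (.rb n) v rfl
      have h3 := D.r_box_idem (u ++ red n :: black :: v) u (.rb n) v rfl
      have h4 := D.ι_G (u ++ red n :: black :: v) (u ++ [red n]) v (by simp)
      have h5 := D.r_idem_idem (u ++ red n :: black :: v)
      have h6 := D.X_pow_r n (.box u (.rb n) v)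
      have h7 := D.X_pow_r n (.idem (u ++ red n :: black :: v))
      have h8 := D.X_pow_G n (u ++ [red n]) v
      have h7' := D.X_pow_r n (.idem (u ++ black :: red n :: v))
      have h8' := D.X_pow_G n u (red n :: v)
      simp (disch := refine id ?_; simp) [op_left, op_left₁, op_right', op_rb, op_bb_left,
        -Finsupp.single_mul, mul_assoc,
        assoc₁ h2, assoc₁ h3, assoc₂ h4, assoc₁ h5, ← assoc₂ h6, ← assoc₂ h7, ← assoc₂ h7',
          assoc₂ h8', ← assoc₂ h8, assoc₂ h1]
    · have h0 := D.rel (.dot_rb n u v')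
      simp only [map_mul, ρ_ι] at h0
      have h1 := D.G_conj (D.X_r (.box u (.rb n) v')) h0.symm
      have h2 := D.r_idem_box (u ++ black :: red n :: v') u (.rb n) v' rfl
      have h3 := D.r_box_idem (u ++ red n :: black :: v') u (.rb n) v' rfl
      have h4 := D.ι_G (u ++ red n :: black :: v') (u ++ [red n]) v' (by simp)
      have h4' := D.ι_G (u ++ black :: red n :: v') u (red n :: v') (by simp)
      have h5 := D.r_idem_idem (u ++ red n :: black :: v')
      have h6 := D.X_pow_r n (.box u (.rb n) v')
      have h7 := D.X_pow_r n (.idem (u ++ red n :: black :: v'))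
      have h7' := D.X_pow_r n (.idem (u ++ black :: red n :: v'))
      have h8 := D.X_pow_G n (u ++ [red n]) v'
      have h8' := D.X_pow_G n u (red n :: v')
      simp (disch := refine id ?_; simp) [op_left, op_left₁, op_right', op_rb, op_bb_right,
        -Finsupp.single_mul, mul_assoc,
        assoc₁ h2, assoc₁ h3, assoc₂ h4, assoc₂ h4', assoc₁ h5, ← assoc₂ h6, ← assoc₂ h7,
          ← assoc₂ h7', ← assoc₂ h8, ← assoc₂ h8', assoc₂ h1]
    · have := D.rel (.bb_rb_rb n u (c ++ v'))
      simp only [map_mul, ρ_ι, List.append_assoc, List.cons_append, List.nil_append] at this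
      simp (disch := refine id ?_; simp) [op_right, op_right₁, -Finsupp.single_mul]
      simp only [← mul_assoc, this]

lemma op_br_br_bb (n : ℕ) (u v : Word) :
    D.op (.box u (.br n) (black :: v)) * D.op (.box (u ++ [black]) (.br n) v) *
      D.op (.box u .bb (red n :: v)) =
    D.op (.box (u ++ [red n]) .bb v) * D.op (.box u (.br n) (black :: v)) *
      D.op (.box (u ++ [black]) (.br n) v) := by
  refine ext_bot (u ++ black :: black :: red n :: v) (fun u' v' r h => ?_) (fun u' v' r h => ?_)
  · simp only [Module.End.mul_apply]
    rw [op_zero D (by simpa [Gen.bot] using h), op_zero D (by simpa [Gen.bot] using h)]; simp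
  · simp only [Module.End.mul_apply]
    rcases split₃ h with ⟨a, rfl, rfl⟩ | ⟨-, rfl, rfl⟩ | ⟨-, rfl, rfl⟩ | ⟨h, _⟩ | ⟨c, rfl, rfl⟩
    · have := D.rel (.br_br_bb n (u' ++ a) v)
      simp only [map_mul, ρ_ι, List.append_assoc, List.cons_append, List.nil_append] at this
      simp (disch := refine id ?_; simp) [op_left, op_left₁, -Finsupp.single_mul]
      simp only [← mul_assoc, this]
    · have h0 := D.rel (.br_dot n u' v)
      simp only [map_mul, ρ_ι] at h0
      have h1 := D.G_conj (D.X_r (.box u' (.br n) v)) h0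
      have h2 := D.r_idem_box (u' ++ red n :: black :: v) u' (.br n) v rfl
      have h3 := D.r_box_idem (u' ++ black :: red n :: v) u' (.br n) v rfl
      have h4 := D.ι_G (u' ++ red n :: black :: v) (u' ++ [red n]) v (by simp)
      have h5 := D.r_idem_idem (u' ++ red n :: black :: v)
      have h5' := D.r_idem_idem (u' ++ black :: red n :: v)
      simp (disch := refine id ?_; simp) [op_left, op_left₁, op_right', op_br, op_bb_left,
        -Finsupp.single_mul, mul_assoc,
        assoc₁ h2, assoc₁ h3, assoc₂ h4, assoc₁ h5, assoc₁ h5', assoc₂ h1]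
    · have h0 := D.rel (.br_dot n u v)
      simp only [map_mul, ρ_ι] at h0
      have h1 := D.G_conj (D.X_r (.box u (.br n) v)) h0
      have h2 := D.r_idem_box (u ++ red n :: black :: v) u (.br n) v rfl
      have h3 := D.r_box_idem (u ++ black :: red n :: v) u (.br n) v rfl
      have h4 := D.ι_G (u ++ red n :: black :: v) (u ++ [red n]) v (by simp)
      have h5 := D.r_idem_idem (u ++ red n :: black :: v)
      have h5' := D.r_idem_idem (u ++ black :: red n :: v)
      simp (disch := refine id ?_; simp) [op_left, op_left₁, op_right', op_br, op_bb_right,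
        -Finsupp.single_mul, mul_assoc,
        assoc₁ h2, assoc₁ h3, assoc₂ h4, assoc₁ h5, assoc₁ h5', assoc₂ h1]
    · cases h
    · have := D.rel (.br_br_bb n u (c ++ v'))
      simp only [map_mul, ρ_ι, List.append_assoc, List.cons_append, List.nil_append] at this
      simp (disch := refine id ?_; simp) [op_right, op_right₁, -Finsupp.single_mul]
      simp only [← mul_assoc, this]

end MarkData

end Marked

/-! ### The mixed relation and the nail relations -/

section Marked

variable {k : Type u} [CommRing k] {N : List ℕ} {b : ℕ} {R : Type u} [Ring R] [Algebra k R]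

namespace MarkData

variable (D : MarkData k N b R)

/-- Expansion of `(x - d)⁻¹ (xⁿ - dⁿ)` as a geometric sum. -/
lemma G_geom (u v : Word) (n : ℕ) (y : R) :
    D.G u v * (D.X ^ n * y) = D.G u v * (D.r (.box u .dot v) ^ n * y) +
      ∑ i ∈ Finset.range n, D.X ^ i * (D.r (.box u .dot v) ^ (n - 1 - i) * y) := by
  have h : Commute D.X (D.r (.box u .dot v)) := D.X_r _
  have := h.mul_geom_sum₂ n
  have e : D.G u v * (D.X ^ n - D.r (.box u .dot v) ^ n) =
      ∑ i ∈ Finset.range n, D.X ^ i * D.r (.box u .dot v) ^ (n - 1 - i) := by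
    rw [← this, ← mul_assoc, r, D.G_mul, one_mul]
  rw [← sub_eq_iff_eq_add', ← mul_sub, ← sub_mul, ← mul_assoc, e, Finset.sum_mul]
  simp only [mul_assoc]

lemma G_geom' (u v : Word) (n : ℕ) (y : R) :
    D.X ^ n * (D.G u v * y) = D.G u v * (D.r (.box u .dot v) ^ n * y) +
      ∑ i ∈ Finset.range n, D.X ^ (n - 1 - i) * (D.r (.box u .dot v) ^ i * y) := by
  rw [assoc₂ (D.X_pow_G n _ _), G_geom, ← Finset.sum_range_reflect]
  congr 1
  refine Finset.sum_congr rfl fun i hi => ?_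
  rw [Finset.mem_range] at hi
  rw [show n - 1 - (n - 1 - i) = i by omega]

/-- The two divided differences on both sides differ by the factors `xⁿ` and `dⁿ`, whose difference
over `x - d` is the sum of the correction terms. -/
lemma op_rb_bb_br (n : ℕ) (u v : Word) :
    D.op (.box u (.rb n) (black :: v)) * D.op (.box (u ++ [red n]) .bb v) *
      D.op (.box u (.br n) (black :: v)) =
    D.op (.box (u ++ [black]) (.br n) v) * D.op (.box u .bb (red n :: v)) *
      D.op (.box (u ++ [black]) (.rb n) v) +
    ∑ i ∈ Finset.range n, D.op (.box u .dot (red n :: black :: v)) ^ i *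
      D.op (.box (u ++ [black, red n]) .dot v) ^ (n - 1 - i) *
      D.op (.idem (u ++ [black, red n, black] ++ v)) := by
  refine ext_bot (u ++ black :: red n :: black :: v) (fun u' v' r h => ?_) (fun u' v' r h => ?_)
  · simp only [Module.End.mul_apply, LinearMap.add_apply, LinearMap.sum_apply]
    rw [op_zero D (by simpa [Gen.bot] using h), op_zero D (by simpa [Gen.bot] using h)]
    simp only [op_zero D (show (Gen.idem (u ++ [black, red n,
      black] ++ v)).bot ≠ _ by simpa [Gen.bot] using h)]
    simp
  · simp only [Module.End.mul_apply, LinearMap.add_apply, LinearMap.sum_apply]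
    rcases split₃ h with ⟨a, rfl, rfl⟩ | ⟨-, rfl, rfl⟩ | ⟨h, _⟩ | ⟨-, rfl, rfl⟩ | ⟨c, rfl, rfl⟩
    · have := D.rel (.rb_bb_br n (u' ++ a) v)
      simp only [map_mul, map_add, map_sum, map_pow, ρ_ι, List.append_assoc, List.cons_append,
        List.nil_append] at this
      have e1 := fun m => D.op_left_dot_pow m u' (a ++ [black,
          red n]) v u' (a ++ black :: red n :: black :: v) rfl (by simp)
      simp (disch := refine id ?_; simp) [op_left, op_left₁, op_left_dot_pow, op_idem_single,
        -Finsupp.single_mul, e1, ← mul_assoc, this]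
      simp only [← Finsupp.single_finsetSum, ← Finsupp.single_add, mul_assoc, add_mul,
        Finset.sum_mul]
    · have h0 := D.rel (.br_rb n u' v)
      simp only [map_mul, map_pow, ρ_ι, List.append_assoc, List.cons_append, List.nil_append] at h0
      have h00 := D.rel (.br_dot n u' v)
      simp only [map_mul, ρ_ι] at h00
      have h1 := D.G_conj (D.X_r (.box u' (.br n) v)) h00
      have h2 := D.r_idem_box (u' ++ black :: red n :: v) u' (.rb n) v rfl
      have h3 := D.r_box_idem (u' ++ red n :: black :: v) u' (.rb n) v rfl
      have h4 := D.ι_G (u' ++ red n :: black :: v) (u' ++ [red n]) v (by simp)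
      have h5 := D.r_idem_idem (u' ++ red n :: black :: v)
      have h5' := D.r_idem_idem (u' ++ black :: red n :: v)
      have h7 := D.X_pow_r n (.idem (u' ++ red n :: black :: v))
      have e1 := fun m => D.op_left_dot_pow m u' [red n] v u' (red n :: black :: v) rfl rfl
      have e2 : ∀ m x, (D.X * D.r (.idem (u' ++ red n :: black :: v))) ^ m *
          (D.r (.box (u' ++ [red n]) .dot v) ^ (n - 1 -
            m) * (D.r (.idem (u' ++ red n :: black :: v)) * x)) =
          D.X ^ m *
          (D.r (.box (u' ++ [red n]) .dot v) ^ (n - 1 -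
            m) * (D.r (.idem (u' ++ red n :: black :: v)) * x)) := by
        intro m x
        have : Commute (D.r (.idem (u' ++ red n :: black :: v)))
            (D.r (.box (u' ++ [red n]) .dot v)) := by
          unfold Commute SemiconjBy
          rw [r_idem_box _ _ _ _ _ (by simp), r_box_idem _ _ _ _ _ (by simp)]
        rw [← assoc₂ (this.pow_right _), X_mul_idem_pow]
      simp (disch := refine id ?_; simp) [op_left, op_left₁, op_right', op_br, op_rb, op_bb_left,
        op_dot_pow, op_idem_single, -Finsupp.single_mul, mul_assoc,
        assoc₁ h2, assoc₁ h3, assoc₂ h4, assoc₁ h5, assoc₁ h5', assoc₂ h1, assoc₁ h0, e1, e2,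
          ← assoc₂ h7,
        ← assoc₂ (D.X_pow_G n _ _).symm, G_geom, ← Finsupp.single_finsetSum]
      abel
    · cases h
    · have h0 := D.rel (.rb_br n u v')
      simp only [map_mul, map_pow, ρ_ι, List.append_assoc, List.cons_append, List.nil_append] at h0
      have h00 := D.rel (.dot_rb n u v')
      simp only [map_mul, ρ_ι] at h00
      have h1 := D.G_conj (D.X_r (.box u (.rb n) v')) h00.symm
      have h00' := D.rel (.br_dot n u v')
      simp only [map_mul, ρ_ι] at h00'
      have h1' := D.G_conj (D.X_r (.box u (.br n) v')) h00'
      have h2 := D.r_idem_box (u ++ red n :: black :: v') u (.br n) v' rfl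
      have h3 := D.r_box_idem (u ++ black :: red n :: v') u (.br n) v' rfl
      have h4 := D.ι_G (u ++ black :: red n :: v') u (red n :: v') (by simp)
      have h4' := D.ι_G (u ++ red n :: black :: v') (u ++ [red n]) v' (by simp)
      have h5 := D.r_idem_idem (u ++ red n :: black :: v')
      have h5' := D.r_idem_idem (u ++ black :: red n :: v')
      have h6 := D.X_pow_r n (.box u (.br n) v')
      have h7 := D.X_pow_r n (.idem (u ++ black :: red n :: v'))
      have e1 := fun m => D.op_right_dot_pow m u [red n] v' (u ++ [black, red n]) v' rfl rfl
      simp only [List.cons_append, List.nil_append] at e1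
      have e2 : ∀ m m' x, D.r (.box u .dot (red n :: v')) ^ m *
          ((D.X * D.r (.idem (u ++ black :: red n :: v'))) ^ m' *
           (D.r (.idem (u ++ black :: red n :: v')) * x)) =
          D.X ^ m' *
          (D.r (.box u .dot (red n :: v')) ^ m * (D.r (.idem (u ++ black :: red n :: v')) * x)) :=
            by
        intro m m' x
        rw [X_mul_idem_pow, assoc₂ (Commute.pow_pow (D.X_r (.box u .dot (red n :: v'))).symm _ _).eq]
      simp (disch := refine id ?_; simp) [op_left, op_left₁, op_right', op_br, op_rb, op_bb_right,
        op_dot_pow, op_idem_single, -Finsupp.single_mul, mul_assoc,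
        assoc₁ h2, assoc₁ h3, assoc₂ h4, assoc₂ h4', assoc₁ h5, assoc₁ h5', assoc₂ h1, assoc₂ h1',
          assoc₁ h0, e1, e2, ← assoc₂ h6, ← assoc₂ h7,
        ← assoc₂ (D.X_pow_G n _ _), ← Finsupp.single_finsetSum]
      simp only [D.G_geom' u (red n :: v'), Finsupp.single_add]
      abel
    · have := D.rel (.rb_bb_br n u (c ++ v'))
      simp only [map_mul, map_add, map_sum, map_pow, ρ_ι, List.append_assoc, List.cons_append,
        List.nil_append] at this
      have e1 := fun m => D.op_right_dot_pow m u (red n :: black :: c) v' (u ++ black :: red n :: black :: c) v' rfl rfl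
      simp only [List.cons_append] at e1
      simp (disch := refine id ?_; simp) [op_right, op_right₁, op_right_dot_pow, op_idem_single,
        -Finsupp.single_mul, e1, ← mul_assoc, this]
      simp only [← Finsupp.single_finsetSum, ← Finsupp.single_add, mul_assoc, add_mul,
        Finset.sum_mul]

lemma r_nail_box (l : Loc) (m v s t : Word) (hs : s = m ++ (l.tgt ++ v)) (ht : t =
    m ++ (l.src ++ v)) :
    D.r (.nail s) * D.r (.box (black :: m) l v) = D.r (.box (black :: m) l v) * D.r (.nail t) := by
  subst hs ht
  simpa only [map_mul, ρ_ι, List.append_assoc] using D.rel (.nail_box l m v)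

lemma nail_G (m v s : Word) (h : s = m ++ black :: v) :
    D.r (.nail s) * D.G (black :: m) v = D.G (black :: m) v * D.r (.nail s) :=
  D.G_conj (D.X_r _) (D.r_nail_box .dot m v _ _ h h)

lemma op_nail_box (l : Loc) (m v : Word) :
    D.op (.nail (m ++ l.tgt ++ v)) * D.op (.box (black :: m) l v) =
      D.op (.box (black :: m) l v) * D.op (.nail (m ++ l.src ++ v)) := by
  refine ext_bot (black :: m ++ (l.src ++ v)) (fun u' v' r h => ?_) (fun u' v' r h => ?_)
  · simp only [Module.End.mul_apply]
    rw [op_zero D (by simpa [Gen.bot] using h), op_zero D (by simpa [Gen.bot] using h)]; simp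
  · simp only [Module.End.mul_apply]
    rcases split_box h with ⟨a, h1, rfl⟩ | ⟨rfl, rfl, rfl⟩ | ⟨rfl, rfl, rfl⟩ | ⟨rfl, rfl, rfl⟩ |
      ⟨n, rfl, rfl, rfl⟩ | ⟨n, rfl, rfl, rfl⟩ | ⟨c, rfl, rfl⟩
    · cases u' with
      | nil =>
        obtain rfl : m = a := by simpa using h1
        have e := D.op_left [] m l v [] _ rfl rfl
        simp only [List.nil_append] at e
        have h2 := D.ω_r_box m l v
        have h3 := D.r_idem_box (m ++ (l.tgt ++ v)) m l v rfl
        have h4 := D.r_box_idem (m ++ (l.src ++ v)) m l v rfl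
        simp (disch := refine id ?_; simp) [op_nail_nil, e, -Finsupp.single_mul, mul_assoc,
          assoc₁ h3, ← assoc₂ h2, assoc₁ h4]
      | cons s u =>
        obtain ⟨rfl, rfl⟩ : black = s ∧ m = u ++ black :: a := by simpa using h1
        have e := D.op_left (black :: u) a l v (black :: u) _ rfl rfl
        simp only [List.cons_append] at e
        have h2 := D.r_nail_box l (u ++ a) v _ _ rfl rfl
        simp only [List.append_assoc] at h2
        simp (disch := refine id ?_; simp) [op_nail_cons, e, -Finsupp.single_mul, assoc₂ h2]
    · have h1 := D.r_nail_box .dot m v' _ _ rfl rfl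
      have h2 := D.r_idem_nail (black :: (m ++ v')) (m ++ v') rfl
      have h3 := D.r_nail_idem (black :: (m ++ v')) (m ++ v') rfl
      have h4 := D.X_r (.nail (m ++ v'))
      simp (disch := refine id ?_; simp) [op_nail_cons, op_dot, -Finsupp.single_mul, mul_assoc,
        assoc₁ h2, assoc₁ h3, ← assoc₂ h4]
    · have h1 := D.nail_G m v _ rfl
      have h2 := D.r_idem_nail (black :: (m ++ black :: v)) (m ++ black :: v) rfl
      have h3 := D.r_nail_idem (black :: (m ++ black :: v)) (m ++ black :: v) rfl
      have e := fun u' v' => D.op_nail_cons (m ++ [black]) v u' v'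
      simp only [List.append_assoc, List.cons_append, List.nil_append] at e
      simp (disch := refine id ?_; simp) [op_nail_cons, op_bb_left, e, -Finsupp.single_mul,
        mul_assoc, assoc₁ h2, assoc₁ h3, assoc₂ h1]
    · have h1 := D.nail_G m v' _ rfl
      have h2 := D.r_idem_nail (black :: (m ++ black :: v')) (m ++ black :: v') rfl
      have h3 := D.r_nail_idem (black :: (m ++ black :: v')) (m ++ black :: v') rfl
      have e := fun u' v'' => D.op_nail_cons (m ++ [black]) v' u' v''
      simp only [List.append_assoc, List.cons_append, List.nil_append] at e
      simp (disch := refine id ?_; simp) [op_nail_cons, op_bb_right, e, -Finsupp.single_mul,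
        mul_assoc, assoc₁ h2, assoc₁ h3, assoc₂ h1]
    · have h2 := D.r_idem_nail (black :: (m ++ red n :: v)) (m ++ red n :: v) rfl
      have h3 := D.r_nail_idem (black :: (m ++ red n :: v)) (m ++ red n :: v) rfl
      have e := fun u' v' => D.op_nail_cons (m ++ [red n]) v u' v'
      simp only [List.append_assoc, List.cons_append, List.nil_append] at e
      simp (disch := refine id ?_; simp) [op_nail_cons, op_br, e, -Finsupp.single_mul, mul_assoc,
        assoc₁ h2, assoc₁ h3]
    · have h2 := D.r_idem_nail (black :: (m ++ red n :: v')) (m ++ red n :: v') rfl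
      have h3 := D.r_nail_idem (black :: (m ++ red n :: v')) (m ++ red n :: v') rfl
      have h4 := D.X_pow_r n (.nail (m ++ red n :: v'))
      have e := fun u' v'' => D.op_nail_cons (m ++ [red n]) v' u' v''
      simp only [List.append_assoc, List.cons_append, List.nil_append] at e
      simp (disch := refine id ?_; simp) [op_nail_cons, op_rb, e, -Finsupp.single_mul, mul_assoc,
        assoc₁ h2, assoc₁ h3, ← assoc₂ h4]
    · have e := fun u' v'' => D.op_nail_cons (m ++ (l.src ++ c)) v' u' v''
      have e' := fun u' v'' => D.op_nail_cons (m ++ (l.tgt ++ c)) v' u' v''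
      simp only [List.append_assoc, List.cons_append, List.nil_append] at e e'
      have h2 := D.r_nail_box l m (c ++ v') _ _ rfl rfl
      simp (disch := refine id ?_; simp) [op_right, e, e', -Finsupp.single_mul, assoc₂ h2]

lemma op_nail_dot (v : Word) :
    D.op (.nail v) * D.op (.box [] .dot v) = D.op (.box [] .dot v) * D.op (.nail v) := by
  refine ext_bot (black :: v) (fun u' v' r h => ?_) (fun u' v' r h => ?_)
  · simp only [Module.End.mul_apply]
    rw [op_zero D (by simpa [Gen.bot] using h), op_zero D (by simpa [Gen.bot] using h)]; simp
  · simp only [Module.End.mul_apply]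
    cases u' with
    | nil =>
      obtain rfl : v = v' := by simpa using h
      have h1 := D.r_idem_idem v
      have h2 := D.X_r (.idem v)
      have h3 := D.ω_r_idem v
      have h4 := D.X_ω
      simp (disch := refine id ?_; simp) [op_nail_nil, op_dot, -Finsupp.single_mul, mul_assoc,
        ← assoc₂ h3, assoc₁ h1, ← assoc₂ h2, assoc₂ h4]
    | cons s u =>
      obtain ⟨rfl, rfl⟩ : black = s ∧ v = u ++ black :: v' := by simpa using h
      have h1 := D.rel (.nail_dot (u ++ v'))
      simp only [map_mul, ρ_ι] at h1
      simp (disch := refine id ?_; simp) [op_nail_cons, op_right, -Finsupp.single_mul, assoc₂ h1]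

lemma r_nail_nail (v : Word) : D.r (.nail v) * D.r (.nail v) = 0 := by
  simpa only [map_mul, ρ_ι, map_zero] using D.rel (.nail_nail v)

lemma op_nail_nail (v : Word) : D.op (.nail v) * D.op (.nail v) = 0 := by
  refine ext_bot (black :: v) (fun u' v' r h => ?_) (fun u' v' r h => ?_)
  · simp only [Module.End.mul_apply]
    rw [op_zero D (by simpa [Gen.bot] using h)]; simp
  · simp only [Module.End.mul_apply]
    cases u' with
    | nil =>
      obtain rfl : v = v' := by simpa using h
      have h3 := D.ω_r_idem v
      have h4 := D.ω_ω
      simp (disch := refine id ?_; simp) [op_nail_nil, -Finsupp.single_mul, mul_assoc,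
        ← assoc₂ h3, assoc₁ h4]
    | cons s u =>
      obtain ⟨rfl, rfl⟩ : black = s ∧ v = u ++ black :: v' := by simpa using h
      have h1 := D.rel (.nail_nail (u ++ v'))
      simp only [map_mul, ρ_ι, map_zero] at h1
      simp (disch := refine id ?_; simp) [op_nail_cons, -Finsupp.single_mul, assoc₁ h1]

lemma r_nail_G (v : Word) : D.r (.nail v) * D.G [] v = D.G [] v * D.r (.nail v) :=
  D.G_conj (D.X_r _) (by simpa only [map_mul, ρ_ι] using D.rel (.nail_dot v))

/-- When one of the two strands is marked, both sides are computed from the values of the crossing: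
the terms with two nails on the same strand vanish, and the others agree up to sign because `ω`
anticommutes with the nail on the unmarked strand. -/
lemma op_nail_bb (v : Word) :
    D.op (.box [] .bb v) * D.op (.nail (black :: v)) * D.op (.box [] .bb v) *
      D.op (.nail (black :: v)) =
      -(D.op (.nail (black :: v)) * D.op (.box [] .bb v) * D.op (.nail (black :: v)) *
        D.op (.box [] .bb v)) := by
  refine ext_bot (black :: black :: v) (fun u' v' r h => ?_) (fun u' v' r h => ?_)
  · simp only [Module.End.mul_apply, LinearMap.neg_apply]
    rw [op_zero D (by simpa [Gen.bot] using h), op_zero D (by simpa [Gen.bot] using h)]; simp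
  · simp only [Module.End.mul_apply, LinearMap.neg_apply]
    rcases split₂ (U := []) h with ⟨a, h1, rfl⟩ | ⟨-, rfl, rfl⟩ | ⟨-, rfl, rfl⟩ | ⟨c, rfl, rfl⟩
    · simp at h1
    · have h1 := D.r_nail_nail v
      have h2 := D.r_idem_idem (black :: v)
      have h3 := D.ω_r_idem (black :: v)
      have h4 := D.ω_ω
      have h5 := D.ω_r_nail v
      have h6 := D.r_idem_nail (black :: v) v rfl
      have h7 := D.r_nail_idem (black :: v) v rfl
      have h8 := D.r_nail_G v
      have h5' : ∀ y, D.r (.nail v) * (D.ω * y) = -(D.ω * (D.r (.nail v) * y)) := by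
        intro y; rw [← mul_assoc, ← mul_assoc, h5]; simp
      have h9 := D.ω_G [] v
      have h10 := D.ι_G (black :: v) [] v rfl
      have e := fun u' v'' => D.op_nail_cons [] v u' v''
      simp only [List.nil_append] at e
      simp (disch := refine id ?_; simp) [op_nail_nil, e, op_bb_left, op_bb_right,
        -Finsupp.single_mul,
        mul_assoc, ← assoc₂ h3, assoc₁ h2, assoc₁ h4, assoc₂ h10, assoc₁ h6, assoc₁ h7, assoc₂ h8,
        assoc₂ h9, h5', assoc₁ h1]
      exact add_comm _ _
    · have h1 := D.r_nail_nail v'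
      have h2 := D.r_idem_idem (black :: v')
      have h3 := D.ω_r_idem (black :: v')
      have h4 := D.ω_ω
      have h5 := D.ω_r_nail v'
      have h5' : ∀ y, D.r (.nail v') * (D.ω * y) = -(D.ω * (D.r (.nail v') * y)) := by
        intro y; rw [← mul_assoc, ← mul_assoc, h5]; simp
      have h6 := D.r_idem_nail (black :: v') v' rfl
      have h7 := D.r_nail_idem (black :: v') v' rfl
      have h8 := D.r_nail_G v'
      have h9 := D.ω_G [] v'
      have h10 := D.ι_G (black :: v') [] v' rfl
      have e := fun u' v'' => D.op_nail_cons [] v' u' v''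
      simp only [List.nil_append] at e
      simp (disch := refine id ?_; simp) [op_nail_nil, e, op_bb_left, op_bb_right,
        -Finsupp.single_mul,
        mul_assoc, ← assoc₂ h3, assoc₁ h2, assoc₁ h4, assoc₂ h10, assoc₁ h6, assoc₁ h7, assoc₂ h8,
        assoc₂ h9, h5', assoc₁ h1]
      exact add_comm _ _
    · have h1 := D.rel (.nail_bb (c ++ v'))
      simp only [map_mul, ρ_ι, map_neg] at h1
      have e := fun u' v'' => D.op_nail_cons (black :: c) v' u' v''
      simp only [List.cons_append] at e
      simp (disch := refine id ?_; simp) [e, op_right, -Finsupp.single_mul]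
      simp only [← mul_assoc, h1, neg_mul, Finsupp.single_neg]

end MarkData

end Marked

/-! ### The representation on words with a marked strand -/

section Marked

variable {k : Type u} [CommRing k] {N : List ℕ} {b : ℕ} {R : Type u} [Ring R] [Algebra k R]

lemma mark_mem_words {u v : Word} : u ++ black :: v ∈ words N (b + 1) ↔ u ++ v ∈ words N b := by
  simp [mem_words, labels, ← add_assoc]

/-- A family of elements of a corner. -/
def cornerGen {S : Type u} [Ring S] {e : S} (he : IsIdempotentElem e)
    (f : Gen → S) (hl : ∀ g, e * f g = f g) (hr : ∀ g, f g * e = f g) (g : Gen) : he.Corner :=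
  ⟨f g, (Subsemigroup.mem_corner_iff he).2 ⟨hl g, hr g⟩⟩

/-- The extension of a family `f` of elements of a corner of `S` to the free algebra. -/
noncomputable def cornerFree {S : Type u} [Ring S] [Algebra k S] {e : S} (he : IsIdempotentElem e)
    (f : Gen → S) (hl : ∀ g, e * f g = f g) (hr : ∀ g, f g * e = f g) :
    FreeAlgebra k Gen →ₐ[k] he.Corner :=
  FreeAlgebra.lift k (cornerGen he f hl hr)

section

variable {S : Type u} [Ring S] [Algebra k S] {e : S} (he : IsIdempotentElem e)
    (f : Gen → S) (hl : ∀ g, e * f g = f g) (hr : ∀ g, f g * e = f g)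
    (h : ∀ F : FreeAlgebra k Gen →ₙₐ[k] S, (∀ g, F (gen g) = f g) → F 1 = e →
      ∀ x y, Rel N b x y → F x = F y)

lemma cornerFree_gen (g : Gen) : (cornerFree (k := k) he f hl hr (gen g)).1 = f g :=
  congrArg (cornerVal he) (FreeAlgebra.lift_ι_apply (cornerGen he f hl hr) g)

lemma cornerFree_rel (h : ∀ F : FreeAlgebra k Gen →ₙₐ[k] S, (∀ g, F (gen g) = f g) → F 1 = e →
      ∀ x y, Rel N b x y → F x = F y) ⦃x y : FreeAlgebra k Gen⦄ (hxy : Rel N b x y) :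
    cornerFree he f hl hr x = cornerFree he f hl hr y :=
  cornerVal_injective he (h
    { toFun := fun x => (cornerFree he f hl hr x).1
      map_smul' := fun c x => by rw [map_smul]; rfl
      map_zero' := by rw [map_zero]; rfl
      map_add' := fun x y => by rw [map_add]; rfl
      map_mul' := fun x y => by rw [map_mul]; rfl }
    (cornerFree_gen he f hl hr)
    (by
      change (cornerFree he f hl hr 1).1 = _
      rw [map_one]; rfl) x y hxy)

/-- A non-unital homomorphism on the algebra, from operators in a corner satisfying the
relations. -/
noncomputable def cornerLift : Alg k N b →ₙₐ[k] S where
  toFun x := (RingQuot.liftAlgHom k ⟨cornerFree he f hl hr, cornerFree_rel he f hl hr h⟩ x).1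
  map_smul' := fun c x => by rw [map_smul]; rfl
  map_zero' := by rw [map_zero]; rfl
  map_add' := fun x y => by rw [map_add]; rfl
  map_mul' := fun x y => by rw [map_mul]; rfl

lemma cornerLift_gen (g : Gen) : cornerLift he f hl hr h (proj k N b (gen g)) = f g :=
  (congrArg (cornerVal he)
    (RingQuot.liftAlgHom_mkAlgHom_apply k _ (cornerFree_rel he f hl hr h) _)).trans
    (cornerFree_gen he f hl hr g)

lemma cornerLift_one : cornerLift he f hl hr h 1 = e :=
  congrArg (cornerVal he) (map_one (RingQuot.liftAlgHom k
    ⟨cornerFree he f hl hr, cornerFree_rel he f hl hr h⟩))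

end

namespace MarkData

variable (D : MarkData k N b R)

lemma op_idem_zero {w : Word} (h : w ∉ words N (b + 1)) : D.op (.idem w) = 0 := by
  refine ext_bot w (fun u v r h => ⟨op_zero D (g := .idem w) h r, rfl⟩) fun u v r hw => ?_
  subst hw
  rw [op_idem_single _ _ _ _ rfl, r_idem_zero _ (by rwa [mark_mem_words] at h)]; simp

lemma op_idem_mul {w w' : Word} (h : w ≠ w') : D.op (.idem w) * D.op (.idem w') = 0 := by
  refine ext_bot w' (fun u v r h => ?_) fun u v r hw => ?_
  · rw [Module.End.mul_apply, op_zero D (g := .idem w') h]; simp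
  · rw [Module.End.mul_apply, op_idem_single _ _ _ _ hw, op_zero D (g := .idem w) (hw ▸ h)]; rfl

/-- The sum of the operators of all the vertical diagrams. -/
noncomputable def unit : Module.End k (MarkMod R) := ∑ w ∈ words N (b + 1), D.op (.idem w)

lemma op_mul_unit (g : Gen) : D.op g * D.unit = D.op g := by
  by_cases hw : g.bot ∈ words N (b + 1)
  · rw [unit, Finset.mul_sum, Finset.sum_eq_single_of_mem _ hw, op_mul_bot]
    intro w' _ hne
    rw [← op_mul_bot D g, mul_assoc, op_idem_mul _ hne.symm, mul_zero]
  · rw [← op_mul_bot, op_idem_zero _ hw, mul_zero, zero_mul]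

lemma unit_mul_op (g : Gen) : D.unit * D.op g = D.op g := by
  by_cases hw : g.top ∈ words N (b + 1)
  · rw [unit, Finset.sum_mul, Finset.sum_eq_single_of_mem _ hw, op_top_mul]
    intro w' _ hne
    rw [← op_top_mul D g, ← mul_assoc, op_idem_mul _ hne, zero_mul]
  · rw [← op_top_mul, op_idem_zero _ hw, zero_mul, mul_zero]

lemma unit_idem : IsIdempotentElem D.unit := by
  change D.unit * D.unit = D.unit
  conv_lhs => rw [unit, Finset.sum_mul]
  exact Finset.sum_congr rfl fun w _ => D.op_mul_unit _

/-- The operators of the generating diagrams satisfy the defining relations of `T_{b+1}`. -/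
lemma rep_rel (F : FreeAlgebra k Gen →ₙₐ[k] Module.End k (MarkMod R)) (hF : ∀ g, F (gen g) = D.op g)
    (h1 : F 1 = D.unit) (x y : FreeAlgebra k Gen) (h : Rel N (b + 1) x y) : F x = F y := by
  have hp : ∀ (x y : FreeAlgebra k Gen) (n : ℕ), F (x ^ n * y) = F x ^ n * F y := fun x y n => by
    induction n with
    | zero => simp
    | succ n ih => rw [pow_succ', mul_assoc, map_mul, ih, pow_succ', mul_assoc]
  cases h with
  | idem_zero w h => rw [hF, map_zero]; exact D.op_idem_zero h
  | idem_mul w w' h => rw [map_mul, hF, hF, map_zero]; exact D.op_idem_mul h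
  | sum_idem => rw [map_sum, h1]; exact Finset.sum_congr rfl fun w _ => hF _
  | top_mul g => rw [map_mul, hF, hF]; exact D.op_top_mul g
  | mul_bot g => rw [map_mul, hF, hF]; exact D.op_mul_bot g
  | box_box l l' u m v => simpa [hF] using D.op_box_box l l' u m v
  | nail_box l m v => simpa [hF] using D.op_nail_box l m v
  | bb_bb u v => simpa [hF] using D.op_bb_bb u v
  | bb_braid u v => simpa [hF] using D.op_bb_braid u v
  | bb_dot u v => simpa [hF] using D.op_bb_dot u v
  | dot_bb u v => simpa [hF] using D.op_dot_bb u v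
  | dot_rb n u v => simpa [hF] using D.op_dot_rb n u v
  | br_dot n u v => simpa [hF] using D.op_br_dot n u v
  | br_rb n u v => rw [hp]; simpa [hF] using D.op_br_rb n u v
  | rb_br n u v => rw [hp]; simpa [hF] using D.op_rb_br n u v
  | bb_rb_rb n u v => simpa [hF] using D.op_bb_rb_rb n u v
  | br_br_bb n u v => simpa [hF] using D.op_br_br_bb n u v
  | rb_bb_br n u v =>
    have := D.op_rb_bb_br n u v
    simp only [mul_assoc] at this ⊢
    simp only [map_add, map_sum, hp]
    simpa [hF] using this
  | nail_dot v => simpa [hF] using D.op_nail_dot v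
  | nail_bb v => simpa [hF] using D.op_nail_bb v
  | nail_nail v => simpa [hF] using D.op_nail_nail v

/-- The representation of the algebra with one more black strand on the module of marked words. -/
noncomputable def rep : Alg k N (b + 1) →ₙₐ[k] Module.End k (MarkMod R) :=
  cornerLift D.unit_idem D.op D.unit_mul_op D.op_mul_unit D.rep_rel

lemma rep_gen (g : Gen) : D.rep (proj k N (b + 1) (gen g)) = D.op g := cornerLift_gen _ _ _ _ _ g

lemma rep_one : D.rep 1 = D.unit := cornerLift_one _ _ _ _ _

end MarkData

/-- Induction on the algebra: it is spanned by the products of generating diagrams. -/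
lemma alg_induction {P : Alg k N b → Prop} (one : P 1)
    (gen_mul : ∀ g x, P x → P (proj k N b (gen g) * x)) (add : ∀ x y, P x → P y → P (x + y))
    (smul : ∀ (c : k) x, P x → P (c • x)) (x : Alg k N b) : P x := by
  obtain ⟨x, rfl⟩ := proj_surjective (k := k) N b x
  suffices h : ∀ y : Alg k N b, P y → P (proj k N b x * y) by simpa using h 1 one
  induction x using FreeAlgebra.induction with
  | grade0 c => intro y hy; rw [AlgHom.commutes, ← Algebra.smul_def]; exact smul c y hy
  | grade1 g => intro y hy; exact gen_mul g y hy
  | mul a c ha hc => intro y hy; rw [map_mul, mul_assoc]; exact ha _ (hc _ hy)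
  | add a c ha hc => intro y hy; rw [map_add, add_mul]; exact add _ _ (ha _ hy) (hc _ hy)

lemma alg_induction' {P : Alg k N b → Prop} (one : P 1)
    (mul_gen : ∀ g x, P x → P (x * proj k N b (gen g))) (add : ∀ x y, P x → P y → P (x + y))
    (smul : ∀ (c : k) x, P x → P (c • x)) (x : Alg k N b) : P x := by
  obtain ⟨x, rfl⟩ := proj_surjective (k := k) N b x
  suffices h : ∀ y : Alg k N b, P y → P (y * proj k N b x) by simpa using h 1 one
  induction x using FreeAlgebra.induction with
  | grade0 c => intro y hy; rw [AlgHom.commutes, ← Algebra.commutes,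
      ← Algebra.smul_def]; exact smul c y hy
  | grade1 g => intro y hy; exact mul_gen g y hy
  | mul a c ha hc => intro y hy; rw [map_mul, ← mul_assoc]; exact hc _ (ha _ hy)
  | add a c ha hc => intro y hy; rw [map_add, mul_add]; exact add _ _ (ha _ hy) (hc _ hy)

namespace MarkData

variable (D : MarkData k N b R)

lemma rmul_op (g : Gen) (r : R) (z : MarkMod R) :
    D.op g (rmul (k := k) r z) = rmul (k := k) r (D.op g z) := by
  induction z using Finsupp.induction_linear with
  | zero => simp
  | add x y hx hy => rw [map_add, map_add, hx, hy, map_add, map_add]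
  | single i a =>
    rw [rmul_single, ← Prod.mk.eta (p := i), op_single, op_single]
    ext j; simp [rmul, mul_assoc]

lemma rmul_rep (y : Alg k N (b + 1)) (r : R) (z : MarkMod R) :
    D.rep y (rmul (k := k) r z) = rmul (k := k) r (D.rep y z) := by
  induction y using alg_induction generalizing z with
  | one => simp [rep_one, unit, rmul_op]
  | gen_mul g x ih => rw [map_mul, Module.End.mul_apply, ih, rep_gen, rmul_op]; rfl
  | add x y hx hy => rw [map_add, LinearMap.add_apply, hx, hy, ← map_add]; rfl
  | smul c x hx => rw [map_smul, LinearMap.smul_apply, hx, LinearMap.smul_apply, ← map_smul]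

end MarkData

end Marked

/-! ### Coefficients in matrices of series -/

section Series

variable {B : Type u} [Ring B]

/-- The series `(x - d)⁻¹ = ∑ d ^ n x ^ (-n-1)`, in the variable `x⁻¹`. -/
noncomputable def geo (d : B) : HahnSeries ℤ B :=
  HahnSeries.ofSuppBddBelow (fun m : ℤ => if 1 ≤ m then d ^ (m - 1).toNat else 0)
    ⟨1, fun m hm => by
      by_contra h
      exact hm (if_neg h)⟩

lemma coeff_geo (d : B) (m : ℤ) :
    (geo d).coeff m = if 1 ≤ m then d ^ (m - 1).toNat else 0 := rfl

/-- The variable `x`, whose inverse is the variable of the Hahn series. -/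
noncomputable abbrev xvar (B : Type u) [Ring B] : HahnSeries ℤ B := HahnSeries.single (-1) 1

lemma coeff_xvar_mul (z : HahnSeries ℤ B) (m : ℤ) : (xvar B * z).coeff m = z.coeff (m + 1) := by
  rw [HahnSeries.coeff_single_mul, one_mul, sub_neg_eq_add]

lemma coeff_mul_xvar (z : HahnSeries ℤ B) (m : ℤ) : (z * xvar B).coeff m = z.coeff (m + 1) := by
  rw [HahnSeries.coeff_mul_single, mul_one, sub_neg_eq_add]

lemma coeff_mul_C (z : HahnSeries ℤ B) (d : B) (m : ℤ) :
    (z * HahnSeries.C d).coeff m = z.coeff m * d := HahnSeries.coeff_mul_single_zero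

lemma coeff_C_mul (z : HahnSeries ℤ B) (d : B) (m : ℤ) :
    (HahnSeries.C d * z).coeff m = d * z.coeff m := HahnSeries.coeff_single_zero_mul

lemma geo_aux (d : B) (m : ℤ) : (geo d).coeff (m + 1) - (geo d).coeff m * d =
    (1 : HahnSeries ℤ B).coeff m := by
  rw [coeff_geo, coeff_geo, HahnSeries.coeff_one]
  rcases lt_trichotomy m 0 with h | rfl | h
  · rw [if_neg (by omega), if_neg (by omega), if_neg (by omega)]; simp
  · simp
  · rw [if_pos (by omega), if_pos (by omega), if_neg (by omega), ← pow_succ,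
      show (m + 1 - 1).toNat = (m - 1).toNat + 1 by omega, sub_self]

lemma geo_comm (d : B) (m : ℤ) : d * (geo d).coeff m = (geo d).coeff m * d := by
  rw [coeff_geo]; split_ifs
  · rw [← pow_succ, ← pow_succ']
  · simp

lemma geo_mul (d : B) : geo d * (xvar B - HahnSeries.C d) = 1 := by
  ext m
  rw [mul_sub, HahnSeries.coeff_sub, coeff_mul_xvar, coeff_mul_C, geo_aux]

lemma mul_geo (d : B) : (xvar B - HahnSeries.C d) * geo d = 1 := by
  ext m
  rw [sub_mul, HahnSeries.coeff_sub, coeff_xvar_mul, coeff_C_mul, geo_comm, geo_aux]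

lemma coeff_geo_mul (d : B) (z : HahnSeries ℤ B) (m : ℤ) :
    (geo d * z).coeff (m + 1) = z.coeff m + d * (geo d * z).coeff m := by
  have h := congrArg (fun w => (w * z).coeff m) (mul_geo d)
  simp only [one_mul, mul_assoc, sub_mul, HahnSeries.coeff_sub, coeff_xvar_mul, coeff_C_mul] at h
  rw [eq_add_of_sub_eq h]

end Series

section Concrete

variable (k : Type u) [CommRing k] (N : List ℕ) (b : ℕ)

/-- The automorphism changing the sign of the diagrams with an odd number of nails. -/
noncomputable def sg : Alg k N b →ₐ[k] Alg k N b := (T k N b).tw 1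

variable {k N b}

lemma sg_gen (g : Gen) : sg k N b (proj k N b (gen g)) = sgn g.deg.1 • proj k N b (gen g) := by
  have := (T k N b).tw_of_mem 1 (gen_mem k N b g)
  rwa [one_mul] at this

lemma sg_idem (w : Word) : sg k N b (proj k N b (idem w)) = proj k N b (idem w) := by
  rw [sg_gen]; simp [Gen.deg, sgn_zero]

lemma sg_box (u : Word) (l : Loc) (v : Word) :
    sg k N b (proj k N b (box l u v)) = proj k N b (box l u v) := by
  rw [sg_gen]; cases l <;> simp [Gen.deg, Loc.deg, sgn_zero]

lemma sg_nail (v : Word) : sg k N b (proj k N b (nail v)) = -proj k N b (nail v) := by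
  rw [sg_gen]; simp [Gen.deg, sgn_one]

lemma sg_sg (a : Alg k N b) : sg k N b (sg k N b a) = a := (T k N b).tw_tw_self 1 a

/-- The coefficient ring: matrices of size two over the series in `x⁻¹` over `T_b`. The second basis
vector records that the marked strand has met the nail. -/
abbrev Coef (k : Type u) [CommRing k] (N : List ℕ) (b : ℕ) : Type u :=
  Matrix (Fin 2) (Fin 2) (HahnSeries ℤ (Alg k N b))

variable (k N b)

/-- The diagonal embedding of `T_b`, twisted in the second entry by the automorphism `sg`, so that
the nail on the marked strand anticommutes with the other nails. -/
noncomputable def coefHom : Alg k N b →ₐ[k] Coef k N b where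
  toFun a := !![HahnSeries.C a, 0; 0, HahnSeries.C (sg k N b a)]
  map_one' := by simp [Matrix.one_fin_two]
  map_mul' x y := by simp [Matrix.mul_fin_two]
  map_zero' := by ext i j; fin_cases i <;> fin_cases j <;> simp
  map_add' x y := by ext i j; fin_cases i <;> fin_cases j <;> simp
  commutes' c := by
    ext i j; fin_cases i <;> fin_cases j <;>
      simp [Matrix.algebraMap_matrix_apply, HahnSeries.algebraMap_apply]

/-- A dot on the marked strand acts by the variable `x`, the nail by a nilpotent matrix, and the
inverse of `x - d` is expanded in powers of `x⁻¹`. -/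
noncomputable def markData : MarkData k N b (Coef k N b) where
  ρ := coefHom k N b
  X := !![xvar _, 0; 0, xvar _]
  ω := !![0, 0; 1, 0]
  G u v := !![geo (proj k N b (dot u v)), 0; 0, geo (proj k N b (dot u v))]
  X_ρ a := by simp [coefHom]
  X_ω := by simp
  ω_ω := by
    rw [Matrix.mul_fin_two]; ext i j; fin_cases i <;> fin_cases j <;> simp
  ω_idem w := by simp [coefHom, sg_idem]
  ω_box u l v := by simp [coefHom, sg_box]
  ω_nail v := by
    simp only [coefHom, AlgHom.coe_mk, RingHom.coe_mk, MonoidHom.coe_mk, OneHom.coe_mk, sg_nail]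
    ext i j; fin_cases i <;> fin_cases j <;> simp [Matrix.mul_apply]
  G_mul u v := by
    simp [coefHom, sg_box, Matrix.one_fin_two]
    exact geo_mul _
  mul_G u v := by
    simp [coefHom, sg_box, Matrix.one_fin_two]
    exact mul_geo _

end Concrete

/-! ### Coefficients of diagrams -/

section Marked

variable {k : Type u} [CommRing k] {N : List ℕ} {b : ℕ} {R : Type u} [Ring R] [Algebra k R]

/-- The crossing moving a black strand to the right through the strand `s`. -/
def right : Strand → Loc
  | black => .bb
  | red n => .br n

/-- The crossing moving a black strand to the left through the strand `s`. -/
def left : Strand → Loc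
  | black => .bb
  | red n => .rb n

@[simp] lemma src_right (s : Strand) : (right s).src = [black, s] := by cases s <;> rfl
@[simp] lemma tgt_right (s : Strand) : (right s).tgt = [s, black] := by cases s <;> rfl
@[simp] lemma src_left (s : Strand) : (left s).src = [s, black] := by cases s <;> rfl
@[simp] lemma tgt_left (s : Strand) : (left s).tgt = [black, s] := by cases s <;> rfl

variable (k N b) in
/-- The diagram in which the black strand between `u` and `v` moves to the very right. -/
noncomputable def cross (u : Word) : Word → Alg k N b
  | [] => proj k N b (idem (u ++ [black]))
  | s :: v => cross (u ++ [s]) v * proj k N b (box (right s) u v)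

variable (k N b) in
/-- The diagram in which the black strand between `p ++ u` and `v` moves to the left of `u`. -/
noncomputable def uncross (p : Word) : Word → Word → Alg k N b
  | [], v => proj k N b (idem (p ++ black :: v))
  | s :: u, v => proj k N b (box (left s) p (u ++ v)) * uncross (p ++ [s]) u v

variable (k N b) in
/-- The diagram in which the black strand between `u` and `v` moves to the very left, is nailed,
carries `l` dots, and then moves to the very right. -/
noncomputable def loop (u v : Word) (l : ℕ) : Alg k N b :=
  cross k N b [] (u ++ v) * proj k N b (dot [] (u ++ v)) ^ l * proj k N b (nail (u ++ v)) *
    uncross k N b [] u v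

variable (k N b) in
/-- The diagram in which the black strand between `u` and `v` carries `l` dots and moves to the very
right. -/
noncomputable def direct (u v : Word) (l : ℕ) : Alg k N b :=
  cross k N b u v * proj k N b (dot u v) ^ l

/-- The elements with coefficients in `S`, supported on the set `s` of marked words. -/
def within (s : Set (Word × Word)) (S : Submodule k R) : Submodule k (MarkMod R) where
  carrier := {z | ∀ i, z i ∈ S ∧ (i ∉ s → z i = 0)}
  zero_mem' i := ⟨S.zero_mem, fun _ => rfl⟩
  add_mem' hx hy i := ⟨S.add_mem (hx i).1 (hy i).1, fun h => by
    rw [Finsupp.add_apply, (hx i).2 h, (hy i).2 h, add_zero]⟩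
  smul_mem' c x hx i := ⟨S.smul_mem c (hx i).1, fun h => by
    rw [Finsupp.smul_apply, (hx i).2 h, smul_zero]⟩

lemma single_mem_within {s : Set (Word × Word)} {S : Submodule k R} {i : Word × Word} {r : R}
    (hi : i ∈ s) (hr : r ∈ S) : Finsupp.single i r ∈ within s S := by
  intro j
  rcases eq_or_ne i j with rfl | h
  · rw [Finsupp.single_eq_same]; exact ⟨hr, fun h => absurd hi h⟩
  · rw [Finsupp.single_eq_of_ne h.symm]; exact ⟨S.zero_mem, fun _ => rfl⟩

lemma within_mono {s t : Set (Word × Word)} {S S' : Submodule k R} (h : s ⊆ t) (hS : S ≤ S')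
    {z : MarkMod R} (hz : z ∈ within s S) : z ∈ within t S' :=
  fun i => ⟨hS (hz i).1, fun hi => (hz i).2 fun hs => hi (h hs)⟩

lemma map_within {s : Set (Word × Word)} {S : Submodule k R} {M : Type u} [AddCommGroup M]
    [Module k M] (T : Submodule k M) (F : MarkMod R →ₗ[k] M)
    (h : ∀ u v, (u, v) ∈ s → ∀ r ∈ S, F (Finsupp.single (u, v) r) ∈ T) {z : MarkMod R}
    (hz : z ∈ within s S) : F z ∈ T := by
  rw [← Finsupp.sum_single z, Finsupp.sum, map_sum]
  refine sum_mem fun i hi => h _ _ ?_ _ (hz i).1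
  by_contra hs
  exact (Finsupp.mem_support_iff.1 hi) ((hz i).2 hs)

namespace MarkData

variable (D : MarkData k N b R)

/-- The sum of the coefficients of the words in which the marked strand is the last one. -/
noncomputable def total : MarkMod R →ₗ[k] R :=
  ∑ w ∈ words N b, (LinearMap.mulLeft k (D.r (.idem w))) ∘ₗ Finsupp.lapply (w, [])

lemma total_apply (z : MarkMod R) : D.total z = ∑ w ∈ words N b, D.r (.idem w) * z (w, []) := by
  simp [total]

lemma total_rmul (r : R) (z : MarkMod R) : D.total (rmul (k := k) r z) = D.total z * r := by
  simp [total_apply, rmul, Finset.sum_mul, mul_assoc]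

lemma total_single_ne (u v : Word) (h : v ≠ []) (r : R) : D.total (Finsupp.single (u, v) r) = 0 :=
    by
  rw [total_apply]
  refine Finset.sum_eq_zero fun w _ => ?_
  rw [Finsupp.single_eq_of_ne (by rintro ⟨⟩; exact h rfl), mul_zero]

lemma total_single (w : Word) (r : R) :
    D.total (Finsupp.single (w, []) r) = D.r (.idem w) * r := by
  rw [total_apply]
  by_cases hw : w ∈ words N b
  · rw [Finset.sum_eq_single_of_mem w hw, Finsupp.single_eq_same]
    intro w' _ hne
    rw [Finsupp.single_eq_of_ne (by rintro ⟨⟩; exact hne rfl), mul_zero]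
  · rw [r_idem_zero _ hw, zero_mul]
    refine Finset.sum_eq_zero fun w' hw' => ?_
    rw [Finsupp.single_eq_of_ne (by rintro ⟨⟩; exact hw hw'), mul_zero]

lemma total_zero {S : Submodule k R} {s : Set (Word × Word)} (hs : ∀ i ∈ s, i.2 ≠ [])
    {z : MarkMod R} (hz : z ∈ within s S) : D.total z = 0 := by
  rw [total_apply]
  refine Finset.sum_eq_zero fun w _ => ?_
  rw [(hz (w, [])).2 fun h => hs _ h rfl, mul_zero]

lemma total_mem {S : Subalgebra k R} (hρ : ∀ a, D.ρ a ∈ S) {s : Set (Word × Word)}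
    {z : MarkMod R} (hz : z ∈ within s S.toSubmodule) : D.total z ∈ S := by
  rw [total_apply]
  exact sum_mem fun w _ => S.mul_mem (hρ _) (hz _).1

lemma op_app_last (g : Gen) (r : R) :
    D.op g.app (Finsupp.single (g.bot, []) r) = Finsupp.single (g.top, []) (D.r g * r) := by
  cases g with
  | idem w => simpa [Gen.app, Gen.bot, Gen.top,
      -Finsupp.single_mul] using D.op_idem w [] w [] rfl rfl r
  | box u l v =>
    simpa [Gen.app, Gen.bot, Gen.top, -Finsupp.single_mul] using D.op_right u l v [] _ _ rfl rfl r
  | nail v =>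
    simpa [Gen.app, Gen.bot, Gen.top, -Finsupp.single_mul] using D.op_nail_cons v [] _ _ rfl rfl r

lemma op_app_ne (g : Gen) (u v : Word) (h : v ≠ []) (r : R) :
    D.op g.app (Finsupp.single (u, v) r) ∈ within (k := k) {i | i.2 ≠ []} (⊤ : Submodule k R) := by
  by_cases hb : g.app.bot = u ++ black :: v
  swap
  · rw [op_zero _ hb]; exact zero_mem _
  cases g with
  | idem w =>
    rw [Gen.app, op_idem_single _ _ _ _ (by exact hb)]
    exact single_mem_within h trivial
  | box U l V =>
    simp only [Gen.app, Gen.bot, List.append_assoc] at hb ⊢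
    rcases split_box hb with ⟨a, rfl, rfl⟩ | ⟨rfl, rfl, rfl⟩ | ⟨rfl, rfl, rfl⟩ | ⟨rfl, rfl, rfl⟩ |
        ⟨n, rfl, rfl, rfl⟩ | ⟨n, rfl, rfl, rfl⟩ | ⟨c, h1, rfl⟩
    · rw [op_left _ _ _ _ _ _ _ rfl rfl]; exact single_mem_within (by simp) trivial
    · rw [op_dot _ _ _ _ _ rfl rfl]; exact single_mem_within (by simp) trivial
    · rw [op_bb_left _ _ _ _ _ rfl rfl]
      exact add_mem (single_mem_within (by simp) trivial) (single_mem_within (by simp) trivial)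
    · rw [op_bb_right _ _ _ _ _ rfl rfl]
      exact add_mem (single_mem_within (by simp) trivial) (single_mem_within (by simp) trivial)
    · rw [op_br _ _ _ _ _ _ rfl rfl]; exact single_mem_within (by simp) trivial
    · rw [op_rb _ _ _ _ _ _ rfl rfl]; exact single_mem_within (by simp) trivial
    · rw [h1, op_right _ _ _ _ _ _ _ rfl rfl]; exact single_mem_within h trivial
  | nail V =>
    simp only [Gen.app, Gen.bot] at hb ⊢
    cases u with
    | nil =>
      obtain rfl : V ++ [black] = v := by simpa using hb
      rw [op_nail_nil _ _ _ rfl]; exact single_mem_within h trivial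
    | cons s u =>
      obtain ⟨rfl, h1⟩ : black = s ∧ V ++ [black] = u ++ black :: v := by simpa using hb
      rw [h1, op_nail_cons _ _ _ _ _ rfl rfl]; exact single_mem_within h trivial

lemma total_op_app (g : Gen) (z : MarkMod R) : D.total (D.op g.app z) = D.r g * D.total z := by
  induction z using Finsupp.induction_linear with
  | zero => simp
  | add x y hx hy => rw [map_add, map_add, hx, hy, map_add, mul_add]
  | single i r =>
    obtain ⟨u, v⟩ := i
    by_cases h : v = []
    · subst h
      rw [total_single]
      by_cases hb : g.bot = u
      · subst hb
        rw [op_app_last, total_single, ← mul_assoc, r_top, ← mul_assoc, r_bot]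
      · rw [op_zero _ (by rw [bot_app]; simpa using hb), map_zero, ← D.r_bot g, mul_assoc]
        have : D.r (.idem g.bot) * D.r (.idem u) = 0 := by
          simpa only [map_mul, ρ_ι, map_zero] using D.rel (.idem_mul _ _ hb)
        rw [← mul_assoc (D.r (.idem _)), this, zero_mul, mul_zero]
    · rw [D.total_zero (fun i hi => hi) (D.op_app_ne g u v h r), total_single_ne _ _ _ h, mul_zero]

lemma total_lastIdem (z : MarkMod R) : D.total (D.rep (lastIdem k N b) z) = D.total z := by
  rw [lastIdem, map_sum, LinearMap.sum_apply, map_sum]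
  have : ∀ w ∈ words N b, D.total (D.rep (proj k N (b + 1) (idem (w ++ [black]))) z) =
      D.r (.idem w) * D.total z := fun w _ => by
    rw [rep_gen]; exact D.total_op_app (.idem w) z
  rw [Finset.sum_congr rfl this, ← Finset.sum_mul]
  have h : ∑ w ∈ words N b, D.r (.idem w) = 1 := by
    simpa only [map_sum, map_one, ρ_ι] using D.rel .sum_idem
  rw [h, one_mul]

lemma total_add (a : Alg k N b) (z : MarkMod R) :
    D.total (D.rep (addStrand k N b a) z) = D.ρ a * D.total z := by
  induction a using alg_induction generalizing z with
  | one => rw [addStrand_one, total_lastIdem, map_one, one_mul]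
  | gen_mul g x ih =>
    rw [map_mul, map_mul, Module.End.mul_apply, addStrand_gen, rep_gen, total_op_app, ih, map_mul,
      mul_assoc]; rfl
  | add x y hx hy =>
    rw [map_add, map_add, LinearMap.add_apply, map_add, hx, hy, map_add, add_mul]
  | smul c x hx => rw [map_smul, map_smul, LinearMap.smul_apply, map_smul, hx, map_smul,
      smul_mul_assoc]

/-- The action of `y` on the word `i.1 ++ black :: i.2` whose black strand between `i.1` and `i.2`
is marked, projected to the words in which the marked strand is the last one. It is linear over
`T_b` by `coeff_add`. -/
noncomputable def coeff (i : Word × Word) (y : Alg k N (b + 1)) : R :=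
  D.total (D.rep y (Finsupp.single i 1))

lemma coeff_add (i : Word × Word) (a : Alg k N b) (y : Alg k N (b + 1)) :
    D.coeff i (addStrand k N b a * y) = D.ρ a * D.coeff i y := by
  rw [coeff, map_mul, Module.End.mul_apply, total_add, coeff]

/-- A local piece at the right of the marked strand does not move it. -/
lemma op_box_lt (U : Word) (l : Loc) (V u v : Word) (h : u.length < U.length) (r : R) :
    D.op (.box U l V) (Finsupp.single (u, v) r) ∈
      within (k := k) {i | i.1.length = u.length ∧ i.2 ≠ []} (⊤ : Submodule k R) := by
  by_cases hb : (Gen.box U l V).bot = u ++ black :: v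
  swap
  · rw [op_zero _ hb]; exact zero_mem _
  simp only [Gen.bot, List.append_assoc] at hb
  rcases split_box hb with ⟨a, rfl, rfl⟩ | ⟨rfl, rfl, rfl⟩ | ⟨rfl, rfl, rfl⟩ | ⟨rfl, rfl, rfl⟩ |
      ⟨n, rfl, rfl, rfl⟩ | ⟨n, rfl, rfl, rfl⟩ | ⟨c, h1, rfl⟩
  · rw [op_left _ _ _ _ _ _ _ rfl rfl]; exact single_mem_within (by cases l <;> simp) trivial
  all_goals simp at h

/-- If the mark starts at the left of the moving strand, it does not arrive at the very right. -/
lemma rep_cross_lt (n : ℕ) (v p : Word) (hp : n ≤ p.length) {z : MarkMod R}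
    (hz : z ∈ within (k := k) {i | i.1.length < n} (⊤ : Submodule k R)) :
    D.rep (cross k N (b + 1) p v) z ∈ within (k := k) {i | i.2 ≠ []} (⊤ : Submodule k R) := by
  induction v generalizing p z with
  | nil =>
    rw [cross, rep_gen]
    refine map_within _ _ (fun u v h r hr => ?_) hz
    by_cases hb : p ++ [black] = u ++ black :: v
    · rw [op_idem_single _ _ _ _ hb]
      refine single_mem_within (fun hv => ?_) trivial
      have := congrArg List.length hb
      simp only [show v = [] from hv, List.length_append, List.length_cons, List.length_nil] at this
      exact absurd h (by simp; omega)
    · rw [op_zero _ (by exact hb)]; exact zero_mem _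
  | cons s v ih =>
    rw [cross, map_mul, Module.End.mul_apply]
    refine ih _ (by simp; omega) ?_
    rw [rep_gen]
    refine map_within _ _ (fun u v' h r hr => ?_) hz
    refine within_mono ?_ le_rfl (D.op_box_lt _ _ _ u v' (lt_of_lt_of_le h hp) r)
    rintro i ⟨h1, h2⟩
    exact (h1 ▸ h : i.1.length < n)

/-- Moving the marked strand to the very right multiplies by `1`, up to the words in which the mark
does not arrive there. -/
lemma rep_cross (v u : Word) (r : R) :
    D.rep (cross k N (b + 1) u v) (Finsupp.single (u, v) r) -
      Finsupp.single (u ++ v, []) (D.r (.idem (u ++ v)) * r) ∈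
      within (k := k) {i | i.2 ≠ []} (⊤ : Submodule k R) := by
  induction v generalizing u r with
  | nil =>
    rw [cross, rep_gen, op_idem_single _ _ _ _ rfl, List.append_nil, sub_self]
    exact zero_mem _
  | cons s v ih =>
    rw [cross, map_mul, Module.End.mul_apply, rep_gen]
    have h2 := D.r_idem_idem (u ++ s :: v)
    have ih := ih (u ++ [s])
    simp only [List.append_assoc, List.cons_append, List.nil_append] at ih
    cases s with
    | black =>
      rw [right, op_bb_left _ _ _ _ _ rfl rfl, map_add, add_sub_assoc]
      refine add_mem ?_ ?_
      · exact (D.rep_cross_lt (u.length + 1) v _ (by simp)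
          (single_mem_within (by simp) trivial))
      · have := ih (D.r (.idem (u ++ black :: v)) * r)
        rwa [assoc₁ h2] at this
    | red n =>
      rw [right, op_br _ _ _ _ _ _ rfl rfl]
      have := ih (D.r (.idem (u ++ red n :: v)) * r)
      rwa [assoc₁ h2] at this

lemma total_rep_cross (v u : Word) (r : R) :
    D.total (D.rep (cross k N (b + 1) u v) (Finsupp.single (u, v) r)) =
      D.r (.idem (u ++ v)) * r := by
  have := D.total_zero (fun i hi => hi) (D.rep_cross v u r)
  rw [map_sub, total_single, assoc₁ (D.r_idem_idem _), sub_eq_zero] at this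
  exact this

/-- The subalgebra `S` contains all the coefficients except the value of the nail on the marked
strand. -/
structure IsEven (S : Subalgebra k R) : Prop where
  ρ_mem : ∀ a, D.ρ a ∈ S
  X_mem : D.X ∈ S
  G_mem : ∀ u v, D.G u v ∈ S

variable {D} {S : Subalgebra k R}

lemma IsEven.op_box_mem (hS : D.IsEven S) (U : Word) (l : Loc) (V : Word) {z : MarkMod R}
    (hz : z ∈ within Set.univ S.toSubmodule) :
    D.op (.box U l V) z ∈ within Set.univ S.toSubmodule := by
  have hr : ∀ g, D.r g ∈ S := fun g => hS.ρ_mem _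
  refine map_within _ _ (fun u v h r hr' => ?_) hz
  by_cases hb : (Gen.box U l V).bot = u ++ black :: v
  swap
  · rw [op_zero _ hb]; exact zero_mem _
  simp only [Gen.bot, List.append_assoc] at hb
  rcases split_box hb with ⟨a, rfl, rfl⟩ | ⟨rfl, rfl, rfl⟩ | ⟨rfl, rfl, rfl⟩ | ⟨rfl, rfl, rfl⟩ |
      ⟨n, rfl, rfl, rfl⟩ | ⟨n, rfl, rfl, rfl⟩ | ⟨c, rfl, rfl⟩
  · rw [op_left _ _ _ _ _ _ _ rfl rfl]; exact single_mem_within trivial (S.mul_mem (hr _) hr')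
  · rw [op_dot _ _ _ _ _ rfl rfl]
    exact single_mem_within trivial (S.mul_mem (S.mul_mem hS.X_mem (hr _)) hr')
  · rw [op_bb_left _ _ _ _ _ rfl rfl]
    exact add_mem (single_mem_within trivial (S.mul_mem (S.mul_mem (hS.G_mem _ _) (hr _)) hr'))
      (single_mem_within trivial (S.mul_mem (hr _) hr'))
  · rw [op_bb_right _ _ _ _ _ rfl rfl]
    exact add_mem (single_mem_within trivial (S.mul_mem (S.neg_mem (S.mul_mem (S.mul_mem (hS.G_mem _ _)
      (hS.G_mem _ _)) (hr _))) hr'))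
      (single_mem_within trivial (S.mul_mem (S.neg_mem (S.mul_mem (hS.G_mem _ _) (hr _))) hr'))
  · rw [op_br _ _ _ _ _ _ rfl rfl]; exact single_mem_within trivial (S.mul_mem (hr _) hr')
  · rw [op_rb _ _ _ _ _ _ rfl rfl]
    exact single_mem_within trivial (S.mul_mem (S.mul_mem (S.pow_mem hS.X_mem _) (hr _)) hr')
  · rw [op_right _ _ _ _ _ _ _ rfl rfl]; exact single_mem_within trivial (S.mul_mem (hr _) hr')

lemma IsEven.op_idem_mem (hS : D.IsEven S) {s : Set (Word × Word)} (w : Word) {z : MarkMod R}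
    (hz : z ∈ within s S.toSubmodule) : D.op (.idem w) z ∈ within s S.toSubmodule := by
  refine map_within _ _ (fun u v h r hr' => ?_) hz
  by_cases hb : w = u ++ black :: v
  · rw [op_idem_single _ _ _ _ hb]; exact single_mem_within h (S.mul_mem (hS.ρ_mem _) hr')
  · rw [op_zero _ (by exact hb)]; exact zero_mem _

lemma IsEven.rep_cross_mem (hS : D.IsEven S) (v p : Word) {z : MarkMod R}
    (hz : z ∈ within Set.univ S.toSubmodule) :
    D.rep (cross k N (b + 1) p v) z ∈ within Set.univ S.toSubmodule := by
  induction v generalizing p z with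
  | nil => rw [cross, rep_gen]; exact hS.op_idem_mem _ hz
  | cons s v ih =>
    rw [cross, map_mul, Module.End.mul_apply, rep_gen]
    exact ih _ (hS.op_box_mem _ _ _ hz)

lemma far_mono {m n : ℕ} (h : n ≤ m) {S : Submodule k R} {z : MarkMod R}
    (hz : z ∈ within {i | m ≤ i.1.length} S) : z ∈ within {i | n ≤ i.1.length} S :=
  within_mono (fun _ hi => le_trans h hi) le_rfl hz

/-- A local piece at the left of the marked strand does not move it. -/
lemma IsEven.op_box_far (hS : D.IsEven S) (n : ℕ) (U : Word) (l : Loc) (V : Word)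
    (hl : l.src.length = l.tgt.length)
    (hn : U.length + l.src.length ≤ n) {z : MarkMod R}
    (hz : z ∈ within {i | n ≤ i.1.length} S.toSubmodule) :
    D.op (.box U l V) z ∈ within {i | n ≤ i.1.length} S.toSubmodule := by
  refine map_within _ _ (fun u v h r hr' => ?_) hz
  by_cases hb : (Gen.box U l V).bot = u ++ black :: v
  swap
  · rw [op_zero _ hb]; exact zero_mem _
  simp only [Gen.bot, List.append_assoc] at hb
  simp only [Set.mem_ofPred_eq] at h
  rcases split_box hb with ⟨a, rfl, rfl⟩ | ⟨rfl, rfl, rfl⟩ | ⟨rfl, rfl, rfl⟩ | ⟨rfl, rfl, rfl⟩ |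
      ⟨n, rfl, rfl, rfl⟩ | ⟨n, rfl, rfl, rfl⟩ | ⟨c, rfl, rfl⟩
  case inr.inr.inr.inr.inr.inr =>
    rw [op_right _ _ _ _ _ _ _ rfl rfl]
    exact single_mem_within (by simpa [← hl] using h) (S.mul_mem (hS.ρ_mem _) hr')
  all_goals simp at h hn
  all_goals omega

lemma IsEven.rep_uncross_far (hS : D.IsEven S) (u v p : Word) {z : MarkMod R}
    (hz : z ∈ within {i | p.length + u.length + 1 ≤ i.1.length} S.toSubmodule) :
    D.rep (uncross k N (b + 1) p u v) z ∈ within {i | p.length + 1 ≤ i.1.length} S.toSubmodule := by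
  induction u generalizing p z with
  | nil => rw [uncross, rep_gen]; exact hS.op_idem_mem _ hz
  | cons s u ih =>
    rw [uncross, map_mul, Module.End.mul_apply, rep_gen]
    refine far_mono (m := p.length + 2) (by omega) (hS.op_box_far _ _ _ _ (by simp) (by simp) ?_)
    have := ih (p ++ [s]) (z := z) (by
      convert hz using 4; simp; omega)
    simpa [add_assoc] using this

variable (D) in
/-- The factor by which the marked strand is multiplied when it moves to the left of `u`. -/
noncomputable def uncrossCoeff (p : Word) : Word → Word → R
  | [], v => D.r (.idem (p ++ v))
  | black :: u, v => -(D.G p (u ++ v) * D.G p (u ++ v) * uncrossCoeff (p ++ [black]) u v)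
  | red n :: u, v => D.X ^ n * uncrossCoeff (p ++ [red n]) u v

lemma idem_uncrossCoeff (u v p w : Word) (hw : w = p ++ (u ++ v)) :
    D.r (.idem w) * D.uncrossCoeff p u v = D.uncrossCoeff p u v := by
  subst hw
  induction u generalizing p with
  | nil => exact D.r_idem_idem _
  | cons s u ih =>
    have ih := ih (p ++ [s])
    simp only [List.append_assoc, List.cons_append, List.nil_append] at ih
    cases s with
    | black =>
      simp only [uncrossCoeff, List.cons_append, mul_neg, mul_assoc]
      rw [assoc₂ (D.ι_G _ _ _ rfl), assoc₂ (D.ι_G _ _ _ rfl), ih]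
    | red n =>
      simp only [uncrossCoeff, List.cons_append]
      rw [← assoc₂ (D.X_pow_r n _), ih]

lemma IsEven.uncrossCoeff_mem (hS : D.IsEven S) (u v p : Word) : D.uncrossCoeff p u v ∈ S := by
  induction u generalizing p with
  | nil => exact hS.ρ_mem _
  | cons s u ih =>
    cases s with
    | black => exact S.neg_mem (S.mul_mem (S.mul_mem (hS.G_mem _ _) (hS.G_mem _ _)) (ih _))
    | red n => exact S.mul_mem (S.pow_mem hS.X_mem _) (ih _)

/-- Moving the marked strand to the left of `u` multiplies it by `uncrossCoeff`, up to the words in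
which the mark does not arrive at the left of `u`. -/
lemma IsEven.rep_uncross (hS : D.IsEven S) (u v p : Word) {r : R} (hr : r ∈ S) :
    D.rep (uncross k N (b + 1) p u v) (Finsupp.single (p ++ u, v) r) -
      Finsupp.single (p, u ++ v) (D.uncrossCoeff p u v * r) ∈
      within {i | p.length + 1 ≤ i.1.length} S.toSubmodule := by
  induction u generalizing p with
  | nil =>
    rw [uncross, rep_gen,
      op_idem_single _ _ _ _ (by simp), List.append_nil, uncrossCoeff, List.nil_append, sub_self]
    exact zero_mem _
  | cons s u ih =>
    have ih := ih (p ++ [s])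
    simp only [List.append_assoc, List.cons_append, List.nil_append] at ih
    have hZ := hS.uncrossCoeff_mem u v (p ++ [s])
    have hι := D.idem_uncrossCoeff u v (p ++ [s]) (p ++ s :: (u ++ v)) (by simp)
    rw [uncross, map_mul, Module.End.mul_apply, rep_gen]
    have h1 := hS.op_box_far (p.length + 2) p (left s) (u ++ v) (by simp) (by simp)
      (z := _) (by simpa [add_assoc, -Finsupp.single_mul] using ih)
    have h2 : D.op (.box p (left s) (u ++ v)) (Finsupp.single (p ++ [s], u ++ v)
          (D.uncrossCoeff (p ++ [s]) u v * r)) -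
        Finsupp.single (p, s :: (u ++ v)) (D.uncrossCoeff p (s :: u) v * r) ∈
        within {i | p.length + 1 ≤ i.1.length} S.toSubmodule := by
      cases s with
      | black =>
        rw [left, op_bb_right _ _ _ _ _ rfl rfl, uncrossCoeff]
        simp only [neg_mul, mul_assoc, assoc₁ hι, add_sub_cancel_left]
        exact single_mem_within (by simp) (S.neg_mem (S.mul_mem (hS.G_mem _ _) (S.mul_mem hZ hr)))
      | red n =>
        rw [left, op_rb _ _ _ _ _ _ rfl rfl, uncrossCoeff]
        simp only [mul_assoc, assoc₁ hι, sub_self]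
        exact zero_mem _
    rw [map_sub] at h1
    have h3 := add_mem (far_mono (n := p.length + 1) (by omega) h1) h2
    rwa [sub_add_sub_cancel] at h3

lemma IsEven.op_nail_far (hS : D.IsEven S) (V : Word) {z : MarkMod R}
    (hz : z ∈ within {i | 1 ≤ i.1.length} S.toSubmodule) :
    D.op (.nail V) z ∈ within {i | 1 ≤ i.1.length} S.toSubmodule := by
  refine map_within _ _ (fun u v h r hr' => ?_) hz
  by_cases hb : (Gen.nail V).bot = u ++ black :: v
  swap
  · rw [op_zero _ hb]; exact zero_mem _
  cases u with
  | nil => simp at h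
  | cons s u =>
    obtain ⟨rfl, rfl⟩ : black = s ∧ V = u ++ black :: v := by simpa [Gen.bot] using hb
    rw [op_nail_cons _ _ _ _ _ rfl rfl]
    exact single_mem_within (by simp) (S.mul_mem (hS.ρ_mem _) hr')

lemma rep_pow (y : Alg k N (b + 1)) (n : ℕ) (z : Alg k N (b + 1)) :
    D.rep (y ^ n * z) = D.rep y ^ n * D.rep z := by
  induction n with
  | zero => simp
  | succ n ih => rw [pow_succ', mul_assoc, map_mul, ih, pow_succ', mul_assoc]

lemma pow_mem_within {s : Set (Word × Word)} {S : Submodule k R} {F : Module.End k (MarkMod R)}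
    (hF : ∀ z ∈ within s S, F z ∈ within s S) (n : ℕ) {z : MarkMod R} (hz : z ∈ within s S) :
    (F ^ n) z ∈ within s S := by
  induction n with
  | zero => exact hz
  | succ n ih => rw [pow_succ', Module.End.mul_apply]; exact hF _ ih

/-- If the mark starts at the right of the strand which turns around, then it does not pass through
the nail. -/
lemma IsEven.loop_far (hS : D.IsEven S) (u v : Word) (l : ℕ) {z : MarkMod R}
    (hz : z ∈ within {i | u.length + 1 ≤ i.1.length} S.toSubmodule) :
    D.rep (loop k N (b + 1) u v l) z ∈ within Set.univ S.toSubmodule := by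
  rw [loop, mul_assoc, mul_assoc, map_mul, rep_pow, map_mul, rep_gen, rep_gen]
  simp only [Module.End.mul_apply]
  refine hS.rep_cross_mem _ _ (within_mono (Set.subset_univ {i | 1 ≤ i.1.length}) le_rfl ?_)
  refine pow_mem_within (fun z hz => hS.op_box_far _ _ _ _ rfl (by simp) hz) _ ?_
  exact hS.op_nail_far _ (by simpa using hS.rep_uncross_far u v [] (by simpa using hz))

/-- The coefficient of the loop at the marked strand itself: the factor collected on the way to the
left, the dots and the nail. Only this part passes through the nail. -/
lemma IsEven.total_loop (hS : D.IsEven S) (u v : Word) (l : ℕ) {r : R} (hr : r ∈ S) :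
    D.total (D.rep (loop k N (b + 1) u v l) (Finsupp.single (u, v) r)) -
      D.ω * D.X ^ l * D.uncrossCoeff [] u v * r ∈ S := by
  rw [loop, mul_assoc, mul_assoc, map_mul, rep_pow, map_mul, rep_gen, rep_gen]
  simp only [Module.End.mul_apply]
  have h := hS.rep_uncross u v [] hr
  have h1 := pow_mem_within (fun z hz => hS.op_box_far 1 [] .dot (u ++ v) rfl (by simp) hz) l
    (hS.op_nail_far (u ++ v) h)
  have h2 := D.total_mem hS.ρ_mem (hS.rep_cross_mem (u ++ v) []
    (within_mono (Set.subset_univ _) le_rfl h1))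
  have hι := D.idem_uncrossCoeff u v [] _ rfl
  simp only [List.nil_append] at h2 hι
  rw [map_sub, op_nail_nil _ _ _ rfl, map_sub, op_dot_pow _ _ _ _ _ _ rfl rfl, map_sub, map_sub,
    total_rep_cross] at h2
  convert h2 using 2
  simp only [List.nil_append, mul_assoc, assoc₁ hι]
  rw [← assoc₁ hι, assoc₂ (D.ω_r_idem _), X_mul_idem_pow, ← assoc₂ (D.X_pow_r _ _),
    assoc₁ (D.r_idem_idem _), ← assoc₂ (D.ω_r_idem _), assoc₁ hι]
  exact assoc₂ (Commute.pow_left D.X_ω l).symm _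

lemma direct_lt (u v u' v' : Word) (l : ℕ) (h : u'.length < u.length) (r : R) :
    D.total (D.rep (direct k N (b + 1) u v l) (Finsupp.single (u', v') r)) = 0 := by
  have h1 : (D.op (.box u .dot v) ^ l) (Finsupp.single (u', v') r) ∈
      within (k := k) {i | i.1.length < u.length} (⊤ : Submodule k R) := by
    refine pow_mem_within (fun z hz => map_within _ _ (fun u₁ v₁ h r hr => ?_) hz) _
      (single_mem_within h trivial)
    refine within_mono ?_ le_rfl (D.op_box_lt _ _ _ u₁ v₁ h r)
    rintro i ⟨h1, h2⟩
    exact (h1 ▸ h : i.1.length < u.length)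
  cases l with
  | zero =>
    rw [direct, pow_zero, mul_one]
    exact D.total_zero (fun i hi => hi) (D.rep_cross_lt u.length v u le_rfl h1)
  | succ l =>
    rw [direct, map_mul, pow_succ, rep_pow, Module.End.mul_apply, rep_gen, ← pow_succ]
    exact D.total_zero (fun i hi => hi) (D.rep_cross_lt u.length v u le_rfl h1)

lemma total_direct (u v : Word) (l : ℕ) (r : R) :
    D.total (D.rep (direct k N (b + 1) u v l) (Finsupp.single (u, v) r)) =
      D.X ^ l * D.r (.idem (u ++ v)) * r := by
  cases l with
  | zero => rw [direct, pow_zero, mul_one, total_rep_cross, pow_zero, one_mul]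
  | succ l =>
    rw [direct, map_mul, pow_succ, rep_pow, Module.End.mul_apply, rep_gen, ← pow_succ,
      op_dot_pow _ _ _ _ _ _ rfl rfl, total_rep_cross]
    have : ∀ n : ℕ, D.r (.idem (u ++ v)) * (D.X * D.r (.idem (u ++ v))) ^ n =
        D.X ^ n * D.r (.idem (u ++ v)) := fun n => by
      have := D.X_mul_idem_pow n (u ++ v) 1
      rw [mul_one] at this
      rw [← this]
      refine (Commute.pow_right ?_ n).eq
      unfold Commute SemiconjBy
      rw [← mul_assoc, ← D.X_r]
    rw [← mul_assoc, this]

lemma IsEven.direct_mem (hS : D.IsEven S) (u v : Word) (l : ℕ) {z : MarkMod R}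
    (hz : z ∈ within Set.univ S.toSubmodule) :
    D.rep (direct k N (b + 1) u v l) z ∈ within Set.univ S.toSubmodule := by
  cases l with
  | zero => rw [direct, pow_zero, mul_one]; exact hS.rep_cross_mem _ _ hz
  | succ l =>
    rw [direct, map_mul, pow_succ, rep_pow, Module.End.mul_apply, rep_gen, ← pow_succ]
    exact hS.rep_cross_mem _ _ (pow_mem_within (fun z hz => hS.op_box_mem _ _ _ hz) _ hz)

end MarkData

end Marked

/-! ### Linear independence -/

section Series

variable {B : Type u} [Ring B]

/-- The series `z` in `x⁻¹` is `c x⁻ᵐ` up to lower powers of `x`. The coefficient `c` may vanish. -/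
def IsLead (z : HahnSeries ℤ B) (m : ℤ) (c : B) : Prop :=
  z.coeff m = c ∧ ∀ m' < m, z.coeff m' = 0

lemma IsLead.geo {z : HahnSeries ℤ B} {m : ℤ} {c : B} (h : IsLead z m c) (d : B) :
    IsLead (geo d * z) (m + 1) c := by
  have h0 : ∀ m' ≤ m, (KLRW.geo d * z).coeff m' = 0 := by
    intro m' hm'
    rw [HahnSeries.coeff_mul]
    refine Finset.sum_eq_zero fun ij hij => ?_
    rw [Finset.mem_antidiagonal] at hij
    obtain ⟨h1, h2, h3⟩ := hij
    by_cases hi : 1 ≤ ij.1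
    · rw [h.2 _ (by omega), mul_zero]
    · rw [coeff_geo, if_neg hi, zero_mul]
  refine ⟨?_, fun m' hm' => h0 _ (by omega)⟩
  rw [coeff_geo_mul, h0 m le_rfl, mul_zero, add_zero, h.1]

lemma coeff_xvar_pow_mul (z : HahnSeries ℤ B) (l : ℕ) (m : ℤ) :
    (xvar B ^ l * z).coeff m = z.coeff (m + l) := by
  induction l generalizing m with
  | zero => simp
  | succ l ih => rw [pow_succ', mul_assoc, coeff_xvar_mul, ih]; congr 1; push_cast; ring

lemma IsLead.xvar_pow {z : HahnSeries ℤ B} {m : ℤ} {c : B} (h : IsLead z m c) (l : ℕ) :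
    IsLead (xvar B ^ l * z) (m - l) c := by
  refine ⟨?_, fun m' hm' => ?_⟩
  · rw [coeff_xvar_pow_mul, sub_add_cancel, h.1]
  · rw [coeff_xvar_pow_mul, h.2 _ (by omega)]

end Series

section Concrete

variable (k : Type u) [CommRing k] (N : List ℕ) (b : ℕ)

/-- The matrices whose lower left entry vanishes. They contain all the coefficients of the
representation except the matrix of the nail on the marked strand, so that the lower left entry
detects the loops. -/
def evenCoef : Subalgebra k (Coef k N b) where
  carrier := {M | M 1 0 = 0}
  mul_mem' {M P} hM hP := by
    simp only [Set.mem_ofPred_eq] at *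
    rw [Matrix.mul_apply, Fin.sum_univ_two, hM, hP, zero_mul, mul_zero, add_zero]
  add_mem' {M P} hM hP := by
    simp only [Set.mem_ofPred_eq] at *
    rw [Matrix.add_apply, hM, hP, add_zero]
  algebraMap_mem' c := by simp [Matrix.algebraMap_matrix_apply]

variable {k N b}

lemma mem_evenCoef {M : Coef k N b} : M ∈ evenCoef k N b ↔ M 1 0 = 0 := Iff.rfl

lemma isEven : (markData k N b).IsEven (evenCoef k N b) where
  ρ_mem a := by rw [mem_evenCoef]; rfl
  X_mem := by rw [mem_evenCoef]; rfl
  G_mem u v := by rw [mem_evenCoef]; rfl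

lemma ρ_mul_zero (a : Alg k N b) (M : Coef k N b) :
    ((markData k N b).ρ a * M) 0 0 = HahnSeries.C a * M 0 0 := by
  rw [Matrix.mul_apply, Fin.sum_univ_two]
  change HahnSeries.C a * _ + 0 * _ = _
  rw [zero_mul, add_zero]

lemma ρ_mul_one (a : Alg k N b) (M : Coef k N b) :
    ((markData k N b).ρ a * M) 1 0 = HahnSeries.C (sg k N b a) * M 1 0 := by
  rw [Matrix.mul_apply, Fin.sum_univ_two]
  change 0 * _ + HahnSeries.C (sg k N b a) * _ = _
  rw [zero_mul, zero_add]

lemma mul_ρ (a : Alg k N b) (M : Coef k N b) (i : Fin 2) :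
    (M * (markData k N b).ρ a) i 0 = M i 0 * HahnSeries.C a := by
  rw [Matrix.mul_apply, Fin.sum_univ_two]
  change _ * HahnSeries.C a + _ * 0 = _
  rw [mul_zero, add_zero]

lemma X_mul (M : Coef k N b) (i j : Fin 2) :
    ((markData k N b).X * M) i j = xvar _ * M i j := by
  rw [Matrix.mul_apply, Fin.sum_univ_two]
  fin_cases i
  · change xvar _ * M 0 j + 0 * M 1 j = xvar _ * M 0 j
    rw [zero_mul, add_zero]
  · change 0 * M 0 j + xvar _ * M 1 j = xvar _ * M 1 j
    rw [zero_mul, zero_add]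

lemma X_pow_mul (l : ℕ) (M : Coef k N b) (i j : Fin 2) :
    ((markData k N b).X ^ l * M) i j = xvar _ ^ l * M i j := by
  induction l with
  | zero => simp
  | succ l ih => rw [pow_succ', mul_assoc, X_mul, ih, ← mul_assoc, ← pow_succ']

lemma G_mul (u v : Word) (M : Coef k N b) (i j : Fin 2) :
    ((markData k N b).G u v * M) i j = geo (proj k N b (dot u v)) * M i j := by
  rw [Matrix.mul_apply, Fin.sum_univ_two]
  fin_cases i
  · change geo _ * M 0 j + 0 * M 1 j = geo _ * M 0 j
    rw [zero_mul, add_zero]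
  · change 0 * M 0 j + geo _ * M 1 j = geo _ * M 1 j
    rw [zero_mul, zero_add]

lemma ω_mul (M : Coef k N b) : ((markData k N b).ω * M) 1 0 = M 0 0 := by
  rw [Matrix.mul_apply, Fin.sum_univ_two]
  change 1 * M 0 0 + 0 * M 1 0 = _
  rw [one_mul, zero_mul, add_zero]

/-- The sum of the labels of the red strands. -/
def weight (w : Word) : ℤ := ((labels w).sum : ℤ)

lemma neg_mul_eq {B : Type u} [Ring B] (x y : B) : -(x * y) = x * -1 * y := by
  rw [mul_neg_one, neg_mul]

/-- The marked strand collects `-(x - d)⁻²` from each black strand and `xⁿ` from each red strand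
labelled `n` on its way to the left, which gives the leading term. -/
lemma lead_uncrossCoeff (u v p : Word) :
    IsLead ((markData k N b).uncrossCoeff p u v 0 0) (2 * (u.count black : ℤ) - weight u)
      ((-1) ^ u.count black * proj k N b (idem (p ++ (u ++ v)))) := by
  induction u generalizing p with
  | nil =>
    have : (markData k N b).uncrossCoeff p [] v 0 0 = HahnSeries.C (proj k N b (idem (p ++ v))) :=
        rfl
    rw [this]
    refine ⟨by simp [weight, labels], fun m' hm' => ?_⟩
    rw [HahnSeries.C_apply, HahnSeries.coeff_single_of_ne]
    have : m' < 0 := by simpa [weight, labels] using hm'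
    omega
  | cons s u ih =>
    have ih := ih (p ++ [s])
    simp only [List.append_assoc, List.cons_append, List.nil_append] at ih
    cases s with
    | black =>
      have h := ((ih.geo (proj k N b (dot p (u ++ v)))).geo (proj k N b (dot p (u ++ v))))
      have e : (markData k N b).uncrossCoeff p (black :: u) v 0 0 =
          -(geo (proj k N b (dot p (u ++ v))) * (geo (proj k N b (dot p (u ++ v))) *
            (markData k N b).uncrossCoeff (p ++ [black]) u v 0 0)) := by
        rw [MarkData.uncrossCoeff, Matrix.neg_apply, mul_assoc, G_mul, G_mul]
      rw [e]
      have e2 : (2 * ((black :: u).count black : ℤ) - weight (black :: u)) =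
          2 * (u.count black : ℤ) - weight u + 1 + 1 := by
        simp [weight, labels]; ring
      rw [e2]
      refine ⟨?_, fun m' hm' => ?_⟩
      · rw [HahnSeries.coeff_neg, h.1, List.count_cons_self, pow_succ]
        exact neg_mul_eq _ _
      · rw [HahnSeries.coeff_neg, h.2 _ hm', neg_zero]
    | red n =>
      have h := ih.xvar_pow n
      have e : (markData k N b).uncrossCoeff p (red n :: u) v 0 0 =
          xvar _ ^ n * (markData k N b).uncrossCoeff (p ++ [red n]) u v 0 0 := by
        rw [MarkData.uncrossCoeff, X_pow_mul]
      have e2 : (2 * ((red n :: u).count black : ℤ) - weight (red n :: u)) =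
          2 * (u.count black : ℤ) - weight u - n := by
        simp [weight, labels]; ring
      rw [e, e2, List.count_cons_of_ne (by simp)]
      exact h

lemma cross_bot (v u : Word) :
    cross k N b u v * proj k N b (idem (u ++ black :: v)) = cross k N b u v := by
  cases v with
  | nil => exact mul_bot (.idem (u ++ [black]))
  | cons s v =>
    have := mul_bot (k := k) (N := N) (b := b) (.box u (right s) v)
    simp only [Gen.bot, src_right, List.append_assoc, List.cons_append, List.nil_append] at this
    rw [cross, mul_assoc, this]

lemma uncross_bot (u v p : Word) :
    uncross k N b p u v * proj k N b (idem (p ++ (u ++ black :: v))) = uncross k N b p u v := by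
  induction u generalizing p with
  | nil => exact mul_bot (.idem (p ++ black :: v))
  | cons s u ih =>
    have := ih (p ++ [s])
    simp only [List.append_assoc, List.cons_append, List.nil_append] at this
    rw [uncross, mul_assoc, List.cons_append, this]

lemma loop_bot (u v : Word) (l : ℕ) :
    loop k N b u v l * proj k N b (idem (u ++ black :: v)) = loop k N b u v l := by
  have := uncross_bot (k := k) (N := N) (b := b) u v []
  rw [List.nil_append] at this
  rw [loop, mul_assoc, this]

lemma direct_bot (u v : Word) (l : ℕ) :
    direct k N b u v l * proj k N b (idem (u ++ black :: v)) = direct k N b u v l := by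
  cases l with
  | zero => rw [direct, pow_zero, mul_one, cross_bot]
  | succ l =>
    have := mul_bot (k := k) (N := N) (b := b) (.box u .dot v)
    simp only [Gen.bot, Loc.src, List.append_assoc, List.cons_append, List.nil_append] at this
    rw [direct, pow_succ, mul_assoc, mul_assoc, this]

/-- The indices `((u, v), l, e)` of the basis: the marked strand starts between `u` and `v`, carries
`l` dots, and passes through the nail if `e` is true. -/
abbrev Idx : Type := (Word × Word) × ℕ × Bool

variable (k N b) in
/-- The basis elements of the algebra over the algebra with one black strand less. -/
noncomputable def basisElt (j : Idx) : Alg k N b :=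
  if j.2.2 then loop k N b j.1.1 j.1.2 j.2.1 else direct k N b j.1.1 j.1.2 j.2.1

lemma basisElt_bot (j : Idx) :
    basisElt k N b j * proj k N b (idem (j.1.1 ++ black :: j.1.2)) = basisElt k N b j := by
  unfold basisElt; split_ifs
  · exact loop_bot _ _ _
  · exact direct_bot _ _ _

lemma coeff_basisElt_ne {i : Word × Word} {j : Idx} (h : i ≠ j.1) (hl : i.1.length = j.1.1.length) :
    (markData k N b).coeff i (basisElt k N (b + 1) j) = 0 := by
  rw [MarkData.coeff, ← basisElt_bot, map_mul, Module.End.mul_apply, MarkData.rep_gen,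
    MarkData.op_zero _ (g := .idem _), map_zero, map_zero]
  intro h'
  obtain ⟨h1, h2⟩ := List.append_inj h' hl.symm
  exact h (Prod.ext h1.symm (List.cons_inj_right _ |>.1 h2).symm)

lemma one_mem_within (i : Word × Word) :
    (Finsupp.single i 1 : MarkMod (Coef k N b)) ∈ within (k := k) (R :=
      Coef k N b) Set.univ (evenCoef k N b).toSubmodule :=
  single_mem_within trivial (one_mem (evenCoef k N b))

lemma coeff_direct_one (i j : Word × Word) (l : ℕ) :
    (markData k N b).coeff i (direct k N (b + 1) j.1 j.2 l) 1 0 = 0 :=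
  (markData k N b).total_mem isEven.ρ_mem (isEven.direct_mem _ _ l (one_mem_within i))

lemma coeff_loop_lt (i j : Word × Word) (l : ℕ) (h : j.1.length < i.1.length) :
    (markData k N b).coeff i (loop k N (b + 1) j.1 j.2 l) 1 0 = 0 :=
  (markData k N b).total_mem isEven.ρ_mem (isEven.loop_far _ _ l
    (single_mem_within h (one_mem (evenCoef k N b))))

lemma lead_loop (i : Word × Word) (l : ℕ) :
    IsLead ((markData k N b).coeff i (loop k N (b + 1) i.1 i.2 l) 1 0)
      (2 * (i.1.count black : ℤ) - weight i.1 - l)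
      ((-1) ^ i.1.count black * proj k N b (idem (i.1 ++ i.2))) := by
  have h := isEven.total_loop i.1 i.2 l (one_mem (evenCoef k N b))
  rw [mem_evenCoef, Matrix.sub_apply, sub_eq_zero, mul_one, mul_assoc, ω_mul, X_pow_mul] at h
  rw [MarkData.coeff, h]
  exact (lead_uncrossCoeff i.1 i.2 []).xvar_pow l

lemma coeff_direct_zero (i : Word × Word) (l : ℕ) (m : ℤ) :
    ((markData k N b).coeff i (direct k N (b + 1) i.1 i.2 l) 0 0).coeff m =
      if m + l = 0 then proj k N b (idem (i.1 ++ i.2)) else 0 := by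
  rw [MarkData.coeff, MarkData.total_direct, mul_one, X_pow_mul, coeff_xvar_pow_mul]
  change (HahnSeries.C _ : HahnSeries ℤ (Alg k N b)).coeff _ = _
  rw [HahnSeries.C_apply, HahnSeries.coeff_single]
  congr

lemma coeff_direct_lt (i j : Word × Word) (l : ℕ) (h : i.1.length < j.1.length) :
    (markData k N b).coeff i (direct k N (b + 1) j.1 j.2 l) = 0 :=
  MarkData.direct_lt _ _ _ _ _ h _

variable (k N b) in
/-- The linear combinations of the basis elements with coefficients in `T_b` at the left. -/
noncomputable def combine : (Idx →₀ Alg k N b) →ₗ[k] Alg k N (b + 1) :=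
  Finsupp.lsum k fun j => (LinearMap.mulRight k (basisElt k N (b + 1) j)) ∘ₗ
    (addStrand k N b : Alg k N b →ₗ[k] Alg k N (b + 1))

lemma combine_apply (f : Idx →₀ Alg k N b) :
    combine k N b f = ∑ j ∈ f.support, addStrand k N b (f j) * basisElt k N (b + 1) j := by
  simp [combine, Finsupp.sum]

lemma coeff_combine (f : Idx →₀ Alg k N b) (i : Word × Word) :
    (markData k N b).coeff i (combine k N b f) =
      ∑ j ∈ f.support, (markData k N b).ρ (f j) * (markData k N b).coeff i (basisElt k N (b +
        1) j) := by
  rw [combine_apply]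
  simp only [← MarkData.coeff_add]
  simp [MarkData.coeff]

lemma matrix_sum_apply {ι : Type*} (s : Finset ι) (f : ι → Coef k N b) (i j : Fin 2) :
    (∑ x ∈ s, f x) i j = ∑ x ∈ s, f x i j := Matrix.sum_apply i j s f

lemma hahn_sum_coeff {ι : Type*} {B : Type u} [Ring B] (s : Finset ι) (f : ι → HahnSeries ℤ B)
    (m : ℤ) :
    (∑ x ∈ s, f x).coeff m = ∑ x ∈ s, (f x).coeff m :=
  HahnSeries.coeff_sum m

lemma neg_one_pow_mul_eq_zero {B : Type u} [Ring B] {n : ℕ} {x y : B} (h : x * ((-1) ^ n * y) =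
    0) : x * y = 0 := by
  rcases neg_one_pow_eq_or B n with h' | h' <;> rw [h'] at h <;> simpa using h

/-- The basis elements are linearly independent. The lower left entries of the coefficients vanish
on the direct diagrams and are triangular on the loops, ordered by the number of strands at the left
of the marked strand and then by the number of dots. Once the coefficients of the loops vanish, the
upper left entries are triangular on the direct diagrams. -/
lemma combine_injective {f : Idx →₀ Alg k N b}
    (hf : ∀ j, f j * proj k N b (idem (j.1.1 ++ j.1.2)) = f j) (h : combine k N b f = 0) : f = 0 :=
      by
  have hc : ∀ i, ∑ j ∈ f.support, (markData k N b).ρ (f j) *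
      (markData k N b).coeff i (basisElt k N (b + 1) j) = 0 := fun i => by
    rw [← coeff_combine, h, MarkData.coeff, map_zero, LinearMap.zero_apply, map_zero]
  -- otherwise, a maximal loop in the support has a nonzero leading term, which nothing cancels
  have h1 : ∀ j ∈ f.support, j.2.2 = false := by
    by_contra! hne
    obtain ⟨j₁, hj₁, hj₁'⟩ := hne
    obtain ⟨j, hj, hmax⟩ := (f.support.filter (fun j => j.2.2 = true)).exists_max_image
      (fun j => toLex (j.1.1.length, j.2.1)) ⟨j₁, by simpa [hj₁'] using hj₁⟩
    rw [Finset.mem_filter] at hj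
    obtain ⟨⟨i, l, ε⟩, rfl⟩ : ∃ j', j' = j := ⟨j, rfl⟩
    obtain rfl : ε = true := hj.2
    have h2 := congrArg (fun M => (M 1 0).coeff (2 * (i.1.count black : ℤ) - weight i.1 - l)) (hc i)
    simp only [matrix_sum_apply, ρ_mul_one, hahn_sum_coeff, coeff_C_mul, Matrix.zero_apply,
      HahnSeries.coeff_zero] at h2
    rw [Finset.sum_eq_single_of_mem _ hj.1] at h2
    · rw [basisElt, if_pos rfl, (lead_loop i l).1] at h2
      have h3 := congrArg (sg k N b) (neg_one_pow_mul_eq_zero h2)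
      rw [map_mul, sg_sg, map_zero, sg_idem, hf] at h3
      exact (Finsupp.mem_support_iff.1 hj.1) h3
    · rintro ⟨i', l', ε'⟩ hj' hne
      cases ε' with
      | false =>
        rw [basisElt, if_neg (by simp), coeff_direct_one, HahnSeries.coeff_zero, mul_zero]
      | true =>
        have hle := hmax ⟨i', l', true⟩ (by simpa using hj')
        rw [Prod.Lex.toLex_le_toLex] at hle
        rcases hle with hlt | ⟨heq, hle⟩
        · rw [basisElt, if_pos rfl, coeff_loop_lt _ _ _ hlt, HahnSeries.coeff_zero, mul_zero]
        · by_cases hi : i = i'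
          · subst hi
            rw [basisElt, if_pos rfl, (lead_loop i l').2, mul_zero]
            have : l' ≠ l := fun e => hne (by rw [e])
            simp only at hle ⊢
            omega
          · rw [coeff_basisElt_ne hi heq.symm]; simp
  -- only direct diagrams remain: compare at one with the fewest strands at the left
  by_contra hne
  obtain ⟨j, hj, hmin⟩ := f.support.exists_min_image (fun j => j.1.1.length)
    (Finsupp.support_nonempty_iff.2 hne)
  obtain ⟨⟨i, l, ε⟩, rfl⟩ : ∃ j', j' = j := ⟨j, rfl⟩
  obtain rfl : ε = false := h1 _ hj
  have h2 := congrArg (fun M => (M 0 0).coeff (-l : ℤ)) (hc i)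
  simp only [matrix_sum_apply, ρ_mul_zero, hahn_sum_coeff, coeff_C_mul, Matrix.zero_apply,
    HahnSeries.coeff_zero] at h2
  rw [Finset.sum_eq_single_of_mem _ hj] at h2
  · rw [basisElt, if_neg (by simp), coeff_direct_zero, if_pos (by simp), hf] at h2
    exact (Finsupp.mem_support_iff.1 hj) h2
  · rintro ⟨i', l', ε'⟩ hj' hne
    obtain rfl : ε' = false := h1 _ hj'
    rcases (hmin _ hj').lt_or_eq with hlt | heq
    · rw [basisElt, if_neg (by simp), coeff_direct_lt _ _ _ hlt]; simp
    · by_cases hi : i = i'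
      · subst hi
        have : l' ≠ l := fun e => hne (by rw [e])
        rw [basisElt, if_neg (by simp), coeff_direct_zero, if_neg (by simp only; omega), mul_zero]
      · rw [coeff_basisElt_ne hi heq]; simp

end Concrete

/-! ### Sliding diagrams along the marked strand -/

section Slides

variable {k : Type u} [CommRing k] {N : List ℕ} {b : ℕ}

local notation "π" => proj k N b
local notation "π'" => proj k N (b + 1)

/-- The black strand between `u` and `v` lies at the left of the top of the local piece `l`, is one
of its strands, or lies at its right. -/
lemma split_box_tgt {U V u v : Word} {l : Loc} (h : U ++ (l.tgt ++ V) = u ++ black :: v) :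
    (∃ a, U = u ++ black :: a ∧ v = a ++ (l.tgt ++ V)) ∨
    (l = .dot ∧ u = U ∧ v = V) ∨ (l = .bb ∧ u = U ∧ v = black :: V) ∨
    (l = .bb ∧ u = U ++ [black] ∧ v = V) ∨ (∃ n, l = .rb n ∧ u = U ∧ v = red n :: V) ∨
    (∃ n, l = .br n ∧ u = U ++ [red n] ∧ v = V) ∨
    (∃ c, V = c ++ black :: v ∧ u = U ++ (l.tgt ++ c)) := by
  rcases MarkData.append_split₃ h with h | ⟨s1, s2, hs, rfl, rfl⟩ | h
  · exact .inl h
  · right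
    cases l with
    | dot => cases s1 <;> simp_all [Loc.tgt]
    | bb =>
      cases s1 with
      | nil => simp only [Loc.tgt, List.nil_append, List.cons.injEq, true_and] at hs; simp [← hs]
      | cons s s1 => cases s1 <;> simp_all [Loc.tgt]
    | rb n =>
      cases s1 with
      | nil => simp only [Loc.tgt, List.nil_append, List.cons.injEq, true_and] at hs; simp [← hs]
      | cons s s1 => cases s1 <;> simp_all [Loc.tgt]
    | br n =>
      cases s1 with
      | nil => simp_all [Loc.tgt]
      | cons s s1 => cases s1 <;> simp_all [Loc.tgt]
  · simp only [h, or_true]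

lemma length_src (l : Loc) : l.src.length = l.tgt.length := by cases l <;> rfl

lemma proj_far (l l' : Loc) (u m v : Word) :
    π (box l u (m ++ (l'.tgt ++ v))) * π (box l' (u ++ (l.src ++ m)) v) =
      π (box l' (u ++ (l.tgt ++ m)) v) * π (box l u (m ++ (l'.src ++ v))) := by
  simpa using proj_rel N b (.box_box l l' u m v)

lemma proj_nail_box (l : Loc) (m v : Word) :
    π (nail (m ++ (l.tgt ++ v))) * π (box l (black :: m) v) =
      π (box l (black :: m) v) * π (nail (m ++ (l.src ++ v))) := by
  simpa using proj_rel N b (.nail_box l m v)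

lemma top_box (l : Loc) (u v w : Word) (hw : w = u ++ (l.tgt ++ v)) :
    π (idem w) * π (box l u v) = π (box l u v) := by
  have := top_mul (k := k) (N := N) (b := b) (.box u l v)
  rwa [Gen.top, List.append_assoc, ← hw] at this

lemma box_bot (l : Loc) (u v w : Word) (hw : w = u ++ (l.src ++ v)) :
    π (box l u v) * π (idem w) = π (box l u v) := by
  have := mul_bot (k := k) (N := N) (b := b) (.box u l v)
  rwa [Gen.bot, List.append_assoc, ← hw] at this

/-- A local piece at the left of the strand moving to the right commutes with it by planar isotopy,
and becomes an element of `T_b` at the top. -/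
lemma cross_box_left (U : Word) (l : Loc) (a v : Word) :
    cross k N (b + 1) (U ++ (l.tgt ++ a)) v * π' (box l U (a ++ black :: v)) =
      addStrand k N b (π (box l U (a ++ v))) * cross k N (b + 1) (U ++ (l.src ++ a)) v := by
  induction v generalizing a with
  | nil =>
    rw [cross, cross, addStrand_gen, Gen.app, top_box _ _ _ _ (by simp), box_bot _ _ _ _ (by simp),
      List.append_nil]
  | cons s v ih =>
    have h := proj_far (k := k) (N := N) (b := b + 1) l (right s) U a v
    have ih := ih (a ++ [s])
    simp only [List.append_assoc, List.cons_append, List.nil_append, src_right, tgt_right] at h ih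
    simp only [cross, mul_assoc, List.append_assoc, List.cons_append, List.nil_append] at ih ⊢
    rw [← h, ← mul_assoc, ih, mul_assoc]

lemma cross_nail (u v : Word) :
    cross k N (b + 1) (black :: u) v * π' (nail (u ++ black :: v)) =
      addStrand k N b (π (nail (u ++ v))) * cross k N (b + 1) (black :: u) v := by
  induction v generalizing u with
  | nil =>
    have h1 := top_mul (k := k) (N := N) (b := b + 1) (.nail (u ++ [black]))
    have h2 := mul_bot (k := k) (N := N) (b := b + 1) (.nail (u ++ [black]))
    rw [cross, addStrand_gen, Gen.app, List.append_nil]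
    exact h1.trans h2.symm
  | cons s v ih =>
    have h := proj_nail_box (k := k) (N := N) (b := b + 1) (right s) u v
    have ih := ih (u ++ [s])
    simp only [List.append_assoc, List.cons_append, List.nil_append, src_right, tgt_right] at h ih
    simp only [cross, mul_assoc, List.append_assoc, List.cons_append, List.nil_append] at ih ⊢
    rw [← h, ← mul_assoc, ih, mul_assoc]

lemma uncross_append (p u₁ u₂ v : Word) :
    uncross k N b p (u₁ ++ u₂) v = uncross k N b p u₁ (u₂ ++ v) * uncross k N b (p ++ u₁) u₂ v := by
  induction u₁ generalizing p with
  | nil =>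
    cases u₂ with
    | nil =>
      have := mul_bot (k := k) (N := N) (b := b) (.idem (p ++ black :: v))
      simp only [uncross, List.nil_append, List.append_nil]
      exact this.symm
    | cons s u =>
      simp only [uncross, List.nil_append, List.append_nil]
      rw [← mul_assoc, top_box _ _ _ _ (by simp)]
  | cons s u₁ ih =>
    simp only [uncross, List.cons_append, List.append_assoc, ih, mul_assoc, List.nil_append]

lemma loop_append (u u' v : Word) (l : ℕ) :
    loop k N b (u ++ u') v l = loop k N b u (u' ++ v) l * uncross k N b u u' v := by
  rw [loop, loop, uncross_append]
  simp only [mul_assoc, List.append_assoc, List.nil_append]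

lemma loop_snoc (u : Word) (s : Strand) (v : Word) (l : ℕ) :
    loop k N b (u ++ [s]) v l = loop k N b u (s :: v) l * π (box (left s) u v) := by
  rw [loop_append, uncross, uncross, box_bot _ _ _ _ (by simp)]; rfl

lemma uncross_box_right (p u c : Word) (l : Loc) (V : Word) :
    uncross k N b p u (c ++ (l.tgt ++ V)) * π (box l (p ++ (u ++ black :: c)) V) =
      π (box l (p ++ black :: (u ++ c)) V) * uncross k N b p u (c ++ (l.src ++ V)) := by
  induction u generalizing p with
  | nil => rw [uncross, uncross, top_box _ _ _ _ (by simp), box_bot _ _ _ _ (by simp)]; rfl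
  | cons s u ih =>
    have h := proj_far (k := k) (N := N) (b := b) (left s) l p (u ++ c) V
    have ih := ih (p ++ [s])
    simp only [List.append_assoc, List.cons_append, List.nil_append, src_left, tgt_left] at h ih
    simp only [uncross, mul_assoc, List.append_assoc, List.cons_append, List.nil_append] at ih ⊢
    rw [ih, ← mul_assoc, h, mul_assoc]

lemma uncross_box_left (U : Word) (l : Loc) (a u v : Word) :
    uncross k N b (U ++ (l.tgt ++ a)) u v * π (box l U (a ++ (u ++ black :: v))) =
      π (box l U (a ++ black :: (u ++ v))) * uncross k N b (U ++ (l.src ++ a)) u v := by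
  induction u generalizing a with
  | nil => rw [uncross, uncross, top_box _ _ _ _ (by simp), box_bot _ _ _ _ (by simp)]; rfl
  | cons s u ih =>
    have h := proj_far (k := k) (N := N) (b := b) l (left s) U a (u ++ v)
    have ih := ih (a ++ [s])
    simp only [List.append_assoc, List.cons_append, List.nil_append, src_left, tgt_left] at h ih
    simp only [uncross, mul_assoc, List.append_assoc, List.cons_append, List.nil_append] at ih ⊢
    rw [ih, ← mul_assoc, ← h, mul_assoc]

lemma uncross_nail (p u v : Word) :
    uncross k N b (black :: p) u v * π (nail (p ++ (u ++ black :: v))) =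
      π (nail (p ++ black :: (u ++ v))) * uncross k N b (black :: p) u v := by
  induction u generalizing p with
  | nil =>
    have h1 := top_mul (k := k) (N := N) (b := b) (.nail (p ++ black :: v))
    have h2 := mul_bot (k := k) (N := N) (b := b) (.nail (p ++ black :: v))
    rw [uncross]
    exact h1.trans h2.symm
  | cons s u ih =>
    have h := proj_nail_box (k := k) (N := N) (b := b) (left s) p (u ++ v)
    have ih := ih (p ++ [s])
    simp only [List.append_assoc, List.cons_append, List.nil_append, src_left, tgt_left] at h ih
    simp only [uncross, mul_assoc, List.append_assoc, List.cons_append, List.nil_append] at ih ⊢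
    rw [ih, ← mul_assoc, ← h, mul_assoc]

lemma dot_pow_box_left (U : Word) (l : Loc) (a v : Word) (i : ℕ) :
    π (dot (U ++ (l.tgt ++ a)) v) ^ i * π (box l U (a ++ black :: v)) =
      π (box l U (a ++ black :: v)) * π (dot (U ++ (l.src ++ a)) v) ^ i := by
  have h := proj_far (k := k) (N := N) (b := b) l .dot U a v
  have h' : SemiconjBy (π (box l U (a ++ black :: v))) (π (dot (U ++ (l.src ++ a)) v))
    (π (dot (U ++ (l.tgt ++ a)) v)) := h
  exact (h'.pow_right i).eq.symm

lemma dot_pow_box_right (u c : Word) (l : Loc) (V : Word) (i : ℕ) :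
    π (dot u (c ++ (l.tgt ++ V))) ^ i * π (box l (u ++ black :: c) V) =
      π (box l (u ++ black :: c) V) * π (dot u (c ++ (l.src ++ V))) ^ i := by
  have h := proj_far (k := k) (N := N) (b := b) .dot l u c V
  have h' : SemiconjBy (π (box l (u ++ black :: c) V)) (π (dot u (c ++ (l.src ++ V))))
    (π (dot u (c ++ (l.tgt ++ V)))) := h.symm
  exact (h'.pow_right i).eq.symm

lemma dot_pow_nail (v : Word) (i : ℕ) :
    π (dot [] v) ^ i * π (nail v) = π (nail v) * π (dot [] v) ^ i := by
  have h : Commute (π (dot [] v)) (π (nail v)) := by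
    have := proj_rel (k := k) N b (.nail_dot v)
    rw [map_mul, map_mul] at this
    exact this.symm
  exact (h.pow_left i).eq

lemma dot_pow_nail_left (u v : Word) (i : ℕ) :
    π (dot (black :: u) v) ^ i * π (nail (u ++ black :: v)) =
      π (nail (u ++ black :: v)) * π (dot (black :: u) v) ^ i := by
  have h : Commute (π (dot (black :: u) v)) (π (nail (u ++ black :: v))) :=
    (proj_nail_box (k := k) (N := N) (b := b) .dot u v).symm
  exact (h.pow_left i).eq

lemma direct_box_left (U : Word) (l : Loc) (a v : Word) (i : ℕ) :
    direct k N (b + 1) (U ++ (l.tgt ++ a)) v i * π' (box l U (a ++ black :: v)) =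
      addStrand k N b (π (box l U (a ++ v))) * direct k N (b + 1) (U ++ (l.src ++ a)) v i := by
  rw [direct, direct, mul_assoc, dot_pow_box_left, ← mul_assoc, cross_box_left, mul_assoc]

lemma direct_nail (u v : Word) (i : ℕ) :
    direct k N (b + 1) (black :: u) v i * π' (nail (u ++ black :: v)) =
      addStrand k N b (π (nail (u ++ v))) * direct k N (b + 1) (black :: u) v i := by
  rw [direct, mul_assoc, dot_pow_nail_left, ← mul_assoc, cross_nail, mul_assoc]

lemma direct_nail_nil (u v : Word) (i : ℕ) :
    direct k N b [] (u ++ v) i * π (nail (u ++ v)) * uncross k N b [] u v = loop k N b u v i := rfl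

/-- Moving a power of `x` to the left through `T`, which exchanges `x` for `y` up to a correction
`e`, gives a geometric sum of corrections. -/
lemma mul_pow_geom {B : Type u} [Ring B] {T x y e : B} (h : T * x = y * T + e) (hx : e * x = x * e)
    (hxy : x * y = y * x) (i : ℕ) :
    T * x ^ i = y ^ i * T + ∑ j ∈ Finset.range i, x ^ j * y ^ (i - 1 - j) * e := by
  induction i with
  | zero => simp
  | succ i ih =>
    have h1 : ∀ j, x ^ (j + 1) * y ^ (i + 1 - 1 - (j + 1)) * e = x ^ j * y ^ (i - 1 - j) * e * x :=
      fun j => by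
        have hc : Commute x (y ^ (i - 1 - j)) := Commute.pow_right hxy _
        rw [show i + 1 - 1 - (j + 1) = i - 1 - j by omega, mul_assoc _ e, hx, ← mul_assoc _ x e,
          mul_assoc _ _ x, ← hc.eq, pow_succ]
        simp only [mul_assoc]
    rw [pow_succ, ← mul_assoc, ih, add_mul, Finset.sum_mul, Finset.sum_range_succ',
      Finset.sum_congr rfl fun j _ => h1 j, mul_assoc _ T, h, mul_add, ← mul_assoc, ← pow_succ]
    simp only [pow_zero, one_mul, Nat.add_sub_cancel, Nat.sub_zero]
    abel

lemma pow_mul_geom {B : Type u} [Ring B] {T x y e : B} (h : x * T = T * y + e) (hy : e * y = y * e)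
    (i : ℕ) :
    x ^ i * T = T * y ^ i + ∑ j ∈ Finset.range i, x ^ j * y ^ (i - 1 - j) * e := by
  induction i with
  | zero => simp
  | succ i ih =>
    have h1 : ∀ j ∈ Finset.range i,
        x ^ j * y ^ (i + 1 - 1 - j) * e = x ^ j * y ^ (i - 1 - j) * e * y := fun j hj => by
      rw [Finset.mem_range] at hj
      rw [mul_assoc _ e, hy, show i + 1 - 1 - j = i - 1 - j + 1 by omega, pow_succ]
      simp only [mul_assoc]
    rw [pow_succ, mul_assoc, h, mul_add, ← mul_assoc, ih, add_mul, Finset.sum_mul,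
      Finset.sum_range_succ, Finset.sum_congr rfl h1, mul_assoc T, ← pow_succ]
    simp only [Nat.add_sub_cancel, Nat.sub_self, pow_zero, mul_one]
    abel

lemma dot_comm_dot (u v : Word) :
    π (dot u (black :: v)) * π (dot (u ++ [black]) v) =
      π (dot (u ++ [black]) v) * π (dot u (black :: v)) := by
  simpa [Loc.src, Loc.tgt] using proj_far (k := k) (N := N) (b := b) .dot .dot u [] v

lemma idem_comm_dot (u v w : Word) (hw : w = u ++ black :: v) :
    π (idem w) * π (dot u v) = π (dot u v) * π (idem w) := by
  rw [top_box _ _ _ _ (by simpa [Loc.tgt] using hw), box_bot _ _ _ _ (by simpa [Loc.src] using hw)]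

/-- Moving dots through a crossing creates all the ways to distribute one dot less. -/
lemma bb_dot_pow (u v : Word) (i : ℕ) :
    π (bb u v) * π (dot u (black :: v)) ^ i = π (dot (u ++ [black]) v) ^ i * π (bb u v) +
      ∑ j ∈ Finset.range i, π (dot u (black :: v)) ^ j * π (dot (u ++ [black]) v) ^ (i - 1 - j) *
        π (idem (u ++ black :: black :: v)) := by
  refine mul_pow_geom ?_ (idem_comm_dot _ _ _ rfl) (dot_comm_dot u v) i
  simpa using proj_rel (k := k) N b (.bb_dot u v)

lemma dot_pow_bb (u v : Word) (i : ℕ) :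
    π (dot u (black :: v)) ^ i * π (bb u v) = π (bb u v) * π (dot (u ++ [black]) v) ^ i +
      ∑ j ∈ Finset.range i, π (dot u (black :: v)) ^ j * π (dot (u ++ [black]) v) ^ (i - 1 - j) *
        π (idem (u ++ black :: black :: v)) := by
  refine pow_mul_geom ?_ (idem_comm_dot _ _ _ (by simp)) i
  simpa using proj_rel (k := k) N b (.dot_bb u v)

end Slides

/-! ### The span of the diagrams with a marked strand -/

section Spanning

variable (k : Type u) [CommRing k] (N : List ℕ) (b : ℕ)

local notation "π" => proj k N b
local notation "π'" => proj k N (b + 1)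

/-- The span over `T_b` of the basis elements with the diagram `w` at the bottom, of which the
direct ones have at least `m` strands at the left of the marked strand and the loops have fewer than
`n`. -/
def marked (m n : ℕ) (w : Word) : Submodule k (Alg k N (b + 1)) :=
  Submodule.span k
    ({y | ∃ a u v l, w = u ++ black :: v ∧ m ≤ u.length ∧
        y = addStrand k N b a * direct k N (b + 1) u v l} ∪
      {y | ∃ a u v l, w = u ++ black :: v ∧ u.length < n ∧
        y = addStrand k N b a * loop k N (b + 1) u v l})

variable {k N b}

lemma marked_mono {m m' n n' : ℕ} (hm : m' ≤ m) (hn : n ≤ n') (w : Word) :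
    marked k N b m n w ≤ marked k N b m' n' w := by
  refine Submodule.span_mono (Set.union_subset_union ?_ ?_)
  · rintro y ⟨a, u, v, l, h1, h2, h3⟩; exact ⟨a, u, v, l, h1, hm.trans h2, h3⟩
  · rintro y ⟨a, u, v, l, h1, h2, h3⟩; exact ⟨a, u, v, l, h1, h2.trans_le hn, h3⟩

lemma marked_le (m n : ℕ) (w : Word) : marked k N b m n w ≤ marked k N b 0 w.length w := by
  refine Submodule.span_mono (Set.union_subset_union ?_ ?_)
  · rintro y ⟨a, u, v, l, h1, h2, h3⟩; exact ⟨a, u, v, l, h1, Nat.zero_le _, h3⟩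
  · rintro y ⟨a, u, v, l, h1, h2, h3⟩; exact ⟨a, u, v, l, h1, by simp [h1], h3⟩

lemma add_direct_mem {m n : ℕ} {u v w : Word} (hw : w = u ++ black :: v) (hm : m ≤ u.length)
    (a : Alg k N b) (l : ℕ) :
    addStrand k N b a * direct k N (b + 1) u v l ∈ marked k N b m n w :=
  Submodule.subset_span (.inl ⟨a, u, v, l, hw, hm, rfl⟩)

lemma add_loop_mem {m n : ℕ} {u v w : Word} (hw : w = u ++ black :: v) (hn : u.length < n)
    (a : Alg k N b) (l : ℕ) :
    addStrand k N b a * loop k N (b + 1) u v l ∈ marked k N b m n w :=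
  Submodule.subset_span (.inr ⟨a, u, v, l, hw, hn, rfl⟩)

lemma one_mul_cross (u v : Word) :
    addStrand k N b 1 * cross k N (b + 1) u v = cross k N (b + 1) u v := by
  rw [addStrand_one]
  induction v generalizing u with
  | nil =>
    exact lastIdem_mul (.idem (u ++ [black])) rfl
  | cons s v ih => rw [cross, ← mul_assoc, ih]

lemma one_mul_direct (u v : Word) (l : ℕ) :
    addStrand k N b 1 * direct k N (b + 1) u v l = direct k N (b + 1) u v l := by
  rw [direct, ← mul_assoc, one_mul_cross]

lemma one_mul_loop (u v : Word) (l : ℕ) :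
    addStrand k N b 1 * loop k N (b + 1) u v l = loop k N (b + 1) u v l := by
  rw [loop]; simp only [← mul_assoc]; rw [one_mul_cross]

lemma direct_mem {m n : ℕ} {u v w : Word} (hw : w = u ++ black :: v) (hm : m ≤ u.length) (l : ℕ) :
    direct k N (b + 1) u v l ∈ marked k N b m n w := by
  rw [← one_mul_direct]; exact add_direct_mem hw hm 1 l

lemma loop_mem {m n : ℕ} {u v w : Word} (hw : w = u ++ black :: v) (hn : u.length < n) (l : ℕ) :
    loop k N (b + 1) u v l ∈ marked k N b m n w := by
  rw [← one_mul_loop]; exact add_loop_mem hw hn 1 l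

lemma add_mul_mem {m n : ℕ} {w : Word} (a : Alg k N b) {y : Alg k N (b + 1)}
    (hy : y ∈ marked k N b m n w) : addStrand k N b a * y ∈ marked k N b m n w := by
  induction hy using Submodule.span_induction with
  | mem y hy =>
    rcases hy with ⟨a', u, v, l, h1, h2, rfl⟩ | ⟨a', u, v, l, h1, h2, rfl⟩
    · rw [← mul_assoc, ← map_mul]; exact add_direct_mem h1 h2 _ _
    · rw [← mul_assoc, ← map_mul]; exact add_loop_mem h1 h2 _ _
  | zero => rw [mul_zero]; exact zero_mem _
  | add x y _ _ hx hy => rw [mul_add]; exact add_mem hx hy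
  | smul c x _ hx => rw [mul_smul_comm]; exact Submodule.smul_mem _ c hx

/-- It suffices to multiply the spanning elements. -/
lemma mul_mem_of {m n : ℕ} {w : Word} {S : Submodule k (Alg k N (b + 1))} (z : Alg k N (b + 1))
    (hS : ∀ a, ∀ y ∈ S, addStrand k N b a * y ∈ S)
    (h1 : ∀ u v l, w = u ++ black :: v → m ≤ u.length → direct k N (b + 1) u v l * z ∈ S)
    (h2 : ∀ u v l, w = u ++ black :: v → u.length < n → loop k N (b + 1) u v l * z ∈ S)
    {y : Alg k N (b + 1)} (hy : y ∈ marked k N b m n w) : y * z ∈ S := by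
  induction hy using Submodule.span_induction with
  | mem y hy =>
    rcases hy with ⟨a', u, v, l, h3, h4, rfl⟩ | ⟨a', u, v, l, h3, h4, rfl⟩
    · rw [mul_assoc]; exact hS _ _ (h1 _ _ _ h3 h4)
    · rw [mul_assoc]; exact hS _ _ (h2 _ _ _ h3 h4)
  | zero => rw [zero_mul]; exact zero_mem _
  | add x y _ _ hx hy => rw [add_mul]; exact add_mem hx hy
  | smul c x _ hx => rw [smul_mul_assoc]; exact Submodule.smul_mem _ c hx

lemma mul_mem_marked {m n m' n' : ℕ} {w w' : Word} (z : Alg k N (b + 1))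
    (h1 : ∀ u v l, w = u ++ black :: v → m ≤ u.length →
      direct k N (b + 1) u v l * z ∈ marked k N b m' n' w')
    (h2 : ∀ u v l, w = u ++ black :: v → u.length < n →
      loop k N (b + 1) u v l * z ∈ marked k N b m' n' w')
    {y : Alg k N (b + 1)} (hy : y ∈ marked k N b m n w) : y * z ∈ marked k N b m' n' w' :=
  mul_mem_of z (fun a _ => add_mul_mem a) h1 h2 hy

lemma marked_mul_idem {m n : ℕ} {w w' : Word} (hw : w = w') {y : Alg k N (b + 1)}
    (hy : y ∈ marked k N b m n w) : y * π' (idem w') = y := by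
  subst hw
  induction hy using Submodule.span_induction with
  | mem y hy =>
    rcases hy with ⟨a', u, v, l, rfl, h4, rfl⟩ | ⟨a', u, v, l, rfl, h4, rfl⟩
    · rw [mul_assoc, direct_bot]
    · rw [mul_assoc, loop_bot]
  | zero => rw [zero_mul]
  | add x y _ _ hx hy => rw [add_mul, hx, hy]
  | smul c x _ hx => rw [smul_mul_assoc, hx]

lemma split_left {U S V u v : Word} (h : U ++ (S ++ V) = u ++ black :: v)
    (hl : U.length + S.length ≤ u.length) : ∃ a, u = U ++ (S ++ a) ∧ V = a ++ black :: v := by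
  rw [← List.append_assoc] at h
  rcases List.append_eq_append_iff.1 h with ⟨a, h1, h2⟩ | ⟨a, h1, h2⟩
  · exact ⟨a, by simpa using h1, h2⟩
  · have := congrArg List.length h1
    simp only [List.length_append] at this
    obtain rfl : a = [] := List.length_eq_zero_iff.1 (by omega)
    exact ⟨[], by simpa using h1.symm, by simpa using h2.symm⟩

/-- A direct diagram remains one when it is multiplied by a local piece at the left of the marked
strand. -/
lemma mul_box_left {m : ℕ} {U V w w' : Word} {l : Loc} (hw : w = U ++ (l.tgt ++ V))
    (hw' : w' = U ++ (l.src ++ V)) (hm : U.length + l.tgt.length ≤ m) {y : Alg k N (b + 1)}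
    (hy : y ∈ marked k N b m 0 w) : y * π' (box l U V) ∈ marked k N b m 0 w' := by
  refine mul_mem_marked _ (fun u v i h1 h2 => ?_) (fun u v i h1 h2 => absurd h2 (by omega)) hy
  obtain ⟨a, rfl, rfl⟩ := split_left (hw.symm.trans h1) (hm.trans h2)
  rw [direct_box_left]
  refine add_direct_mem (by simp [hw']) ?_ _ _
  simpa [length_src] using h2

lemma mul_box_left_pow {m : ℕ} {u v w : Word} (hw : w = u ++ black :: v) (hm : u.length < m)
    {y : Alg k N (b + 1)} (hy : y ∈ marked k N b m 0 w) (i : ℕ) :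
    y * π' (dot u v) ^ i ∈ marked k N b m 0 w := by
  induction i with
  | zero => simpa using hy
  | succ i ih =>
    rw [pow_succ, ← mul_assoc]
    exact mul_box_left (by simpa [Loc.tgt] using hw) (by simpa [Loc.src] using hw)
      (by simpa [Loc.tgt] using hm) ih

/-- Replacing a triple product by the other side of a relation with the correction `e`, where `c`
slides through the first factor. -/
lemma slide_aux {B : Type u} [Ring B] {c c' a A₁ A₂ A₃ B₁ B₂ B₃ e : B} (hL : c * A₁ = a * c')
    (hr : B₁ * B₂ * B₃ = A₁ * A₂ * A₃ + e) : c * B₁ * B₂ * B₃ - a * (c' * A₂ * A₃) = c * e := by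
  have : c * (B₁ * B₂ * B₃) = c * A₁ * A₂ * A₃ + c * e := by
    rw [hr, mul_add]; simp only [mul_assoc]
  rw [hL] at this
  simp only [← mul_assoc] at this ⊢
  rw [this, add_sub_cancel_left]

lemma slide_aux' {B : Type u} [Ring B] {c c' a A₁ A₂ A₃ B₁ B₂ B₃ e : B} (hL : c * A₁ = a * c')
    (hr : B₁ * B₂ * B₃ = A₁ * A₂ * A₃ - e) :
    c * B₁ * B₂ * B₃ - a * (c' * A₂ * A₃) = -(c * e) := by
  rw [slide_aux hL (hr.trans (sub_eq_add_neg _ _)), mul_neg]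

/-- A local piece at the right of the marked strand slides through the strand, up to diagrams in
which the marked strand starts further to the right. -/
lemma cross_box_right (u c : Word) (l : Loc) (V : Word) :
    cross k N (b + 1) u (c ++ (l.tgt ++ V)) * π' (box l (u ++ black :: c) V) -
      addStrand k N b (π (box l (u ++ c) V)) * cross k N (b + 1) u (c ++ (l.src ++ V)) ∈
      marked k N b (u.length + 1) 0 (u ++ black :: (c ++ (l.src ++ V))) := by
  induction c generalizing u with
  | nil =>
    simp only [List.nil_append, List.append_nil]
    have hL := cross_box_left (k := k) (N := N) (b := b) u l [] V
    simp only [List.append_nil, List.nil_append] at hL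
    cases l with
    | dot =>
      have hr := proj_rel (k := k) N (b + 1) (.dot_bb u V)
      simp only [map_mul, map_add, List.append_assoc, List.cons_append, List.nil_append] at hr
      simp only [Loc.src, Loc.tgt, cross, right, List.cons_append, List.nil_append] at hL ⊢
      rw [mul_assoc, ← sub_eq_iff_eq_add.2 hr, mul_sub, ← mul_assoc, hL, mul_assoc,
        sub_sub_cancel_left]
      have h0 := cross_bot (k := k) (N := N) (b := b + 1) V (u ++ [black])
      simp only [List.append_assoc, List.cons_append, List.nil_append] at h0
      rw [h0]
      have := direct_mem (k := k) (N := N) (b := b) (m := u.length + 1) (n := 0)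
        (u := u ++ [black]) (v := V) (w := u ++ black :: black :: V) (by simp) (by simp) 0
      rw [direct, pow_zero, mul_one] at this
      exact neg_mem this
    | bb =>
      have hr := proj_rel (k := k) N (b + 1) (.bb_braid u V)
      simp only [map_mul, List.append_assoc, List.cons_append, List.nil_append] at hr
      simp only [Loc.src, Loc.tgt, cross, right, List.append_assoc, List.cons_append,
        List.nil_append] at hL ⊢
      rw [slide_aux hL (hr.symm.trans (add_zero _).symm), mul_zero]
      exact zero_mem _
    | br n =>
      have hr := proj_rel (k := k) N (b + 1) (.br_br_bb n u V)
      simp only [map_mul, List.append_assoc, List.cons_append, List.nil_append] at hr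
      simp only [Loc.src, Loc.tgt, cross, right, List.append_assoc, List.cons_append,
        List.nil_append] at hL ⊢
      rw [slide_aux hL (hr.symm.trans (add_zero _).symm), mul_zero]
      exact zero_mem _
    | rb n =>
      have hr := proj_rel (k := k) N (b + 1) (.rb_bb_br n u V)
      simp only [map_mul, map_add, map_sum, map_pow, List.append_assoc, List.cons_append,
        List.nil_append] at hr
      simp only [Loc.src, Loc.tgt, cross, right, List.append_assoc, List.cons_append,
        List.nil_append] at hL ⊢
      rw [slide_aux' hL ((sub_eq_iff_eq_add.2 hr).symm), Finset.mul_sum]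
      refine neg_mem (sum_mem fun i _ => ?_)
      have hc : Commute (π' (dot u (red n :: black :: V))) (π' (dot (u ++ [black, red n]) V)) := by
        have := proj_far (k := k) (N := N) (b := b + 1) .dot .dot u [red n] V
        simp only [Loc.src, Loc.tgt, List.cons_append, List.nil_append] at this
        exact this
      have h0 := direct_mem (k := k) (N := N) (b := b) (m := u.length + 1) (n := 0)
        (u := u ++ [black, red n]) (v := V) (w := u ++ black :: red n :: black :: V) (by simp)
        (by simp) (n - 1 - i)
      have h1 := mul_box_left_pow (u := u) (v := red n :: black :: V) rfl (Nat.lt_succ_self _) h0 i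
      rw [direct] at h1
      rw [(hc.pow_pow _ _).eq, ← mul_assoc, ← mul_assoc, marked_mul_idem rfl h1]
      exact h1
  | cons s c ih =>
    have h := proj_far (k := k) (N := N) (b := b + 1) (right s) l u c V
    have ih := ih (u ++ [s])
    simp only [List.append_assoc, List.cons_append, List.nil_append, src_right, tgt_right] at h ih
    have := mul_box_left (l := right s) (U := u) (V := c ++ (l.src ++ V)) (by simp)
      (w' := u ++ black :: s :: (c ++ (l.src ++ V))) (by simp) (by simp) ih
    simp only [cross, List.cons_append]
    rw [mul_assoc, h, ← mul_assoc, ← mul_assoc, ← sub_mul]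
    exact marked_mono (by simp) le_rfl _ this

lemma direct_box_right {u c V w : Word} {l : Loc} (hw : w = u ++ black :: (c ++ (l.src ++ V)))
    (i : ℕ) :
    direct k N (b + 1) u (c ++ (l.tgt ++ V)) i * π' (box l (u ++ black :: c) V) ∈
      marked k N b u.length 0 w := by
  subst hw
  have h := mul_box_left_pow rfl (Nat.lt_succ_self _) (cross_box_right (k := k) (N := N) (b := b)
    u c l V) i
  rw [sub_mul, mul_assoc (addStrand k N b _)] at h
  rw [direct, mul_assoc, dot_pow_box_right, ← mul_assoc]
  rw [← sub_add_cancel (_ * _ * _) (addStrand k N b (π (box l (u ++ c) V)) *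
    direct k N (b + 1) u (c ++ (l.src ++ V)) i)]
  exact add_mem (marked_mono (Nat.le_succ _) le_rfl _ h) (add_direct_mem rfl le_rfl _ _)

lemma direct_dot {U V : Word} {u v : Word} (h : U ++ black :: V = u ++ black :: v) (i : ℕ) :
    direct k N (b + 1) u v i * π' (dot U V) ∈ marked k N b 0 0 (U ++ black :: V) := by
  rcases split_box_tgt (l := .dot) h with ⟨c, rfl, rfl⟩ | ⟨-, rfl, rfl⟩ | ⟨h, -⟩ | ⟨h, -⟩ |
      ⟨n, h, -⟩ | ⟨n, h, -⟩ | ⟨c, rfl, rfl⟩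
  · exact marked_mono (Nat.zero_le _) le_rfl _ (direct_box_right (by simp [Loc.src]) i)
  · rw [direct, mul_assoc, ← pow_succ]
    exact direct_mem rfl (Nat.zero_le _) (i + 1)
  · cases h
  · cases h
  · cases h
  · cases h
  · rw [direct_box_left]
    exact add_direct_mem (by simp [Loc.src]) (Nat.zero_le _) _ _

lemma mul_dot_pow {U V w : Word} (hw : w = U ++ black :: V) {y : Alg k N (b + 1)}
    (hy : y ∈ marked k N b 0 0 w) (i : ℕ) : y * π' (dot U V) ^ i ∈ marked k N b 0 0 w := by
  induction i with
  | zero => simpa using hy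
  | succ i ih =>
    rw [pow_succ, ← mul_assoc]
    subst hw
    exact mul_mem_marked _ (fun u v j h _ => direct_dot h j)
      (fun u v j _ h => absurd h (by omega)) ih

/-- The span of the diagrams in which the marked strand moves directly is stable under the
multiplication by local pieces. -/
lemma direct_box {U V : Word} {l : Loc} {u v w : Word} (h : U ++ (l.tgt ++ V) = u ++ black :: v)
    (hw : w = U ++ (l.src ++ V)) (i : ℕ) :
    direct k N (b + 1) u v i * π' (box l U V) ∈ marked k N b 0 0 w := by
  subst hw
  rcases split_box_tgt h with ⟨c, rfl, rfl⟩ | ⟨rfl, rfl, rfl⟩ | ⟨rfl, rfl, rfl⟩ | ⟨rfl, rfl, rfl⟩ |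
      ⟨n, rfl, rfl, rfl⟩ | ⟨n, rfl, rfl, rfl⟩ | ⟨c, rfl, rfl⟩
  · exact marked_mono (Nat.zero_le _) le_rfl _ (direct_box_right (by simp) i)
  · exact direct_dot rfl i
  · rw [direct, mul_assoc, dot_pow_bb, mul_add, Finset.mul_sum]
    have h1 := proj_rel (k := k) N (b + 1) (.bb_bb u V)
    rw [map_mul, map_zero] at h1
    rw [cross, right, ← mul_assoc, mul_assoc (cross k N (b + 1) _ _), h1, mul_zero, zero_mul,
      zero_add]
    refine sum_mem fun j _ => ?_
    have h2 := mul_dot_pow (U := u ++ [black]) (V := V) (by simp)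
      (direct_mem (b := b) (k := k) (N := N) (u := u) (v := black :: V) rfl (Nat.zero_le _) j)
      (i - 1 - j)
    rw [direct, cross, right] at h2
    rw [← mul_assoc, ← mul_assoc, marked_mul_idem rfl h2]
    exact h2
  · rw [direct, mul_assoc, eq_sub_of_add_eq (bb_dot_pow U v i).symm, mul_sub, Finset.mul_sum,
      ← mul_assoc]
    refine sub_mem (direct_mem (u := U) (v := black :: v) (by simp [Loc.src]) (Nat.zero_le _) i)
      (sum_mem fun j _ => ?_)
    have hc : Commute (π' (dot U (black :: v))) (π' (dot (U ++ [black]) v)) := dot_comm_dot _ _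
    have h2 := mul_dot_pow (U := U) (V := black :: v) rfl
      (direct_mem (b := b) (k := k) (N := N) (u := U ++ [black]) (v := v) (by simp) (Nat.zero_le _)
        (i - 1 - j)) j
    rw [direct, mul_assoc, ← (hc.pow_pow _ _).eq] at h2
    rw [← mul_assoc, marked_mul_idem rfl h2]
    exact h2
  · have hc : SemiconjBy (π' (rb n u V)) (π' (dot (u ++ [red n]) V)) (π' (dot u (red n :: V))) := by
      have := proj_rel (k := k) N (b + 1) (.dot_rb n u V)
      rw [map_mul, map_mul] at this
      exact this.symm
    have h1 := proj_rel (k := k) N (b + 1) (.br_rb n u V)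
    simp only [map_mul, map_pow] at h1
    rw [direct, mul_assoc, ← (hc.pow_right i).eq, cross, right, mul_assoc, ← mul_assoc (π' _), h1,
      (Commute.pow_left (show Commute _ _ from (idem_comm_dot _ _ _ (by simp)).symm) n).eq,
      mul_assoc, ← pow_add, ← mul_assoc]
    have := cross_bot (k := k) (N := N) (b := b + 1) V (u ++ [red n])
    simp only [List.append_assoc, List.cons_append, List.nil_append] at this ⊢
    rw [this]
    exact direct_mem (u := u ++ [red n]) (v := V) (by simp [Loc.src]) (Nat.zero_le _) _
  · have hc : SemiconjBy (π' (br n U v)) (π' (dot U (red n :: v))) (π' (dot (U ++ [red n]) v)) := by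
      have := proj_rel (k := k) N (b + 1) (.br_dot n U v)
      rw [map_mul, map_mul] at this
      exact this
    rw [direct, mul_assoc, ← (hc.pow_right i).eq, ← mul_assoc]
    exact direct_mem (u := U) (v := red n :: v) (by simp [Loc.src]) (Nat.zero_le _) _
  · rw [direct_box_left]
    exact add_direct_mem (by simp) (Nat.zero_le _) _ _

lemma mul_box {U V w w' : Word} {l : Loc} (hw : w = U ++ (l.tgt ++ V))
    (hw' : w' = U ++ (l.src ++ V)) {y : Alg k N (b + 1)}
    (hy : y ∈ marked k N b 0 0 w) : y * π' (box l U V) ∈ marked k N b 0 0 w' :=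
  mul_mem_marked _ (fun _ _ i h _ => direct_box (hw.symm.trans h) hw' i)
    (fun _ _ _ _ h => absurd h (by omega)) hy

/-- Stability under the local pieces with at least `n` strands at their left implies stability under
the diagrams moving the marked strand to the left. -/
lemma mul_uncross {n : ℕ} (h : ∀ {U V : Word} {l : Loc} {y : Alg k N (b + 1)}, n ≤ U.length →
      y ∈ marked k N b 0 n (U ++ (l.tgt ++ V)) →
      y * π' (box l U V) ∈ marked k N b 0 n (U ++ (l.src ++ V)))
    {p u v w w' : Word} (hp : n ≤ p.length) (hw : w = p ++ black :: (u ++ v))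
    (hw' : w' = p ++ (u ++ black :: v)) {y : Alg k N (b + 1)} (hy : y ∈ marked k N b 0 n w) :
    y * uncross k N (b + 1) p u v ∈ marked k N b 0 n w' := by
  subst hw'
  induction u generalizing p w y with
  | nil =>
    subst hw
    rw [uncross, marked_mul_idem (by simp) hy]
    exact hy
  | cons s u ih =>
    rw [uncross, ← mul_assoc]
    have := ih (p := p ++ [s]) (w := p ++ ((left s).src ++ (u ++ v))) (by simp; omega) (by simp)
      (h hp (by rw [hw] at hy; simpa using hy))
    simpa using this

lemma mul_nail {w : Word} {y : Alg k N (b + 1)} (hy : y ∈ marked k N b 0 0 (black :: w)) :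
    y * π' (nail w) ∈ marked k N b 0 1 (black :: w) := by
  refine mul_mem_marked _ (fun u v i h _ => ?_) (fun _ _ _ _ h => absurd h (by omega)) hy
  cases u with
  | nil =>
    obtain rfl : w = v := by simpa using h
    have := loop_mem (k := k) (N := N) (b := b) (m := 0) (n := 1) (u := []) (v := w) rfl (by simp) i
    have h2 : π' (nail w) * π' (idem (black :: w)) = π' (nail w) := mul_bot (.nail w)
    rw [loop, uncross, List.nil_append, List.nil_append, mul_assoc _ (π' _) (π' _), h2] at this
    exact this
  | cons s u =>
    obtain ⟨rfl, rfl⟩ : black = s ∧ w = u ++ black :: v := by simpa using h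
    rw [direct_nail]
    exact add_direct_mem (u := black :: u) (v := v) rfl (Nat.zero_le _) _ _

/-- After the nail, the marked strand may return to any position. -/
lemma mul_nail_uncross {u v w : Word} (hw : w = u ++ black :: v) {y : Alg k N (b + 1)}
    (hy : y ∈ marked k N b 0 0 (black :: (u ++ v))) :
    y * π' (nail (u ++ v)) * uncross k N (b + 1) [] u v ∈ marked k N b 0 (u.length + 1) w := by
  subst hw
  rw [mul_assoc]
  refine mul_mem_marked _ (fun u' v' i h _ => ?_) (fun _ _ _ _ h => absurd h (by omega)) hy
  rw [← mul_assoc]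
  cases u' with
  | nil =>
    obtain rfl : u ++ v = v' := by simpa using h
    rw [direct_nail_nil]
    exact loop_mem rfl (Nat.lt_succ_self _) i
  | cons s u' =>
    obtain ⟨rfl, h'⟩ : black = s ∧ u ++ v = u' ++ black :: v' := by simpa using h
    rw [h', direct_nail]
    have h1 := add_direct_mem (k := k) (N := N) (b := b) (m := 0) (n := 0) h (Nat.zero_le _)
      (π (nail (u' ++ v'))) i
    have h2 := mul_uncross (n := 0) (p := []) (u := u) (v := v) (w' := u ++ black :: v)
      (fun _ hy => mul_box rfl rfl hy) (Nat.zero_le _) rfl rfl h1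
    exact marked_mono le_rfl (Nat.zero_le _) _ h2

lemma loop_box_right {u c V w : Word} {l : Loc} (hw : w = u ++ black :: (c ++ (l.src ++ V)))
    (i : ℕ) :
    loop k N (b + 1) u (c ++ (l.tgt ++ V)) i * π' (box l (u ++ black :: c) V) ∈
      marked k N b 0 (u.length + 1) w := by
  have h := proj_nail_box (k := k) (N := N) (b := b + 1) l (u ++ c) V
  have h2 := uncross_box_right (k := k) (N := N) (b := b + 1) [] u c l V
  simp only [List.append_assoc, List.nil_append, List.cons_append] at h h2
  have := mul_nail_uncross hw (mul_box (U := black :: (u ++ c)) (V := V) (l := l)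
    (w := black :: (u ++ (c ++ (l.tgt ++ V)))) (by simp) (by simp)
    (direct_mem (b := b) (k := k) (N := N) (u := []) rfl (Nat.zero_le _) i))
  rw [← direct_nail_nil, mul_assoc, h2, ← mul_assoc, mul_assoc _ (π' _) (π' _), h, ← mul_assoc]
  exact this

lemma mul_box_right {n : ℕ} {U V w w' : Word} {l : Loc} (hn : n ≤ U.length)
    (hw : w = U ++ (l.tgt ++ V)) (hw' : w' = U ++ (l.src ++ V)) {y : Alg k N (b + 1)}
    (hy : y ∈ marked k N b 0 n w) : y * π' (box l U V) ∈ marked k N b 0 n w' := by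
  refine mul_mem_marked _ (fun _ _ i h _ => ?_) (fun u v i h hu => ?_) hy
  · exact marked_mono le_rfl (Nat.zero_le _) _ (direct_box (hw.symm.trans h) hw' i)
  · have h := hw.symm.trans h
    rcases List.append_eq_append_iff.1 h with ⟨a, rfl, h2⟩ | ⟨a, rfl, h2⟩
    · rw [List.length_append] at hu; omega
    · cases a with
      | nil => simp only [List.append_nil] at hn; omega
      | cons s a =>
        obtain ⟨rfl, rfl⟩ : black = s ∧ v = a ++ (l.tgt ++ V) := by simpa using h2
        exact marked_mono le_rfl hu _ (loop_box_right (by simp [hw']) i)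

/-- A dot slides along the strand, up to diagrams in which the strand turns around further to the
left. -/
lemma loop_dot (u v : Word) (i : ℕ) :
    loop k N (b + 1) u v i * π' (dot u v) - loop k N (b + 1) u v (i + 1) ∈
      marked k N b 0 u.length (u ++ black :: v) := by
  induction u using List.reverseRecOn generalizing v i with
  | nil =>
    have h1 : π' (idem (black :: v)) * π' (dot [] v) = π' (dot [] v) := top_box _ _ _ _ rfl
    have h2 : π' (dot [] v) * π' (idem (black :: v)) = π' (dot [] v) := box_bot _ _ _ _ rfl
    have h3 : π' (nail v) * π' (idem (black :: v)) = π' (nail v) := mul_bot (.nail v)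
    have h4 := dot_pow_nail (k := k) (N := N) (b := b + 1) v 1
    rw [pow_one] at h4
    have : loop k N (b + 1) [] v i * π' (dot [] v) = loop k N (b + 1) [] v (i + 1) := by
      simp only [loop, uncross, List.nil_append]
      rw [mul_assoc, h1, mul_assoc _ _ (π' (idem _)), h3, mul_assoc, ← h4, pow_succ]
      simp only [mul_assoc]
    rw [this, sub_self]
    exact zero_mem _
  | append_singleton u s ih =>
    have ih := ih (s :: v) i
    have h := mul_box_right (U := u) (V := v) (l := left s) le_rfl (by simp) rfl ih
    rw [sub_mul, ← loop_snoc] at h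
    rw [List.append_assoc, List.cons_append, List.nil_append]
    rw [src_left] at h
    cases s with
    | black =>
      have hr := proj_rel (k := k) N (b + 1) (.dot_bb u v)
      simp only [map_mul, map_add, List.append_assoc, List.cons_append, List.nil_append] at hr
      have hb := loop_bot (k := k) (N := N) (b := b + 1) u (black :: v) i
      have := loop_mem (k := k) (N := N) (b := b) (m := 0) (n := u.length + 1) (u := u)
        (v := black :: v) rfl (by simp) i
      rw [left, mul_assoc, hr, mul_add, hb, ← mul_assoc] at h
      rw [loop_snoc _ _ _ i, left]
      have h2 := sub_mem (marked_mono le_rfl (Nat.le_succ _) _ h) this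
      rw [add_sub_right_comm, add_sub_cancel_right] at h2
      rw [List.length_append]
      exact h2
    | red n =>
      have hr := proj_rel (k := k) N (b + 1) (.dot_rb n u v)
      simp only [map_mul, List.append_assoc, List.cons_append, List.nil_append] at hr
      rw [left, mul_assoc, hr, ← mul_assoc] at h
      rw [loop_snoc _ _ _ i, left]
      exact marked_mono le_rfl (by simp) _ h

lemma loop_dot_mem (u v : Word) (i : ℕ) :
    loop k N (b + 1) u v i * π' (dot u v) ∈ marked k N b 0 (u.length + 1) (u ++ black :: v) := by
  have := add_mem (marked_mono le_rfl (Nat.le_succ _) _ (loop_dot (k := k) (N := N) (b := b) u v i))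
    (loop_mem (m := 0) rfl (Nat.lt_succ_self u.length) (i + 1))
  rwa [sub_add_cancel] at this

lemma mul_dot_right {n : ℕ} {U V w : Word} (hn : n ≤ U.length + 1) (hw : w = U ++ black :: V)
    {y : Alg k N (b + 1)} (hy : y ∈ marked k N b 0 n w) :
    y * π' (dot U V) ∈ marked k N b 0 n w := by
  refine mul_mem_marked _ (fun _ _ i h _ => ?_) (fun u v i h hu => ?_) hy
  · exact marked_mono le_rfl (Nat.zero_le _) _
      (direct_box (l := .dot) (hw.symm.trans h) hw i)
  · rcases Nat.lt_or_ge u.length U.length with h' | h'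
    · exact marked_mono le_rfl hu _ (mul_box_right (l := .dot) (n := u.length + 1) h' hw hw
        (loop_mem h (Nat.lt_succ_self _) i))
    · obtain ⟨rfl, h2⟩ := List.append_inj (hw.symm.trans h) (by omega)
      obtain rfl : V = v := by simpa using h2
      subst hw
      exact marked_mono le_rfl hu _ (loop_dot_mem _ _ i)

lemma mul_dot_right_pow {n : ℕ} {U V w : Word} (hn : n ≤ U.length + 1) (hw : w = U ++ black :: V)
    {y : Alg k N (b + 1)} (hy : y ∈ marked k N b 0 n w) (i : ℕ) :
    y * π' (dot U V) ^ i ∈ marked k N b 0 n w := by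
  induction i with
  | zero => simpa using hy
  | succ i ih => rw [pow_succ, ← mul_assoc]; exact mul_dot_right hn hw ih

/-- The marked strand may return through a few more strands. -/
lemma mul_uncross_mem {p u v w w' : Word} (hw : w = p ++ black :: (u ++ v))
    (hw' : w' = p ++ (u ++ black :: v)) {y : Alg k N (b + 1)}
    (hy : y ∈ marked k N b 0 (p.length + 1) w) :
    y * uncross k N (b + 1) p u v ∈ marked k N b 0 w'.length w' := by
  refine mul_mem_marked _ (fun u' v' i h _ => ?_) (fun u' v' i h hu => ?_) hy
  · exact marked_mono le_rfl (Nat.zero_le _) _ (mul_uncross (n := 0)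
      (fun _ hy => mul_box rfl rfl hy) (Nat.zero_le _) hw hw' (direct_mem h (Nat.zero_le _) i))
  · rcases Nat.lt_or_ge u'.length p.length with h' | h'
    · exact marked_le _ _ _ (mul_uncross (n := u'.length + 1)
        (fun hn hy => mul_box_right hn rfl rfl hy) h' hw hw' (loop_mem h (Nat.lt_succ_self _) i))
    · obtain ⟨rfl, h2⟩ := List.append_inj (hw.symm.trans h) (by omega)
      obtain rfl : u ++ v = v' := by simpa using h2
      rw [← loop_append]
      exact loop_mem (by simp [hw']) (by simp [hw']) i

end Spanning

/-! ### Loops -/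

section Spanning

variable {k : Type u} [CommRing k] {N : List ℕ} {b : ℕ}

local notation "π" => proj k N b
local notation "π'" => proj k N (b + 1)

lemma mul_nail_left {w : Word} {y : Alg k N (b + 1)} (hy : y ∈ marked k N b 1 0 (black :: w)) :
    y * π' (nail w) ∈ marked k N b 1 0 (black :: w) := by
  refine mul_mem_marked _ (fun u v i h hu => ?_) (fun _ _ _ _ h => absurd h (by omega)) hy
  cases u with
  | nil => simp at hu
  | cons s u =>
    obtain ⟨rfl, rfl⟩ : black = s ∧ w = u ++ black :: v := by simpa using h
    rw [direct_nail]
    exact add_direct_mem (u := black :: u) (v := v) rfl hu _ _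

/-- A local piece at the left of the marked strand slides through the part of a loop which returns
to the right. The correction terms of the relations are combinations of basis elements again. -/
lemma loop_box_left {U c v w : Word} {l : Loc} (hw : w = U ++ (l.src ++ (c ++ black :: v)))
    (i : ℕ) :
    loop k N (b + 1) (U ++ (l.tgt ++ c)) v i * π' (box l U (c ++ black :: v)) ∈
      marked k N b 0 w.length w := by
  -- the remaining strands of `c` play no role
  suffices h : ∃ y ∈ marked k N b 0 (U.length + 1) (U ++ black :: (l.src ++ (c ++ v))),
      ∃ z ∈ marked k N b 0 (U.length + 1) (U ++ (l.src ++ black :: (c ++ v))),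
      loop k N (b + 1) U (l.tgt ++ (c ++ v)) i *
        (uncross k N (b + 1) U l.tgt (c ++ v) * π' (box l U (black :: (c ++ v)))) =
      y * uncross k N (b + 1) U l.src (c ++ v) + z by
    obtain ⟨y, hy, z, hz, h⟩ := h
    have h1 := uncross_box_left (k := k) (N := N) (b := b + 1) U l [] c v
    simp only [List.nil_append, List.append_nil] at h1
    have h2 : z * uncross k N (b + 1) (U ++ l.src) c v ∈ marked k N b 0 w.length w := by
      refine marked_le _ _ _ (mul_uncross (n := U.length + 1)
        (fun hn hy => mul_box_right hn rfl rfl hy)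
        ?_ (by simp) (by simp [hw]) hz)
      cases l <;> simp [Loc.src]
    have h3 := mul_uncross_mem (u := l.src ++ c) (v := v) (by simp) (by simpa using hw) hy
    rw [uncross_append] at h3
    rw [loop_append, uncross_append, mul_assoc, mul_assoc, h1, ← mul_assoc (uncross k N (b +
      1) _ _ _),
      ← mul_assoc, List.append_assoc, h, add_mul, mul_assoc]
    exact add_mem h3 h2
  generalize c ++ v = V
  have hR : ∀ y, y ∈ marked k N b 0 (U.length + 1) (U ++ black :: (l.tgt ++ V)) →
      y * π' (box l (U ++ [black]) V) ∈ marked k N b 0 (U.length + 1) (U ++ black ::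
        (l.src ++ V)) :=
    fun y hy => mul_box_right (by simp) (by simp) (by simp) hy
  have hL := loop_mem (k := k) (N := N) (b := b) (m := 0) (n := U.length + 1) (u := U)
    (v := l.tgt ++ V) rfl (by simp) i
  have hLR := hR _ hL
  have e1 : ∀ (l : Loc) (u v : Word), π' (box l u v) * π' (idem (u ++ (l.src ++ v))) =
      π' (box l u v) :=
    fun l u v => box_bot _ _ _ _ rfl
  refine ⟨_, hLR, ?_⟩
  cases l with
  | dot =>
    have hr := proj_rel (k := k) N (b + 1) (.bb_dot U V)
    have e2 := e1 .bb U V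
    simp only [map_mul, map_add, List.append_assoc, List.cons_append, List.nil_append, Loc.src,
      Loc.tgt, uncross, left] at hr e2 hLR hL ⊢
    refine ⟨_, hL, ?_⟩
    have hb := loop_bot (k := k) (N := N) (b := b + 1) U (black :: V) i
    rw [e2, hr, mul_add, hb, ← mul_assoc]
  | bb =>
    have hr := proj_rel (k := k) N (b + 1) (.bb_braid U V)
    have e2 := e1 .bb (U ++ [black]) V
    refine ⟨0, zero_mem _, ?_⟩
    simp only [map_mul, map_add, List.append_assoc, List.cons_append, List.nil_append, Loc.src,
      Loc.tgt, uncross, left] at hr e2 hLR hL ⊢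
    rw [e2, hr, add_zero]
    simp only [mul_assoc]
  | br n =>
    have hr := proj_rel (k := k) N (b + 1) (.rb_bb_br n U V)
    have e2 := e1 .bb (U ++ [red n]) V
    have e3 := e1 (.rb n) (U ++ [black]) V
    simp only [map_mul, map_add, map_sum, map_pow, List.append_assoc, List.cons_append,
      List.nil_append, Loc.src, Loc.tgt, uncross, left] at hr e2 e3 hLR hL ⊢
    have hs : ∑ j ∈ Finset.range n, loop k N (b + 1) U (red n :: black :: V) i *
        (π' (dot U (red n :: black :: V)) ^ j * π' (dot (U ++ [black, red n]) V) ^ (n - 1 - j) *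
          π' (idem (U ++ black :: red n :: black :: V))) ∈
        marked k N b 0 (U.length + 1) (U ++ black :: red n :: black :: V) := by
      refine sum_mem fun j _ => ?_
      have h1 := mul_dot_right_pow (U := U ++ [black, red n]) (V := V) (by simp) (by simp)
        (mul_dot_right_pow le_rfl rfl hL j) (n - 1 - j)
      rw [← mul_assoc, ← mul_assoc, marked_mul_idem rfl h1]
      exact h1
    rw [e2, hr, e3, mul_add, Finset.mul_sum]
    exact ⟨_, hs, by simp only [mul_assoc]⟩
  | rb n =>
    have hr := proj_rel (k := k) N (b + 1) (.bb_rb_rb n U V)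
    have e2 := e1 (.rb n) (U ++ [black]) V
    have e3 := e1 .bb (U ++ [red n]) V
    refine ⟨0, zero_mem _, ?_⟩
    simp only [map_mul, map_add, List.append_assoc, List.cons_append, List.nil_append, Loc.src,
      Loc.tgt, uncross, left] at hr e2 e3 hLR hL ⊢
    rw [e2, hr, e3, add_zero]
    simp only [mul_assoc]

lemma loop_box {U V : Word} {l : Loc} {u v w : Word} (h : U ++ (l.tgt ++ V) = u ++ black :: v)
    (hw : w = U ++ (l.src ++ V)) (i : ℕ) :
    loop k N (b + 1) u v i * π' (box l U V) ∈ marked k N b 0 w.length w := by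
  subst hw
  rcases split_box_tgt h with ⟨c, rfl, rfl⟩ | ⟨rfl, rfl, rfl⟩ | ⟨rfl, rfl, rfl⟩ | ⟨rfl, rfl, rfl⟩ |
      ⟨n, rfl, rfl, rfl⟩ | ⟨n, rfl, rfl, rfl⟩ | ⟨c, rfl, rfl⟩
  · exact marked_le _ _ _ (loop_box_right (by simp) i)
  · exact marked_le _ _ _ (loop_dot_mem _ _ i)
  · have := loop_snoc (k := k) (N := N) (b := b + 1) u black V i
    rw [left] at this
    rw [← this]
    exact loop_mem (by simp [Loc.src]) (by simp [Loc.src]) i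
  · have h1 := proj_rel (k := k) N (b + 1) (.bb_bb U v)
    rw [map_mul, map_zero] at h1
    rw [loop_snoc, left, mul_assoc, h1, mul_zero]
    exact zero_mem _
  · have := loop_snoc (k := k) (N := N) (b := b + 1) u (red n) V i
    rw [left] at this
    rw [← this]
    exact loop_mem (by simp [Loc.src]) (by simp [Loc.src]) i
  · have h1 := proj_rel (k := k) N (b + 1) (.rb_br n U v)
    simp only [map_mul, map_pow] at h1
    have h2 := mul_dot_right_pow (k := k) (N := N) (b := b) le_rfl rfl
      (loop_mem (m := 0) rfl (Nat.lt_succ_self U.length) (v := red n :: v) i) n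
    rw [loop_snoc, left, mul_assoc, h1, ← mul_assoc, marked_mul_idem (by simp) h2]
    simpa [Loc.src] using marked_le _ _ _ h2
  · exact loop_box_left (by simp) i

/-- The computation for a nail below a loop: the dots are moved to the neighbouring strand, after
which the relation `τθτθ = -θτθτ` applies. -/
lemma nail_aux {B : Type u} [Ring B] {c c' x θ τ ν θ' e : B} {i : ℕ} {f y : ℕ → B}
    (hc : c' = c * τ) (h3 : τ * x ^ i = y i * τ + ∑ j ∈ Finset.range i, f j * e)
    (he : e * θ = θ) (h1 : ν * θ' = θ * ν) (h2 : τ * θ * τ * θ = -(θ * τ * θ * τ)) :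
    c' * x ^ i * θ * (τ * ν) * θ' =
      ∑ j ∈ Finset.range i, c * f j * θ * τ * θ * ν - c * y i * θ * τ * θ * (τ * ν) := by
  have e0 : c' * x ^ i * θ * (τ * ν) * θ' = c * (τ * x ^ i) * θ * τ * (ν * θ') := by
    rw [hc]; simp only [mul_assoc]
  have e1 : c * (y i * τ) * θ * τ * (θ * ν) = c * y i * (τ * θ * τ * θ) * ν := by
    simp only [mul_assoc]
  have e2 : ∀ j, c * (f j * e) * θ * τ * (θ * ν) = c * f j * θ * τ * θ * ν := fun j => by
    rw [mul_assoc c, mul_assoc (f j), he]; simp only [mul_assoc]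
  rw [e0, h1, h3, mul_add, add_mul, add_mul, add_mul, e1, h2, Finset.mul_sum, Finset.sum_mul,
    Finset.sum_mul, Finset.sum_mul, Finset.sum_congr rfl fun j _ => e2 j, mul_neg, neg_mul]
  simp only [mul_assoc]
  abel

/-- A nail below a loop: if it is on the marked strand, there are two nails in a row; otherwise it
is exchanged with the loop. -/
lemma loop_nail {u v w : Word} (h : black :: w = u ++ black :: v) (i : ℕ) :
    loop k N (b + 1) u v i * π' (nail w) ∈ marked k N b 0 (black :: w).length (black :: w) := by
  cases u with
  | nil =>
    obtain rfl : w = v := by simpa using h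
    have h1 : π' (idem (black :: w)) * π' (nail w) = π' (nail w) := top_mul (.nail w)
    have h2 := proj_rel (k := k) N (b + 1) (.nail_nail w)
    rw [map_mul, map_zero] at h2
    rw [loop, uncross, List.nil_append, List.nil_append, mul_assoc, h1, mul_assoc, h2, mul_zero]
    exact zero_mem _
  | cons s u =>
    obtain ⟨rfl, rfl⟩ : black = s ∧ w = u ++ black :: v := by simpa using h
    -- after moving the dots to the second strand, the relation between nails and crossings applies
    have h1 := uncross_nail (k := k) (N := N) (b := b + 1) [] u v
    have h2 := proj_rel (k := k) N (b + 1) (.nail_bb (u ++ v))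
    simp only [map_mul, map_neg, List.nil_append] at h1 h2
    have e1 : π' (idem (black :: black :: (u ++ v))) * π' (nail (black :: (u ++ v))) =
      π' (nail (black :: (u ++ v))) := top_mul (.nail _)
    have e : loop k N (b + 1) (black :: u) v i * π' (nail (u ++ black :: v)) =
        ∑ j ∈ Finset.range i, cross k N (b + 1) [black] (u ++ v) *
          (π' (dot [] (black :: (u ++ v))) ^ j * π' (dot [black] (u ++ v)) ^ (i - 1 - j)) *
            π' (nail (black :: (u ++ v))) * π' (bb [] (u ++ v)) * π' (nail (black :: (u ++ v))) *
              uncross k N (b + 1) [black] u v -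
        direct k N (b + 1) [black] (u ++ v) i * π' (nail (black :: (u ++ v))) *
          π' (bb [] (u ++ v)) * π' (nail (black :: (u ++ v))) *
          (π' (bb [] (u ++ v)) * uncross k N (b + 1) [black] u v) := by
      have h3 := bb_dot_pow (k := k) (N := N) (b := b + 1) [] (u ++ v) i
      simp only [List.nil_append] at h3
      rw [loop, uncross, left, List.cons_append, List.nil_append]
      exact nail_aux (y := fun i => π' (dot [black] (u ++ v)) ^ i) (by rw [cross, right]; rfl)
        h3 e1 h1 h2
    rw [e]
    refine sub_mem (sum_mem fun j _ => ?_) ?_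
    · have hc : Commute (π' (dot [] (black :: (u ++ v)))) (π' (dot [black] (u ++ v))) :=
        dot_comm_dot _ _
      have h4 := mul_box_left_pow (u := []) (v := black :: (u ++ v)) rfl Nat.one_pos
        (direct_mem (k := k) (N := N) (b := b) (m := 1) (u := [black]) (v := u ++ v) rfl (by simp)
          (i - 1 - j)) j
      have h5 := mul_nail (mul_box (U := []) (V := u ++ v) (l := .bb) rfl rfl
        (marked_mono (Nat.zero_le _) le_rfl _ (mul_nail_left h4)))
      have h6 := marked_le _ _ _ (mul_uncross (n := 1) (p := [black]) (u := u) (v := v)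
        (w' := black :: (u ++ black :: v))
        (fun hn hy => mul_box_right hn rfl rfl hy) (by simp) rfl (by simp) h5)
      rw [(hc.pow_pow _ _).eq, ← mul_assoc (cross k N (b + 1) _ _)]
      exact h6
    · have h4 := mul_nail_left (direct_mem (k := k) (N := N) (b := b) (m := 1) (u := [black])
        (v := u ++ v) (w := black :: black :: (u ++ v)) rfl (by simp) i)
      have h5 := mul_box (U := []) (V := u ++ v) (l := .bb) rfl rfl
        (marked_mono (Nat.zero_le _) le_rfl _ h4)
      have h6 := marked_le _ _ _ (mul_nail_uncross (u := black :: u) (v := v)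
        (w := black :: (u ++ black :: v)) rfl h5)
      rw [uncross, left] at h6
      exact h6

variable (k N b) in
lemma lastIdem_eq_direct :
    lastIdem k N b = ∑ w ∈ words N b, direct k N (b + 1) w [] 0 := by
  simp [lastIdem, direct, cross]

/-- The span of the basis elements is stable under the right multiplication by generating
diagrams. -/
lemma mul_gen_mem (g : Gen) {y : Alg k N (b + 1)} (hy : y ∈ marked k N b 0 g.top.length g.top) :
    y * π' (gen g) ∈ marked k N b 0 g.bot.length g.bot := by
  cases g with
  | idem w => exact (marked_mul_idem rfl hy).symm ▸ hy
  | box U l V =>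
    refine mul_mem_marked _ (fun u v i h _ => ?_) (fun u v i h _ => ?_) hy
    · exact marked_le _ _ _ (direct_box (by rw [← h, Gen.top, List.append_assoc])
        (by rw [Gen.bot, List.append_assoc]) i)
    · exact loop_box (by rw [← h, Gen.top, List.append_assoc])
        (by rw [Gen.bot, List.append_assoc]) i
  | nail w =>
    refine mul_mem_marked _ (fun u v i h _ => ?_) (fun u v i h _ => ?_) hy
    · exact marked_le _ _ _ (mul_nail (direct_mem h (Nat.zero_le _) i))
    · exact loop_nail h i

end Spanning

/-! ### Coordinates -/

section Coordinates

variable {k : Type u} [CommRing k] {N : List ℕ} {b : ℕ}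

local notation "π" => proj k N b
local notation "π'" => proj k N (b + 1)

lemma cross_top (u v : Word) :
    addStrand k N b (π (idem (u ++ v))) * cross k N (b + 1) u v = cross k N (b + 1) u v := by
  induction v generalizing u with
  | nil =>
    rw [cross, addStrand_gen, List.append_nil]
    exact top_mul (.idem (u ++ [black]))
  | cons s v ih =>
    have ih := ih (u ++ [s])
    rw [List.append_assoc, List.cons_append, List.nil_append] at ih
    rw [cross, ← mul_assoc, ih]

/-- The vertical diagram at the top of a basis element, without the marked strand. -/
noncomputable def Idx.idem (k : Type u) [CommRing k] (N : List ℕ) (b : ℕ) (j : Idx) : Alg k N b :=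
  proj k N b (KLRW.idem (j.1.1 ++ j.1.2))

lemma idem_mul_basisElt (j : Idx) :
    addStrand k N b (j.idem k N b) * basisElt k N (b + 1) j = basisElt k N (b + 1) j := by
  unfold basisElt Idx.idem
  split_ifs
  · simp only [loop, ← mul_assoc]
    have := cross_top (k := k) (N := N) (b := b) [] (j.1.1 ++ j.1.2)
    rw [List.nil_append] at this
    rw [this]
  · rw [direct, ← mul_assoc, cross_top]

lemma Idx.idem_mul_idem (j : Idx) : j.idem k N b * j.idem k N b = j.idem k N b :=
  top_mul (.idem _)

lemma combine_single (j : Idx) (a : Alg k N b) :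
    combine k N b (Finsupp.single j a) = addStrand k N b a * basisElt k N (b + 1) j := by
  simp [combine]

variable (k N b) in
/-- The families of coefficients compatible with the diagrams at the top of the basis elements. -/
def families : Submodule k (Idx →₀ Alg k N b) where
  carrier := {f | ∀ j, f j * j.idem k N b = f j}
  zero_mem' j := by simp
  add_mem' hf hg j := by simp [add_mul, hf j, hg j]
  smul_mem' c f hf j := by simp [hf j]

lemma single_mem_families {j : Idx} {a : Alg k N b} (h : a * j.idem k N b = a) :
    Finsupp.single j a ∈ families k N b := fun i => by
  rcases eq_or_ne i j with rfl | hi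
  · rwa [Finsupp.single_eq_same]
  · rw [Finsupp.single_eq_of_ne hi, zero_mul]

lemma exists_family (j : Idx) (a : Alg k N b) :
    ∃ f ∈ families k N b, combine k N b f = addStrand k N b a * basisElt k N (b + 1) j :=
  ⟨_, single_mem_families (j := j) (a := a * j.idem k N b)
    (by rw [mul_assoc, Idx.idem_mul_idem]), by
    rw [combine_single, map_mul, mul_assoc, idem_mul_basisElt]⟩

lemma marked_le_map (m n : ℕ) (w : Word) :
    marked k N b m n w ≤ (families k N b).map (combine k N b) := by
  refine Submodule.span_le.2 ?_
  rintro y (⟨a, u, v, l, -, -, rfl⟩ | ⟨a, u, v, l, -, -, rfl⟩)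
  · exact exists_family ((u, v), l, false) a
  · exact exists_family ((u, v), l, true) a

lemma lastIdem_mul_mem (y : Alg k N (b + 1)) :
    lastIdem k N b * y ∈ ⨆ w, marked k N b 0 w.length w := by
  induction y using alg_induction' with
  | one =>
    rw [mul_one, lastIdem_eq_direct]
    refine sum_mem fun w _ => Submodule.mem_iSup_of_mem (w ++ [black])
      (direct_mem rfl (Nat.zero_le _) 0)
  | mul_gen g x ih =>
    rw [← mul_assoc]
    refine Submodule.iSup_induction _ (motive := fun y => y * π' (gen g) ∈ _) ih (fun w y hy => ?_)
      (by simp) (fun x y hx hy => by rw [add_mul]; exact add_mem hx hy)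
    by_cases hw : w = g.top
    · subst hw
      exact Submodule.mem_iSup_of_mem g.bot (mul_gen_mem g hy)
    · rw [← marked_mul_idem rfl hy, ← top_mul g, mul_assoc, ← mul_assoc (π' (idem w)),
        idem_mul_ne hw, zero_mul, mul_zero]
      exact zero_mem _
  | add x y hx hy => rw [mul_add]; exact add_mem hx hy
  | smul c x hx => rw [mul_smul_comm]; exact Submodule.smul_mem _ c hx

lemma exists_coords (y : Alg k N (b + 1)) :
    ∃ f ∈ families k N b, combine k N b f = lastIdem k N b * y := by
  have h : (⨆ w : Word, marked k N b 0 w.length w) ≤ (families k N b).map (combine k N b) :=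
    iSup_le fun w => marked_le_map _ _ _
  exact h (lastIdem_mul_mem y)

lemma eq_of_map_eq {V W : Type*} [AddCommMonoid V] [Module k V] [AddCommMonoid W] [Module k W]
    {S : Submodule k V} {F : V →ₗ[k] W} (hF : ∀ f ∈ S, F f = 0 → f = 0) {f g : V} (hf : f ∈ S)
    (hg : g ∈ S) (h : F f = F g) : f = g := by
  let _ := Module.addCommMonoidToAddCommGroup k (M := V)
  let _ := Module.addCommMonoidToAddCommGroup k (M := W)
  exact sub_eq_zero.1 (hF _ (sub_mem hf hg) (by rw [map_sub, h, sub_self]))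

lemma families_ext {f g : Idx →₀ Alg k N b} (hf : f ∈ families k N b) (hg : g ∈ families k N b)
    (h : combine k N b f = combine k N b g) : f = g :=
  eq_of_map_eq (S := families k N b) (F := combine k N b)
    (fun _ hf h => combine_injective (fun j => hf j) h) hf hg h

variable (k N b) in
/-- The coordinates in the basis. -/
noncomputable def coords : Alg k N (b + 1) →ₗ[k] (Idx →₀ Alg k N b) where
  toFun y := (exists_coords y).choose
  map_add' x y := families_ext (exists_coords _).choose_spec.1
    (add_mem (exists_coords _).choose_spec.1 (exists_coords _).choose_spec.1) (by
      rw [map_add, (exists_coords _).choose_spec.2, (exists_coords _).choose_spec.2,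
        (exists_coords _).choose_spec.2, mul_add])
  map_smul' c x := families_ext (exists_coords _).choose_spec.1
    (Submodule.smul_mem _ c (exists_coords _).choose_spec.1) (by
      rw [RingHom.id_apply, map_smul, (exists_coords _).choose_spec.2,
        (exists_coords _).choose_spec.2, mul_smul_comm])

lemma coords_mem (y : Alg k N (b + 1)) : coords k N b y ∈ families k N b :=
  (exists_coords y).choose_spec.1

lemma combine_coords (y : Alg k N (b + 1)) : combine k N b (coords k N b y) = lastIdem k N b * y :=
  (exists_coords y).choose_spec.2

lemma coords_eq {y : Alg k N (b + 1)} {f : Idx →₀ Alg k N b} (hf : f ∈ families k N b)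
    (h : combine k N b f = lastIdem k N b * y) : coords k N b y = f :=
  families_ext (coords_mem y) hf (by rw [combine_coords, h])

lemma coords_basisElt (j : Idx) :
    coords k N b (basisElt k N (b + 1) j) = Finsupp.single j (j.idem k N b) := by
  refine coords_eq (single_mem_families j.idem_mul_idem) ?_
  rw [combine_single, ← addStrand_one]
  nth_rewrite 2 [← idem_mul_basisElt]
  rw [← mul_assoc, ← map_mul, one_mul]

lemma coords_mul (a : Alg k N b) (y : Alg k N (b + 1)) (j : Idx) :
    coords k N b (addStrand k N b a * y) j = a * coords k N b y j := by
  have h : Finsupp.mapRange.linearMap (LinearMap.mulLeft k a) (coords k N b y) ∈ families k N b :=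
    fun j => by simp [mul_assoc, coords_mem y j]
  rw [coords_eq h]
  · simp
  · have e : ∀ f, combine k N b (Finsupp.mapRange.linearMap (LinearMap.mulLeft k a) f) =
        addStrand k N b a * combine k N b f := fun f => by
      induction f using Finsupp.induction_linear with
      | zero => simp
      | add f g hf hg => simp only [map_add, hf, hg, mul_add]
      | single j c => simp [combine_single, mul_assoc, -Finsupp.single_mul]
    rw [e, combine_coords, ← mul_assoc, ← mul_assoc, ← addStrand_one, ← map_mul, ← map_mul, one_mul,
      mul_one]

end Coordinates

end KLRW

end DGKLRW

/-! ### Coinduction -/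

namespace DGKLRW

section Homogeneous

variable {k : Type u} [CommRing k]

/-- The part of degree `s` of a linear map `f` out of a graded algebra, when the linear maps `p i`
take the part of degree `i` in the target. -/
noncomputable def homPart {D : GrAlg k} {V : Type u} [AddCommGroup V] [Module k V]
    (p : Deg → V →ₗ[k] V) (s : Deg) (f : D →ₗ[k] V) : D →ₗ[k] V :=
  (DirectSum.toModule k Deg V fun i => p (i + s) ∘ₗ f ∘ₗ (D.gr i).subtype) ∘ₗ
    (DirectSum.decomposeLinearEquiv D.gr).toLinearMap

variable {D : GrAlg k} {V : Type u} [AddCommGroup V] [Module k V] {p : Deg → V →ₗ[k] V}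

lemma homPart_of_mem {s i : Deg} {f : D →ₗ[k] V} {y : D} (hy : y ∈ D.gr i) :
    homPart p s f y = p (i + s) (f y) := by
  have h : DirectSum.decompose D.gr y = DirectSum.lof k Deg (fun i => D.gr i) i ⟨y, hy⟩ :=
    DirectSum.decompose_of_mem D.gr hy
  simp only [homPart, LinearMap.comp_apply, LinearEquiv.coe_coe,
    DirectSum.decomposeLinearEquiv_apply, h, DirectSum.toModule_lof]
  rfl

lemma grAlg_hom_ext {f g : D →ₗ[k] V} (h : ∀ i, ∀ y ∈ D.gr i, f y = g y) : f = g :=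
  LinearMap.ext fun y => hom_induction D.internal (p := fun y => f y = g y) (by simp)
    (fun x y hx hy => by simp only [map_add, hx, hy]) h y

lemma homPart_add (s : Deg) (f g : D →ₗ[k] V) :
    homPart p s (f + g) = homPart p s f + homPart p s g :=
  grAlg_hom_ext fun i y hy => by simp [homPart_of_mem hy]

lemma homPart_smul (s : Deg) (c : k) (f : D →ₗ[k] V) :
    homPart p s (c • f) = c • homPart p s f :=
  grAlg_hom_ext fun i y hy => by simp [homPart_of_mem hy]

lemma homPart_zero (s : Deg) : homPart p s (0 : D →ₗ[k] V) = 0 :=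
  grAlg_hom_ext fun i y hy => by simp [homPart_of_mem hy]

/-- A spanning family of submodules that is separated by linear maps is a grading. -/
lemma internal_of_separating {W : Type u} [AddCommGroup W] [Module k W]
    (G : Deg → Submodule k W) (j : W →ₗ[k] V) (hj : Function.Injective j)
    (K : Deg → W →ₗ[k] V)
    (hK : ∀ i, ∀ x ∈ G i, K i x = j x) (hK' : ∀ i i', i ≠ i' → ∀ x ∈ G i, K i' x = 0)
    (hG : ∀ x, x ∈ ⨆ i, G i) :
    DirectSum.IsInternal G := by
  have key : ∀ (x : ⨁ i, G i) (i : Deg), K i (DirectSum.coeLinearMap G x) = j (x i) := by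
    intro x i
    induction x using DirectSum.induction_on with
    | zero => simp
    | of i' y =>
      have : DirectSum.coeLinearMap G (DirectSum.of (fun i => G i) i' y) = y :=
        DirectSum.coeLinearMap_lof G i' y
      rw [this, DirectSum.coe_of_apply]
      split_ifs with h
      · subst h; exact hK _ _ y.2
      · rw [hK' _ _ h _ y.2, ZeroMemClass.coe_zero, map_zero]
    | add x y hx hy =>
      rw [map_add, map_add, hx, hy, DirectSum.add_apply, Submodule.coe_add, map_add]
  constructor
  · intro x y hxy
    refine DFinsupp.ext fun i => Subtype.ext (hj ?_)
    have h : DirectSum.coeLinearMap G x = DirectSum.coeLinearMap G y := hxy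
    rw [← key x i, ← key y i, h]
  · intro m
    have h : m ∈ LinearMap.range (DirectSum.coeLinearMap G) := by
      rw [DirectSum.range_coeLinearMap]; exact hG m
    exact h

/-- A family of submodules generates its span, as a family of submodules of the span. -/
lemma mem_iSup_comap (G : Deg → Submodule k V) (m : ↥(⨆ i, G i)) :
    m ∈ ⨆ i, (G i).comap (⨆ i, G i).subtype := by
  obtain ⟨m, hm⟩ := m
  induction hm using Submodule.iSup_induction' with
  | mem i x hx => exact Submodule.mem_iSup_of_mem i hx
  | zero => exact zero_mem _
  | add x y hx hy h1 h2 => exact add_mem h1 h2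

end Homogeneous

namespace DGMod

variable {k : Type u} [CommRing k] {B D : GrAlg k}

/-- The projection to the part of degree `i`. -/
noncomputable def part (X : DGMod B) (i : Deg) : X →ₗ[k] X := Finsupp.lapply i ∘ₗ X.coaction

lemma part_of_mem (X : DGMod B) {i : Deg} {x : X} (hx : x ∈ X.gr i) : X.part i x = x := by
  simp [part, X.coaction_of_mem hx]

lemma part_of_ne (X : DGMod B) {i j : Deg} (h : i ≠ j) {x : X} (hx : x ∈ X.gr i) :
    X.part j x = 0 := by
  simp [part, X.coaction_of_mem hx, Finsupp.single_eq_of_ne h.symm]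

lemma part_mem (X : DGMod B) (i : Deg) (x : X) : X.part i x ∈ X.gr i := by
  refine hom_induction X.internal (p := fun x => X.part i x ∈ X.gr i) (by simp)
    (fun x y hx hy => by rw [map_add]; exact add_mem hx hy) (fun j x hx => ?_) x
  by_cases h : j = i
  · subst h; rwa [part_of_mem X hx]
  · rw [part_of_ne X h hx]; exact zero_mem _

/-- A linear map of degree `t` commutes with the projections to the homogeneous parts. -/
lemma part_map (X : DGMod B) {B' : GrAlg k} (Y : DGMod B') (f : X →ₗ[k] Y) (t : Deg)
    (hf : ∀ i, ∀ x ∈ X.gr i, f x ∈ Y.gr (i + t)) (i : Deg) (x : X) :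
    f (X.part i x) = Y.part (i + t) (f x) := by
  refine hom_induction X.internal (p := fun x => f (X.part i x) = Y.part (i + t) (f x)) (by simp)
    (fun x y hx hy => by simp only [map_add, hx, hy]) (fun j x hx => ?_) x
  by_cases h : j = i
  · subst h; rw [part_of_mem X hx, part_of_mem Y (hf _ _ hx)]
  · rw [part_of_ne X h hx, part_of_ne Y (by simpa using h) (hf _ _ hx), map_zero]

variable (ψ : GrHom B D) (X Y : DGMod B)

/-- The `B`-linear maps from `D`, regarded as a `B`-module through `ψ`, to `X`. -/
def linMaps : Submodule k (D →ₗ[k] X) where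
  carrier := {f | ∀ (b : B) (y : D), f (ψ b * y) = X.act b (f y)}
  zero_mem' b y := by simp
  add_mem' hf hg b y := by simp [hf b y, hg b y]
  smul_mem' c f hf b y := by simp [hf b y]

/-- The `B`-linear maps from `D` to `X` of degree `s`. -/
def linMapsOfDeg (s : Deg) : Submodule k (D →ₗ[k] X) where
  carrier := {f | f ∈ linMaps ψ X ∧ ∀ (j : Deg) (y : D), y ∈ D.gr j → f y ∈ X.gr (j + s)}
  zero_mem' := ⟨zero_mem _, fun _ _ _ => zero_mem _⟩
  add_mem' hf hg := ⟨add_mem hf.1 hg.1, fun j y hy => add_mem (hf.2 j y hy) (hg.2 j y hy)⟩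
  smul_mem' c f hf := ⟨Submodule.smul_mem _ c hf.1,
    fun j y hy => Submodule.smul_mem _ c (hf.2 j y hy)⟩

variable {ψ X Y}

lemma homPart_linMaps {f : D →ₗ[k] X} (hf : f ∈ linMaps ψ X) (s : Deg) :
    homPart X.part s f ∈ linMapsOfDeg ψ X s := by
  refine ⟨fun b y => ?_, fun j y hy => ?_⟩
  · refine hom_induction B.internal (p := fun b => homPart X.part s f (ψ b * y) =
      X.act b (homPart X.part s f y)) (by simp)
      (fun x y hx hy => by simp only [map_add, add_mul, hx, hy, LinearMap.add_apply])
      (fun i b hb => ?_) b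
    refine hom_induction D.internal (p := fun y => homPart X.part s f (ψ b * y) =
      X.act b (homPart X.part s f y)) (by simp)
      (fun x y hx hy => by simp only [map_add, mul_add, hx, hy]) (fun j y hy => ?_) y
    rw [homPart_of_mem (SetLike.mul_mem_graded (ψ.mem hb) hy), homPart_of_mem hy, hf,
      part_map X X (X.act b) i (fun j x hx => by rw [add_comm]; exact X.act_mem hb hx)]
    congr 2
    abel
  · rw [homPart_of_mem hy]; exact part_mem _ _ _

lemma homPart_self {s : Deg} {f : D →ₗ[k] X} (hf : f ∈ linMapsOfDeg ψ X s) :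
    homPart X.part s f = f :=
  grAlg_hom_ext fun i y hy => by rw [homPart_of_mem hy, part_of_mem X (hf.2 _ _ hy)]

lemma homPart_ne {s t : Deg} (h : s ≠ t) {f : D →ₗ[k] X} (hf : f ∈ linMapsOfDeg ψ X s) :
    homPart X.part t f = 0 :=
  grAlg_hom_ext fun i y hy => by
    rw [homPart_of_mem hy, part_of_ne X (by simpa using h) (hf.2 _ _ hy)]; rfl

variable (ψ X) in
/-- The maps with finitely many homogeneous parts. -/
def coindSub : Submodule k (D →ₗ[k] X) := ⨆ s, linMapsOfDeg ψ X s

lemma coindSub_le : coindSub ψ X ≤ linMaps ψ X := iSup_le fun _ _ hf => hf.1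

/-- A map with finitely many homogeneous parts is their sum. -/
lemma sum_homPart {f : D →ₗ[k] X} (hf : f ∈ coindSub ψ X) :
    ∃ S : Finset Deg, ∑ s ∈ S, homPart X.part s f = f := by
  classical
  suffices h : ∃ S : Finset Deg, ∀ T, S ⊆ T → ∑ s ∈ T, homPart X.part s f = f by
    obtain ⟨S, hS⟩ := h
    exact ⟨S, hS S subset_rfl⟩
  refine Submodule.iSup_induction _ (motive := fun f => ∃ S : Finset Deg, ∀ T, S ⊆ T →
    ∑ s ∈ T, homPart X.part s f = f) hf (fun s f hf => ⟨{s}, fun T hT => ?_⟩)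
    ⟨∅, fun T _ => by simp [homPart_zero]⟩ ?_
  · rw [Finset.sum_eq_single_of_mem s (hT (by simp)) fun t _ h => homPart_ne h.symm hf,
      homPart_self hf]
  · rintro f g ⟨S, hS⟩ ⟨S', hS'⟩
    refine ⟨S ∪ S', fun T hT => ?_⟩
    simp only [homPart_add, Finset.sum_add_distrib]
    rw [hS T (Finset.union_subset_left hT), hS' T (Finset.union_subset_right hT)]

lemma sum_homPart_mem {f : D →ₗ[k] X} (hf : f ∈ linMaps ψ X) (S : Finset Deg) (t : Deg) :
    ∑ s ∈ S, homPart X.part (s + t) f ∈ coindSub ψ X :=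
  sum_mem fun s _ => Submodule.mem_iSup_of_mem _ (homPart_linMaps hf _)

/-- The differential `f ↦ d ∘ f`, with the appropriate sign. -/
noncomputable def coindD (D : GrAlg k) (X : DGMod B) : (D →ₗ[k] X) →ₗ[k] (D →ₗ[k] X) where
  toFun f := X.d ∘ₗ f ∘ₗ (D.tw 1).toLinearMap
  map_add' f g := by ext; simp
  map_smul' c f := by ext; simp

lemma coindD_apply (f : D →ₗ[k] X) (y : D) : coindD D X f y = X.d (f (D.tw 1 y)) := rfl

lemma coindD_linMaps {f : D →ₗ[k] X} (hf : f ∈ linMaps ψ X) : coindD D X f ∈ linMaps ψ X :=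
  fun b y => by
    rw [coindD_apply, map_mul, ψ.tw_apply, hf, X.d_act, B.tw_tw_self]; rfl

lemma coindD_mem {s : Deg} {f : D →ₗ[k] X} (hf : f ∈ linMapsOfDeg ψ X s) :
    coindD D X f ∈ linMapsOfDeg ψ X (s - (1, 0, 0)) :=
  ⟨coindD_linMaps hf.1, fun j y hy => by
    rw [coindD_apply, ← add_sub_assoc]; exact X.d_mem (hf.2 _ _ (D.tw_mem 1 hy))⟩

lemma homPart_coindD (s : Deg) (f : D →ₗ[k] X) :
    coindD D X (homPart X.part (s + (1, 0, 0)) f) = homPart X.part s (coindD D X f) :=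
  grAlg_hom_ext fun i y hy => by
    rw [coindD_apply, homPart_of_mem (D.tw_mem 1 hy), homPart_of_mem hy, coindD_apply,
      part_map X X X.d (-(1, 0, 0)) (fun i x hx => by rw [← sub_eq_add_neg]; exact X.d_mem hx)]
    congr 2
    abel

lemma homPart_comp (p : Mor X Y) (s : Deg) (f : D →ₗ[k] X) :
    p.toLin ∘ₗ homPart X.part s f = homPart Y.part s (p.toLin ∘ₗ f) :=
  grAlg_hom_ext fun i y hy => by
    rw [LinearMap.comp_apply, homPart_of_mem hy, homPart_of_mem hy,
      part_map X Y p.toLin 0 (fun i x hx => by rw [add_zero]; exact p.mem hx), add_zero]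
    rfl

lemma coindD_mem_coindSub {f : D →ₗ[k] X} (hf : f ∈ coindSub ψ X) :
    coindD D X f ∈ coindSub ψ X :=
  Submodule.iSup_induction _ (motive := fun f => coindD D X f ∈ coindSub ψ X) hf
    (fun _ _ hf => Submodule.mem_iSup_of_mem _ (coindD_mem hf)) (by rw [map_zero]; exact zero_mem _)
    fun f g hf hg => by rw [map_add]; exact add_mem hf hg

lemma comp_mulRight_mem_of_deg {i j : Deg} {a : D} (ha : a ∈ D.gr i) {f : D →ₗ[k] X}
    (hf : f ∈ linMapsOfDeg ψ X j) :
    f ∘ₗ LinearMap.mulRight k a ∈ linMapsOfDeg ψ X (i + j) := by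
  refine ⟨fun b y => ?_, fun s y hy => ?_⟩
  · exact (congrArg f (mul_assoc _ _ _)).trans (hf.1 b (y * a))
  · rw [← add_assoc]
    exact hf.2 _ _ (SetLike.mul_mem_graded hy ha)

lemma comp_mulRight_mem (a : D) {f : D →ₗ[k] X} (hf : f ∈ coindSub ψ X) :
    f ∘ₗ LinearMap.mulRight k a ∈ coindSub ψ X := by
  refine hom_induction D.internal (p := fun a => f ∘ₗ LinearMap.mulRight k a ∈ coindSub ψ X)
    ?_ ?_ (fun i a ha => ?_) a
  · have : f ∘ₗ LinearMap.mulRight k (0 : D) = 0 := by ext; simp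
    rw [this]; exact zero_mem _
  · intro a a' h h'
    have : f ∘ₗ LinearMap.mulRight k (a + a') =
        f ∘ₗ LinearMap.mulRight k a + f ∘ₗ LinearMap.mulRight k a' := by
      ext; simp [mul_add]
    rw [this]; exact add_mem h h'
  · refine Submodule.iSup_induction _
      (motive := fun f => f ∘ₗ LinearMap.mulRight k a ∈ coindSub ψ X) hf
      (fun _ _ hf => Submodule.mem_iSup_of_mem _ (comp_mulRight_mem_of_deg ha hf)) ?_
      fun f g hf hg => ?_
    · rw [LinearMap.zero_comp]; exact zero_mem _
    · rw [LinearMap.add_comp]; exact add_mem hf hg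

variable (ψ X) in
/-- Coinduction along `ψ : B → D`: the dg-module of `B`-linear maps from `D` to `X`. It is right
adjoint to restriction. -/
noncomputable def coind : DGMod D where
  carrier := coindSub ψ X
  act := AlgHom.ofLinearMap
    { toFun := fun a =>
        ((LinearMap.lcomp k X (LinearMap.mulRight k a)).restrict (p := coindSub ψ X)
          (q := coindSub ψ X) fun f hf => comp_mulRight_mem a hf)
      map_add' := fun a b => by
        ext f y
        exact (congrArg f.1 (mul_add y a b)).trans (map_add f.1 _ _)
      map_smul' := fun c a => by
        ext f y
        exact (congrArg f.1 (mul_smul_comm c y a)).trans (map_smul f.1 _ _) }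
    (by ext f y; exact congrArg f.1 (mul_one y))
    (fun a b => by ext f y; exact congrArg f.1 (mul_assoc y a b).symm)
  gr s := (linMapsOfDeg ψ X s).comap (coindSub ψ X).subtype
  internal := internal_of_separating _ (coindSub ψ X).subtype Subtype.val_injective (fun s =>
    { toFun := fun f => homPart X.part s f.1
      map_add' := fun f g => homPart_add s f.1 g.1
      map_smul' := fun c f => homPart_smul s c f.1 })
    (fun _ _ h => homPart_self h) (fun _ _ h _ hf => homPart_ne h hf)
    (mem_iSup_comap (linMapsOfDeg ψ X))
  act_mem := by
    rintro i j a ⟨f, hf'⟩ ha hf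
    exact comp_mulRight_mem_of_deg ha hf
  d := (coindD D X).restrict (p := coindSub ψ X) (q := coindSub ψ X)
    fun f hf => coindD_mem_coindSub hf
  d_mem {i f} hf := coindD_mem hf
  d_d f := Subtype.ext <| LinearMap.ext fun y => X.d_d _
  d_act a f := Subtype.ext <| LinearMap.ext fun y => by
    have h : D.tw 1 (y * D.tw 1 a) = D.tw 1 y * a := by
      rw [map_mul (D.tw 1) y, D.tw_tw_self]
    exact congrArg (fun z => X.d (f.1 z)) h.symm

end DGMod

end DGKLRW

/-! ### Cofibrant modules under restriction -/

namespace DGKLRW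

variable {k : Type u} [CommRing k] {B D : GrAlg k}

/-- A family `e` exhibiting `ψ(1) D` as a direct sum of projective `B`-modules `B ε i`, where `B`
acts on `D` through `ψ`. The linear map `coord` gives the coordinates. -/
structure IdemBasis (ψ : GrHom B D) where
  ι : Type
  e : ι → D
  ε : ι → B
  sign : ι → ℤ
  coord : D →ₗ[k] (ι →₀ B)
  sign_sq : ∀ i, sign i * sign i = 1
  tw_e : ∀ i, D.tw 1 (e i) = sign i • e i
  tw_ε : ∀ i, B.tw 1 (ε i) = ε i
  ε_e : ∀ i, ψ (ε i) * e i = e i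
  coord_mul : ∀ b y i, coord (ψ b * y) i = b * coord y i
  coord_e : ∀ i, coord (e i) = Finsupp.single i (ε i)
  sum_coord : ∀ y, (coord y).sum (fun i b => ψ b * e i) = ψ 1 * y

namespace DGMod

variable {ψ : GrHom B D} (𝔟 : IdemBasis ψ) {X Y : DGMod B}

/-- The `B`-linear map from `D` which sends `e i` to `ε i • x i`. -/
noncomputable def extend (X : DGMod B) (x : 𝔟.ι → X) : D →ₗ[k] X :=
  (Finsupp.lsum k fun i => LinearMap.applyₗ (x i) ∘ₗ X.act.toLinearMap) ∘ₗ 𝔟.coord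

variable {𝔟}

lemma extend_apply (x : 𝔟.ι → X) (y : D) :
    extend 𝔟 X x y = (𝔟.coord y).sum fun i b => X.act b (x i) := rfl

lemma extend_e (x : 𝔟.ι → X) (i : 𝔟.ι) : extend 𝔟 X x (𝔟.e i) = X.act (𝔟.ε i) (x i) := by
  rw [extend_apply, 𝔟.coord_e, Finsupp.sum_single_index (by simp)]

lemma extend_mem (x : 𝔟.ι → X) : extend 𝔟 X x ∈ linMaps ψ X := fun b y => by
  classical
  have hs : (𝔟.coord (ψ b * y)).support ⊆ (𝔟.coord y).support := fun i hi => by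
    rw [Finsupp.mem_support_iff, 𝔟.coord_mul] at hi
    exact Finsupp.mem_support_iff.2 fun h => hi (by rw [h, mul_zero])
  rw [extend_apply, extend_apply, Finsupp.sum_of_support_subset _ hs _ (by simp), Finsupp.sum,
    map_sum]
  exact Finset.sum_congr rfl fun i _ => by rw [𝔟.coord_mul, map_mul]; rfl

lemma linMaps_ext {f g : D →ₗ[k] X} (hf : f ∈ linMaps ψ X) (hg : g ∈ linMaps ψ X)
    (h : ∀ i, f (𝔟.e i) = g (𝔟.e i)) : f = g := by
  have h1 : ∀ {f : D →ₗ[k] X}, f ∈ linMaps ψ X → ∀ y,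
      f y = (𝔟.coord y).sum fun i b => X.act b (f (𝔟.e i)) := fun {f} hf y => by
    have : f y = f (ψ 1 * y) := by rw [hf, map_one]; rfl
    rw [this, ← 𝔟.sum_coord, Finsupp.sum, map_sum]
    exact Finset.sum_congr rfl fun i _ => hf _ _
  ext y
  rw [h1 hf, h1 hg]
  simp only [h]

lemma act_ε {f : D →ₗ[k] X} (hf : f ∈ linMaps ψ X) (i : 𝔟.ι) :
    X.act (𝔟.ε i) (f (𝔟.e i)) = f (𝔟.e i) := by rw [← hf, 𝔟.ε_e]

lemma coindD_e (f : D →ₗ[k] X) (i : 𝔟.ι) :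
    coindD D X f (𝔟.e i) = 𝔟.sign i • X.d (f (𝔟.e i)) := by
  rw [coindD_apply, 𝔟.tw_e, map_zsmul, map_zsmul]

lemma coindD_extend_e (x : 𝔟.ι → X) (i : 𝔟.ι) :
    coindD D X (extend 𝔟 X fun i => 𝔟.sign i • x i) (𝔟.e i) = X.act (𝔟.ε i) (X.d (x i)) := by
  rw [coindD_e, extend_e, map_zsmul, map_zsmul, smul_smul, 𝔟.sign_sq, one_smul, X.d_act, 𝔟.tw_ε]

lemma comp_linMaps (p : Mor X Y) {f : D →ₗ[k] X} (hf : f ∈ linMaps ψ X) :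
    p.toLin ∘ₗ f ∈ linMaps ψ Y := fun b y => by
  rw [LinearMap.comp_apply, hf, p.act]; rfl

lemma comp_coindSub (p : Mor X Y) {f : D →ₗ[k] X} (hf : f ∈ coindSub ψ X) :
    p.toLin ∘ₗ f ∈ coindSub ψ Y :=
  Submodule.iSup_induction _ (motive := fun f => p.toLin ∘ₗ f ∈ coindSub ψ Y) hf
    (fun s _ hf => Submodule.mem_iSup_of_mem s
      ⟨comp_linMaps p hf.1, fun _ _ hy => p.mem (hf.2 _ _ hy)⟩)
    (by rw [LinearMap.comp_zero]; exact zero_mem _)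
    fun f g hf hg => by rw [LinearMap.comp_add]; exact add_mem hf hg

variable (ψ) in
/-- The morphism of coinduced modules induced by a morphism. -/
def coindMor (p : Mor X Y) : Mor (coind ψ X) (coind ψ Y) where
  toLin :=
    { toFun := fun f => ⟨p.toLin ∘ₗ f.1, comp_coindSub p f.2⟩
      map_add' := fun _ _ => Subtype.ext (LinearMap.comp_add _ _ _)
      map_smul' := fun _ _ => Subtype.ext (LinearMap.comp_smul _ _ _) }
  mem hf := ⟨comp_linMaps p hf.1, fun _ _ hy => p.mem (hf.2 _ _ hy)⟩
  act _ _ := rfl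
  comm _ := Subtype.ext <| LinearMap.ext fun _ => p.comm _

lemma comp_sum (p : X →ₗ[k] Y) (S : Finset Deg) (f : Deg → D →ₗ[k] X) :
    p ∘ₗ (∑ s ∈ S, f s) = ∑ s ∈ S, p ∘ₗ f s := map_sum (LinearMap.llcomp k D X Y p) f S

/-- Maps out of `ψ(1) D` are given by their values on the elements `e i`, where preimages are
chosen. Only finitely many homogeneous parts of the resulting map are kept, to obtain an element of
the coinduced module. -/
lemma coindMor_surjective (𝔟 : IdemBasis ψ) {p : Mor X Y} (hp : Function.Surjective p.toLin) :
    Function.Surjective (coindMor ψ p).toLin := by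
  rintro ⟨f, hf⟩
  obtain ⟨S, hS⟩ := sum_homPart hf
  choose x hx using fun i => hp (f (𝔟.e i))
  have h : p.toLin ∘ₗ extend 𝔟 X x = f :=
    linMaps_ext (comp_linMaps p (extend_mem x)) (coindSub_le hf) fun i => by
      rw [LinearMap.comp_apply, extend_e, p.act, hx, act_ε (coindSub_le hf)]
  refine ⟨⟨∑ s ∈ S, homPart X.part (s + 0) (extend 𝔟 X x), sum_homPart_mem (extend_mem x) S 0⟩,
    Subtype.ext ?_⟩
  change p.toLin ∘ₗ (∑ s ∈ S, homPart X.part (s + 0) (extend 𝔟 X x)) = f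
  rw [comp_sum, ← hS]
  exact Finset.sum_congr rfl fun s _ => by rw [homPart_comp, add_zero, h]

/-- Since `D` has no differential, cycles and boundaries of maps out of `ψ(1) D` are described by
their values on the elements `e i`. -/
lemma coindMor_isQuasiIso (𝔟 : IdemBasis ψ) {p : Mor X Y} (hq : p.IsQuasiIso) :
    (coindMor ψ p).IsQuasiIso := by
  rw [Mor.isQuasiIso_iff] at hq ⊢
  have hd0 : ∀ {Z : DGMod B} {f : D →ₗ[k] Z}, coindD D Z f = 0 → ∀ i, Z.d (f (𝔟.e i)) = 0 :=
    fun {Z f} hf i => by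
      have h := congrArg (fun f => 𝔟.sign i • f (𝔟.e i)) hf
      simpa [coindD_e, smul_smul, 𝔟.sign_sq] using h
  constructor
  · rintro ⟨f, hf⟩ hfd ⟨⟨g, hg⟩, hgf⟩
    replace hfd : coindD D X f = 0 := congrArg Subtype.val hfd
    replace hgf : coindD D Y g = p.toLin ∘ₗ f := congrArg Subtype.val hgf
    obtain ⟨S, hS⟩ := sum_homPart hf
    choose x hx using fun i => hq.1 (f (𝔟.e i)) (hd0 hfd i)
      ⟨𝔟.sign i • g (𝔟.e i), by rw [map_zsmul, ← coindD_e, hgf]; rfl⟩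
    have h : coindD D X (extend 𝔟 X fun i => 𝔟.sign i • x i) = f :=
      linMaps_ext (coindD_linMaps (extend_mem _)) (coindSub_le hf) fun i => by
        rw [coindD_extend_e, hx, act_ε (coindSub_le hf)]
    refine ⟨⟨_, sum_homPart_mem (extend_mem fun i => 𝔟.sign i • x i) S (1, 0, 0)⟩,
      Subtype.ext ?_⟩
    change coindD D X (∑ s ∈ S, homPart X.part (s + (1, 0, 0)) _) = f
    rw [map_sum]
    refine Eq.trans ?_ hS
    exact Finset.sum_congr rfl fun s _ => by rw [homPart_coindD, h]
  · rintro ⟨f, hf⟩ hfd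
    replace hfd : coindD D Y f = 0 := congrArg Subtype.val hfd
    obtain ⟨S, hS⟩ := sum_homPart hf
    choose x y hx hxy using fun i => hq.2 (f (𝔟.e i)) (hd0 hfd i)
    have hX : coindD D X (extend 𝔟 X x) = 0 :=
      linMaps_ext (coindD_linMaps (extend_mem _)) (zero_mem _) fun i => by
        rw [coindD_e, extend_e, X.d_act, hx, map_zero, smul_zero]; rfl
    have h : p.toLin ∘ₗ extend 𝔟 X x + coindD D Y (extend 𝔟 Y fun i => 𝔟.sign i • y i) = f :=
      linMaps_ext (add_mem (comp_linMaps p (extend_mem _)) (coindD_linMaps (extend_mem _)))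
        (coindSub_le hf) fun i => by
        rw [LinearMap.add_apply, coindD_extend_e, LinearMap.comp_apply, extend_e, p.act, ← map_add,
          ← hxy, act_ε (coindSub_le hf)]
    refine ⟨⟨_, sum_homPart_mem (extend_mem x) S 0⟩,
      ⟨_, sum_homPart_mem (extend_mem fun i => 𝔟.sign i • y i) S (1, 0, 0)⟩,
      Subtype.ext ?_, Subtype.ext ?_⟩
    · change coindD D X (∑ s ∈ S, homPart X.part (s + 0) _) = 0
      rw [map_sum]
      refine Finset.sum_eq_zero fun s _ => ?_
      have := homPart_coindD (s - (1, 0, 0)) (extend 𝔟 X x)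
      rw [hX, homPart_zero, sub_add_cancel] at this
      rw [add_zero, this]
    · change f = p.toLin ∘ₗ (∑ s ∈ S, homPart X.part (s + 0) _) +
        coindD D Y (∑ s ∈ S, homPart Y.part (s + (1, 0, 0)) _)
      rw [map_sum, comp_sum, ← Finset.sum_add_distrib]
      refine hS.symm.trans ?_
      refine Finset.sum_congr rfl fun s _ => ?_
      rw [homPart_coindD, homPart_comp, add_zero, ← homPart_add, h]

variable (P : DGMod D)

/-- The projection of a `D`-module to its restriction. -/
def toRes (ψ : GrHom B D) (P : DGMod D) : P →ₗ[k] P.res ψ :=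
  (P.act (ψ 1)).codRestrict _ fun m => by
    change P.act (ψ 1) (P.act (ψ 1) m) = P.act (ψ 1) m
    rw [← Module.End.mul_apply, ← map_mul P.act, ψ.one_mul_apply]

lemma toRes_act (b : B) (m : P) : toRes ψ P (P.act (ψ b) m) = (P.res ψ).act b (toRes ψ P m) :=
  Subtype.ext <| by
    change P.act (ψ 1) (P.act (ψ b) m) = P.act (ψ b) (P.act (ψ 1) m)
    rw [← Module.End.mul_apply, ← Module.End.mul_apply, ← map_mul P.act, ← map_mul P.act,
      ψ.one_mul_apply, ψ.apply_mul_one]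

lemma toRes_d (m : P) : toRes ψ P (P.d m) = (P.res ψ).d (toRes ψ P m) :=
  Subtype.ext <| by
    change P.act (ψ 1) (P.d m) = P.d (P.act (ψ 1) m)
    rw [P.d_act, ψ.tw_one]

lemma toRes_mem {i : Deg} {m : P} (hm : m ∈ P.gr i) : toRes ψ P m ∈ (P.res ψ).gr i := by
  change P.act (ψ 1) m ∈ P.gr i
  simpa using P.act_mem ψ.one_mem hm

lemma toRes_val (m : P.res ψ) : toRes ψ P m.1 = m := Subtype.ext m.2

/-- The map `P → Coind Y` which corresponds to a morphism `Res P → Y`. -/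
noncomputable def curryLin (g : Mor (P.res ψ) Y) : P →ₗ[k] (D →ₗ[k] Y) :=
  (LinearMap.llcomp k D P Y (g.toLin ∘ₗ toRes ψ P)) ∘ₗ (P.act.toLinearMap.flip)

lemma curryLin_apply (g : Mor (P.res ψ) Y) (m : P) (y : D) :
    curryLin P g m y = g.toLin (toRes ψ P (P.act y m)) := rfl

lemma curryLin_mem_of_deg (g : Mor (P.res ψ) Y) {i : Deg} {m : P} (hm : m ∈ P.gr i) :
    curryLin P g m ∈ linMapsOfDeg ψ Y i :=
  ⟨fun b y => by
    rw [curryLin_apply, curryLin_apply, map_mul, Module.End.mul_apply, toRes_act, g.act],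
  fun j y hy => g.mem (toRes_mem P (P.act_mem hy hm))⟩

lemma curryLin_mem (g : Mor (P.res ψ) Y) (m : P) : curryLin P g m ∈ coindSub ψ Y :=
  hom_induction P.internal (p := fun m => curryLin P g m ∈ coindSub ψ Y)
    (by rw [map_zero]; exact zero_mem _) (fun x y hx hy => by rw [map_add]; exact add_mem hx hy)
    (fun i _ hm => Submodule.mem_iSup_of_mem i (curryLin_mem_of_deg P g hm)) m

/-- The morphism `P → Coind Y` which corresponds to a morphism `Res P → Y`. -/
noncomputable def curry (g : Mor (P.res ψ) Y) : Mor P (coind ψ Y) where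
  toLin := (curryLin P g).codRestrict (coindSub ψ Y) (curryLin_mem P g)
  mem hm := curryLin_mem_of_deg P g hm
  act a m := Subtype.ext <| LinearMap.ext fun y => by
    change g.toLin (toRes ψ P (P.act y (P.act a m))) = g.toLin (toRes ψ P (P.act (y * a) m))
    rw [map_mul]; rfl
  comm m := Subtype.ext <| LinearMap.ext fun y => by
    change g.toLin (toRes ψ P (P.act y (P.d m))) =
      Y.d (g.toLin (toRes ψ P (P.act (D.tw 1 y) m)))
    rw [← g.comm, ← toRes_d, P.d_act, D.tw_tw_self]

/-- Restriction along a map `ψ : B → D` such that `ψ(1) D` is a sum of projective `B`-modules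
preserves cofibrant dg-modules, since its right adjoint preserves surjective quasi-isomorphisms. -/
theorem Cofibrant.res (𝔟 : IdemBasis ψ) {P : DGMod D} (hP : P.Cofibrant) :
    (P.res ψ).Cofibrant := by
  intro X Y p hp hq g
  -- lift the adjoint of `g`, and evaluate the lift at `ψ 1`
  obtain ⟨H, hH⟩ := hP _ _ (coindMor ψ p) (coindMor_surjective 𝔟 hp) (coindMor_isQuasiIso 𝔟 hq)
    (curry P g)
  refine ⟨⟨{ toFun := fun m => (H.toLin m.1).1 (ψ 1)
             map_add' := fun m n => by rw [Submodule.coe_add, map_add]; rfl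
             map_smul' := fun c m => by rw [Submodule.coe_smul, map_smul]; rfl },
    fun {i m} hm => ?_, fun a m => ?_, fun m => ?_⟩, LinearMap.ext fun m => ?_⟩
  · have := (H.mem hm).2 0 _ ψ.one_mem
    rwa [zero_add] at this
  · change (H.toLin (P.act (ψ a) m.1)).1 (ψ 1) = X.act a ((H.toLin m.1).1 (ψ 1))
    rw [H.act, ← coindSub_le (H.toLin m.1).2 a (ψ 1)]
    change (H.toLin m.1).1 (ψ 1 * ψ a) = _
    rw [ψ.one_mul_apply, ψ.apply_mul_one]
  · change (H.toLin (P.d m.1)).1 (ψ 1) = X.d ((H.toLin m.1).1 (ψ 1))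
    rw [H.comm]
    change X.d ((H.toLin m.1).1 (D.tw 1 (ψ 1))) = _
    rw [ψ.tw_one]
  · have h := congrArg (fun f : D →ₗ[k] Y => f (ψ 1))
      (congrArg Subtype.val (LinearMap.congr_fun hH m.1))
    change p.toLin ((H.toLin m.1).1 (ψ 1)) = g.toLin (toRes ψ P (P.act (ψ 1) m.1)) at h
    change p.toLin ((H.toLin m.1).1 (ψ 1)) = g.toLin m
    have hm : P.act (ψ 1) m.1 = m.1 := m.2
    rw [h, hm, toRes_val]

end DGMod

end DGKLRW

/-! ### Cones and splittings -/

namespace DGKLRW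

variable {k : Type u} [CommRing k]

/-- A short exact sequence of dg-modules. -/
structure DGMod.ShortExact {A : GrAlg k} {X Y Z : DGMod A} (f : DGMod.Mor X Y)
    (g : DGMod.Mor Y Z) : Prop where
  zero : ∀ x, g.toLin (f.toLin x) = 0
  injective : Function.Injective f.toLin
  surjective : Function.Surjective g.toLin
  exact : ∀ y, g.toLin y = 0 → ∃ x, f.toLin x = y

section Cone

open DGMod

/-- The morphism from the cone of `f` induced by a morphism which vanishes on the image of `f`. -/
noncomputable def DGMod.Mor.ofCone {A : GrAlg k} {X Y Z : DGMod A} (f : Mor X Y) (g : Mor Y Z)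
    (h : ∀ x, g.toLin (f.toLin x) = 0) : Mor (cone f) Z where
  toLin := g.toLin ∘ₗ LinearMap.snd k X Y
  mem := fun hx => g.mem hx.2
  act := fun a x => g.act a x.2
  comm := fun x => by
    change g.toLin (f.toLin x.1 + Y.d x.2) = Z.d (g.toLin x.2)
    rw [map_add, h, zero_add, g.comm]

/-- In a short exact sequence, the cone of the first map is quasi-isomorphic to the cokernel. -/
lemma DGMod.ShortExact.isQuasiIso_ofCone {A : GrAlg k} {X Y Z : DGMod A} {f : Mor X Y}
    {g : Mor Y Z} (h : ShortExact f g) : (Mor.ofCone f g h.zero).IsQuasiIso := by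
  rw [DGMod.Mor.isQuasiIso_iff]
  constructor
  · rintro ⟨z, y⟩ hd ⟨w, hw⟩
    have h1 : -(X.d z) = 0 := congrArg Prod.fst hd
    have h2 : f.toLin z + Y.d y = 0 := congrArg Prod.snd hd
    replace hw : Z.d w = g.toLin y := hw
    -- correct `y` by a boundary to move it into the image of `f`
    obtain ⟨y₁, rfl⟩ := h.surjective w
    obtain ⟨z₁, hz₁⟩ := h.exact (y - Y.d y₁) (by rw [map_sub, g.comm, hw, sub_self])
    refine ⟨(z₁, y₁), Prod.ext (h.injective ?_) ?_⟩
    · change f.toLin (-(X.d z₁)) = f.toLin z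
      rw [map_neg, f.comm, hz₁, map_sub, Y.d_d, sub_zero, eq_neg_of_add_eq_zero_left h2]
    · change f.toLin z₁ + Y.d y₁ = y
      rw [hz₁, sub_add_cancel]
  · intro w hw
    obtain ⟨y, rfl⟩ := h.surjective w
    obtain ⟨z, hz⟩ := h.exact (Y.d y) (by rw [g.comm, hw])
    refine ⟨(-z, y), 0, Prod.ext (h.injective ?_) ?_, ?_⟩
    · change f.toLin (-(X.d (-z))) = f.toLin 0
      rw [map_neg X.d, neg_neg, f.comm, hz, Y.d_d, map_zero]
    · change f.toLin (-z) + Y.d y = 0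
      rw [map_neg, hz, neg_add_cancel]
    · rw [map_zero, add_zero]; rfl

variable {A B : GrAlg k} {F G H : DGFunctor A B}

/-- The morphism from the cone of `α` induced by a morphism which vanishes on the image of `α`. -/
noncomputable def DGNat.ofCone (α : DGNat F G) (η : DGNat G H)
    (h : ∀ M x, (η.app M).toLin ((α.app M).toLin x) = 0) : DGNat (DGFunctor.cone α) H where
  app M := Mor.ofCone (α.app M) (η.app M) (h M)
  naturality n f x := η.naturality n f x.2

theorem DGNat.exists_isQuasiIso_cone (α : DGNat F G) (η : DGNat G H)
    (h : ∀ M, ShortExact (α.app M) (η.app M)) :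
    ∃ η' : DGNat (DGFunctor.cone α) H, η'.IsQuasiIso :=
  ⟨DGNat.ofCone α η fun M => (h M).zero, fun M => (h M).isQuasiIso_ofCone⟩

end Cone

/-- The structure which makes `ψ(1) D ψ(1)`, up to the sub-bimodule `J`, the sum of copies of `B`
shifted by `t i` and twisted accordingly. The map `coord` gives the coordinates with respect to
the elements `b i`. -/
structure Splitting {B D : GrAlg k} (ψ : GrHom B D) (s : Deg) {ι : Type} (t : ι → Deg) where
  J : Submodule k D
  coord : D →ₗ[k] (ι →₀ B)
  b : ι → D
  coord_mem : ∀ {j y}, y ∈ D.gr j → ∀ i, coord y i ∈ B.gr (j + (s - t i))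
  coord_mul_left : ∀ a y i, coord (ψ a * y) i = B.tw (t i).1 a * coord y i
  coord_mul_right : ∀ y a i, coord (y * ψ a) i = coord y i * a
  coord_J : ∀ y ∈ J, coord y = 0
  one_mul_b : ∀ i, ψ 1 * b i = b i
  coord_b : ∀ i, coord (b i) = Finsupp.single i 1
  sub_mem : ∀ y, ψ 1 * y * ψ 1 - (coord y).sum (fun i a => b i * ψ a) ∈ J

namespace Splitting

variable {B D : GrAlg k} {ψ : GrHom B D} {s : Deg} {ι : Type} {t : ι → Deg}
  (𝔰 : Splitting ψ s t)

open DGMod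

lemma coord_tw (n : ℤ) (y : D) (i : ι) (hs : s.1 = 0) :
    𝔰.coord (D.tw n y) i = sgn ((t i).1 * n) • B.tw n (𝔰.coord y i) := by
  refine hom_induction D.internal (p := fun y => 𝔰.coord (D.tw n y) i =
    sgn ((t i).1 * n) • B.tw n (𝔰.coord y i)) (by simp) (fun x y hx hy => by
      simp only [map_add, Finsupp.add_apply, hx, hy, smul_add]) (fun j y hy => ?_) y
  rw [D.tw_of_mem n hy, B.tw_of_mem n (𝔰.coord_mem hy i), map_zsmul, smul_smul, ← sgn_add,
    Finsupp.smul_apply]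
  congr 1
  have : (t i).1 * n + n * (j + (s - t i)).1 = n * j.1 := by
    rw [Prod.fst_add, Prod.fst_sub, hs]; ring
  rw [this]

lemma basisTmul_mem (M : DGMod B) (i : ι) (m : M) :
    (M.ind ψ).act (ψ 1) (tmul ψ M (𝔰.b i) m) = tmul ψ M (𝔰.b i) m := by
  rw [ind_act, 𝔰.one_mul_b]

variable [DecidableEq ι]

/-- The bilinear map sending `y ⊗ m` to the family of the `(coord y i) m`. -/
noncomputable def pairBilin (M : DGMod B) : D →ₗ[k] M →ₗ[k] DGMod.coprod fun i => M.shift (t i) :=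
  (Finsupp.lsum k fun i => (M.act.toLinearMap : B →ₗ[k] M →ₗ[k] M).compr₂
    (incl (fun i => M.shift (t i)) i).toLin) ∘ₗ 𝔰.coord

lemma pairBilin_apply (M : DGMod B) (y : D) (m : M) (i : ι) :
    (𝔰.pairBilin M y m) i = M.act (𝔰.coord y i) m := by
  have h : ∀ f : ι →₀ B, (Finsupp.lsum k fun i => (M.act.toLinearMap : B →ₗ[k] M →ₗ[k] M).compr₂
    (incl (fun i => M.shift (t i)) i).toLin) f m i = M.act (f i) m := fun f => by
    induction f using Finsupp.induction_linear with
    | zero => simp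
    | add f g hf hg =>
      rw [map_add, LinearMap.add_apply, Finsupp.add_apply, map_add, LinearMap.add_apply, ← hf, ← hg]
      rfl
    | single j b =>
      rw [Finsupp.lsum_single, Finsupp.single_apply]
      change DirectSum.lof k ι (fun i => (M.shift (t i)).carrier) j (M.act b m) i = _
      by_cases hj : j = i
      · subst hj; rw [if_pos rfl, DirectSum.lof_apply]
      · rw [if_neg hj, map_zero, LinearMap.zero_apply, DirectSum.lof_eq_of,
          DirectSum.of_eq_of_ne _ _ _ (Ne.symm hj)]
  exact h _

/-- The map `D ⊗ M → ⨁ M` given by the coordinates. -/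
noncomputable def pair (M : DGMod B) : M.ind ψ →ₗ[k] DGMod.coprod fun i => M.shift (t i) :=
  tlift ψ (𝔰.pairBilin M) fun y a m => DFinsupp.ext fun i => by
    refine (𝔰.pairBilin_apply M _ m i).trans ((?_ : _ = _).trans (𝔰.pairBilin_apply M _ _ i).symm)
    rw [𝔰.coord_mul_right, map_mul]; rfl

lemma pair_tmul (M : DGMod B) (y : D) (m : M) (i : ι) :
    (𝔰.pair M (tmul ψ M y m)) i = M.act (𝔰.coord y i) m := by
  rw [pair, tlift_tmul, pairBilin_apply]

lemma pair_tmul_eq_sum (M : DGMod B) (y : D) (m : M) :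
    𝔰.pair M (tmul ψ M y m) = ∑ i ∈ (𝔰.coord y).support,
      (incl (fun i => M.shift (t i)) i).toLin (M.act (𝔰.coord y i) m) := by
  rw [pair, tlift_tmul, pairBilin, LinearMap.comp_apply, Finsupp.lsum_apply, Finsupp.sum,
    LinearMap.sum_apply]
  rfl

lemma pair_ext {M M' : DGMod B} {f g : M.ind ψ →ₗ[k] DGMod.coprod fun i => M'.shift (t i)}
    (h : ∀ y m i, f (tmul ψ M y m) i = g (tmul ψ M y m) i) : f = g :=
  ind_hom_ext ψ fun y m => DFinsupp.ext fun i => h y m i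

/-- The morphism of dg-modules given by the coordinates. -/
noncomputable def mor {s : ℤ × ℤ} (𝔰 : Splitting ψ (0, s) t) (M : DGMod B) :
    Mor (((M.ind ψ).res ψ).shift (0, s)) (DGMod.coprod fun i => M.shift (t i)) where
  toLin := 𝔰.pair M ∘ₗ Submodule.subtype _
  mem := fun {i z} hz l => by
    have h := ind_mem ψ (DGMod.coprod fun i => M.shift (t i)).gr (0, s) (𝔰.pair M)
      (fun {i j x m} hx hm l => by
        rw [pair_tmul]
        change _ ∈ M.gr (i + j + (0, s) - t l)
        have := M.act_mem (𝔰.coord_mem hx l) hm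
        rwa [show i + j + (0, s) - t l = i + ((0, s) - t l) + j by abel]) (i := i - (0, s)) hz l
    rwa [sub_add_cancel] at h
  act := fun a z => by
    obtain ⟨z, hz⟩ := z
    change 𝔰.pair M ((M.ind ψ).act (ψ (B.tw 0 a)) z) = _
    rw [B.tw_zero]
    refine LinearMap.congr_fun (f := 𝔰.pair M ∘ₗ (M.ind ψ).act (ψ a))
      (g := (DGMod.coprod fun i => M.shift (t i)).act a ∘ₗ 𝔰.pair M)
      (pair_ext fun y m i => ?_) z
    rw [LinearMap.comp_apply, ind_act, pair_tmul, coord_mul_left, map_mul]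
    change _ = M.act (B.tw (t i).1 a) (𝔰.pair M (tmul ψ M y m) i)
    rw [pair_tmul]; rfl
  comm := fun z => by
    obtain ⟨z, hz⟩ := z
    change 𝔰.pair M (sgn 0 • (M.ind ψ).d z) = _
    rw [sgn_zero, one_smul]
    refine LinearMap.congr_fun (f := 𝔰.pair M ∘ₗ (M.ind ψ).d)
      (g := (DGMod.coprod fun i => M.shift (t i)).d ∘ₗ 𝔰.pair M)
      (pair_ext fun y m i => ?_) z
    rw [LinearMap.comp_apply, ind_d, pair_tmul, 𝔰.coord_tw 1 y i rfl, map_zsmul, mul_one]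
    change _ = sgn (t i).1 • M.d (𝔰.pair M (tmul ψ M y m) i)
    rw [pair_tmul, M.d_act]; rfl

/-- The natural transformation given by the coordinates. -/
noncomputable def nat {s : ℤ × ℤ} (𝔰 : Splitting ψ (0, s) t)
    (hψ : ∀ M : DGMod D, M.Cofibrant → (M.res ψ).Cofibrant) :
    DGNat (((DGFunctor.shift B (0, s)).comp (DGFunctor.res ψ hψ)).comp (DGFunctor.ind ψ))
      (DGFunctor.coprod fun i => DGFunctor.shift B (t i)) where
  app M := 𝔰.mor M.obj
  naturality {M N} n f z := by
    obtain ⟨z, hz⟩ := z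
    have h0 : sgn (0 * n) • (indHom ψ n f).1 z = (indHom ψ n f).1 z := by
      rw [zero_mul, sgn_zero, one_smul]
    refine (congrArg (𝔰.pair N.obj) h0).trans ?_
    refine LinearMap.congr_fun (f := 𝔰.pair N.obj ∘ₗ (indHom ψ n f).1)
      (g := ((DGFunctor.coprod fun i => DGFunctor.shift B (t i)).map n f).1 ∘ₗ 𝔰.pair M.obj)
      (pair_ext fun y m i => ?_) z
    rw [LinearMap.comp_apply, indHom_tmul, pair_tmul, 𝔰.coord_tw n y i rfl, map_zsmul]
    change _ = sgn ((t i).1 * n) • f.1 (𝔰.pair M.obj (tmul ψ M.obj y m) i)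
    rw [pair_tmul, f.2.2]; rfl

lemma pair_basis (M : DGMod B) (i : ι) (m : M) :
    𝔰.pair M (tmul ψ M (𝔰.b i) m) = (incl (fun i => M.shift (t i)) i).toLin m :=
  DFinsupp.ext fun j => by
    rw [pair_tmul, 𝔰.coord_b]
    change _ = DirectSum.lof k ι (fun i => (M.shift (t i)).carrier) i m j
    rw [Finsupp.single_apply]
    by_cases hj : i = j
    · subst hj; rw [if_pos rfl, DirectSum.lof_apply, map_one]; rfl
    · rw [if_neg hj, map_zero, LinearMap.zero_apply, DirectSum.lof_eq_of,
        DirectSum.of_eq_of_ne _ _ _ (Ne.symm hj)]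

lemma mor_surjective {s : ℤ × ℤ} (𝔰 : Splitting ψ (0, s) t) (M : DGMod B) :
    Function.Surjective (𝔰.mor M).toLin := by
  intro x
  induction x using coprod_induction with
  | h0 => exact ⟨0, map_zero _⟩
  | hadd x y hx hy =>
    obtain ⟨z, rfl⟩ := hx
    obtain ⟨w, rfl⟩ := hy
    exact ⟨z + w, map_add _ _ _⟩
  | hof i m => exact ⟨⟨_, 𝔰.basisTmul_mem M i m⟩, 𝔰.pair_basis M i m⟩

/-- An element of `ψ(1) D ⊗ M` with vanishing coordinates comes from `J ⊗ M`. -/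
lemma mem_span_of_pair_eq_zero (M : DGMod B) {z : M.ind ψ} (hz : (M.ind ψ).act (ψ 1) z = z)
    (h : 𝔰.pair M z = 0) : z ∈ Submodule.span k {z | ∃ y ∈ 𝔰.J, ∃ m, z = tmul ψ M y m} := by
  let g : (DGMod.coprod fun i => M.shift (t i)) →ₗ[k] M.ind ψ :=
    desc fun i => tmul ψ M (𝔰.b i)
  have key : ∀ z, (M.ind ψ).act (ψ 1) z - g (𝔰.pair M z) ∈
      Submodule.span k {z | ∃ y ∈ 𝔰.J, ∃ m, z = tmul ψ M y m} := fun z => by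
    refine ind_induction ψ (p := fun z => (M.ind ψ).act (ψ 1) z - g (𝔰.pair M z) ∈
      Submodule.span k {z | ∃ y ∈ 𝔰.J, ∃ m, z = tmul ψ M y m}) ?_ (fun x y hx hy => ?_)
      (fun y m => ?_) z
    · rw [map_zero, map_zero, map_zero, sub_zero]; exact zero_mem _
    · rw [map_add, map_add, map_add, add_sub_add_comm]; exact add_mem hx hy
    · refine Submodule.subset_span ⟨_, 𝔰.sub_mem y, m, ?_⟩
      rw [ind_act, ← tmul_one, map_sub, LinearMap.sub_apply, pair_tmul_eq_sum, map_sum,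
        Finsupp.sum, map_sum, LinearMap.sum_apply]
      congr 1
      refine Finset.sum_congr rfl fun i _ => ?_
      rw [← tmul_act]
      exact desc_incl _ i _
  have := key z
  rwa [h, map_zero, sub_zero, hz] at this

end Splitting

end DGKLRW

/-! ### The cone of the exchange map -/

namespace DGKLRW

variable {k : Type u} [CommRing k]

/-- The linear span of the products `ψ(x) τ ψ(x')`. -/
def crossSpan {B D : GrAlg k} (ψ : GrHom B D) (τ : D) : Submodule k D :=
  Submodule.span k {y | ∃ x x', y = ψ x * τ * ψ x'}

section Exchange

open DGMod

variable {C B D : GrAlg k} {φ : GrHom C B} {ψ : GrHom B D} {τ : D}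
  (hc : ∀ c : C, ψ (φ c) * τ = τ * ψ (φ c))

lemma cross_tmul_mem (hτ : τ * ψ (φ 1) = τ) (s : ℤ × ℤ)
    (M : DGMod B) {y : D} (hy : y ∈ crossSpan ψ τ) (m : M) :
    ∃ z, (exchangeLin φ ψ s τ hc M z).1 = tmul ψ M y m := by
  induction hy using Submodule.span_induction with
  | mem y hy =>
    obtain ⟨x, x', rfl⟩ := hy
    refine ⟨tmul φ ((M.res φ).shift (0, s)) x (toRes φ M (M.act x' m)), ?_⟩
    rw [exchangeLin_tmul]
    change tmul ψ M (ψ x * τ) (M.act (φ 1) (M.act x' m)) = _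
    rw [tmul_act, tmul_act, mul_assoc (ψ x), hτ]
  | zero => exact ⟨0, by rw [map_zero, map_zero]; rfl⟩
  | add x y _ _ hx hy =>
    obtain ⟨z, hz⟩ := hx
    obtain ⟨w, hw⟩ := hy
    exact ⟨z + w, by rw [map_add, map_add, LinearMap.add_apply, ← hz, ← hw]; rfl⟩
  | smul c x _ hx =>
    obtain ⟨z, hz⟩ := hx
    exact ⟨c • z, by rw [map_smul, map_smul, LinearMap.smul_apply, ← hz]; rfl⟩

/-- A family of elements of `B` determines a tensor with the elements of a basis of `B` over `C`. -/
noncomputable def collect (𝔟 : IdemBasis φ) (M : DGMod B) (s : ℤ × ℤ) :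
    (𝔟.ι →₀ B) →ₗ[k] M →ₗ[k] ((M.res φ).shift (0, s)).ind φ :=
  Finsupp.lsum k fun i => (tmul φ ((M.res φ).shift (0, s))).compl₂
    (toRes φ M ∘ₗ M.act (𝔟.e i))

lemma collect_apply (𝔟 : IdemBasis φ) (M : DGMod B) (s : ℤ × ℤ) (w : 𝔟.ι →₀ B) (m : M) :
    collect 𝔟 M s w m = w.sum fun i x =>
      tmul φ ((M.res φ).shift (0, s)) x (toRes φ M (M.act (𝔟.e i) m)) := by
  rw [collect, Finsupp.lsum_apply, Finsupp.sum, LinearMap.sum_apply]; rfl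

lemma tmul_act_shift (M : DGMod B) (s : ℤ × ℤ) (x : B) (c : C) (m : M.res φ) :
    tmul φ ((M.res φ).shift (0, s)) x ((M.res φ).act c m) =
      tmul φ ((M.res φ).shift (0, s)) (x * φ c) m := by
  refine Eq.trans ?_ (tmul_act φ ((M.res φ).shift (0, s)) x c m)
  change _ = tmul φ ((M.res φ).shift (0, s)) x ((M.res φ).act (C.tw 0 c) m)
  rw [C.tw_zero]

lemma toRes_act_one_mul (M : DGMod B) (x : B) (m : M) :
    toRes φ M (M.act (φ 1 * x) m) = toRes φ M (M.act x m) := by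
  refine Subtype.ext ?_
  change M.act (φ 1) (M.act (φ 1 * x) m) = M.act (φ 1) (M.act x m)
  rw [← Module.End.mul_apply, ← Module.End.mul_apply, ← map_mul M.act, ← map_mul M.act,
    ← mul_assoc, φ.one_mul_apply]

/-- If `w` is the family of the coordinates of `x'` multiplied by `x` at the left, the tensor which
it determines is `x ⊗ x'`. -/
lemma collect_coord (𝔟 : IdemBasis φ) (M : DGMod B) (s : ℤ × ℤ) (w : 𝔟.ι →₀ B) (x x' : B)
    (hw : ∀ i, w i = x * φ (𝔟.coord x' i)) (m : M) :
    collect 𝔟 M s w m =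
      tmul φ ((M.res φ).shift (0, s)) x (toRes φ M (M.act x' m)) := by
  classical
  have hsupp : w.support ⊆ (𝔟.coord x').support := fun i hi => by
    rw [Finsupp.mem_support_iff, hw] at hi
    exact Finsupp.mem_support_iff.2 fun h => hi (by rw [h, map_zero, mul_zero])
  rw [collect_apply, Finsupp.sum_of_support_subset _ hsupp _ (by simp)]
  have h1 : toRes φ M (M.act x' m) = ∑ i ∈ (𝔟.coord x').support,
      (M.res φ).act (𝔟.coord x' i) (toRes φ M (M.act (𝔟.e i) m)) := by
    rw [← toRes_act_one_mul, ← 𝔟.sum_coord, Finsupp.sum, map_sum, LinearMap.sum_apply, map_sum]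
    refine Finset.sum_congr rfl fun i _ => ?_
    rw [map_mul M.act, Module.End.mul_apply, toRes_act]
  rw [h1, map_sum]
  refine Finset.sum_congr rfl fun i _ => ?_
  rw [hw, tmul_act_shift]

/-- The map `x ⊗ m ↦ ψ(x) τ ⊗ m` is injective when the coefficients of `ψ(x) τ ψ(x')` determine
those of `x'`, since it then has a retraction. -/
lemma exchangeLin_injective {s₀ : Deg} {ι : Type} {t : ι → Deg} (𝔰 : Splitting ψ s₀ t)
    (hJ : 𝔰.J = crossSpan ψ τ) (hτ₁ : τ * ψ 1 = τ) (𝔟 : IdemBasis φ) (r : D →ₗ[k] 𝔟.ι →₀ B)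
    (hr : ∀ x x' i, r (ψ x * τ * ψ x') i = x * φ (𝔟.coord x' i)) (s : ℤ × ℤ) (M : DGMod B) :
    Function.Injective (exchangeLin φ ψ s τ hc M) := by
  -- the projection to `J` along the elements `b i`
  let q : D →ₗ[k] D :=
    LinearMap.mulRight k (ψ 1) ∘ₗ LinearMap.mulLeft k (ψ 1) -
      (Finsupp.lsum k fun i => LinearMap.mulLeft k (𝔰.b i) ∘ₗ (ψ.toHom : B →ₗ[k] D)) ∘ₗ 𝔰.coord
  have hq : ∀ y, q y = ψ 1 * y * ψ 1 - (𝔰.coord y).sum (fun i a => 𝔰.b i * ψ a) := fun y => rfl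
  have hqJ : ∀ y, q y ∈ crossSpan ψ τ := fun y => hJ ▸ 𝔰.sub_mem y
  have hqr : ∀ y a, q (y * ψ a) = q y * ψ a := fun y a => by
    classical
    have hsupp : (𝔰.coord (y * ψ a)).support ⊆ (𝔰.coord y).support := fun i hi => by
      rw [Finsupp.mem_support_iff, 𝔰.coord_mul_right] at hi
      exact Finsupp.mem_support_iff.2 fun h => hi (by rw [h, zero_mul])
    rw [hq, hq, sub_mul, Finsupp.sum_of_support_subset _ hsupp _ (by simp), Finsupp.sum,
      Finset.sum_mul]
    congr 1
    · rw [← mul_assoc, mul_assoc _ (ψ a), mul_assoc _ (ψ 1) (ψ a), ψ.apply_mul_one,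
        ψ.one_mul_apply]
    · exact Finset.sum_congr rfl fun i _ => by rw [𝔰.coord_mul_right, map_mul, mul_assoc]
  have hbal : ∀ y ∈ crossSpan ψ τ, ∀ a m,
      collect 𝔟 M s (r (y * ψ a)) m = collect 𝔟 M s (r y) (M.act a m) := fun y hy a m => by
    induction hy using Submodule.span_induction with
    | mem y hy =>
      obtain ⟨x, x', rfl⟩ := hy
      rw [mul_assoc (ψ x * τ), ← map_mul ψ.toHom, collect_coord 𝔟 M s _ x (x' * a) (hr _ _),
        collect_coord 𝔟 M s _ x x' (hr _ _), map_mul M.act, Module.End.mul_apply]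
    | zero => simp
    | add x y _ _ hx hy => simp only [add_mul, map_add, LinearMap.add_apply, hx, hy]
    | smul c x _ hx => simp only [smul_mul_assoc, map_smul, LinearMap.smul_apply, hx]
  let R : M.ind ψ →ₗ[k] ((M.res φ).shift (0, s)).ind φ :=
    tlift ψ (collect 𝔟 M s ∘ₗ r ∘ₗ q) fun y a m => by
      simp only [LinearMap.comp_apply]
      rw [hqr]
      exact hbal _ (hqJ y) a m
  refine Function.LeftInverse.injective (g := fun z => R z.1) fun z => ?_
  refine LinearMap.congr_fun (f := R ∘ₗ Submodule.subtype _ ∘ₗ exchangeLin φ ψ s τ hc M)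
    (g := LinearMap.id) (ind_hom_ext φ fun x m => ?_) z
  have h1 : ψ x * τ * ψ 1 = ψ x * τ := by rw [mul_assoc, hτ₁]
  have h2 : q (ψ x * τ) = ψ x * τ * ψ 1 := by
    have h3 : 𝔰.coord (ψ x * τ) = 0 := 𝔰.coord_J _ (hJ ▸ Submodule.subset_span ⟨x, 1, h1.symm⟩)
    rw [hq, h3, Finsupp.sum_zero_index, sub_zero, ← mul_assoc, ψ.one_mul_apply]
  rw [LinearMap.comp_apply, LinearMap.comp_apply, Submodule.subtype_apply, exchangeLin_tmul,
    tlift_tmul, LinearMap.comp_apply, LinearMap.comp_apply, h2,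
    collect_coord 𝔟 M s _ x 1 (hr _ _)]
  refine congrArg (tmul φ ((M.res φ).shift (0, s)) x) (Subtype.ext ?_)
  change M.act (φ 1) (M.act 1 m.1) = m.1
  exact (congrArg _ (LinearMap.congr_fun (map_one M.act) m.1)).trans m.2

lemma pair_exchangeLin {s₀ : Deg} {ι : Type} [DecidableEq ι] {t : ι → Deg}
    (𝔰 : Splitting ψ s₀ t) (hJ : 𝔰.J = crossSpan ψ τ) (hτ₁ : τ * ψ 1 = τ) (s : ℤ × ℤ)
    (M : DGMod B) (z : ((M.res φ).shift (0, s)).ind φ) :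
    𝔰.pair M (exchangeLin φ ψ s τ hc M z).1 = 0 := by
  refine LinearMap.congr_fun (f := 𝔰.pair M ∘ₗ Submodule.subtype _ ∘ₗ
    exchangeLin φ ψ s τ hc M) (g := 0) (ind_hom_ext φ fun x m => DFinsupp.ext fun i => ?_) z
  rw [LinearMap.comp_apply, LinearMap.comp_apply, Submodule.subtype_apply, exchangeLin_tmul,
    𝔰.pair_tmul, 𝔰.coord_J, Finsupp.zero_apply, map_zero]
  · rfl
  · rw [hJ]
    exact Submodule.subset_span ⟨x, 1, by rw [mul_assoc, hτ₁]⟩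

lemma exists_exchangeLin_eq {s₀ : Deg} {ι : Type} [DecidableEq ι] {t : ι → Deg}
    (𝔰 : Splitting ψ s₀ t) (hJ : 𝔰.J = crossSpan ψ τ) (hτ₂ : τ * ψ (φ 1) = τ) (s : ℤ × ℤ)
    (M : DGMod B) (y : (M.ind ψ).res ψ) (hy : 𝔰.pair M y.1 = 0) :
    ∃ z, exchangeLin φ ψ s τ hc M z = y := by
  have h := 𝔰.mem_span_of_pair_eq_zero M y.2 hy
  have h' : y.1 ∈ (LinearMap.range (exchangeLin φ ψ s τ hc M)).map (Submodule.subtype _) := by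
    refine Submodule.span_le.2 ?_ h
    rintro _ ⟨z, hz, m, rfl⟩
    rw [hJ] at hz
    obtain ⟨w, hw⟩ := cross_tmul_mem hc hτ₂ s M hz m
    exact ⟨_, ⟨w, rfl⟩, hw⟩
  obtain ⟨_, ⟨w, rfl⟩, hw⟩ := h'
  exact ⟨w, Subtype.ext hw⟩

lemma eq_zero_of_pair_eq_zero {s₀ : Deg} {ι : Type} [DecidableEq ι] {t : ι → Deg}
    (𝔰 : Splitting ψ s₀ t) (hJ : 𝔰.J = ⊥) (M : DGMod B) (y : (M.ind ψ).res ψ)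
    (hy : 𝔰.pair M y.1 = 0) : y = 0 := by
  have h := 𝔰.mem_span_of_pair_eq_zero M y.2 hy
  refine Subtype.ext ((Submodule.mem_bot k).1 (Submodule.span_le.2 ?_ h))
  rintro _ ⟨z, hz, m, rfl⟩
  rw [hJ, Submodule.mem_bot] at hz
  rw [hz, map_zero, LinearMap.zero_apply]
  exact zero_mem _

lemma shortExact_exchange {s s' t₀ : ℤ × ℤ} (hs : s' + t₀ = s) (hτ : τ ∈ D.gr (0, t₀)) {ι : Type}
    [DecidableEq ι] {t : ι → Deg} (𝔰 : Splitting ψ (0, s') t) (hJ : 𝔰.J = crossSpan ψ τ)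
    (hτ₁ : τ * ψ 1 = τ) (hτ₂ : τ * ψ (φ 1) = τ) (𝔟 : IdemBasis φ) (r : D →ₗ[k] 𝔟.ι →₀ B)
    (hr : ∀ x x' i, r (ψ x * τ * ψ x') i = x * φ (𝔟.coord x' i)) (M : DGMod B) :
    ShortExact (exchange φ ψ s τ hc s' t₀ hs hτ M) (𝔰.mor M) where
  zero x := pair_exchangeLin hc 𝔰 hJ hτ₁ s M x
  injective := exchangeLin_injective hc 𝔰 hJ hτ₁ 𝔟 r hr s M
  surjective := 𝔰.mor_surjective M
  exact y hy := exists_exchangeLin_eq hc 𝔰 hJ hτ₂ s M y hy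

/-- The cone of `x ⊗ m ↦ ψ(x) τ ⊗ m` is quasi-isomorphic to its cokernel, which the splitting
identifies with a sum of shifted copies of the identity. -/
theorem exists_isQuasiIso_cone_exchange
    (hφ : ∀ M : DGMod B, M.Cofibrant → (M.res φ).Cofibrant)
    (hψ : ∀ M : DGMod D, M.Cofibrant → (M.res ψ).Cofibrant) {s s' t₀ : ℤ × ℤ}
    (hs : s' + t₀ = s) (hτ : τ ∈ D.gr (0, t₀)) {ι : Type} [DecidableEq ι] {t : ι → Deg}
    (𝔰 : Splitting ψ (0, s') t) (hJ : 𝔰.J = crossSpan ψ τ) (hτ₁ : τ * ψ 1 = τ)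
    (hτ₂ : τ * ψ (φ 1) = τ) (𝔟 : IdemBasis φ) (r : D →ₗ[k] 𝔟.ι →₀ B)
    (hr : ∀ x x' i, r (ψ x * τ * ψ x') i = x * φ (𝔟.coord x' i)) :
    ∃ η : DGNat (DGFunctor.cone (DGNat.exchange φ ψ hφ hψ s s' t₀ hs τ hτ hc))
      (DGFunctor.coprod fun i => DGFunctor.shift B (t i)), η.IsQuasiIso :=
  DGNat.exists_isQuasiIso_cone _ (𝔰.nat hψ) fun M =>
    shortExact_exchange hc hs hτ 𝔰 hJ hτ₁ hτ₂ 𝔟 r hr M.obj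

end Exchange

/-- The case of a morphism from the zero functor. -/
theorem exists_isQuasiIso_cone_zero {B D : GrAlg k} {ψ : GrHom B D}
    (hψ : ∀ M : DGMod D, M.Cofibrant → (M.res ψ).Cofibrant) {s' : ℤ × ℤ}
    {ι : Type} [DecidableEq ι] {t : ι → Deg}
    (𝔰 : Splitting ψ (0, s') t) (hJ : 𝔰.J = ⊥)
    (α : DGNat (DGFunctor.zero B B) (((DGFunctor.shift B (0, s')).comp (DGFunctor.res ψ hψ)).comp
      (DGFunctor.ind ψ))) :
    ∃ η : DGNat (DGFunctor.cone α) (DGFunctor.coprod fun i => DGFunctor.shift B (t i)),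
      η.IsQuasiIso := by
  have hE : ∀ (X : Empty → DGMod B) (M : DGMod B)
      (f : DGMod.Mor (DGMod.coprod X) (((M.ind ψ).res ψ).shift (0, s'))),
      DGMod.ShortExact f (𝔰.mor M) := fun X M f => by
    have hz : ∀ x : DGMod.coprod X, x = 0 := fun x => DFinsupp.ext fun i => i.elim
    exact {
      zero := fun x => by rw [hz x, map_zero, map_zero]
      injective := fun x y _ => (hz x).trans (hz y).symm
      surjective := 𝔰.mor_surjective M
      exact := fun y hy => ⟨0, (map_zero _).trans (eq_zero_of_pair_eq_zero 𝔰 hJ M y hy).symm⟩ }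
  exact DGNat.exists_isQuasiIso_cone _ (𝔰.nat hψ) fun M => hE _ M.obj _

end DGKLRW

/-! ### Triangular coordinates -/

namespace DGKLRW

variable {k : Type u} [CommRing k] {B D : GrAlg k} {ψ : GrHom B D} {ι : Type}

section Homogenize

/-- The homogeneous part of a family of coordinates, the coordinate with index `i` being of
degree `s - t i`. -/
noncomputable def gradedCoord (s : Deg) (t : ι → Deg) (P : D →ₗ[k] (ι →₀ B)) : D →ₗ[k] (ι →₀ B) :=
  homPart (fun j => Finsupp.lsum k fun i =>
    Finsupp.lsingle i ∘ₗ GradedAlgebra.proj B.gr (j + (s - t i))) 0 P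

variable {s : Deg} {t : ι → Deg} {P : D →ₗ[k] (ι →₀ B)}

lemma gradedCoord_of_mem {j : Deg} {y : D} (hy : y ∈ D.gr j) (i : ι) :
    gradedCoord s t P y i = GradedAlgebra.proj B.gr (j + (s - t i)) (P y i) := by
  rw [gradedCoord, homPart_of_mem hy, add_zero]
  generalize P y = f
  induction f using Finsupp.induction_linear with
  | zero => simp
  | add f g hf hg => rw [map_add, Finsupp.add_apply, hf, hg, Finsupp.add_apply, map_add]
  | single l a =>
    rw [Finsupp.lsum_single, LinearMap.comp_apply, Finsupp.lsingle_apply]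
    rcases eq_or_ne l i with rfl | h
    · rw [Finsupp.single_eq_same, Finsupp.single_eq_same]
    · rw [Finsupp.single_eq_of_ne h.symm, Finsupp.single_eq_of_ne h.symm, map_zero]

lemma gradedCoord_mem {j : Deg} {y : D} (hy : y ∈ D.gr j) (i : ι) :
    gradedCoord s t P y i ∈ B.gr (j + (s - t i)) := by
  rw [gradedCoord_of_mem hy]; exact SetLike.coe_mem _

lemma gradedCoord_mul_left (hP : ∀ a y i, P (ψ a * y) i = B.tw (t i).1 a * P y i) (a : B) (y : D)
    (i : ι) : gradedCoord s t P (ψ a * y) i = B.tw (t i).1 a * gradedCoord s t P y i := by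
  refine hom_induction B.internal (p := fun a => gradedCoord s t P (ψ a * y) i =
    B.tw (t i).1 a * gradedCoord s t P y i) (by simp)
    (fun a a' h h' => by simp only [map_add, add_mul, Finsupp.add_apply, h, h'])
    (fun l a ha => ?_) a
  refine hom_induction D.internal (p := fun y => gradedCoord s t P (ψ a * y) i =
    B.tw (t i).1 a * gradedCoord s t P y i) (by simp)
    (fun a a' h h' => by simp only [map_add, mul_add, Finsupp.add_apply, h, h'])
    (fun j y hy => ?_) y
  rw [gradedCoord_of_mem (SetLike.mul_mem_graded (ψ.mem ha) hy), gradedCoord_of_mem hy, hP,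
    add_assoc]
  exact DirectSum.coe_decompose_mul_add_of_left_mem B.gr (B.tw_mem _ ha)

lemma gradedCoord_mul_right (hP : ∀ y a i, P (y * ψ a) i = P y i * a) (y : D) (a : B) (i : ι) :
    gradedCoord s t P (y * ψ a) i = gradedCoord s t P y i * a := by
  refine hom_induction B.internal (p := fun a => gradedCoord s t P (y * ψ a) i =
    gradedCoord s t P y i * a) (by simp)
    (fun a a' h h' => by simp only [map_add, mul_add, Finsupp.add_apply, h, h'])
    (fun l a ha => ?_) a
  refine hom_induction D.internal (p := fun y => gradedCoord s t P (y * ψ a) i =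
    gradedCoord s t P y i * a) (by simp)
    (fun a a' h h' => by simp only [map_add, add_mul, Finsupp.add_apply, h, h'])
    (fun j y hy => ?_) y
  rw [gradedCoord_of_mem (SetLike.mul_mem_graded hy (ψ.mem ha)), gradedCoord_of_mem hy, hP,
    add_right_comm]
  exact DirectSum.coe_decompose_mul_add_of_right_mem B.gr ha

lemma gradedCoord_eq_zero {j : Deg} {y : D} (hy : y ∈ D.gr j) {i : ι} (h : P y i = 0) :
    gradedCoord s t P y i = 0 := by
  rw [gradedCoord_of_mem hy, h, map_zero]

lemma gradedCoord_eq_zsmul_one {j : Deg} {y : D} (hy : y ∈ D.gr j) {i : ι} {n : ℤ}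
    (h : P y i = n • 1) (hj : j + (s - t i) = 0) : gradedCoord s t P y i = n • 1 := by
  rw [gradedCoord_of_mem hy, h, hj, map_zsmul, GradedAlgebra.proj_apply,
    DirectSum.decompose_of_mem_same B.gr SetLike.GradedOne.one_mem]

lemma gradedCoord_eq_single {j : Deg} {y : D} (hy : y ∈ D.gr j) {i : ι}
    (h : P y = Finsupp.single i 1) (hj : j + (s - t i) = 0) :
    gradedCoord s t P y = Finsupp.single i 1 := Finsupp.ext fun l => by
  rcases eq_or_ne l i with rfl | hl
  · rw [gradedCoord_eq_zsmul_one (n := 1) hy (by rw [h, Finsupp.single_eq_same, one_smul]) hj,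
      Finsupp.single_eq_same, one_smul]
  · rw [Finsupp.single_eq_of_ne hl, gradedCoord_eq_zero hy (by rw [h, Finsupp.single_eq_of_ne hl])]

end Homogenize

section Triangular

variable {t : ℕ ⊕ ℕ → Deg} {P : D →ₗ[k] (ℕ ⊕ ℕ →₀ B)} {x ξ : ℕ → D} {ε : ℤ}

/-- Elements with coordinates `Finsupp.single i 1` exist, by a triangular elimination: among the
coordinates indexed by `Sum.inl`, the element `ξ p` has the value `±1` at `p` and vanishes later,
and the elements `x q` remove its coordinates indexed by `Sum.inr`. -/
lemma exists_dual
    (hl : ∀ a y i, P (ψ a * y) i = B.tw (t i).1 a * P y i)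
    (hr : ∀ y a i, P (y * ψ a) i = P y i * a)
    (hx : ∀ p, P (x p) = Finsupp.single (.inr p) 1)
    (hξ : ∀ p q, p < q → P (ξ p) (.inl q) = 0) (hε : ε * ε = 1)
    (hξ' : ∀ p, P (ξ p) (.inl p) = ε • 1) (i : ℕ ⊕ ℕ) :
    ∃ y, ψ 1 * y = y ∧ P y = Finsupp.single i 1 := by
  classical
  have h1 : ∀ y, P (ψ 1 * y) = P y := fun y => Finsupp.ext fun i => by rw [hl, map_one, one_mul]
  let Q : Submodule k (ℕ ⊕ ℕ →₀ B) :=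
    (LinearMap.eqLocus (LinearMap.mulLeft k (ψ 1)) LinearMap.id).map P
  have hQ : ∀ y, P y ∈ Q := fun y => ⟨ψ 1 * y, by
    change ψ 1 * (ψ 1 * y) = ψ 1 * y
    rw [← mul_assoc, ψ.one_mul_apply], h1 y⟩
  have hsingle : ∀ i, Finsupp.single i 1 ∈ Q → ∀ a, Finsupp.single i a ∈ Q := fun i hi a => by
    obtain ⟨y, -, hy⟩ := hi
    have : P (y * ψ a) = Finsupp.single i a := Finsupp.ext fun j => by
      rw [hr, hy, Finsupp.single_apply, Finsupp.single_apply]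
      split_ifs
      · rw [one_mul]
      · rw [zero_mul]
    exact this ▸ hQ _
  have hinr : ∀ p, Finsupp.single (.inr p) (1 : B) ∈ Q := fun p => hx p ▸ hQ _
  have hinl : ∀ p, Finsupp.single (.inl p) (1 : B) ∈ Q := fun p => by
    induction p using Nat.strong_induction_on with
    | _ p ih =>
      have hmem : Finsupp.single (.inl p) (P (ξ p) (.inl p)) ∈ Q := by
        rw [eq_sub_of_add_eq (Finsupp.single_add_erase (.inl p) (P (ξ p)))]
        refine sub_mem (hQ _) ?_
        rw [← Finsupp.sum_single (Finsupp.erase _ _)]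
        refine sum_mem fun i hi => ?_
        rw [Finsupp.mem_support_iff] at hi
        rcases i with q | q
        · rcases lt_trichotomy q p with hq | rfl | hq
          · exact hsingle _ (ih q hq) _
          · exact absurd Finsupp.erase_same hi
          · refine absurd ?_ hi
            rw [Finsupp.erase_ne (by simpa using hq.ne'), hξ _ _ hq]
        · exact hsingle _ (hinr q) _
      have := zsmul_mem hmem ε
      rwa [hξ', Finsupp.smul_single, smul_smul, hε, one_smul] at this
  obtain ⟨y, hy, hy'⟩ : Finsupp.single i 1 ∈ Q := by
    rcases i with p | p
    · exact hinl p
    · exact hinr p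
  exact ⟨y, hy, hy'⟩

/-- A splitting is determined by coordinates which are triangular on given elements `x p` and
`ξ p`, provided that these span `ψ(1) D ψ(1)` modulo a subspace `J` without coordinates. -/
noncomputable def Splitting.ofTriangular {s : Deg}
    (hm : ∀ {j y}, y ∈ D.gr j → ∀ i, P y i ∈ B.gr (j + (s - t i)))
    (hl : ∀ a y i, P (ψ a * y) i = B.tw (t i).1 a * P y i)
    (hr : ∀ y a i, P (y * ψ a) i = P y i * a)
    (hx : ∀ p, P (x p) = Finsupp.single (.inr p) 1)
    (hξ : ∀ p q, p < q → P (ξ p) (.inl q) = 0) (hε : ε * ε = 1)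
    (hξ' : ∀ p, P (ξ p) (.inl p) = ε • 1) (J : Submodule k D) (hJ : ∀ y ∈ J, P y = 0)
    (hspan : ∀ y, ∃ j ∈ J, ∃ f g : ℕ →₀ B, ψ 1 * y * ψ 1 =
      j + f.sum (fun p a => ψ a * x p) + g.sum (fun p a => ψ a * ξ p)) :
    Splitting ψ s t where
  J := J
  coord := P
  b i := (exists_dual hl hr hx hξ hε hξ' i).choose
  coord_mem := hm
  coord_mul_left := hl
  coord_mul_right := hr
  coord_J := hJ
  one_mul_b i := (exists_dual hl hr hx hξ hε hξ' i).choose_spec.1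
  coord_b i := (exists_dual hl hr hx hξ hε hξ' i).choose_spec.2
  sub_mem y := by
    classical
    set d : ℕ ⊕ ℕ → D := fun i => (exists_dual hl hr hx hξ hε hξ' i).choose with hd
    have hd1 : ∀ i, ψ 1 * d i = d i := fun i => (exists_dual hl hr hx hξ hε hξ' i).choose_spec.1
    have hd2 : ∀ i, P (d i) = Finsupp.single i 1 :=
      fun i => (exists_dual hl hr hx hξ hε hξ' i).choose_spec.2
    have h11 : ψ 1 * ψ 1 = ψ 1 := by rw [← map_mul, one_mul]
    have hPs : ∀ h : ℕ ⊕ ℕ →₀ B, P (h.sum fun i a => d i * ψ a) = h := fun h => by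
      conv_rhs => rw [← Finsupp.sum_single h]
      rw [Finsupp.sum, map_sum, Finsupp.sum]
      refine Finset.sum_congr rfl fun i _ => Finsupp.ext fun j => ?_
      rw [hr, hd2, Finsupp.single_apply, Finsupp.single_apply]
      split_ifs
      · rw [one_mul]
      · rw [zero_mul]
    -- subtracting the part with the coordinates of `y` leaves an element `z` without coordinates
    set z := ψ 1 * y * ψ 1 - (P y).sum fun i a => d i * ψ a with hz
    have hz1 : ψ 1 * z * ψ 1 = z := by
      rw [hz, mul_sub, sub_mul, ← mul_assoc, ← mul_assoc, h11, mul_assoc _ (ψ 1) (ψ 1), h11,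
        Finsupp.sum, Finset.mul_sum, Finset.sum_mul]
      congr 1
      refine Finset.sum_congr rfl fun i _ => ?_
      rw [← mul_assoc, hd1, mul_assoc, ← map_mul, mul_one]
    have hz0 : P z = 0 := by
      rw [hz, map_sub, hPs, sub_eq_zero]
      exact Finsupp.ext fun i => by rw [hr, hl, map_one, one_mul, mul_one]
    -- by triangularity, an element without coordinates in the span of the given ones lies in `J`
    obtain ⟨j, hj, f, g, e⟩ := hspan z
    rw [hz1] at e
    have hinl : ∀ q, g.sum (fun p a => B.tw (t (.inl q)).1 a * P (ξ p) (.inl q)) = 0 := fun q => by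
      have := DFunLike.congr_fun (congrArg P e) (.inl q)
      rw [hz0, map_add, map_add, hJ j hj, zero_add, Finsupp.sum, Finsupp.sum, map_sum, map_sum,
        Finsupp.add_apply, Finsupp.finsetSum_apply, Finsupp.finsetSum_apply,
        Finset.sum_eq_zero, zero_add] at this
      · exact (Finset.sum_congr rfl fun p _ => (hl _ _ _).symm).trans this.symm
      · intro p _
        rw [hl, hx, Finsupp.single_eq_of_ne (by simp), mul_zero]
    -- The largest index in the support of `g` would give a nonzero coordinate.
    have hg : g = 0 := by
      by_contra hne
      have hs := Finsupp.support_nonempty_iff.2 hne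
      set q := g.support.max' hs
      have hq : q ∈ g.support := g.support.max'_mem hs
      have := hinl q
      rw [Finsupp.sum, Finset.sum_eq_single_of_mem q hq (fun p hp hpq => by
        rw [hξ p q (lt_of_le_of_ne (g.support.le_max' p hp) hpq), mul_zero]), hξ',
        mul_smul_comm, mul_one] at this
      have := congrArg (fun v => ε • v) this
      simp only [smul_smul, hε, one_smul, smul_zero] at this
      have h2 := congrArg (B.tw (t (.inl q)).1) this
      rw [B.tw_tw_self, map_zero] at h2
      exact (Finsupp.mem_support_iff.1 hq) h2
    subst hg
    have hf : f = 0 := Finsupp.ext fun q => by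
      have := DFunLike.congr_fun (congrArg P e) (.inr q)
      rw [hz0, map_add, map_add, hJ j hj, zero_add, Finsupp.sum_zero_index, map_zero, add_zero,
        Finsupp.sum, map_sum, Finsupp.finsetSum_apply, Finset.sum_eq_single q] at this
      · rw [hl, hx, Finsupp.single_eq_same, mul_one] at this
        have h2 := congrArg (B.tw (t (.inr q)).1) this.symm
        rwa [B.tw_tw_self, Finsupp.zero_apply, map_zero] at h2
      · intro p _ hp
        rw [hl, hx, Finsupp.single_eq_of_ne (by simpa using hp.symm), mul_zero]
      · intro hq
        rw [hl, Finsupp.notMem_support_iff.1 hq, map_zero, zero_mul]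
    rw [e, hf, Finsupp.sum_zero_index, Finsupp.sum_zero_index, add_zero, add_zero]
    exact hj

end Triangular

end DGKLRW

namespace DGKLRW

namespace KLRW

set_option linter.unusedSimpArgs false

open Strand

/-! ### Restriction of cofibrant modules over the KLRW algebras -/

section Degrees

variable {k : Type u} [CommRing k] {N : List ℕ} {b : ℕ}

local notation "π" => proj k N b

/-- The degree of the crossing of a black strand with the strands of `w`. -/
def crossDeg (w : Word) : Deg := (0, weight w - 2 * (w.count black : ℤ), 0)

lemma crossDeg_nil : crossDeg [] = 0 := by simp [crossDeg, weight, labels]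

lemma crossDeg_right (s : Strand) (w : Word) : crossDeg (s :: w) = crossDeg w + (right s).deg := by
  cases s <;> ext <;> simp [crossDeg, weight, labels, right, Loc.deg] <;> ring

lemma crossDeg_left (s : Strand) (w : Word) : crossDeg (s :: w) = (left s).deg + crossDeg w := by
  cases s <;> ext <;> simp [crossDeg, weight, labels, left, Loc.deg] <;> ring

lemma mul_mem_gr {i j : Deg} {x y : Alg k N b} (hx : x ∈ gr k N b i) (hy : y ∈ gr k N b j) :
    x * y ∈ gr k N b (i + j) :=
  SetLike.mul_mem_graded (A := (T k N b).gr) hx hy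

lemma pow_mem_gr {i : Deg} {x : Alg k N b} (hx : x ∈ gr k N b i) (n : ℕ) :
    x ^ n ∈ gr k N b (n • i) :=
  SetLike.pow_mem_graded (A := (T k N b).gr) n hx

lemma cross_mem_gr (u v : Word) : cross k N b u v ∈ gr k N b (crossDeg v) := by
  induction v generalizing u with
  | nil => rw [cross, crossDeg_nil]; exact gen_mem k N b (.idem _)
  | cons s v ih =>
    rw [cross, crossDeg_right]; exact mul_mem_gr (ih _) (gen_mem k N b (.box u (right s) v))

lemma uncross_mem_gr (p u v : Word) : uncross k N b p u v ∈ gr k N b (crossDeg u) := by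
  induction u generalizing p with
  | nil => rw [uncross, crossDeg_nil]; exact gen_mem k N b (.idem _)
  | cons s u ih =>
    rw [uncross, crossDeg_left]; exact mul_mem_gr (gen_mem k N b (.box p (left s) (u ++ v))) (ih _)

lemma direct_mem_gr (u v : Word) (l : ℕ) :
    direct k N b u v l ∈ gr k N b (crossDeg v + l • (0, 2, 0)) :=
  mul_mem_gr (cross_mem_gr u v) (pow_mem_gr (gen_mem k N b (.box u .dot v)) l)

lemma loop_mem_gr (u v : Word) (l : ℕ) :
    loop k N b u v l ∈ gr k N b (crossDeg (u ++ v) + l • (0, 2, 0) + (1, 0, 2) + crossDeg u) :=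
  mul_mem_gr (mul_mem_gr (mul_mem_gr (cross_mem_gr _ _)
    (pow_mem_gr (gen_mem k N b (.box [] .dot (u ++ v))) l)) (gen_mem k N b (.nail (u ++ v))))
    (uncross_mem_gr _ _ _)

lemma tw_of_mem_gr {i : Deg} {x : T k N b} (hx : x ∈ (T k N b).gr i) {s : ℤ} (hs : sgn (1 * i.1) =
    s) :
    (T k N b).tw 1 x = s • x := by
  rw [(T k N b).tw_of_mem 1 hx, hs]

/-- The sign by which the sign involution acts on a basis element. -/
def Idx.sign (j : Idx) : ℤ := if j.2.2 then -1 else 1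

lemma tw_basisElt (j : Idx) :
    (T k N b).tw 1 (basisElt k N b j) = j.sign • basisElt k N b j := by
  unfold basisElt Idx.sign
  split_ifs
  · exact tw_of_mem_gr (loop_mem_gr _ _ _) (by simp [crossDeg, sgn])
  · exact tw_of_mem_gr (direct_mem_gr _ _ _) (by simp [crossDeg, sgn])

variable (k N b) in
/-- The basis of `T_{b+1}` over `T_b` given by the diagrams in which the last black strand at the
top moves to the left, directly or through the nail. -/
noncomputable def idemBasis : IdemBasis (addBlack k N b) where
  ι := Idx
  e := basisElt k N (b + 1)
  ε := Idx.idem k N b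
  sign := Idx.sign
  coord := coords k N b
  sign_sq j := by unfold Idx.sign; split_ifs <;> rfl
  tw_e j := tw_basisElt j
  tw_ε j :=
    (tw_of_mem_gr (gen_mem k N b (.idem (j.1.1 ++ j.1.2))) (s := 1)
      (by simp [sgn, Gen.deg])).trans (one_zsmul _)
  ε_e j := idem_mul_basisElt j
  coord_mul := coords_mul
  coord_e := coords_basisElt
  sum_coord y := by
    have h := combine_coords y
    rw [combine_apply, ← addStrand_one] at h
    exact h

end Degrees

end KLRW

theorem resCofibrant (k : Type u) [CommRing k] (N : List ℕ) : ResCofibrant k N :=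
  fun b _ hM => hM.res (KLRW.idemBasis k N b)

end DGKLRW

namespace DGKLRW

namespace KLRW

set_option linter.unusedSimpArgs false

open Strand

/-! ### The contraction along the marked strand -/

section Contraction

variable {k : Type u} [CommRing k] {N : List ℕ} {b : ℕ} {R : Type u} [Ring R] [Algebra k R]

namespace MarkData

variable (D : MarkData k N b R)

/-- The sum of all words in which the last black strand is the marked one. -/
noncomputable def vac : MarkMod R := ∑ w ∈ words N b, Finsupp.single (w, []) (D.r (.idem w))

/-- The contraction of the representation with the marked strand at the right on both sides. -/
noncomputable def contr : Alg k N (b + 1) →ₗ[k] R :=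
  D.total ∘ₗ LinearMap.applyₗ D.vac ∘ₗ (D.rep : Alg k N (b + 1) →ₗ[k] Module.End k (MarkMod R))

lemma contr_apply (y : Alg k N (b + 1)) : D.contr y = D.total (D.rep y D.vac) := rfl

lemma contr_add_mul (a : Alg k N b) (y : Alg k N (b + 1)) :
    D.contr (addStrand k N b a * y) = D.ρ a * D.contr y := by
  rw [contr_apply, map_mul, Module.End.mul_apply, total_add, contr_apply]

lemma op_app_vac (g : Gen) : D.op g.app D.vac = rmul (k := k) (D.r g) D.vac := by
  have hl : D.op g.app D.vac = Finsupp.single (g.top, []) (D.r g) := by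
    rw [vac, map_sum]
    by_cases hb : g.bot ∈ words N b
    · rw [Finset.sum_eq_single_of_mem _ hb, op_app_last, r_bot]
      intro w _ hw
      exact D.op_zero (by rw [bot_app]; simpa using hw.symm) _
    · rw [← r_bot, r_idem_zero _ hb, mul_zero, Finsupp.single_zero]
      refine Finset.sum_eq_zero fun w hw => D.op_zero ?_ _
      rw [bot_app]
      simpa using fun h : g.bot = w => hb (h ▸ hw)
  have hr : rmul (k := k) (D.r g) D.vac = Finsupp.single (g.top, []) (D.r g) := by
    rw [vac, map_sum]
    have hz : ∀ w, w ≠ g.top → rmul (k := k) (D.r g) (Finsupp.single (w, []) (D.r (.idem w))) = 0 :=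
      fun w hw => by
        have : D.r (.idem w) * D.r (.idem g.top) = 0 := by
          simpa only [map_mul, ρ_ι, map_zero] using D.rel (.idem_mul _ _ hw)
        rw [rmul_single, ← D.r_top g, ← mul_assoc, this, zero_mul, Finsupp.single_zero]
    by_cases hb : g.top ∈ words N b
    · rw [Finset.sum_eq_single_of_mem _ hb fun w _ hw => hz w hw, rmul_single, r_top]
    · rw [← r_top, r_idem_zero _ hb, zero_mul, Finsupp.single_zero]
      exact Finset.sum_eq_zero fun w hw => by rw [rmul_single, mul_zero, Finsupp.single_zero]
  rw [hl, hr]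

lemma rmul_rmul (r s : R) (z : MarkMod R) :
    rmul (k := k) r (rmul (k := k) s z) = rmul (k := k) (s * r) z := by ext; simp [rmul, mul_assoc]

/-- Diagrams with a vertical marked strand act on `vac` like scalars at the right. -/
lemma rep_add_vac (a : Alg k N b) :
    D.rep (addStrand k N b a) D.vac = rmul (k := k) (D.ρ a) D.vac := by
  induction a using alg_induction' with
  | one =>
    have h : ∑ w ∈ words N b, D.r (.idem w) = 1 := by
      simpa only [map_sum, map_one, ρ_ι] using D.rel .sum_idem
    rw [addStrand_one, lastIdem, map_sum, LinearMap.sum_apply, map_one, ← h]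
    have : ∀ w ∈ words N b, D.rep (proj k N (b + 1) (idem (w ++ [black]))) D.vac =
        rmul (k := k) (D.r (.idem w)) D.vac := fun w _ => by
      rw [rep_gen]; exact D.op_app_vac (.idem w)
    rw [Finset.sum_congr rfl this]
    ext i
    simp [rmul, Finsupp.finsetSum_apply, Finset.mul_sum]
  | mul_gen g x ih =>
    rw [map_mul, map_mul, Module.End.mul_apply, addStrand_gen, rep_gen, op_app_vac, rmul_rep, ih,
      rmul_rmul, map_mul]; rfl
  | add x y hx hy =>
    rw [map_add, map_add, LinearMap.add_apply, hx, hy, map_add]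
    ext i; simp [rmul, mul_add]
  | smul c x hx =>
    rw [map_smul, map_smul, LinearMap.smul_apply, hx, map_smul]
    ext i; simp [rmul]

lemma contr_mul_add (y : Alg k N (b + 1)) (a : Alg k N b) :
    D.contr (y * addStrand k N b a) = D.contr y * D.ρ a := by
  rw [contr_apply, map_mul, Module.End.mul_apply, rep_add_vac, rmul_rep, total_rmul, contr_apply]

lemma contr_eq_sum (y : Alg k N (b + 1)) :
    D.contr y = ∑ w ∈ words N b, D.coeff (w, []) y * D.r (.idem w) := by
  rw [contr_apply, vac, map_sum, map_sum]
  refine Finset.sum_congr rfl fun w _ => ?_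
  rw [coeff, ← total_rmul, ← rmul_rep, rmul_single, one_mul]

end MarkData

/-- The contraction of the crossing of the last two black strands is `-(x - d)⁻¹`, in which only
negative powers of `x` occur. -/
lemma MarkData.contr_bb (D : MarkData k N (b + 1) R) (U : Word) :
    D.contr (proj k N (b + 2) (bb U [])) =
      -(D.r (.idem (U ++ [black])) * (D.G U [] * D.r (.idem (U ++ [black])))) := by
  rw [contr_apply, rep_gen, vac, map_sum]
  by_cases hU : U ++ [black] ∈ words N (b + 1)
  · rw [Finset.sum_eq_single_of_mem _ hU, D.op_bb_right U [] _ _ rfl rfl, map_add,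
      total_single_ne _ _ _ (by simp), zero_add, total_single, neg_mul, mul_neg, mul_assoc,
      r_idem_idem]
    intro w _ hw
    refine D.op_zero ?_ _
    simp [Gen.bot, Loc.src]
    intro h
    exact hw (List.append_cancel_right (bs := [black]) (by simpa using h.symm))
  · rw [r_idem_zero _ hU, zero_mul, neg_zero, Finset.sum_eq_zero, map_zero]
    intro w hw
    refine D.op_zero ?_ _
    simp [Gen.bot, Loc.src]
    intro h
    refine hU ?_
    rwa [List.append_cancel_right (as := U ++ [black]) (bs := [black]) (cs := w) (by simpa using h)]

lemma MarkData.IsEven.contr_bb_mem {D : MarkData k N (b + 1) R} {S : Subalgebra k R}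
    (hS : D.IsEven S) (U : Word) : D.contr (proj k N (b + 2) (bb U [])) ∈ S := by
  rw [contr_bb]
  exact S.neg_mem (S.mul_mem (hS.ρ_mem _) (S.mul_mem (hS.G_mem _ _) (hS.ρ_mem _)))

end Contraction

section Values

variable {k : Type u} [CommRing k] {N : List ℕ} {b : ℕ}

/-- The coefficients of a Hahn series in the degrees `m`, `m - 1`, and so on. Only finitely many do
not vanish, since the support is bounded below. -/
noncomputable def tail {B : Type u} [Ring B] (m : ℤ) (z : HahnSeries ℤ B) : ℕ →₀ B :=
  Finsupp.ofSupportFinite (fun p => z.coeff (m - p)) <| by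
    refine (Set.finite_le_nat (m - z.order).toNat).subset fun p hp => ?_
    have := HahnSeries.order_le_of_coeff_ne_zero hp
    simp only [Set.mem_ofPred_eq]
    omega

@[simp] lemma tail_apply {B : Type u} [Ring B] (m : ℤ) (z : HahnSeries ℤ B) (p : ℕ) :
    tail m z p = z.coeff (m - p) := rfl

variable (k N b) in
/-- The polynomial part in `x` of the upper left entry of the contraction, indexed by `Sum.inr`, and
the part of degree at least `|N| - 2b` in `x` of its lower left entry, indexed by `Sum.inl`. -/
noncomputable def polar : Alg k N (b + 1) →ₗ[k] (ℕ ⊕ ℕ →₀ Alg k N b) where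
  toFun y := Finsupp.sumElim (tail (2 * (b : ℤ) - N.sum) ((markData k N b).contr y 1 0))
    (tail 0 ((markData k N b).contr y 0 0))
  map_add' x y := by ext (p | p) <;> simp
  map_smul' c x := by ext (p | p) <;> simp

lemma polar_inl (y : Alg k N (b + 1)) (p : ℕ) : polar k N b y (.inl p) =
    ((markData k N b).contr y 1 0).coeff (2 * (b : ℤ) - N.sum - p) := rfl

lemma polar_inr (y : Alg k N (b + 1)) (p : ℕ) : polar k N b y (.inr p) =
    ((markData k N b).contr y 0 0).coeff (0 - p) := rfl

lemma polar_mul_right (y : Alg k N (b + 1)) (a : Alg k N b) (i : ℕ ⊕ ℕ) :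
    polar k N b (y * addStrand k N b a) i = polar k N b y i * a := by
  rcases i with p | p
  · rw [polar_inl, polar_inl, MarkData.contr_mul_add, mul_ρ, coeff_mul_C]
  · rw [polar_inr, polar_inr, MarkData.contr_mul_add, mul_ρ, coeff_mul_C]

lemma polar_mul_inl (a : Alg k N b) (y : Alg k N (b + 1)) (p : ℕ) :
    polar k N b (addStrand k N b a * y) (.inl p) = sg k N b a * polar k N b y (.inl p) := by
  rw [polar_inl, polar_inl, MarkData.contr_add_mul, ρ_mul_one, coeff_C_mul]

lemma polar_mul_inr (a : Alg k N b) (y : Alg k N (b + 1)) (p : ℕ) :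
    polar k N b (addStrand k N b a * y) (.inr p) = a * polar k N b y (.inr p) := by
  rw [polar_inr, polar_inr, MarkData.contr_add_mul, ρ_mul_zero, coeff_C_mul]

lemma coeff_ρ_G_ρ (a c : Alg k N b) (u v : Word) {m : ℤ} (hm : m ≤ 0) :
    ((-((markData k N b).ρ a * ((markData k N b).G u v * (markData k N b).ρ c))) 0 0).coeff m =
      0 := by
  have hc : (markData k N b).ρ c 0 0 = HahnSeries.C c := rfl
  rw [Matrix.neg_apply, HahnSeries.coeff_neg, ρ_mul_zero, coeff_C_mul, G_mul, hc, coeff_mul_C,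
    coeff_geo, if_neg (by omega), zero_mul, mul_zero, neg_zero]

lemma polar_lastCrossing : polar k N (b + 1) (lastCrossing k N b) = 0 := by
  rw [lastCrossing, map_sum]
  refine Finset.sum_eq_zero fun U _ => Finsupp.ext fun i => ?_
  rw [Finsupp.zero_apply]
  rcases i with p | p
  · rw [polar_inl, mem_evenCoef.1 (isEven.contr_bb_mem U), HahnSeries.coeff_zero]
  · rw [polar_inr, MarkData.contr_bb]
    exact coeff_ρ_G_ρ _ _ _ _ (by omega)

lemma length_eq {w w' : Word} (hw : w ∈ words N b) (hw' : w' ∈ words N b) :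
    w.length = w'.length := by
  have key : ∀ w : Word, w.length = w.count black + (labels w).length := fun w => by
    induction w with
    | nil => rfl
    | cons s w ih => cases s <;> simp [labels, ih] <;> omega
  rw [key, key, (mem_words.1 hw).1, (mem_words.1 hw).2, (mem_words.1 hw').1, (mem_words.1 hw').2]

variable (k N b) in
/-- The sum of the basis elements in which the marked strand starts at the very right. For `e =
false` these are `l` dots on the last black strand, and for `e = true` the last black strand turns
around through the nail. -/
noncomputable def bubble (l : ℕ) (e : Bool) : Alg k N (b + 1) :=
  ∑ w ∈ words N b, basisElt k N (b + 1) ((w, []), l, e)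

lemma contr_bubble (l : ℕ) (e : Bool) : (markData k N b).contr (bubble k N b l e) =
    ∑ w ∈ words N b, (markData k N b).coeff (w, []) (basisElt k N (b + 1) ((w, []), l, e)) *
      (markData k N b).r (.idem w) := by
  rw [MarkData.contr_eq_sum]
  refine Finset.sum_congr rfl fun w hw => ?_
  congr 1
  have h : ∀ y, (markData k N b).coeff (w, []) y =
    ((markData k N b).total ∘ₗ LinearMap.applyₗ (Finsupp.single (w, []) 1) ∘ₗ
      ((markData k N b).rep : Alg k N (b + 1) →ₗ[k] Module.End k (MarkMod (Coef k N b)))) y :=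
    fun y => rfl
  rw [bubble, h, map_sum, Finset.sum_eq_single_of_mem w hw, h]
  intro w' hw' hne
  rw [← h]
  exact coeff_basisElt_ne (by rintro ⟨⟩; exact hne rfl) (length_eq hw hw')

lemma sum_idem_mul_idem : ∑ w ∈ words N b, proj k N b (idem w) * proj k N b (idem w) = 1 := by
  have h : ∑ w ∈ words N b, proj k N b (idem w) = 1 := by
    rw [← map_sum, ← map_one (proj k N b)]
    exact RingQuot.mkAlgHom_rel k .sum_idem
  rw [← h]
  exact Finset.sum_congr rfl fun w _ => top_mul (.idem w)

lemma contr_bubble_coeff (l : ℕ) (e : Bool) (i : Fin 2) (m : ℤ) :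
    ((markData k N b).contr (bubble k N b l e) i 0).coeff m =
      ∑ w ∈ words N b, ((markData k N b).coeff (w, [])
        (basisElt k N (b + 1) ((w, []), l, e)) i 0).coeff m * proj k N b (idem w) := by
  rw [contr_bubble, matrix_sum_apply, hahn_sum_coeff]
  refine Finset.sum_congr rfl fun w _ => ?_
  refine (congrArg (fun z => HahnSeries.coeff z m) (mul_ρ (proj k N b (idem w)) _ i)).trans ?_
  rw [coeff_mul_C]

lemma polar_bubble_false (l : ℕ) : polar k N b (bubble k N b l false) = Finsupp.single (.inr l) 1 :=
    by
  ext i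
  rcases i with p | p
  · rw [polar_inl, contr_bubble_coeff, Finsupp.single_eq_of_ne (by simp)]
    refine Finset.sum_eq_zero fun w _ => ?_
    have : basisElt k N (b + 1) ((w, []), l, false) = direct k N (b + 1) w [] l := rfl
    rw [this, coeff_direct_one (w, []) (w, []), HahnSeries.coeff_zero, zero_mul]
  · rw [polar_inr, contr_bubble_coeff, Finsupp.single_apply]
    have : ∀ w ∈ words N b, ((markData k N b).coeff (w, [])
        (basisElt k N (b + 1) ((w, []), l, false)) 0 0).coeff (0 - (p : ℤ)) * proj k N b (idem w) =
        if l = p then proj k N b (idem w) * proj k N b (idem w) else 0 := fun w _ => by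
      have h := coeff_direct_zero (k := k) (N := N) (b := b) (w, []) l (0 - (p : ℤ))
      rw [List.append_nil] at h
      refine (congrArg (· * proj k N b (idem w)) h).trans ?_
      rw [ite_mul, zero_mul]
      congr 1
      simp only [eq_iff_iff]; omega
    rw [Finset.sum_congr rfl this]
    simp only [Sum.inr.injEq]
    split_ifs
    · exact sum_idem_mul_idem
    · exact Finset.sum_const_zero

lemma lead_bubble {w : Word} (hw : w ∈ words N b) (l : ℕ) :
    IsLead ((markData k N b).coeff (w, []) (basisElt k N (b + 1) ((w, []), l, true)) 1 0)
      (2 * (b : ℤ) - N.sum - l) ((-1) ^ b * proj k N b (idem w)) := by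
  have h := lead_loop (k := k) (N := N) (b := b) (w, []) l
  simp only [weight, (mem_words.1 hw).1, (mem_words.1 hw).2, List.append_nil] at h
  exact h

lemma polar_bubble_lt {l p : ℕ} (h : l < p) : polar k N b (bubble k N b l true) (.inl p) = 0 := by
  rw [polar_inl, contr_bubble_coeff]
  exact Finset.sum_eq_zero fun w hw => by
    rw [(lead_bubble hw l).2 _ (by omega), zero_mul]

lemma polar_bubble_true (l : ℕ) :
    polar k N b (bubble k N b l true) (.inl l) = ((-1) ^ b : ℤ) • 1 := by
  rw [polar_inl, contr_bubble_coeff, Finset.sum_congr rfl fun w hw => by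
    rw [(lead_bubble hw l).1, mul_assoc], ← Finset.mul_sum, sum_idem_mul_idem]
  simp

end Values

/-! ### The corner of the last black strand -/

section Spanning

variable {k : Type u} [CommRing k] {N : List ℕ} {b : ℕ}

lemma addStrand_mul_pow (x y : Alg k N b) (l : ℕ) :
    addStrand k N b (x * y ^ l) = addStrand k N b x * addStrand k N b y ^ l := by
  induction l with
  | zero => simp
  | succ l ih => rw [pow_succ, ← mul_assoc, map_mul, ih, pow_succ, mul_assoc]

lemma lastCrossing_mul_one :
    lastCrossing k N b * addStrand k N (b + 1) 1 = lastCrossing k N b := by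
  rw [addStrand_one, lastCrossing, Finset.sum_mul]
  exact Finset.sum_congr rfl fun w _ => mul_lastIdem (w := w ++ [black]) (.box w .bb [])
    (by simp [Gen.bot, Loc.src])

lemma lastCrossing_mul_one_one :
    lastCrossing k N b * addStrand k N (b + 1) (addStrand k N b 1) = lastCrossing k N b := by
  rw [addStrand_one, lastIdem, map_sum, Finset.mul_sum, lastCrossing]
  refine Finset.sum_congr rfl fun w _ => ?_
  rw [addStrand_gen]
  refine (lastCrossing_mul (g := .idem (w ++ [black] ++ [black])) rfl).trans ?_
  have := mul_bot (k := k) (N := N) (b := b + 2) (.box w .bb [])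
  simpa [Gen.bot, Loc.src] using this

lemma cross_snoc (u v : Word) : cross k N (b + 2) u (v ++ [black]) =
    lastCrossing k N b * addStrand k N (b + 1) (cross k N (b + 1) u v) := by
  induction v generalizing u with
  | nil =>
    rw [List.nil_append, cross, cross, cross, addStrand_gen]
    refine Eq.trans ?_ (lastCrossing_mul (g := .idem (u ++ [black] ++ [black])) rfl).symm
    have h1 := mul_bot (k := k) (N := N) (b := b + 2) (.box u .bb [])
    have h2 := top_mul (k := k) (N := N) (b := b + 2) (.box u .bb [])
    simp only [Gen.bot, Gen.top, Loc.src, Loc.tgt, List.append_assoc, List.cons_append,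
      List.nil_append] at h1 h2 ⊢
    exact h2.trans h1.symm
  | cons s v ih =>
    rw [List.cons_append, cross, cross, ih, map_mul, addStrand_gen, mul_assoc]; rfl

lemma uncross_snoc (p u v : Word) : uncross k N (b + 1) p u (v ++ [black]) =
    addStrand k N b (uncross k N b p u v) := by
  induction u generalizing p with
  | nil =>
    rw [uncross, uncross, addStrand_gen, Gen.app, List.append_assoc, List.cons_append]
  | cons s u ih =>
    rw [uncross, uncross, ih, map_mul, addStrand_gen, Gen.app, List.append_assoc]

lemma basisElt_snoc (u v : Word) (l : ℕ) (e : Bool) :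
    basisElt k N (b + 2) ((u, v ++ [black]), l, e) =
      lastCrossing k N b * addStrand k N (b + 1) (basisElt k N (b + 1) ((u, v), l, e)) := by
  cases e
  · change direct k N (b + 2) u (v ++ [black]) l =
      lastCrossing k N b * addStrand k N (b + 1) (direct k N (b + 1) u v l)
    rw [direct, direct, addStrand_mul_pow, cross_snoc, addStrand_gen, mul_assoc]; rfl
  · change loop k N (b + 2) u (v ++ [black]) l =
      lastCrossing k N b * addStrand k N (b + 1) (loop k N (b + 1) u v l)
    rw [loop, loop, map_mul, map_mul, addStrand_mul_pow, addStrand_gen, addStrand_gen, uncross_snoc,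
      ← List.append_assoc, cross_snoc]
    simp only [mul_assoc]; rfl

lemma idem_mul_bubble (u : Word) (l : ℕ) (e : Bool) :
    addStrand k N b (proj k N b (idem u)) * bubble k N b l e =
      basisElt k N (b + 1) ((u, []), l, e) := by
  have h : ∀ w, addStrand k N b (proj k N b (idem w)) * basisElt k N (b + 1) ((w, []), l, e) =
      basisElt k N (b + 1) ((w, []), l, e) := fun w => by
    have := idem_mul_basisElt (k := k) (N := N) (b := b) ((w, []), l, e)
    simpa only [Idx.idem, List.append_nil] using this
  rw [bubble, Finset.mul_sum]
  by_cases hu : u ∈ words N b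
  · rw [Finset.sum_eq_single_of_mem u hu, h]
    intro w _ hw
    rw [← h w, ← mul_assoc, ← map_mul, idem_mul_ne hw.symm, map_zero, zero_mul]
  · rw [← h u]
    have hz : proj k N b (idem u) = 0 := gen_eq_zero_of_top (g := .idem u) hu
    rw [hz, map_zero, zero_mul]
    exact Finset.sum_eq_zero fun w _ => zero_mul _

variable (k N b) in
/-- The combinations of the elements `bubble k N b l e` with coefficients at the left. -/
noncomputable def bubbles (e : Bool) : (ℕ →₀ Alg k N b) →ₗ[k] Alg k N (b + 1) :=
  Finsupp.lsum k fun l => (LinearMap.mulRight k (bubble k N b l e)) ∘ₗ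
    (addStrand k N b : Alg k N b →ₗ[k] Alg k N (b + 1))

lemma bubbles_apply (e : Bool) (f : ℕ →₀ Alg k N b) : bubbles k N b e f =
    f.sum fun l a => addStrand k N b a * bubble k N b l e := by
  simp [bubbles, Finsupp.sum]

lemma bubbles_single (e : Bool) (l : ℕ) (a : Alg k N b) : bubbles k N b e (Finsupp.single l a) =
    addStrand k N b a * bubble k N b l e := by
  simp [bubbles]

/-- The corner of the idempotent `1_{b,1}` is spanned by the elements `bubble k N b l e` and by the
basis elements in which the last black strand moves to the left at the bottom. -/
lemma corner_mem {J : Submodule k (Alg k N (b + 1))}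
    (hJ : ∀ a u v l e, addStrand k N b a * basisElt k N (b + 1) ((u, v ++ [black]), l, e) ∈ J)
    (y : Alg k N (b + 1)) : lastIdem k N b * y * lastIdem k N b ∈
      J ⊔ (LinearMap.range (bubbles k N b false) ⊔ LinearMap.range (bubbles k N b true)) := by
  have hB : ∀ e f, bubbles k N b e f ∈ J ⊔ (LinearMap.range (bubbles k N b false) ⊔
      LinearMap.range (bubbles k N b true)) := fun e f => by
    cases e
    · exact Submodule.mem_sup_right (Submodule.mem_sup_left ⟨f, rfl⟩)
    · exact Submodule.mem_sup_right (Submodule.mem_sup_right ⟨f, rfl⟩)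
  rw [← combine_coords]
  induction coords k N b y using Finsupp.induction_linear with
  | zero => rw [map_zero, zero_mul]; exact zero_mem _
  | add f g hf hg => rw [map_add, add_mul]; exact add_mem hf hg
  | single j a =>
    obtain ⟨⟨u, v⟩, l, e⟩ := j
    rw [combine_single, mul_assoc, ← basisElt_bot, mul_assoc]
    rcases v.eq_nil_or_concat with rfl | ⟨v, s, rfl⟩
    · have h := mul_lastIdem (k := k) (N := N) (b := b) (.idem (u ++ [black])) rfl
      rw [h, basisElt_bot ((u, []), l, e), ← idem_mul_bubble, ← mul_assoc, ← map_mul,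
        ← bubbles_single]
      exact hB _ _
    · rw [List.concat_eq_append]
      cases s with
      | black =>
        have h := mul_lastIdem (k := k) (N := N) (b := b) (.idem (u ++ black :: (v ++ [black])))
          (w := u ++ black :: v) (by simp [Gen.bot])
        rw [h, basisElt_bot ((u, v ++ [black]), l, e)]
        exact Submodule.mem_sup_left (hJ _ _ _ _ _)
      | red n =>
        rw [lastIdem, Finset.mul_sum, Finset.sum_eq_zero, mul_zero, mul_zero]
        · exact zero_mem _
        · intro w _
          refine idem_mul_ne fun h => ?_
          obtain ⟨-, h⟩ := List.append_inj' (s₁ := u ++ black :: v) (t₁ := [red n])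
            (s₂ := w) (t₂ := [black]) (by simpa using h) rfl
          cases h

lemma exists_corner_eq {J : Submodule k (Alg k N (b + 1))}
    (hJ : ∀ a u v l e, addStrand k N b a * basisElt k N (b + 1) ((u, v ++ [black]), l, e) ∈ J)
    (y : Alg k N (b + 1)) : ∃ j ∈ J, ∃ f g : ℕ →₀ Alg k N b,
      addStrand k N b 1 * y * addStrand k N b 1 = j +
        (f.sum fun l a => addStrand k N b a * bubble k N b l false) +
        (g.sum fun l a => addStrand k N b a * bubble k N b l true) := by
  obtain ⟨j, hj, z, hz, e⟩ := Submodule.mem_sup.1 (corner_mem hJ y)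
  obtain ⟨_, ⟨f, rfl⟩, _, ⟨g, rfl⟩, rfl⟩ := Submodule.mem_sup.1 hz
  refine ⟨j, hj, f, g, ?_⟩
  rw [addStrand_one, ← e, bubbles_apply, bubbles_apply, add_assoc]

end Spanning

section Coefficients

variable {k : Type u} [CommRing k] {N : List ℕ} {b : ℕ}

/-- The index of a basis element with a vertical black strand added at the right. -/
def Idx.app (j : Idx) : Idx := ((j.1.1, j.1.2 ++ [black]), j.2)

lemma Idx.app_injective : Function.Injective Idx.app := by
  rintro ⟨⟨u, v⟩, l⟩ ⟨⟨u', v'⟩, l'⟩ h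
  simpa [Idx.app] using h

/-- Adding a vertical black strand at the right to a basis element and multiplying by the crossing
of the last two black strands gives the basis element with that strand added, so that the
coordinates are carried over. -/
lemma coords_lastCrossing_mul (y : Alg k N (b + 1)) (j : Idx) :
    coords k N (b + 1) (lastCrossing k N b * addStrand k N (b + 1) y) j.app =
      addStrand k N b (coords k N b y j) := by
  have key : ∀ f ∈ families k N b, coords k N (b + 1)
      (lastCrossing k N b * addStrand k N (b + 1) (combine k N b f)) j.app =
      addStrand k N b (f j) := fun f hf => by
    have h : ∀ i, coords k N (b + 1) (lastCrossing k N b * addStrand k N (b + 1)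
        (addStrand k N b (f i) * basisElt k N (b + 1) i)) j.app = if i = j then
        addStrand k N b (f i) else 0 := fun i => by
      have e := basisElt_snoc (k := k) (N := N) (b := b) i.1.1 i.1.2 i.2.1 i.2.2
      rw [map_mul (addStrand k N (b + 1)), ← mul_assoc, ← lastCrossing_comm, mul_assoc, ← e,
        coords_mul]
      have e' := coords_basisElt (k := k) (N := N) (b := b + 1) i.app
      refine (congrArg (fun g : Idx →₀ Alg k N (b +
        1) => addStrand k N b (f i) * g j.app) e').trans ?_
      simp only [Finsupp.single_apply, Idx.app_injective.eq_iff]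
      split_ifs
      · have e2 : i.app.idem k N (b + 1) = addStrand k N b (i.idem k N b) := by
          rw [Idx.idem, Idx.idem, addStrand_gen]
          simp [Gen.app, Idx.app]
        rw [e2, ← map_mul, hf i]
      · rw [mul_zero]
    rw [combine_apply, map_sum, Finset.mul_sum, map_sum, Finsupp.finsetSum_apply,
      Finset.sum_congr rfl fun i _ => h i, Finset.sum_ite_eq']
    split_ifs with hj
    · rfl
    · rw [Finsupp.notMem_support_iff.1 hj, map_zero]
  rw [← key _ (coords_mem y), combine_coords, map_mul (addStrand k N (b + 1)), ← mul_assoc,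
    ← addStrand_one, lastCrossing_mul_one_one]

end Coefficients

end KLRW

/-! ### The categorified commutator relation -/

open KLRW

section Commutator

variable (k : Type u) [CommRing k] (N : List ℕ) (b : ℕ)

/-- The shifts of the summands of the quantum sum. -/
def quantumDeg (n : ℤ) : ℕ ⊕ ℕ → Deg
  | .inl p => (1, 1 + 2 * (p : ℤ) + n, 1)
  | .inr p => (0, 1 + 2 * (p : ℤ) - n, -1)

lemma quantumSum_eq (A : GrAlg k) (n : ℤ) :
    quantumSum A n = DGFunctor.coprod fun i => DGFunctor.shift A (quantumDeg n i) := by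
  refine congrArg DGFunctor.coprod (funext fun i => ?_)
  rcases i with p | p <;> rfl

lemma bubble_false_mem (p : ℕ) : bubble k N b p false ∈ (T k N (b + 1)).gr (0, 2 * p, 0) := by
  refine sum_mem fun w _ => ?_
  have h := direct_mem_gr (k := k) (N := N) (b := b + 1) w [] p
  rw [crossDeg_nil, zero_add] at h
  exact (show ((0, 2 * (p : ℤ), 0) : Deg) = p • (0, 2, 0) by ext <;> simp [mul_comm]) ▸ h

lemma bubble_true_mem (p : ℕ) : bubble k N b p true ∈
    (T k N (b + 1)).gr (1, 2 * ((N.sum : ℤ) - 2 * b) + 2 * p, 2) := by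
  refine sum_mem fun w hw => ?_
  have h := loop_mem_gr (k := k) (N := N) (b := b + 1) w [] p
  rw [List.append_nil, crossDeg, weight, (mem_words.1 hw).1, (mem_words.1 hw).2] at h
  refine (?_ : ((1, 2 * ((N.sum : ℤ) - 2 * b) + 2 * p, 2) : Deg) = _) ▸ h
  ext <;> simp; ring

/-- The homogeneous coordinates on `T_{b+1}` with values in `T_b` given by the polar parts of the
contraction. -/
noncomputable def polarCoord : T k N (b + 1) →ₗ[k] (ℕ ⊕ ℕ →₀ T k N b) :=
  gradedCoord (0, 1 + 2 * (b : ℤ) - (N.sum : ℤ), -1) (quantumDeg ((N.sum : ℤ) - 2 * (b : ℤ)))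
    (polar k N b)

lemma polarCoord_mul_left (a : T k N b) (y : T k N (b + 1)) (i : ℕ ⊕ ℕ) :
    polarCoord k N b (addBlack k N b a * y) i =
      (T k N b).tw (quantumDeg ((N.sum : ℤ) - 2 * (b : ℤ)) i).1 a * polarCoord k N b y i := by
  refine gradedCoord_mul_left (fun a y i => ?_) a y i
  rcases i with p | p
  · exact polar_mul_inl a y p
  · exact (polar_mul_inr a y p).trans (congrArg (· * _) ((T k N b).tw_zero a).symm)

lemma polarCoord_mul_right (y : T k N (b + 1)) (a : T k N b) (i : ℕ ⊕ ℕ) :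
    polarCoord k N b (y * addBlack k N b a) i = polarCoord k N b y i * a :=
  gradedCoord_mul_right polar_mul_right y a i

/-- The splitting of the corner of the idempotent `1_{b,1}` given by the polar parts of the
contraction, modulo a given subspace. -/
noncomputable def bubbleSplitting (J : Submodule k (Alg k N (b + 1)))
    (hJ : ∀ a u v l e, addStrand k N b a * basisElt k N (b + 1) ((u, v ++ [.black]), l, e) ∈ J)
    (hJ' : ∀ y ∈ J, polarCoord k N b y = 0) :
    Splitting (addBlack k N b) (0, 1 + 2 * (b : ℤ) - (N.sum : ℤ), -1)
      (quantumDeg ((N.sum : ℤ) - 2 * (b : ℤ))) :=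
  Splitting.ofTriangular (P := polarCoord k N b)
    (x := fun p => bubble k N b p false) (ξ := fun p => bubble k N b p true) (ε := (-1) ^ b)
    gradedCoord_mem (polarCoord_mul_left k N b) (polarCoord_mul_right k N b)
    (fun p => gradedCoord_eq_single (bubble_false_mem k N b p) (polar_bubble_false p)
      (by ext <;> simp [quantumDeg]; ring))
    (fun p q h => gradedCoord_eq_zero (bubble_true_mem k N b p) (polar_bubble_lt h))
    (by rw [← mul_pow]; simp)
    (fun p => gradedCoord_eq_zsmul_one (bubble_true_mem k N b p) (polar_bubble_true p)
      (by ext <;> simp [quantumDeg]; ring))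
    J hJ' (exists_corner_eq hJ)

lemma basisElt_zero (u v : Word) (l : ℕ) (e : Bool) :
    basisElt k N 1 ((u, v ++ [.black]), l, e) = 0 := by
  have h : proj k N 1 (KLRW.idem (u ++ .black :: (v ++ [.black]))) = 0 :=
    idem_eq_zero fun h => by
      have := (mem_words.1 h).1
      simp at this
      omega
  rw [← basisElt_bot]
  exact (congrArg (_ * ·) h).trans (mul_zero _)

lemma lastCrossing_mul_mem (a : Alg k N (b + 1)) (u v : Word) (l : ℕ) (e : Bool) :
    addStrand k N (b + 1) a * basisElt k N (b + 2) ((u, v ++ [.black]), l, e) ∈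
      crossSpan (addBlack k N (b + 1)) (lastCrossing k N b) := by
  rw [basisElt_snoc, ← mul_assoc]
  exact Submodule.subset_span ⟨_, _, rfl⟩

lemma polarCoord_crossSpan {y : T k N (b + 2)}
    (hy : y ∈ crossSpan (addBlack k N (b + 1)) (lastCrossing k N b)) :
    polarCoord k N (b + 1) y = 0 := by
  have h0 : polarCoord k N (b + 1) (lastCrossing k N b) = 0 := Finsupp.ext fun i =>
    gradedCoord_eq_zero (lastCrossing_mem k N b) (DFunLike.congr_fun polar_lastCrossing i)
  induction hy using Submodule.span_induction with
  | mem y hy =>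
    obtain ⟨x, x', rfl⟩ := hy
    refine Finsupp.ext fun i => (polarCoord_mul_right k N (b + 1) _ x' i).trans ?_
    have h := (polarCoord_mul_left k N (b + 1) x (lastCrossing k N b) i).trans
      (congrArg (_ * ·) (DFunLike.congr_fun h0 i))
    refine (congrArg (· * x') h).trans ?_
    rw [Finsupp.zero_apply, mul_zero, zero_mul]
  | zero => exact map_zero _
  | add x y _ _ hx hy => rw [map_add, hx, hy, add_zero]
  | smul c x _ hx => rw [map_smul, hx, smul_zero]

/-- The coefficients at the basis elements with a vertical black strand at the right. -/
noncomputable def appCoords : Alg k N (b + 2) →ₗ[k] (Idx →₀ Alg k N (b + 1)) :=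
  Finsupp.lcomapDomain Idx.app Idx.app_injective ∘ₗ coords k N (b + 1)

lemma appCoords_cross (x : Alg k N (b + 1)) (x' : Alg k N (b + 1)) (i : Idx) :
    appCoords k N b (addStrand k N (b + 1) x * lastCrossing k N b * addStrand k N (b + 1) x') i =
      x * addStrand k N b (coords k N b x' i) := by
  change coords k N (b + 1) _ i.app = _
  rw [mul_assoc, coords_mul, coords_lastCrossing_mul]

theorem exists_isQuasiIso_commutatorMap (h : ResCofibrant k N) :
    ∃ η : DGNat (DGFunctor.cone (commutatorMap h b))
      (quantumSum (T k N b) ((N.sum : ℤ) - 2 * (b : ℤ))), η.IsQuasiIso := by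
  rw [quantumSum_eq]
  cases b with
  | zero =>
    exact exists_isQuasiIso_cone_zero (h 0) (bubbleSplitting k N 0 ⊥
      (fun a u v l e => (Submodule.mem_bot k).2
        ((congrArg (_ * ·) (basisElt_zero k N u v l e)).trans (mul_zero _)))
      (fun y hy => (congrArg _ ((Submodule.mem_bot k).1 hy)).trans (map_zero _))) rfl (commutatorMap h 0)
  | succ b =>
    exact exists_isQuasiIso_cone_exchange (hc := lastCrossing_comm) (h b) (h (b + 1)) _
      (lastCrossing_mem k N b) (bubbleSplitting k N (b + 1)
        (crossSpan (addBlack k N (b + 1)) (lastCrossing k N b)) (lastCrossing_mul_mem k N b)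
        (fun y hy => polarCoord_crossSpan k N b hy)) rfl
      lastCrossing_mul_one lastCrossing_mul_one_one
      (idemBasis k N b) (appCoords k N b) (appCoords_cross k N b)

end Commutator

end DGKLRW

theorem mainTheorem2 (k : Type u) [CommRing k] (N : List ℕ) :
    ∃ h : DGKLRW.ResCofibrant k N, ∀ b : ℕ,
      ∃ η : DGKLRW.DGNat (DGKLRW.DGFunctor.cone (DGKLRW.commutatorMap h b))
        (DGKLRW.quantumSum (DGKLRW.T k N b) ((N.sum : ℤ) - 2 * (b : ℤ))), η.IsQuasiIso :=
  ⟨DGKLRW.resCofibrant k N, fun b => DGKLRW.exists_isQuasiIso_commutatorMap k N b _⟩
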